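/- Let $\mathbb T=\mathbb R/\mathbb Z$ and $\Omega=\mathbb T\times\mathbb R\times\mathbb T\ni(x,y,z)$. For $f\in L^2(\Omega)$ let $\widehat f(k,\eta,l)=\int_\Omega f\,e^{-2\pi i(kx+\eta y+lz)}\,dx\,dy\,dz$, $(k,\eta,l)\in\mathbb Z\times\mathbb R\times\mathbb Z$, be its (Plancherel) Fourier transform, let $m(D)f$ be defined by $\widehat{m(D)f}=m\widehat f$, and let $\|f\|_{H^s}=\|\langle k,\eta,l\rangle^s\widehat f\|_{L^2}$ with $\langle\cdot\rangle=(1+|\cdot|^2)^{1/2}$ (with value $\infty$ if $f\notin H^s$). Write $f_0=\int_{\mathbb T}f\,dx$, $f_{\neq}=f-f_0$, $\overline f_0=\int_{\mathbb T}\int_{\mathbb T}f\,dx\,dz$, $\widetilde f_0=f_0-\overline f_0$, and $\|(f,g)\|_X=(\|f\|_X^2+\|g\|_X^2)^{1/2}$. The norm of $W^{m,1}(\mathbb R\times\mathbb T)$ is $\sum_{a+b\le m}\|\partial_y^a\partial_z^b f\|_{L^1}$ (possibly $\infty$). Let $\nu>0$ and $\beta\in\mathbb R$ with $|\beta|\ge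 2$. Let $u_{\rm in}=(u^1_{\rm in},u^2_{\rm in},u^3_{\rm in})$ be a smooth, square integrable, divergence-free (real- or complex-valued) vector field on $\Omega$, and let $u\in C([0,\infty);L^2(\Omega))$ be a solution, in the sense of distributions on $(0,\infty)\times\Omega$, with $u(0)=u_{\rm in}$, of $$\partial_t u+y\,\partial_x u-\nu\Delta u+\begin{pmatrix}(1-\beta)u^2\\ \beta u^1\\ 0\end{pmatrix}+(\beta-2)\nabla\Delta^{-1}\partial_x u^2-\beta\nabla\Delta^{-1}\partial_y u^1=0 .$$ Put $U^j(t,X,Y,Z)=u^j(t,X+tY,Y,Z)$, $U^2_{\rm in}=u^2_{\rm in}$ and $W^2_{\rm in}=\partial_z u^1_{\rm in}-\partial_x u^3_{\rm in}$. Then the following hold. (1) For every $s\ge0$ there is a constant $C_s$, depending only on $s$, such that for all $t\ge0$ $$\|(U^1_{\neq},U^3_{\neq})(t)\|_{H^s}\le C_s\,e^{-\frac1{24}\nu t^3}\big(\|U^2_{\rm in}\|_{H^{s+2}}+\|W^2_{\rm in}\|_{H^{s+1}}\big),$$ $$\|U^2_{\neq}(t)\|_{H^s}\le C_s\,\langle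 t\rangle^{-1}e^{-\frac1{24}\nu t^3}\big(\|U^2_{\rm in}\|_{H^{s+3}}+\|W^2_{\rm in}\|_{H^{s+2}}\big).$$ (2) Let $\mathcal L_\pm=\nu\Delta_{y,z}\pm i\sqrt{\beta(\beta-1)}\,|\partial_z||\nabla_{y,z}|^{-1}$. For all $t\ge0$ $$\widetilde u_0^1(t)=\tfrac12\big(e^{\mathcal L_+t}+e^{\mathcal L_-t}\big)\widetilde u^1_{0\rm in}+\tfrac i2\tfrac{\beta-1}{\sqrt{\beta(\beta-1)}}|\nabla_{y,z}||\partial_z|^{-1}\big(e^{\mathcal L_-t}-e^{\mathcal L_+t}\big)\widetilde u^2_{0\rm in},$$ $$\widetilde u_0^2(t)=\tfrac12\big(e^{\mathcal L_+t}+e^{\mathcal L_-t}\big)\widetilde u^2_{0\rm in}+\tfrac i2\tfrac{\sqrt{\beta(\beta-1)}}{\beta-1}|\nabla_{y,z}|^{-1}|\partial_z|\big(e^{\mathcal L_+t}-e^{\mathcal L_-t}\big)\widetilde u^1_{0\rm in},$$ $$\widetilde u_0^3(t)=-\partial_z^{-1}\partial_y\widetilde u_0^2(t),$$ and $$\overline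 u_0^1(t)=e^{\nu\partial_{yy}t}\,\overline u^1_{0\rm in},\qquad \overline u_0^2(t)=0,\qquad \overline u_0^3(t)=e^{\nu\partial_{yy}t}\,\overline u^3_{0\rm in}.$$ (3) There is an absolute constant $C$ such that for all $t>0$ $$\|\widetilde u_0^1(t)\|_{L^\infty(\mathbb R\times\mathbb T)}\le C e^{-\nu t}\big(\sqrt{\beta(\beta-1)}\,t\big)^{-\frac13}\big(\|\widetilde u^1_{0\rm in}\|_{W^{4,1}(\mathbb R\times\mathbb T)}+\|\widetilde u^2_{0\rm in}\|_{W^{5,1}(\mathbb R\times\mathbb T)}\big),$$ $$\|\widetilde u_0^2(t)\|_{L^\infty(\mathbb R\times\mathbb T)}\le C e^{-\nu t}\big(\sqrt{\beta(\beta-1)}\,t\big)^{-\frac13}\|(\widetilde u^1_{0\rm in},\widetilde u^2_{0\rm in})\|_{W^{4,1}(\mathbb R\times\mathbb T)},$$ $$\|\widetilde u_0^3(t)\|_{L^\infty(\mathbb R\times\mathbb T)}\le C e^{-\nu t}\big(\sqrt{\beta(\beta-1)}\,t\big)^{-\frac13}\|(\widetilde u^1_{0\rm in},\widetilde u^2_{0\rm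 in})\|_{W^{5,1}(\mathbb R\times\mathbb T)}.$$ -/

import Mathlib

open MeasureTheory Filter Topology Set
open scoped ENNReal ContDiff FourierTransform

namespace Couette

noncomputable section

/-- The torus `𝕋 = ℝ / ℤ`, of total mass one. -/
abbrev Torus : Type := UnitAddCircle

/-- The spatial domain `𝕋 × ℝ × 𝕋`, with points `(x, y, z)`. -/
abbrev Dom : Type := Torus × ℝ × Torus

/-! ### Derivatives on the domain -/

/-- `∂ₓ f`. -/
def dx (f : Dom → ℂ) (p : Dom) : ℂ :=
  deriv (fun s : ℝ => f (p.1 + (s : Torus), p.2.1, p.2.2)) 0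

/-- `∂_y f`. -/
def dy (f : Dom → ℂ) (p : Dom) : ℂ :=
  deriv (fun s : ℝ => f (p.1, p.2.1 + s, p.2.2)) 0

/-- `∂_z f`. -/
def dz (f : Dom → ℂ) (p : Dom) : ℂ :=
  deriv (fun s : ℝ => f (p.1, p.2.1, p.2.2 + (s : Torus))) 0

/-- The Laplacian `∂ₓ² + ∂_y² + ∂_z²`. -/
def lap (f : Dom → ℂ) (p : Dom) : ℂ :=
  dx (dx f) p + dy (dy f) p + dz (dz f) p

/-- `f` is smooth on `𝕋 × ℝ × 𝕋`: its lift to `ℝ³`, periodic in `x` and `z`, is `C^∞`. -/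
def Smooth (f : Dom → ℂ) : Prop :=
  ContDiff ℝ ∞ (fun q : ℝ × ℝ × ℝ => f ((q.1 : Torus), q.2.1, (q.2.2 : Torus)))

/-- `∇ · v = 0`. -/
def DivFree (v : Fin 3 → Dom → ℂ) : Prop :=
  ∀ p, dx (v 0) p + dy (v 1) p + dz (v 2) p = 0

/-! ### Fourier transform, Fourier multipliers, norms -/

/-- The `(k, l)` Fourier coefficient in `(x, z)`, as a function of `y`. -/
def mode (f : Dom → ℂ) (k l : ℤ) (y : ℝ) : ℂ :=
  ∫ x : Torus, ∫ z : Torus, fourier (-k) x * fourier (-l) z * f (x, y, z)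

open Classical in
/-- The Fourier transform `f̂(k, η, l) = ∫∫∫ f(x,y,z) e^{-2πi(kx + ηy + lz)} dx dy dz` of a square
integrable `f`; in the variable `y` it is the `L²` (Plancherel) Fourier transform, so that it is
determined for almost every `η`. -/
def fhat (f : Dom → ℂ) (k : ℤ) (η : ℝ) (l : ℤ) : ℂ :=
  if h : MemLp (mode f k l) 2 (volume : Measure ℝ) then
    (𝓕 (h.toLp (mode f k l)) : Lp ℂ 2 (volume : Measure ℝ)) η
  else 0

/-- `⟨k, η, l⟩ = (1 + k² + η² + l²)^{1/2}`. -/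
def jap (k : ℤ) (η : ℝ) (l : ℤ) : ℝ := √(1 + (k : ℝ) ^ 2 + η ^ 2 + (l : ℝ) ^ 2)

open Classical in
/-- The Sobolev norm `‖f‖_{H^s} = ‖⟨k, η, l⟩^s f̂‖_{L²}`, `s ≥ 0`; it is `∞` when `f` is not in
`H^s`. -/
def hsNorm (s : ℝ) (f : Dom → ℂ) : ℝ≥0∞ :=
  if MemLp f 2 (volume : Measure Dom) then
    (∑' k : ℤ, ∑' l : ℤ, ∫⁻ η : ℝ, (ENNReal.ofReal (jap k η l ^ s) * ‖fhat f k η l‖ₑ) ^ 2)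
      ^ (1 / 2 : ℝ)
  else ⊤

/-- `‖(f, g)‖ = (‖f‖² + ‖g‖²)^{1/2}`, from the values of the two norms. -/
def pairNorm (a b : ℝ≥0∞) : ℝ≥0∞ := (a ^ 2 + b ^ 2) ^ (1 / 2 : ℝ)

/-- `g = m(D) f` for the Fourier multiplier with symbol `m`: `g` is square integrable and
`ĝ = m f̂`. It is used for symbols in `(η, l)` only. -/
def IsMul (m : ℝ → ℤ → ℂ) (f g : Dom → ℂ) : Prop :=
  MemLp g 2 (volume : Measure Dom) ∧
    ∀ k l : ℤ, ∀ᵐ η : ℝ, fhat g k η l = m η l * fhat f k η l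

/-! ### Projections. Functions that do not depend on `x` (or `z`) are kept as functions on the
whole domain; since `𝕋` has mass one, their `L^p` norms over `ℝ × 𝕋` (or `ℝ`) are their `L^p` norms
over `𝕋 × ℝ × 𝕋`. -/

/-- `f₀`, the zero frequency in `x`. -/
def zeroX (f : Dom → ℂ) (p : Dom) : ℂ := ∫ x : Torus, f (x, p.2.1, p.2.2)

/-- `f_≠ = f - f₀`. -/
def nonzeroX (f : Dom → ℂ) (p : Dom) : ℂ := f p - zeroX f p

/-- The double zero frequency `f̄₀`. -/
def doubleZero (f : Dom → ℂ) (p : Dom) : ℂ := ∫ x : Torus, ∫ z : Torus, f (x, p.2.1, z)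

/-- The simple zero frequency `f̃₀ = f₀ - f̄₀`. -/
def simpleZero (f : Dom → ℂ) (p : Dom) : ℂ := zeroX f p - doubleZero f p

/-- The moving frame: `F(X, Y, Z) = f(X + tY, Y, Z)`, that is `X = x - ty`, `Y = y`, `Z = z`. -/
def moving (t : ℝ) (f : Dom → ℂ) (p : Dom) : ℂ :=
  f (p.1 + ((t * p.2.1 : ℝ) : Torus), p.2.1, p.2.2)

/-- The norm of `L^∞(ℝ × 𝕋)`, for a function that does not depend on `x`. -/
def supNorm (f : Dom → ℂ) : ℝ≥0∞ := eLpNorm f ⊤ (volume : Measure Dom)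

/-- The norm of `W^{m,1}(ℝ × 𝕋)`, for a smooth function that does not depend on `x`:
the sum of `‖∂_y^a ∂_z^b f‖_{L¹}` over `a + b ≤ m`. -/
def wm1Norm (m : ℕ) (f : Dom → ℂ) : ℝ≥0∞ :=
  ∑ ab ∈ (Finset.range (m + 1) ×ˢ Finset.range (m + 1)).filter (fun ab => ab.1 + ab.2 ≤ m),
    eLpNorm (dy^[ab.1] (dz^[ab.2] f)) 1 (volume : Measure Dom)

/-! ### The linearized equation -/

/-- The frequency vector `ξ = (k, η, l)`. -/
def freq (k : ℤ) (η : ℝ) (l : ℤ) : Fin 3 → ℝ := ![(k : ℝ), η, (l : ℝ)]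

/-- The symbol `ξᵢ ξⱼ / |ξ|²` of `∂ᵢ Δ⁻¹ ∂ⱼ`. -/
def riesz (i j : Fin 3) (k : ℤ) (η : ℝ) (l : ℤ) : ℂ :=
  ((freq k η l i * freq k η l j / ((k : ℝ) ^ 2 + η ^ 2 + (l : ℝ) ^ 2) : ℝ) : ℂ)

/-- `g = (β - 2) ∇Δ⁻¹∂ₓ v² - β ∇Δ⁻¹∂_y v¹`, the gradient of the linear pressure. -/
def IsPressureGrad (β : ℝ) (v g : Fin 3 → Dom → ℂ) : Prop :=
  ∀ j, MemLp (g j) 2 (volume : Measure Dom) ∧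
    ∀ k l : ℤ, ∀ᵐ η : ℝ, fhat (g j) k η l =
      ((β : ℂ) - 2) * (riesz j 0 k η l * fhat (v 1) k η l)
        - (β : ℂ) * (riesz j 1 k η l * fhat (v 0) k η l)

/-- The zeroth order term `((1 - β) v², β v¹, 0)`. -/
def coriolis (β : ℝ) (v : Fin 3 → Dom → ℂ) (j : Fin 3) (p : Dom) : ℂ :=
  (![(1 - (β : ℂ)) * v 1 p, (β : ℂ) * v 0 p, 0] : Fin 3 → ℂ) j

/-- Test functions: smooth and compactly supported in `(0, ∞) × 𝕋 × ℝ × 𝕋`. -/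
structure IsTest (φ : ℝ × Dom → ℂ) : Prop where
  smooth : ContDiff ℝ ∞ (fun q : ℝ × ℝ × ℝ × ℝ =>
    φ (q.1, (q.2.1 : Torus), q.2.2.1, (q.2.2.2 : Torus)))
  compact : HasCompactSupport φ
  pos : tsupport φ ⊆ Ioi 0 ×ˢ univ

/-- `u ∈ C([0, ∞); L²(𝕋 × ℝ × 𝕋))` solves
`∂ₜu + y∂ₓu - νΔu + ((1-β)u², βu¹, 0) + (β-2)∇Δ⁻¹∂ₓu² - β∇Δ⁻¹∂_yu¹ = 0`
in the sense of distributions on `(0, ∞) × 𝕋 × ℝ × 𝕋`, with `u(0) = u_in`.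
The components `u¹, u², u³` have the indices `0, 1, 2`. -/
structure IsSolution (ν β : ℝ) (uin : Fin 3 → Dom → ℂ) (u : ℝ → Fin 3 → Dom → ℂ) : Prop where
  memLp : ∀ t, 0 ≤ t → ∀ j, MemLp (u t j) 2 (volume : Measure Dom)
  continuous : ∀ t, 0 ≤ t → ∀ j,
    Tendsto (fun s => eLpNorm (u s j - u t j) 2 (volume : Measure Dom)) (𝓝[Ici 0] t) (𝓝 0)
  initial : ∀ j, u 0 j =ᵐ[volume] uin j
  equation : ∃ g : ℝ → Fin 3 → Dom → ℂ, (∀ t, 0 ≤ t → IsPressureGrad β (u t) (g t)) ∧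
    ∀ (j : Fin 3) (φ : ℝ × Dom → ℂ), IsTest φ →
      ∫ t in Ioi (0 : ℝ), ∫ p : Dom,
        (u t j p * (deriv (fun s => φ (s, p)) t + (p.2.1 : ℂ) * dx (fun q => φ (t, q)) p
            + (ν : ℂ) * lap (fun q => φ (t, q)) p)
          - (coriolis β (u t) j p + g t j p) * φ (t, p)) = 0

/-- The standing assumptions: `ν > 0`, `|β| ≥ 2`, the initial field is smooth, square integrable and
divergence free, and `u` is the solution that starts from it. -/
structure Setting (ν β : ℝ) (uin : Fin 3 → Dom → ℂ) (u : ℝ → Fin 3 → Dom → ℂ) : Prop where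
  visc : 0 < ν
  rot : 2 ≤ |β|
  smooth : ∀ j, Smooth (uin j)
  memLp : ∀ j, MemLp (uin j) 2 (volume : Measure Dom)
  divFree : DivFree uin
  solution : IsSolution ν β uin u

/-- `w² = ∂_z v¹ - ∂ₓ v³`. -/
def vort (v : Fin 3 → Dom → ℂ) (p : Dom) : ℂ := dz (v 0) p - dx (v 2) p

/-! ### Symbols in `(η, l)` -/

/-- Symbol of `Δ_{y,z}`. -/
def symLap (η : ℝ) (l : ℤ) : ℝ := -(2 * Real.pi) ^ 2 * (η ^ 2 + (l : ℝ) ^ 2)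

/-- Symbol of `|∂_z|`. -/
def symDz (l : ℤ) : ℝ := 2 * Real.pi * |(l : ℝ)|

/-- Symbol of `|∇_{y,z}|`. -/
def symGrad (η : ℝ) (l : ℤ) : ℝ := 2 * Real.pi * √(η ^ 2 + (l : ℝ) ^ 2)

/-- Symbol of `𝓛₊ = νΔ_{y,z} + i √(β(β-1)) |∂_z| |∇_{y,z}|⁻¹`. -/
def symLplus (ν β η : ℝ) (l : ℤ) : ℂ :=
  ((ν * symLap η l : ℝ) : ℂ)
    + Complex.I * ((√(β * (β - 1)) * (symDz l * (symGrad η l)⁻¹) : ℝ) : ℂ)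

/-- Symbol of `𝓛₋ = νΔ_{y,z} - i √(β(β-1)) |∂_z| |∇_{y,z}|⁻¹`. -/
def symLminus (ν β η : ℝ) (l : ℤ) : ℂ :=
  ((ν * symLap η l : ℝ) : ℂ)
    - Complex.I * ((√(β * (β - 1)) * (symDz l * (symGrad η l)⁻¹) : ℝ) : ℂ)

/-- Symbol of `e^{𝓛₊ t}`. -/
def expPlus (ν β t η : ℝ) (l : ℤ) : ℂ := Complex.exp (symLplus ν β η l * t)

/-- Symbol of `e^{𝓛₋ t}`. -/
def expMinus (ν β t η : ℝ) (l : ℤ) : ℂ := Complex.exp (symLminus ν β η l * t)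

/-- Symbol of `e^{ν ∂_{yy} t}`. -/
def expHeat (ν t η : ℝ) (_ : ℤ) : ℂ := Complex.exp (((-ν * (2 * Real.pi * η) ^ 2 * t : ℝ) : ℂ))

/-- Symbol of `∂_z⁻¹ ∂_y`, on functions without zero frequency in `z`. -/
def symDzInvDy (η : ℝ) (l : ℤ) : ℂ :=
  (2 * Real.pi * Complex.I * (l : ℂ))⁻¹ * (2 * Real.pi * Complex.I * (η : ℂ))

/-- The decay rate `e^{-νt} (√(β(β-1)) t)^{-1/3}`. -/
def dispRate (ν β t : ℝ) : ℝ := Real.exp (-ν * t) * (√(β * (β - 1)) * t) ^ (-(1 / 3) : ℝ)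

end

end Couette

open Couette

namespace Couette

noncomputable section

/-! ### Square integrable functions on the domain and their modes -/

/-! Fourier series in `x` and `z`, the Plancherel transform in `y` and the passage to the frame that
follows the shear turn the equation into a linear `3 × 3` system of ordinary differential equations
in `t` for each frequency `(k, η, l)`, in which `η - kt` plays the part of the frequency in `y`. All
three statements are read off from this system.

Reduction to the system. The solution is only a distribution, so the equation is tested with plane
waves `e^{-2πi(k(x-ty)+lz)}` times a profile in `y` and a cut-off in `t`. The operator `∂ₜ + y∂ₓ`
annihilates these waves, and the remaining terms form a matrix, `bmat`. The lemma of du Bois-Reymond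
(`sub_eq_integral_of_weak`) gives the system in integrated form after pairing in `η`. A jointly
measurable version of the solution, a density argument and Fubini then give a classical solution in
`t` for almost every `η` (`exists_pointwise_ode`, `Setting.exists_modes`).

Frequencies `k ≠ 0`. The divergence solves a homogeneous scalar equation, hence stays zero
(`dvg_eq`), and the system reduces to the second component `f₁` and the vorticity `ω`. With `q = k²
+ (η-kt)² + l²`, the energy `((β-1)/β) q |f₁|² + |ω|²` has no cross terms left in its derivative.
Multiplied by a weight that decreases while `k(η-kt) > 0` and is constant afterwards, and by the
exponential of twice the accumulated viscosity, it is nonincreasing (`energy_bound`). Since `∫₀ᵗ q ≥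
t³/12`, this is enhanced dissipation. The factor `q` in front of `|f₁|²` together with `1 + t² ≤
2q(1+η²)` is inviscid damping (`mode_bounds`).

Frequencies `k = 0`. For `l ≠ 0` the first two components form a `2 × 2` system with constant
coefficients and eigenvalues `-4π²ν(η²+l²) ± iΩ`, where `Ω = √(β(β-1)) |l| / |(η,l)|`
(`solves_zero`); the third follows from incompressibility. For `l = 0` incompressibility kills the
second component, and the others solve the heat equation.

Dispersive decay. Four derivatives of the data pay for a factor `Δ⁻²` in the multiplier. After the
scaling `η = |l| x` its kernel is an oscillatory integral with phase `λx ± τ(1+x²)^{-1/2}`, `τ =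
√(β(β-1)) t`. The second derivative of the phase vanishes at `x = ±1/√2`. Removing a neighbourhood
of size `τ^{-1/3}` of these points and using the second derivative test elsewhere gives `τ^{-1/3}`
(`Amplitude.norm_kernel_le_of_pow`). The scaling leaves a factor `|l|⁻³`, so the bounds of the modes
can be summed over `l` (`supNorm_simpleZero_le`). -/

instance instProbTorus : IsProbabilityMeasure (volume : Measure Torus) :=
  ⟨UnitAddCircle.measure_univ⟩

instance instProbTorusProd : IsProbabilityMeasure (volume : Measure (Torus × Torus)) :=
  inferInstanceAs (IsProbabilityMeasure ((volume : Measure Torus).prod volume))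

lemma norm_fourier_apply (n : ℤ) (x : Torus) : ‖(fourier n x : ℂ)‖ = 1 := by
  rw [fourier_apply]; exact Circle.norm_coe _

lemma enorm_fourier_apply (n : ℤ) (x : Torus) : ‖(fourier n x : ℂ)‖ₑ = 1 := by
  rw [← ofReal_norm, norm_fourier_apply]; simp

/-- The square of an `L²` norm as a lower integral. -/
lemma eLpNorm_two_sq {α : Type*} [MeasurableSpace α] (μ : Measure α) (f : α → ℂ) :
    eLpNorm f 2 μ ^ 2 = ∫⁻ x, ‖f x‖ₑ ^ 2 ∂μ := by
  have := eLpNorm_nnreal_pow_eq_lintegral (f := f) (μ := μ) (p := 2) (by norm_num)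
  simpa using this

lemma memLp_two_iff {α : Type*} [MeasurableSpace α] {μ : Measure α} {f : α → ℂ} :
    MemLp f 2 μ ↔ AEStronglyMeasurable f μ ∧ ∫⁻ x, ‖f x‖ₑ ^ 2 ∂μ < ⊤ := by
  rw [MemLp, ← eLpNorm_two_sq, ENNReal.pow_lt_top_iff]
  simp

section Slices

variable {α β : Type*} [MeasurableSpace α] [MeasurableSpace β] {μ : Measure α} {ν : Measure β}
  [IsProbabilityMeasure ν]

lemma enorm_integral_sq_le {f : β → ℂ} (hf : AEStronglyMeasurable f ν) :
    ‖∫ y, f y ∂ν‖ₑ ^ 2 ≤ ∫⁻ y, ‖f y‖ₑ ^ 2 ∂ν := by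
  calc ‖∫ y, f y ∂ν‖ₑ ^ 2 ≤ (∫⁻ y, ‖f y‖ₑ ∂ν) ^ 2 := by
        gcongr; exact enorm_integral_le_lintegral_enorm f
    _ = eLpNorm f 1 ν ^ 2 := by rw [eLpNorm_one_eq_lintegral_enorm]
    _ ≤ eLpNorm f 2 ν ^ 2 := by
        gcongr; exact eLpNorm_le_eLpNorm_of_exponent_le (by norm_num) hf
    _ = _ := eLpNorm_two_sq ν f

lemma ae_memLp_slice {f : α × β → ℂ} (hf : MemLp f 2 (μ.prod ν)) :
    ∀ᵐ x ∂μ, MemLp (fun y => f (x, y)) 2 ν := by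
  have h1 := hf.1.prodMk_left
  have h2 := (memLp_two_iff.1 hf).2
  rw [lintegral_prod _ (by have := hf.1.enorm; fun_prop)] at h2
  have h3 := ae_lt_top' (by
    have := hf.1.enorm.pow_const 2
    exact this.lintegral_prod_right') h2.ne
  filter_upwards [h1, h3] with x h1 h3
  exact memLp_two_iff.2 ⟨h1, h3⟩

lemma lintegral_enorm_integral_slice_le {f : α × β → ℂ} (hf : MemLp f 2 (μ.prod ν)) :
    ∫⁻ x, ‖∫ y, f (x, y) ∂ν‖ₑ ^ 2 ∂μ ≤ ∫⁻ q, ‖f q‖ₑ ^ 2 ∂(μ.prod ν) := by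
  rw [lintegral_prod _ (by have := hf.1.enorm; fun_prop)]
  refine lintegral_mono_ae ?_
  filter_upwards [hf.1.prodMk_left] with x h1
  exact enorm_integral_sq_le h1

lemma memLp_integral_slice {f : α × β → ℂ} (hf : MemLp f 2 (μ.prod ν)) :
    MemLp (fun x => ∫ y, f (x, y) ∂ν) 2 μ :=
  memLp_two_iff.2 ⟨hf.1.integral_prod_right',
    (lintegral_enorm_integral_slice_le hf).trans_lt (memLp_two_iff.1 hf).2⟩

/-- Passing from slices to the product requires a measurable set, so the argument runs through the
strongly measurable representative of `f`. -/
lemma ae_prod_of_ae_ae {f : α × β → ℂ} (hf : AEStronglyMeasurable f (μ.prod ν)) {s : Set ℂ}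
    (hs : MeasurableSet s) (h : ∀ᵐ x ∂μ, ∀ᵐ y ∂ν, f (x, y) ∈ s) : ∀ᵐ q ∂(μ.prod ν), f q ∈ s := by
  have h1 : ∀ᵐ q ∂(μ.prod ν), hf.mk f q ∈ s := by
    rw [Measure.ae_prod_iff_ae_ae (hf.stronglyMeasurable_mk.measurable hs)]
    filter_upwards [h, Measure.ae_ae_of_ae_prod hf.ae_eq_mk] with x h2 h3
    filter_upwards [h2, h3] with y h4 h5
    rwa [← h5]
  filter_upwards [h1, hf.ae_eq_mk] with q h2 h3
  rwa [h3]

end Slices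

/-- `(x, y, z) ↦ (y, (x, z))`. -/
def pull : Dom ≃ᵐ ℝ × (Torus × Torus) where
  toFun p := (p.2.1, (p.1, p.2.2))
  invFun q := (q.2.1, q.1, q.2.2)
  left_inv _ := rfl
  right_inv _ := rfl
  measurable_toFun := by
    simp only [Equiv.coe_fn_mk]; fun_prop
  measurable_invFun := by
    simp only [Equiv.coe_fn_symm_mk]; fun_prop

lemma measurePreserving_pull : MeasurePreserving pull (volume : Measure Dom) volume := by
  have h1 : MeasurePreserving (fun p : Torus × ℝ × Torus => ((p.1, p.2.1), p.2.2)) volume volume :=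
    (measurePreserving_prodAssoc (volume : Measure Torus) (volume : Measure ℝ)
      (volume : Measure Torus)).symm MeasurableEquiv.prodAssoc
  have h2 : MeasurePreserving (Prod.map Prod.swap id : (Torus × ℝ) × Torus → (ℝ × Torus) × Torus)
      volume volume :=
    (Measure.measurePreserving_swap (μ := (volume : Measure Torus))
      (ν := (volume : Measure ℝ))).prod (MeasurePreserving.id (volume : Measure Torus))
  have h3 := measurePreserving_prodAssoc (volume : Measure ℝ) (volume : Measure Torus)
      (volume : Measure Torus)
  exact (h3.comp (h2.comp h1) :)

lemma measurePreserving_pull_symm : MeasurePreserving pull.symm volume (volume : Measure Dom) :=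
  measurePreserving_pull.symm pull

lemma memLp_pull {f : Dom → ℂ} {p : ℝ≥0∞} (hf : MemLp f p (volume : Measure Dom)) :
    MemLp (fun q : ℝ × (Torus × Torus) => f (q.2.1, q.1, q.2.2)) p
      ((volume : Measure ℝ).prod volume) :=
  hf.comp_measurePreserving measurePreserving_pull_symm

lemma integral_pull (f : Dom → ℂ) :
    ∫ q : ℝ × (Torus × Torus), f (q.2.1, q.1, q.2.2) = ∫ p : Dom, f p :=
  measurePreserving_pull_symm.integral_comp pull.symm.measurableEmbedding f

lemma lintegral_pull (f : Dom → ℝ≥0∞) :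
    ∫⁻ q : ℝ × (Torus × Torus), f (q.2.1, q.1, q.2.2) = ∫⁻ p : Dom, f p :=
  measurePreserving_pull_symm.lintegral_comp_emb pull.symm.measurableEmbedding f

/-- Almost every slice `(x, z) ↦ f (x, y, z)` of a square integrable function is square
integrable. -/
lemma ae_memLp_slice_y {f : Dom → ℂ} (hf : MemLp f 2 (volume : Measure Dom)) :
    ∀ᵐ y : ℝ, MemLp (fun q : Torus × Torus => f (q.1, y, q.2)) 2 volume :=
  ae_memLp_slice (memLp_pull hf)

lemma ae_slice_of_ae {P : Dom → Prop} (h : ∀ᵐ p, P p) :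
    ∀ᵐ y : ℝ, ∀ᵐ q : Torus × Torus, P (q.1, y, q.2) := by
  have h1 : ∀ᵐ q : ℝ × (Torus × Torus), P (pull.symm q) :=
    measurePreserving_pull_symm.quasiMeasurePreserving.ae h
  exact Measure.ae_ae_of_ae_prod h1

lemma memLp_fourier_mul {f : Torus × Torus → ℂ} {p : ℝ≥0∞} (k l : ℤ) (hf : MemLp f p volume) :
    MemLp (fun q => fourier k q.1 * fourier l q.2 * f q) p volume := by
  refine hf.of_le (g := f) ?_ (Eventually.of_forall fun q => ?_)
  · have := hf.1
    fun_prop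
  · simp only [norm_mul, norm_fourier_apply, one_mul, le_refl]

lemma mode_eq_integral_of_integrable {f : Dom → ℂ} {y : ℝ}
    (h : Integrable (fun q : Torus × Torus => f (q.1, y, q.2)) volume) (k l : ℤ) :
    mode f k l y = ∫ q : Torus × Torus, fourier (-k) q.1 * fourier (-l) q.2 * f (q.1, y, q.2) := by
  have h1 : Integrable (fun q : Torus × Torus => fourier (-k) q.1 * fourier (-l) q.2
      * f (q.1, y, q.2)) volume :=
    memLp_one_iff_integrable.1 (memLp_fourier_mul _ _ (memLp_one_iff_integrable.2 h))
  exact (integral_prod (μ := (volume : Measure Torus)) (ν := (volume : Measure Torus)) _ h1).symm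

lemma memLp_fourier_mul_dom {f : Dom → ℂ} {p : ℝ≥0∞} (k l : ℤ) (hf : MemLp f p volume) :
    MemLp (fun q : Dom => fourier k q.1 * fourier l q.2.2 * f q) p volume := by
  refine hf.of_le (g := f) ?_ (Eventually.of_forall fun q => ?_)
  · have := hf.1
    fun_prop
  · simp only [norm_mul, norm_fourier_apply, one_mul, le_refl]

lemma ae_mode_eq {f : Dom → ℂ} (hf : MemLp f 2 (volume : Measure Dom)) (k l : ℤ) :
    ∀ᵐ y : ℝ, mode f k l y =
      ∫ q : Torus × Torus, fourier (-k) q.1 * fourier (-l) q.2 * f (q.1, y, q.2) := by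
  filter_upwards [ae_memLp_slice_y hf] with y hy
  exact mode_eq_integral_of_integrable (hy.integrable (by norm_num)) k l

lemma memLp_mode {f : Dom → ℂ} (hf : MemLp f 2 (volume : Measure Dom)) (k l : ℤ) :
    MemLp (mode f k l) 2 (volume : Measure ℝ) := by
  have h := memLp_integral_slice (memLp_pull (memLp_fourier_mul_dom (-k) (-l) hf))
  refine (memLp_congr_ae ?_).2 h
  exact ae_mode_eq hf k l

lemma lintegral_mode_le {f : Dom → ℂ} (hf : MemLp f 2 (volume : Measure Dom)) (k l : ℤ) :
    ∫⁻ y, ‖mode f k l y‖ₑ ^ 2 ≤ ∫⁻ p : Dom, ‖f p‖ₑ ^ 2 := by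
  have h := lintegral_enorm_integral_slice_le (memLp_pull (memLp_fourier_mul_dom (-k) (-l) hf))
  calc ∫⁻ y, ‖mode f k l y‖ₑ ^ 2 = _ := lintegral_congr_ae (by
        filter_upwards [ae_mode_eq hf k l] with y hy
        rw [hy])
    _ ≤ _ := h
    _ = ∫⁻ q : ℝ × (Torus × Torus), ‖f (q.2.1, q.1, q.2.2)‖ₑ ^ 2 := by
        refine lintegral_congr fun q => ?_
        simp only [enorm_mul, enorm_fourier_apply, one_mul]
    _ = _ := lintegral_pull fun p => ‖f p‖ₑ ^ 2

lemma mode_congr_ae {f g : Dom → ℂ} (h : f =ᵐ[volume] g) (k l : ℤ)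
    : ∀ᵐ y : ℝ, mode f k l y = mode g k l y := by
  filter_upwards [ae_slice_of_ae h] with y hy
  have h2 := Measure.ae_ae_of_ae_prod hy
  refine integral_congr_ae ?_
  filter_upwards [h2] with x hx
  refine integral_congr_ae ?_
  filter_upwards [hx] with z hz
  simp [hz]

lemma mode_add {f g : Dom → ℂ} (hf : MemLp f 2 (volume : Measure Dom))
    (hg : MemLp g 2 (volume : Measure Dom)) (k l : ℤ) :
    ∀ᵐ y : ℝ, mode (f + g) k l y = mode f k l y + mode g k l y := by
  filter_upwards [ae_mode_eq hf k l, ae_mode_eq hg k l, ae_mode_eq (hf.add hg) k l,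
    ae_memLp_slice_y hf, ae_memLp_slice_y hg] with y h1 h2 h3 h4 h5
  rw [h1, h2, h3, ← integral_add]
  · simp [mul_add]
  · exact ((memLp_fourier_mul _ _ h4).integrable (by norm_num))
  · exact ((memLp_fourier_mul _ _ h5).integrable (by norm_num))

lemma mode_const_mul (f : Dom → ℂ) (c : ℂ) (k l : ℤ) (y : ℝ) :
    mode (fun p => c * f p) k l y = c * mode f k l y := by
  simp only [mode, ← integral_const_mul]
  congr! 4
  ring

lemma mode_sub {f g : Dom → ℂ} (hf : MemLp f 2 (volume : Measure Dom))
    (hg : MemLp g 2 (volume : Measure Dom)) (k l : ℤ) :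
    ∀ᵐ y : ℝ, mode (f - g) k l y = mode f k l y - mode g k l y := by
  have h := mode_add hf (hg.const_mul (-1)) k l
  filter_upwards [h] with y hy
  rw [mode_const_mul] at hy
  rw [show f - g = f + fun x => -1 * g x by ext; simp; ring, hy]
  ring

/-- Pairing with `e^{-2πi(kx+lz)} c(y)` is pairing the mode with `c`. -/
lemma integral_char_mul {f : Dom → ℂ} (hf : MemLp f 2 (volume : Measure Dom)) {c : ℝ → ℂ}
    (hc : MemLp c 2 (volume : Measure ℝ)) (k l : ℤ) :
    ∫ p : Dom, f p * (fourier (-k) p.1 * fourier (-l) p.2.2 * c p.2.1) =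
      ∫ y, mode f k l y * c y := by
  have hcD : MemLp (fun q : ℝ × (Torus × Torus) => c q.1) 2 ((volume : Measure ℝ).prod volume) :=
    hc.comp_fst _
  have hInt := ((memLp_pull (memLp_fourier_mul_dom (-k) (-l) hf)).integrable_mul hcD)
  rw [← integral_pull]
  have h1 := integral_prod _ hInt
  calc _ = _ := by
        refine Eq.trans ?_ h1
        refine integral_congr_ae (Eventually.of_forall fun q => ?_)
        simp only [Pi.mul_apply]; ring
    _ = _ := by
        refine integral_congr_ae ?_
        filter_upwards [ae_mode_eq hf k l] with y hy
        simp only [Pi.mul_apply]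
        rw [integral_mul_const, hy]

lemma integrable_char_mul {f : Dom → ℂ} (hf : MemLp f 2 (volume : Measure Dom)) {c : ℝ → ℂ}
    (hc : MemLp c 2 (volume : Measure ℝ)) (k l : ℤ) :
    Integrable (fun p : Dom => f p * (fourier (-k) p.1 * fourier (-l) p.2.2 * c p.2.1)) := by
  have hcD : MemLp (fun q : ℝ × (Torus × Torus) => c q.1) 2 ((volume : Measure ℝ).prod volume) :=
    hc.comp_fst _
  have hcD' : MemLp (fun p : Dom => c p.2.1) 2 volume :=
    hcD.comp_measurePreserving measurePreserving_pull
  exact hf.integrable_mul (memLp_fourier_mul_dom (-k) (-l) hcD')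

/-! ### Uniqueness for Fourier coefficients -/

lemma volume_torus_eq : (volume : Measure Torus) = AddCircle.haarAddCircle := by
  rw [AddCircle.volume_eq_smul_haarAddCircle]; simp

/-- The Fourier series of `g` converges to `g` in `L²`, and here all its terms are zero. -/
lemma ae_eq_zero_of_fourier {g : Torus → ℂ} (hg : MemLp g 2 volume)
    (h : ∀ n : ℤ, ∫ x, fourier (-n) x * g x = 0) : ∀ᵐ x, g x = 0 := by
  rw [volume_torus_eq] at hg
  have hs := hasSum_fourier_series_L2 (hg.toLp g)
  have h0 : ∀ n, fourierCoeff (hg.toLp g) n = 0 := by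
    intro n
    rw [fourierCoeff_congr_ae hg.coeFn_toLp, fourierCoeff]
    simpa [volume_torus_eq] using h n
  simp only [h0, zero_smul] at hs
  have h1 : hg.toLp g = 0 := hs.unique hasSum_zero
  have h2 := hg.coeFn_toLp
  rw [h1] at h2
  rw [volume_torus_eq]
  filter_upwards [h2, Lp.coeFn_zero ℂ 2 (AddCircle.haarAddCircle (T := 1))] with x hx hx'
  rw [← hx, hx']; rfl

/-- The one-dimensional statement is used twice: in `x`, for each of the countably many coefficients
in `z`, and then in `z` on almost every slice. -/
lemma ae_eq_zero_of_fourier_prod {h : Torus × Torus → ℂ} (hh : MemLp h 2 volume)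
    (h0 : ∀ k l : ℤ, ∫ q, fourier (-k) q.1 * fourier (-l) q.2 * h q = 0) : ∀ᵐ q, h q = 0 := by
  have hl : ∀ l : ℤ, ∀ᵐ x : Torus, ∫ z, fourier (-l) z * h (x, z) = 0 := by
    intro l
    have hm : MemLp (fun q : Torus × Torus => fourier (-l) q.2 * h q) 2
        ((volume : Measure Torus).prod volume) := by
      have hm := memLp_fourier_mul 0 (-l) hh
      simp only [fourier_zero, one_mul] at hm
      exact hm
    have hm2 : MemLp (fun x : Torus => ∫ z : Torus, fourier (-l) z * h (x, z)) 2 volume :=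
      memLp_integral_slice hm
    refine ae_eq_zero_of_fourier hm2 fun k => ?_
    have hi := (memLp_fourier_mul (-k) (-l) hh).integrable (by norm_num)
    have e1 := integral_prod (μ := (volume : Measure Torus)) (ν := (volume : Measure Torus)) _ hi
    rw [← h0 k l]
    refine Eq.trans ?_ e1.symm
    simp only [mul_assoc, integral_const_mul]
  rw [← ae_all_iff] at hl
  have hs := ae_memLp_slice (μ := (volume : Measure Torus)) (ν := (volume : Measure Torus)) hh
  refine ae_prod_of_ae_ae (s := {0}) (μ := (volume : Measure Torus))
    (ν := (volume : Measure Torus)) hh.1 (measurableSet_singleton _) ?_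
  filter_upwards [hl, hs] with x h1 h2
  exact ae_eq_zero_of_fourier h2 h1

lemma ae_of_ae_slice {f : Dom → ℂ} (hf : AEStronglyMeasurable f volume) {s : Set ℂ}
    (hs : MeasurableSet s) (h : ∀ᵐ y : ℝ, ∀ᵐ q : Torus × Torus, f (q.1, y, q.2) ∈ s) :
    ∀ᵐ p, f p ∈ s := by
  have h1 : ∀ᵐ q : ℝ × (Torus × Torus), f (q.2.1, q.1, q.2.2) ∈ s :=
    ae_prod_of_ae_ae (μ := (volume : Measure ℝ)) (ν := (volume : Measure (Torus × Torus)))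
      (f := fun q : ℝ × (Torus × Torus) => f (q.2.1, q.1, q.2.2))
      (hf.comp_measurePreserving measurePreserving_pull_symm) hs h
  exact measurePreserving_pull.quasiMeasurePreserving.ae h1

/-- A square integrable function all of whose modes vanish is zero. -/
lemma ae_eq_zero_of_mode {f : Dom → ℂ} (hf : MemLp f 2 (volume : Measure Dom))
    (h : ∀ k l : ℤ, ∀ᵐ y : ℝ, mode f k l y = 0) : f =ᵐ[volume] 0 := by
  refine ae_of_ae_slice hf.1 (measurableSet_singleton 0) ?_
  have h' : ∀ᵐ y : ℝ, ∀ k l : ℤ, mode f k l y = 0 := by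
    simp only [ae_all_iff]; exact h
  filter_upwards [h', ae_memLp_slice_y hf] with y h1 h2
  refine ae_eq_zero_of_fourier_prod h2 fun k l => ?_
  rw [← mode_eq_integral_of_integrable (h2.integrable (by norm_num)), h1]

lemma ae_eq_of_mode {f g : Dom → ℂ} (hf : MemLp f 2 (volume : Measure Dom))
    (hg : MemLp g 2 (volume : Measure Dom))
    (h : ∀ k l : ℤ, ∀ᵐ y : ℝ, mode f k l y = mode g k l y) : f =ᵐ[volume] g := by
  have h1 := ae_eq_zero_of_mode (hf.sub hg) fun k l => by
    filter_upwards [mode_sub hf hg k l, h k l] with y h1 h2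
    rw [h1, h2, sub_self]
  filter_upwards [h1] with p hp
  exact sub_eq_zero.1 hp

/-! ### The Plancherel transform of square integrable functions on the line -/

open Classical in
/-- The Plancherel transform of a square integrable function on the line. -/
def ftL (φ : ℝ → ℂ) (η : ℝ) : ℂ :=
  if h : MemLp φ 2 (volume : Measure ℝ) then
    (𝓕 (h.toLp φ) : Lp ℂ 2 (volume : Measure ℝ)) η
  else 0

lemma fhat_eq_ftL (f : Dom → ℂ) (k : ℤ) (η : ℝ) (l : ℤ) : fhat f k η l = ftL (mode f k l) η := rfl

lemma ftL_eq {φ : ℝ → ℂ} (h : MemLp φ 2 (volume : Measure ℝ)) :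
    ftL φ = (𝓕 (h.toLp φ) : Lp ℂ 2 (volume : Measure ℝ)) := by
  ext η; simp [ftL, h]

/-- Equality holds at every point: `ftL` evaluates the chosen representative of an `L²` class, which
depends on the class alone. -/
lemma ftL_congr_ae {φ ψ : ℝ → ℂ} (h : φ =ᵐ[volume] ψ) : ftL φ = ftL ψ := by
  by_cases h1 : MemLp φ 2 (volume : Measure ℝ)
  · have h2 := (memLp_congr_ae h).1 h1
    rw [ftL_eq h1, ftL_eq h2, (MemLp.toLp_eq_toLp_iff h1 h2).2 h]
  · have h2 : ¬ MemLp ψ 2 (volume : Measure ℝ) := fun h2 => h1 ((memLp_congr_ae h).2 h2)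
    ext η; simp [ftL, h1, h2]

lemma memLp_ftL (φ : ℝ → ℂ) : MemLp (ftL φ) 2 (volume : Measure ℝ) := by
  by_cases h : MemLp φ 2 (volume : Measure ℝ)
  · rw [ftL_eq h]; exact Lp.memLp _
  · have : ftL φ = 0 := by ext; simp [ftL, h]
    rw [this]; exact MemLp.zero

lemma ftL_add {φ ψ : ℝ → ℂ} (hφ : MemLp φ 2 (volume : Measure ℝ))
    (hψ : MemLp ψ 2 (volume : Measure ℝ)) :
    ∀ᵐ η, ftL (fun y => φ y + ψ y) η = ftL φ η + ftL ψ η := by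
  have h : ftL (φ + ψ) = _ := ftL_eq (hφ.add hψ)
  rw [show (fun y => φ y + ψ y) = φ + ψ from rfl, h, ftL_eq hφ, ftL_eq hψ, MemLp.toLp_add,
    FourierTransform.fourier_add]
  exact Lp.coeFn_add _ _

lemma ftL_const_mul {φ : ℝ → ℂ} (hφ : MemLp φ 2 (volume : Measure ℝ)) (c : ℂ) :
    ∀ᵐ η, ftL (fun y => c * φ y) η = c * ftL φ η := by
  have h : ftL (c • φ) = _ := ftL_eq (hφ.const_smul c)
  rw [show (fun y => c * φ y) = c • φ from rfl, h, ftL_eq hφ, MemLp.toLp_const_smul,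
    FourierTransform.fourier_smul]
  exact Lp.coeFn_smul _ _

lemma eLpNorm_ftL {φ : ℝ → ℂ} (hφ : MemLp φ 2 (volume : Measure ℝ)) :
    eLpNorm (ftL φ) 2 volume = eLpNorm φ 2 volume := by
  rw [ftL_eq hφ, ← Lp.enorm_def, ← ofReal_norm, Lp.norm_fourier_eq, ofReal_norm, Lp.enorm_def]
  exact eLpNorm_congr_ae hφ.coeFn_toLp

lemma ae_eq_of_ftL {φ ψ : ℝ → ℂ} (hφ : MemLp φ 2 (volume : Measure ℝ))
    (hψ : MemLp ψ 2 (volume : Measure ℝ)) (h : ∀ᵐ η, ftL φ η = ftL ψ η) :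
    ∀ᵐ y, φ y = ψ y := by
  rw [ftL_eq hφ, ftL_eq hψ] at h
  have h1 : (𝓕 (hφ.toLp φ) : Lp ℂ 2 (volume : Measure ℝ)) = 𝓕 (hψ.toLp ψ) := Lp.ext h
  have h2 := (Lp.fourierTransformₗᵢ ℝ ℂ).injective h1
  exact (MemLp.toLp_eq_toLp_iff hφ hψ).1 h2

lemma exists_ftL_eq {ψ : ℝ → ℂ} (hψ : MemLp ψ 2 (volume : Measure ℝ)) :
    ∃ φ : ℝ → ℂ, MemLp φ 2 (volume : Measure ℝ) ∧ ∀ᵐ η, ftL φ η = ψ η := by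
  refine ⟨(𝓕⁻ (hψ.toLp ψ) : Lp ℂ 2 (volume : Measure ℝ)), Lp.memLp _, ?_⟩
  rw [ftL_eq (Lp.memLp _), Lp.toLp_coeFn, FourierTransform.fourier_fourierInv_eq]
  exact hψ.coeFn_toLp

/-- The Plancherel transform is self adjoint for the bilinear pairing. -/
lemma integral_ftL_mul {φ : ℝ → ℂ} (hφ : MemLp φ 2 (volume : Measure ℝ)) (g : SchwartzMap ℝ ℂ) :
    ∫ η, ftL φ η * g η = ∫ y, φ y * 𝓕 (g : ℝ → ℂ) y := by
  have h := Lp.fourier_toTemperedDistribution_eq (hφ.toLp φ)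
  have h1 := DFunLike.congr_fun h g
  rw [TemperedDistribution.fourier_apply, Lp.toTemperedDistribution_apply,
    Lp.toTemperedDistribution_apply] at h1
  rw [ftL_eq hφ]
  simp only [smul_eq_mul] at h1
  calc _ = _ := by simp only [mul_comm _ (g _)]; exact h1.symm
    _ = _ := by
      refine integral_congr_ae ?_
      filter_upwards [hφ.coeFn_toLp] with y hy
      rw [hy, mul_comm, SchwartzMap.fourier_coe]

/-- Moving the transform onto the test function shows that `ftL φ` and `ψ` have the same pairings;
real compactly supported test functions already separate locally integrable functions. -/
lemma ftL_ae_eq_of_pairing {φ ψ : ℝ → ℂ} (hφ : MemLp φ 2 (volume : Measure ℝ))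
    (hψ : LocallyIntegrable ψ)
    (h : ∀ g : SchwartzMap ℝ ℂ, HasCompactSupport g →
      ∫ y, φ y * 𝓕 (g : ℝ → ℂ) y = ∫ η, ψ η * g η) :
    ∀ᵐ η, ftL φ η = ψ η := by
  refine ae_eq_of_integral_contDiff_smul_eq ((memLp_ftL φ).locallyIntegrable (by norm_num)) hψ ?_
  intro g hg hgc
  have hg₁ : HasCompactSupport (Complex.ofRealCLM ∘ g) := hgc.comp_left rfl
  have hg₂ : ContDiff ℝ ∞ (Complex.ofRealCLM ∘ g) := by fun_prop
  have h1 := h (hg₁.toSchwartzMap hg₂) hg₁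
  rw [← integral_ftL_mul hφ] at h1
  simpa [mul_comm] using h1

/-- On integrable functions the Plancherel transform is the Fourier integral. -/
lemma ftL_eq_fourier {φ : ℝ → ℂ} (hφ : MemLp φ 2 (volume : Measure ℝ)) (h1 : Integrable φ) :
    ∀ᵐ η, ftL φ η = 𝓕 φ η := by
  have hc : Continuous (𝓕 φ) := VectorFourier.fourierIntegral_continuous
    Real.continuous_fourierChar (innerSL ℝ).continuous₂ h1
  refine ftL_ae_eq_of_pairing hφ hc.locallyIntegrable fun g _ => ?_
  have := VectorFourier.integral_fourierIntegral_smul_eq_flip (L := innerₗ ℝ) (μ := volume)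
    (ν := volume) Real.continuous_fourierChar (innerSL ℝ).continuous₂ h1 (g.integrable)
  simp only [smul_eq_mul] at this
  rw [flip_innerₗ] at this
  exact this.symm

lemma fourierInv_integral (ψ : ℝ → ℂ) (y : ℝ) :
    𝓕⁻ ψ y = ∫ η : ℝ, Complex.exp (2 * Real.pi * Complex.I * (η * y)) * ψ η := by
  rw [Real.fourierInv_eq']
  simp [mul_comm, mul_left_comm]

lemma fourier_integral (ψ : ℝ → ℂ) (y : ℝ) :
    𝓕 ψ y = ∫ η : ℝ, Complex.exp (-(2 * Real.pi * Complex.I * (η * y))) * ψ η := by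
  rw [Real.fourier_eq']
  simp [mul_comm, mul_left_comm]

/-- A square integrable function with integrable transform is the inverse Fourier integral. -/
lemma ae_eq_fourierInv {φ ψ : ℝ → ℂ} (hφ : MemLp φ 2 (volume : Measure ℝ))
    (hψ : Integrable ψ) (h : ∀ᵐ η, ftL φ η = ψ η) : ∀ᵐ y, φ y = 𝓕⁻ ψ y := by
  have hc : Continuous (𝓕 ψ) := VectorFourier.fourierIntegral_continuous
    Real.continuous_fourierChar (innerSL ℝ).continuous₂ hψ
  have hc' : Continuous (𝓕⁻ ψ) := by
    have : 𝓕⁻ ψ = fun y => 𝓕 ψ (-y) := by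
      ext y; rw [Real.fourierInv_eq_fourier_neg]
    rw [this]; fun_prop
  refine ae_eq_of_integral_contDiff_smul_eq (hφ.locallyIntegrable (by norm_num))
    hc'.locallyIntegrable ?_
  intro g hg hgc
  have hg₁ : HasCompactSupport (Complex.ofRealCLM ∘ g) := hgc.comp_left rfl
  have hg₂ : ContDiff ℝ ∞ (Complex.ofRealCLM ∘ g) := by fun_prop
  set G := hg₁.toSchwartzMap hg₂ with hG
  -- Pairing with the inverse transform of `G` makes the other side equal to `∫ φ G`.
  have h1 := integral_ftL_mul hφ (𝓕⁻ G)
  have h2 : 𝓕 ((𝓕⁻ G : SchwartzMap ℝ ℂ) : ℝ → ℂ) = G := by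
    rw [← SchwartzMap.fourier_coe, FourierTransform.fourier_fourierInv_eq]
  rw [h2] at h1
  have h3 : ∫ η, ftL φ η * (𝓕⁻ G : SchwartzMap ℝ ℂ) η = ∫ η, ψ η * 𝓕 (G : ℝ → ℂ) (-η) := by
    refine integral_congr_ae ?_
    filter_upwards [h] with η hη
    rw [hη, SchwartzMap.fourierInv_coe, Real.fourierInv_eq_fourier_neg]
  have h4 : ∫ η, ψ η * 𝓕 (G : ℝ → ℂ) (-η) = ∫ y, 𝓕⁻ ψ y * G y := by
    -- The inverse transform is the Fourier integral for the bilinear form `-⟨·,·⟩`, which is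
    -- symmetric, so it too can be moved across the pairing.
    have e := VectorFourier.integral_fourierIntegral_smul_eq_flip (L := -innerₗ ℝ) (μ := volume)
      (ν := volume) Real.continuous_fourierChar (by
        simp only [LinearMap.neg_apply, innerₗ_apply_apply]; fun_prop) hψ (G.integrable)
    have e2 : ∀ (F : ℝ → ℂ) (y : ℝ),
        VectorFourier.fourierIntegral Real.fourierChar volume (-innerₗ ℝ) F y = 𝓕⁻ F y := by
      intro F y
      rw [Real.fourierInv_eq, VectorFourier.fourierIntegral]
      simp
    have e3 : (-innerₗ ℝ : ℝ →ₗ[ℝ] ℝ →ₗ[ℝ] ℝ).flip = -innerₗ ℝ := by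
      ext; simp
    rw [e3] at e
    simp only [e2, smul_eq_mul] at e
    rw [e]
    simp only [Real.fourierInv_eq_fourier_neg]
  rw [h3, h4] at h1
  have hGc : ∀ y, G y = (g y : ℂ) := fun y => rfl
  simp only [hGc] at h1
  simpa [mul_comm] using h1.symm

/-- The transform of a modulated function. -/
lemma ftL_modulate {φ : ℝ → ℂ} (hφ : MemLp φ 2 (volume : Measure ℝ)) (s : ℝ) :
    ∀ᵐ η, ftL (fun y : ℝ => Complex.exp (2 * Real.pi * Complex.I * (s * y)) * φ y) η
      = ftL φ (η - s) := by
  have hm : MemLp (fun y : ℝ => Complex.exp (2 * Real.pi * Complex.I * (s * y)) * φ y) 2 volume := by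
    refine hφ.of_le (g := φ) (by have := hφ.1; fun_prop) (Eventually.of_forall fun y => ?_)
    rw [norm_mul, show (2 * Real.pi * Complex.I * (s * y) : ℂ)
      = ((2 * Real.pi * (s * y) : ℝ) : ℂ) * Complex.I by push_cast; ring,
      Complex.norm_exp_ofReal_mul_I, one_mul]
  have hsub : MemLp (fun η => ftL φ (η - s)) 2 volume :=
    (memLp_ftL φ).comp_measurePreserving (measurePreserving_sub_right volume s)
  refine ftL_ae_eq_of_pairing hm (hsub.locallyIntegrable (by norm_num)) fun g _ => ?_
  let g' : SchwartzMap ℝ ℂ := SchwartzMap.compSubConstCLM ℂ (-s) g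
  have hg' : ∀ x, g' x = g (x + s) := fun x => by simp [g']
  have h1 := integral_ftL_mul hφ g'
  have h2 : ∫ η, ftL φ (η - s) * g η = ∫ η, ftL φ η * g' η := by
    rw [← integral_sub_right_eq_self (fun η => ftL φ η * g' η) s]
    simp [hg']
  rw [h2, h1]
  congr 1
  ext y
  have h3 : 𝓕 (g' : ℝ → ℂ) y = Complex.exp (2 * Real.pi * Complex.I * (s * y))
      * 𝓕 (g : ℝ → ℂ) y := by
    rw [fourier_integral, fourier_integral, ← integral_const_mul]
    simp only [hg']
    rw [← integral_sub_right_eq_self _ s]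
    congr 1
    ext η
    rw [← mul_assoc (Complex.exp _) (Complex.exp _), ← Complex.exp_add, sub_add_cancel]
    congr 2
    push_cast; ring
  rw [h3]; ring

/-- The transform of a derivative. -/
lemma ftL_deriv {φ φ' : ℝ → ℂ} (hφ : MemLp φ 2 (volume : Measure ℝ))
    (hd : ∀ y, HasDerivAt φ (φ' y) y) (hφ' : MemLp φ' 2 (volume : Measure ℝ)) :
    ∀ᵐ η : ℝ, ftL φ' η = 2 * Real.pi * Complex.I * η * ftL φ η := by
  have hloc : LocallyIntegrable (fun η : ℝ => 2 * Real.pi * Complex.I * η * ftL φ η) volume :=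
    LocallyIntegrable.continuous_mul (by fun_prop)
      ((memLp_ftL φ).locallyIntegrable (by norm_num))
  refine ftL_ae_eq_of_pairing hφ' hloc fun g _ => ?_
  let G : SchwartzMap ℝ ℂ := SchwartzMap.smulLeftCLM ℂ (fun η : ℝ => 2 * Real.pi * Complex.I * η) g
  have hG : ∀ η, G η = 2 * Real.pi * Complex.I * η * g η := fun η => by
    simp only [G]
    rw [SchwartzMap.smulLeftCLM_apply_apply (by fun_prop)]; simp
  have h1 := integral_ftL_mul hφ G
  have h2 : ∫ η, 2 * Real.pi * Complex.I * η * ftL φ η * g η = ∫ η, ftL φ η * G η := by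
    congr 1; ext η; rw [hG]; ring
  have h3 : ∀ y, HasDerivAt (𝓕 (g : ℝ → ℂ)) (- 𝓕 (G : ℝ → ℂ) y) y := by
    intro y
    have hi : Integrable (fun x : ℝ => x • g x) := by
      have : Integrable (fun x : ℝ => (2 * Real.pi * Complex.I)⁻¹ * G x) :=
        G.integrable.const_mul _
      refine this.congr (Eventually.of_forall fun x => ?_)
      simp only [hG, Complex.real_smul]
      field_simp
    have := Real.hasDerivAt_fourier g.integrable hi y
    have e : - 𝓕 (G : ℝ → ℂ) y = 𝓕 (fun x : ℝ => (-2 * Real.pi * Complex.I * x) • g x) y := ?_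
    · rw [e]; exact this
    rw [fourier_integral, fourier_integral, ← integral_neg]
    congr 1; ext η; rw [hG]; simp
  rw [h2, h1]
  have hFG : MemLp (𝓕 (G : ℝ → ℂ)) 2 volume := by
    rw [← SchwartzMap.fourier_coe]; exact SchwartzMap.memLp _ 2 volume
  have hFg : MemLp (𝓕 (g : ℝ → ℂ)) 2 volume := by
    rw [← SchwartzMap.fourier_coe]; exact SchwartzMap.memLp _ 2 volume
  -- There are no boundary terms, since `φ · 𝓕 g` and both products with one derivative are
  -- integrable.
  have h4 := integral_mul_deriv_eq_deriv_mul_of_integrable (u := φ) (v := 𝓕 (g : ℝ → ℂ))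
    (fun y _ => hd y) (fun y _ => h3 y) (hφ.integrable_mul hFG.neg) (hφ'.integrable_mul hFg) (hφ.integrable_mul hFg)
  simp only [mul_neg, integral_neg, neg_inj] at h4
  exact h4.symm

/-! ### Modes of the projections -/

lemma integral_fourier_torus (k : ℤ) : ∫ x : Torus, (fourier k x : ℂ) = if k = 0 then 1 else 0 := by
  have h := congrFun (fourierCoeff_fourier (T := 1) k) 0
  rw [fourierCoeff, ← volume_torus_eq] at h
  simp only [neg_zero, fourier_zero, one_smul] at h
  rw [h]
  by_cases hk : k = 0
  · simp [hk]
  · simp [hk, Ne.symm hk]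

lemma doubleZero_eq (f : Dom → ℂ) (p : Dom) : doubleZero f p = mode f 0 0 p.2.1 := by
  simp [doubleZero, mode]

lemma memLp_of_y {c : ℝ → ℂ} {r : ℝ≥0∞} (hc : MemLp c r (volume : Measure ℝ)) :
    MemLp (fun p : Dom => c p.2.1) r volume := by
  have hcD : MemLp (fun q : ℝ × (Torus × Torus) => c q.1) r ((volume : Measure ℝ).prod volume) :=
    hc.comp_fst _
  exact hcD.comp_measurePreserving measurePreserving_pull

lemma memLp_doubleZero {f : Dom → ℂ} (hf : MemLp f 2 (volume : Measure Dom)) :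
    MemLp (doubleZero f) 2 (volume : Measure Dom) := by
  rw [show doubleZero f = fun p => mode f 0 0 p.2.1 from funext (doubleZero_eq f)]
  exact memLp_of_y (memLp_mode hf 0 0)

lemma memLp_zeroX {f : Dom → ℂ} (hf : MemLp f 2 (volume : Measure Dom)) :
    MemLp (zeroX f) 2 (volume : Measure Dom) := by
  have h1 : MemLp (fun q : (ℝ × Torus) × Torus => f (q.2, q.1)) 2
      ((volume : Measure (ℝ × Torus)).prod volume) :=
    hf.comp_measurePreserving (Measure.measurePreserving_swap (μ := (volume : Measure (ℝ × Torus)))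
      (ν := (volume : Measure Torus)))
  have h2 := memLp_integral_slice h1
  exact h2.comp_snd (volume : Measure Torus)

lemma memLp_nonzeroX {f : Dom → ℂ} (hf : MemLp f 2 (volume : Measure Dom)) :
    MemLp (nonzeroX f) 2 (volume : Measure Dom) := hf.sub (memLp_zeroX hf)

lemma memLp_simpleZero {f : Dom → ℂ} (hf : MemLp f 2 (volume : Measure Dom)) :
    MemLp (simpleZero f) 2 (volume : Measure Dom) := (memLp_zeroX hf).sub (memLp_doubleZero hf)

lemma mode_zeroX_of_integrable {f : Dom → ℂ} {y : ℝ}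
    (h : Integrable (fun q : Torus × Torus => f (q.1, y, q.2)) volume) (k l : ℤ) :
    mode (zeroX f) k l y = if k = 0 then mode f 0 l y else 0 := by
  have e1 : mode (zeroX f) k l y = (∫ x : Torus, (fourier (-k) x : ℂ)) *
      ∫ z : Torus, ∫ x : Torus, fourier (-l) z * f (x, y, z) := by
    simp only [mode, zeroX, mul_assoc, integral_const_mul, integral_mul_const]
  have hi : Integrable (fun q : Torus × Torus => fourier (-l) q.2 * f (q.1, y, q.2)) volume := by
    have := memLp_one_iff_integrable.1 (memLp_fourier_mul 0 (-l) (memLp_one_iff_integrable.2 h))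
    simpa only [fourier_zero, one_mul] using this
  have e2 : ∫ z : Torus, ∫ x : Torus, fourier (-l) z * f (x, y, z) = mode f 0 l y := by
    rw [integral_integral_swap (f := fun z x => fourier (-l) z * f (x, y, z)) hi.swap]
    simp [mode]
  rw [e1, e2, integral_fourier_torus]
  by_cases hk : k = 0 <;> simp [hk]

lemma mode_doubleZero (f : Dom → ℂ) (k l : ℤ) (y : ℝ) :
    mode (doubleZero f) k l y = if k = 0 ∧ l = 0 then mode f 0 0 y else 0 := by
  have e1 : mode (doubleZero f) k l y = (∫ x : Torus, (fourier (-k) x : ℂ)) *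
      ((∫ x : Torus, (fourier (-l) x : ℂ)) * mode f 0 0 y) := by
    have : doubleZero f = fun p => mode f 0 0 p.2.1 := funext (doubleZero_eq f)
    rw [this]
    rw [mode]
    simp only [mul_assoc, integral_const_mul, integral_mul_const]
  rw [e1, integral_fourier_torus, integral_fourier_torus]
  by_cases hk : k = 0 <;> by_cases hl : l = 0 <;> simp [hk, hl]

lemma ae_mode_zeroX {f : Dom → ℂ} (hf : MemLp f 2 (volume : Measure Dom)) (k l : ℤ) :
    ∀ᵐ y : ℝ, mode (zeroX f) k l y = if k = 0 then mode f 0 l y else 0 := by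
  filter_upwards [ae_memLp_slice_y hf] with y hy
  exact mode_zeroX_of_integrable (hy.integrable (by norm_num)) k l

lemma ae_mode_simpleZero {f : Dom → ℂ} (hf : MemLp f 2 (volume : Measure Dom)) (k l : ℤ) :
    ∀ᵐ y : ℝ, mode (simpleZero f) k l y = if k = 0 ∧ l ≠ 0 then mode f 0 l y else 0 := by
  filter_upwards [ae_mode_zeroX hf k l, mode_sub (memLp_zeroX hf) (memLp_doubleZero hf) k l]
    with y h1 h2
  rw [show simpleZero f = zeroX f - doubleZero f from rfl, h2, h1, mode_doubleZero]
  by_cases hk : k = 0 <;> by_cases hl : l = 0 <;> simp [hk, hl]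

lemma ae_mode_nonzeroX {f : Dom → ℂ} (hf : MemLp f 2 (volume : Measure Dom)) (k l : ℤ) :
    ∀ᵐ y : ℝ, mode (nonzeroX f) k l y = if k = 0 then 0 else mode f k l y := by
  filter_upwards [ae_mode_zeroX hf k l, mode_sub hf (memLp_zeroX hf) k l] with y h1 h2
  rw [show nonzeroX f = f - zeroX f from rfl, h2, h1]
  by_cases hk : k = 0 <;> simp [hk]

lemma fourier_coe_torus (k : ℤ) (s : ℝ) :
    (fourier k (s : Torus) : ℂ) = Complex.exp (2 * Real.pi * Complex.I * (k * s)) := by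
  rw [fourier_coe_apply]; congr 1; push_cast; ring

lemma fourier_add_torus (k : ℤ) (x y : Torus) :
    (fourier k (x + y) : ℂ) = fourier k x * fourier k y := by
  simp [fourier_apply, AddCircle.toCircle_add]

/-- The translation of `x` by `ty` becomes a phase linear in `y`; under the transform in `y` this is
the shift of `η` by `kt`. -/
lemma mode_moving (t : ℝ) (f : Dom → ℂ) (k l : ℤ) (y : ℝ) :
    mode (moving t f) k l y =
      Complex.exp (2 * Real.pi * Complex.I * ((k * t : ℝ) * y)) * mode f k l y := by
  have h := integral_sub_right_eq_self (μ := (volume : Measure Torus))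
    (fun x : Torus => ∫ z : Torus, fourier (-k) x * fourier (-l) z * moving t f (x, y, z))
    ((t * y : ℝ) : Torus)
  rw [mode, ← h, mode, ← integral_const_mul]
  congr 1; ext x
  rw [← integral_const_mul]
  congr 1; ext z
  rw [moving, sub_add_cancel, sub_eq_add_neg, fourier_add_torus, ← AddCircle.coe_neg,
    fourier_coe_torus]
  have : (2 * Real.pi * Complex.I * (((-k : ℤ) : ℂ) * ((-(t * y) : ℝ) : ℂ)) : ℂ) =
      2 * Real.pi * Complex.I * ((k * t : ℝ) * y) := by push_cast; ring
  rw [this]; ring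

/-- The shear is a skew product: for fixed `(y, z)` it is a translation of the torus. -/
lemma measurePreserving_shear (t : ℝ) :
    MeasurePreserving (fun p : Dom => (p.1 + ((t * p.2.1 : ℝ) : Torus), p.2.1, p.2.2))
      volume volume := by
  have h : MeasurePreserving (fun q : (ℝ × Torus) × Torus =>
      (q.1, q.2 + ((t * q.1.1 : ℝ) : Torus))) ((volume : Measure (ℝ × Torus)).prod volume)
      ((volume : Measure (ℝ × Torus)).prod volume) := by
    refine (MeasurePreserving.id (volume : Measure (ℝ × Torus))).skew_product
      (g := fun q x => x + ((t * q.1 : ℝ) : Torus)) ?_ ?_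
    · have : Measurable (fun r : ℝ => (r : Torus)) := AddCircle.measurable_mk'
      fun_prop
    · exact Eventually.of_forall fun q =>
        (measurePreserving_add_right (volume : Measure Torus) _).map_eq
  have h1 := Measure.measurePreserving_swap (μ := (volume : Measure Torus))
    (ν := (volume : Measure (ℝ × Torus)))
  have h2 := Measure.measurePreserving_swap (μ := (volume : Measure (ℝ × Torus)))
    (ν := (volume : Measure Torus))
  exact (h2.comp (h.comp h1) :)

lemma memLp_moving {f : Dom → ℂ} (hf : MemLp f 2 (volume : Measure Dom)) (t : ℝ) :
    MemLp (moving t f) 2 (volume : Measure Dom) :=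
  hf.comp_measurePreserving (measurePreserving_shear t)

/-! ### Transforms of the projections -/

lemma ftL_zero : ∀ᵐ η, ftL (fun _ => 0) η = 0 := by
  have := ftL_const_mul (φ := fun _ : ℝ => (0 : ℂ)) MemLp.zero 0
  simpa using this

lemma fhat_zero_of_mode {f : Dom → ℂ} {k l : ℤ} (h : ∀ᵐ y : ℝ, mode f k l y = 0) :
    ∀ᵐ η : ℝ, fhat f k η l = 0 := by
  filter_upwards [ftL_zero] with η hη
  rw [fhat_eq_ftL, ftL_congr_ae (ψ := fun _ => 0) h, hη]

lemma fhat_simpleZero {f : Dom → ℂ} (hf : MemLp f 2 (volume : Measure Dom)) {l : ℤ}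
    (hl : l ≠ 0) (η : ℝ) : fhat (simpleZero f) 0 η l = fhat f 0 η l := by
  rw [fhat_eq_ftL, fhat_eq_ftL, ftL_congr_ae]
  filter_upwards [ae_mode_simpleZero hf 0 l] with y hy
  simp [hy, hl]

lemma fhat_simpleZero_zero {f : Dom → ℂ} (hf : MemLp f 2 (volume : Measure Dom)) {k l : ℤ}
    (hl : ¬ (k = 0 ∧ l ≠ 0)) : ∀ᵐ η : ℝ, fhat (simpleZero f) k η l = 0 := by
  refine fhat_zero_of_mode ?_
  filter_upwards [ae_mode_simpleZero hf k l] with y hy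
  rw [hy, if_neg hl]

lemma fhat_doubleZero (f : Dom → ℂ) (η : ℝ) : fhat (doubleZero f) 0 η 0 = fhat f 0 η 0 := by
  rw [fhat_eq_ftL, fhat_eq_ftL, ftL_congr_ae]
  exact Eventually.of_forall fun y => by simp [mode_doubleZero]

lemma fhat_doubleZero_zero (f : Dom → ℂ) {k l : ℤ} (hl : ¬ (k = 0 ∧ l = 0)) :
    ∀ᵐ η : ℝ, fhat (doubleZero f) k η l = 0 :=
  fhat_zero_of_mode (Eventually.of_forall fun y => by rw [mode_doubleZero, if_neg hl])

/-- The transform in the moving frame. -/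
lemma fhat_nonzeroX_moving {f : Dom → ℂ} (hf : MemLp f 2 (volume : Measure Dom)) (t : ℝ)
    {k : ℤ} (hk : k ≠ 0) (l : ℤ) :
    ∀ᵐ η : ℝ, fhat (nonzeroX (moving t f)) k η l = fhat f k (η - k * t) l := by
  filter_upwards [ftL_modulate (memLp_mode hf k l) (k * t)] with η hη
  rw [fhat_eq_ftL, fhat_eq_ftL, ← hη]
  have : (fun y : ℝ => Complex.exp (2 * Real.pi * Complex.I * (((k * t : ℝ) : ℂ) * y))
      * mode f k l y) = mode (moving t f) k l := by
    ext y; rw [mode_moving]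
  rw [this, ftL_congr_ae]
  filter_upwards [ae_mode_nonzeroX (memLp_moving hf t) k l] with y hy
  simp [hy, hk]

lemma fhat_nonzeroX_moving_zero {f : Dom → ℂ} (hf : MemLp f 2 (volume : Measure Dom)) (t : ℝ)
    (l : ℤ) : ∀ᵐ η : ℝ, fhat (nonzeroX (moving t f)) 0 η l = 0 := by
  refine fhat_zero_of_mode ?_
  filter_upwards [ae_mode_nonzeroX (memLp_moving hf t) 0 l] with y hy
  simp [hy]

lemma fhat_congr_ae {f g : Dom → ℂ} (h : f =ᵐ[volume] g) (k : ℤ) (η : ℝ) (l : ℤ) :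
    fhat f k η l = fhat g k η l := by
  rw [fhat_eq_ftL, fhat_eq_ftL, ftL_congr_ae (mode_congr_ae h k l)]

lemma fhat_add {f g : Dom → ℂ} (hf : MemLp f 2 (volume : Measure Dom))
    (hg : MemLp g 2 (volume : Measure Dom)) (k l : ℤ) :
    ∀ᵐ η : ℝ, fhat (f + g) k η l = fhat f k η l + fhat g k η l := by
  filter_upwards [ftL_add (memLp_mode hf k l) (memLp_mode hg k l)] with η hη
  rw [fhat_eq_ftL, fhat_eq_ftL, fhat_eq_ftL, ← hη, ftL_congr_ae (mode_add hf hg k l)]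

lemma ae_eq_of_fhat {f g : Dom → ℂ} (hf : MemLp f 2 (volume : Measure Dom))
    (hg : MemLp g 2 (volume : Measure Dom))
    (h : ∀ k l : ℤ, ∀ᵐ η : ℝ, fhat f k η l = fhat g k η l) : f =ᵐ[volume] g :=
  ae_eq_of_mode hf hg fun k l => ae_eq_of_ftL (memLp_mode hf k l) (memLp_mode hg k l) (h k l)

/-! ### Synthesis from modes -/

/-- Square integrable functions on the line and on the domain. -/
abbrev LineL2 : Type := Lp ℂ 2 (volume : Measure ℝ)

/-- Square integrable functions on the domain. -/
abbrev DomL2 : Type := Lp ℂ 2 (volume : Measure Dom)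

lemma memLp_char {c : ℝ → ℂ} (hc : MemLp c 2 (volume : Measure ℝ)) (k l : ℤ) :
    MemLp (fun p : Dom => fourier k p.1 * fourier l p.2.2 * c p.2.1) 2 volume :=
  memLp_fourier_mul_dom k l (memLp_of_y hc)

lemma ae_of_y {P : ℝ → Prop} (h : ∀ᵐ y, P y) : ∀ᵐ p : Dom, P p.2.1 := by
  have h1 : ∀ᵐ q : ℝ × (Torus × Torus), P q.1 := Measure.quasiMeasurePreserving_fst.ae h
  exact measurePreserving_pull.quasiMeasurePreserving.ae h1

/-- `c ↦ e^{2πi(kx+lz)} c(y)`. -/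
def charMap (i : ℤ × ℤ) : LineL2 →ₗ[ℂ] DomL2 where
  toFun c := (memLp_char (Lp.memLp c) i.1 i.2).toLp _
  map_add' a b := by
    rw [← MemLp.toLp_add, MemLp.toLp_eq_toLp_iff]
    filter_upwards [ae_of_y (Lp.coeFn_add a b)] with p hp
    simp only [Pi.add_apply, hp]; ring
  map_smul' r a := by
    rw [RingHom.id_apply, ← MemLp.toLp_const_smul, MemLp.toLp_eq_toLp_iff]
    filter_upwards [ae_of_y (Lp.coeFn_smul r a)] with p hp
    simp only [Pi.smul_apply, hp, smul_eq_mul]; ring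

/-- The mode of a class of square integrable functions. -/
def modeLp (F : DomL2) (i : ℤ × ℤ) : LineL2 := (memLp_mode (Lp.memLp F) i.1 i.2).toLp _

lemma mode_char (c : ℝ → ℂ) (k l k' l' : ℤ) (y : ℝ) :
    mode (fun p : Dom => fourier k p.1 * fourier l p.2.2 * c p.2.1) k' l' y =
      if k' = k ∧ l' = l then c y else 0 := by
  have e1 : mode (fun p : Dom => fourier k p.1 * fourier l p.2.2 * c p.2.1) k' l' y =
      (∫ x : Torus, (fourier (-k' + k) x : ℂ)) * ((∫ x : Torus, (fourier (-l' + l) x : ℂ)) * c y) := by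
    rw [← integral_mul_const, ← integral_mul_const, mode]
    congr 1; ext x
    rw [← integral_const_mul]
    congr 1; ext z
    rw [fourier_add, fourier_add]; ring
  rw [e1, integral_fourier_torus, integral_fourier_torus]
  have h1 : -k' + k = 0 ↔ k' = k := by omega
  have h2 : -l' + l = 0 ↔ l' = l := by omega
  simp only [h1, h2]
  by_cases hk : k' = k <;> by_cases hl : l' = l <;> simp [hk, hl]

/-- So `modeLp` is the adjoint of `charMap`: orthogonality and completeness of the family of
characters become statements about modes. -/
lemma inner_charMap (i : ℤ × ℤ) (c : LineL2) (F : DomL2) :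
    inner ℂ (charMap i c) F = inner ℂ c (modeLp F i) := by
  rw [L2.inner_def, L2.inner_def]
  have hconj : MemLp (fun y => (starRingEnd ℂ) (c y)) 2 volume := (Lp.memLp c).star
  have h := integral_char_mul (Lp.memLp F) hconj i.1 i.2
  calc _ = _ := by
        refine Eq.trans (integral_congr_ae ?_) h
        filter_upwards [(memLp_char (Lp.memLp c) i.1 i.2).coeFn_toLp] with p hp
        simp only [charMap, LinearMap.coe_mk, AddHom.coe_mk, hp, RCLike.inner_apply, map_mul,
          fourier_neg]
    _ = _ := by
        refine integral_congr_ae ?_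
        filter_upwards [(memLp_mode (Lp.memLp F) i.1 i.2).coeFn_toLp] with y hy
        simp only [modeLp, hy, RCLike.inner_apply]

lemma modeLp_charMap (i j : ℤ × ℤ) (c : LineL2) :
    modeLp (charMap i c) j = if j = i then c else 0 := by
  have h1 : ∀ᵐ y, mode (charMap i c) j.1 j.2 y = if j = i then c y else 0 := by
    filter_upwards [mode_congr_ae (memLp_char (Lp.memLp c) i.1 i.2).coeFn_toLp j.1 j.2] with y hy
    simp only [charMap, LinearMap.coe_mk, AddHom.coe_mk]
    rw [hy, mode_char]
    simp only [Prod.ext_iff]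
  refine Lp.ext ?_
  have h2 := (memLp_mode (Lp.memLp (charMap i c)) j.1 j.2).coeFn_toLp
  by_cases hij : j = i
  · subst hij
    filter_upwards [h1, h2] with y e1 e2
    simp only [modeLp, e2, e1, if_true]
  · filter_upwards [h1, h2, Lp.coeFn_zero ℂ 2 (volume : Measure ℝ)] with y e1 e2 e3
    simp only [modeLp, e2, e1, hij, if_false, e3, Pi.zero_apply]

/-- `charMap` as an isometry. -/
def charIso (i : ℤ × ℤ) : LineL2 →ₗᵢ[ℂ] DomL2 :=
  (charMap i).isometryOfInner fun a b => by rw [inner_charMap, modeLp_charMap, if_pos rfl]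

/-- The ranges are orthogonal because a character has a single nonzero mode; they span a dense
subspace because a function orthogonal to all of them has only zero modes. -/
lemma isHilbertSum_charIso : IsHilbertSum ℂ (fun _ : ℤ × ℤ => LineL2) charIso := by
  refine IsHilbertSum.mk ?_ ?_
  · intro i j hij a b
    change inner ℂ (charMap i a) (charMap j b) = 0
    rw [inner_charMap, modeLp_charMap, if_neg hij, inner_zero_right]
  · rw [top_le_iff, Submodule.topologicalClosure_eq_top_iff, Submodule.eq_bot_iff]
    intro F hF
    have h1 : ∀ i, modeLp F i = 0 := by
      intro i
      have h2 : charMap i (modeLp F i) ∈ ⨆ j, (charIso j).toLinearMap.range :=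
        Submodule.mem_iSup_of_mem i ⟨_, rfl⟩
      have h3 := Submodule.inner_right_of_mem_orthogonal h2 hF
      rw [inner_charMap] at h3
      exact inner_self_eq_zero.1 h3
    refine (Lp.eq_zero_iff_ae_eq_zero).2 (ae_eq_zero_of_mode (Lp.memLp F) fun k l => ?_)
    have h4 := (memLp_mode (Lp.memLp F) k l).coeFn_toLp
    have h5 := h1 (k, l)
    rw [modeLp] at h5
    simp only at h5
    rw [h5] at h4
    filter_upwards [h4, Lp.coeFn_zero ℂ 2 (volume : Measure ℝ)] with y e1 e2
    rw [← e1, e2]; rfl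

/-- The coordinates in the Hilbert sum are the modes, so a function can be built from any square
summable family of modes. -/
lemma linearIsometryEquiv_charIso_apply (F : DomL2) (i : ℤ × ℤ) :
    isHilbertSum_charIso.linearIsometryEquiv F i = modeLp F i := by
  refine ext_inner_left ℂ fun c => ?_
  classical
  have h1 : isHilbertSum_charIso.linearIsometryEquiv (charMap i c) = lp.single 2 i c := by
    rw [← LinearIsometryEquiv.eq_symm_apply]
    exact (isHilbertSum_charIso.linearIsometryEquiv_symm_apply_single c).symm
  rw [← inner_charMap, ← LinearIsometryEquiv.inner_map_map isHilbertSum_charIso.linearIsometryEquiv,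
    h1, lp.inner_single_left]

/-- Bounded multipliers act on square integrable functions. -/
lemma exists_isMul {m : ℝ → ℤ → ℂ} (hm : ∀ l, Measurable fun η => m η l) {C : ℝ}
    (hC : ∀ η l, ‖m η l‖ ≤ C) {f : Dom → ℂ} (hf : MemLp f 2 (volume : Measure Dom)) :
    ∃ g, IsMul m f g := by
  set F : DomL2 := hf.toLp f with hF
  have hmode : ∀ k l : ℤ, ∀ᵐ y, mode F k l y = mode f k l y := mode_congr_ae hf.coeFn_toLp
  have hmem : ∀ i : ℤ × ℤ, MemLp (fun η => m η i.2 * fhat f i.1 η i.2) 2 volume := by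
    intro i
    refine (memLp_ftL (mode f i.1 i.2)).of_le_mul (c := C) ?_ (Eventually.of_forall fun η => ?_)
    · have h1 := hm i.2
      have h2 := (memLp_ftL (mode f i.1 i.2)).1
      exact h1.aestronglyMeasurable.mul h2
    · rw [norm_mul, fhat_eq_ftL]
      gcongr
      exact hC η i.2
  -- `φ i` is the mode that the image must have. The bound `C` on the symbol carries square
  -- summability over from the modes of `f`.
  choose φ hφ hφf using fun i => exists_ftL_eq (hmem i)
  have hnorm : ∀ i, ‖(hφ i).toLp (φ i)‖ ≤ C * ‖modeLp F i‖ := by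
    intro i
    have hC0 : 0 ≤ C := (norm_nonneg _).trans (hC 0 0)
    rw [Lp.norm_toLp, modeLp, Lp.norm_toLp, ← eLpNorm_ftL (hφ i),
      ← eLpNorm_ftL (memLp_mode (Lp.memLp F) i.1 i.2), eLpNorm_congr_ae (hφf i),
      ftL_congr_ae (hmode i.1 i.2)]
    have h1 : eLpNorm (fun η => m η i.2 * fhat f i.1 η i.2) 2 volume ≤
        ENNReal.ofReal C * eLpNorm (ftL (mode f i.1 i.2)) 2 volume := by
      refine eLpNorm_le_mul_eLpNorm_of_ae_le_mul (Eventually.of_forall fun η => ?_) 2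
      rw [norm_mul, fhat_eq_ftL]
      gcongr
      exact hC η i.2
    refine (ENNReal.toReal_mono (ENNReal.mul_ne_top ENNReal.ofReal_ne_top
      (memLp_ftL _).2.ne) h1).trans ?_
    rw [ENNReal.toReal_mul, ENNReal.toReal_ofReal hC0]
  set L := isHilbertSum_charIso.linearIsometryEquiv with hL
  have hw : Memℓp (fun i => (hφ i).toLp (φ i)) 2 := by
    have h1 : Memℓp (fun i => (C : ℂ) • (L F) i) 2 := (lp.memℓp (L F)).const_smul (C : ℂ)
    refine memℓp_gen ?_
    have h2 := h1.summable (by norm_num)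
    refine Summable.of_nonneg_of_le (fun i => by positivity) (fun i => ?_) h2
    refine Real.rpow_le_rpow (norm_nonneg _) ?_ (by norm_num)
    refine (hnorm i).trans ?_
    rw [norm_smul, linearIsometryEquiv_charIso_apply]
    gcongr
    simpa using le_abs_self C
  let w : lp (fun _ : ℤ × ℤ => LineL2) 2 := ⟨_, hw⟩
  refine ⟨L.symm w, Lp.memLp _, fun k l => ?_⟩
  have h1 : modeLp (L.symm w) (k, l) = (hφ (k, l)).toLp (φ (k, l)) := by
    rw [← linearIsometryEquiv_charIso_apply, ← hL, LinearIsometryEquiv.apply_symm_apply]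
  have h2 : ∀ᵐ y, mode (L.symm w) k l y = φ (k, l) y := by
    have h3 := (memLp_mode (Lp.memLp (L.symm w)) k l).coeFn_toLp
    rw [show ((memLp_mode (Lp.memLp (L.symm w)) k l).toLp _) = modeLp (L.symm w) (k, l) from rfl,
      h1] at h3
    filter_upwards [h3, (hφ (k, l)).coeFn_toLp] with y e1 e2
    rw [← e1, e2]
  filter_upwards [hφf (k, l)] with η hη
  rw [fhat_eq_ftL, ftL_congr_ae h2, hη]

/-! ### Smooth functions on the domain -/

/-- Periodic lift of a function on the domain. -/
def lft (f : Dom → ℂ) (q : ℝ × ℝ × ℝ) : ℂ := f ((q.1 : Torus), q.2.1, (q.2.2 : Torus))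

lemma exists_coe_eq (p : Dom) : ∃ q : ℝ × ℝ × ℝ, p = ((q.1 : Torus), q.2.1, (q.2.2 : Torus)) := by
  obtain ⟨x, y, z⟩ := p
  obtain ⟨a, rfl⟩ := QuotientAddGroup.mk_surjective x
  obtain ⟨c, rfl⟩ := QuotientAddGroup.mk_surjective z
  exact ⟨(a, y, c), rfl⟩

/-- The covering `ℝ³ → 𝕋 × ℝ × 𝕋` is an open quotient map. -/
lemma continuous_of_lft {f : Dom → ℂ} (h : Continuous (lft f)) : Continuous f := by
  have hq : IsOpenQuotientMap (fun a : ℝ => (a : Torus)) := QuotientAddGroup.isOpenQuotientMap_mk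
  have h3 : IsOpenQuotientMap (Prod.map (fun a : ℝ => (a : Torus))
      (Prod.map (id : ℝ → ℝ) (fun a : ℝ => (a : Torus)))) :=
    hq.prodMap (IsOpenQuotientMap.id.prodMap hq)
  exact h3.isQuotientMap.continuous_iff.2 h

lemma Smooth.contDiff {f : Dom → ℂ} (h : Smooth f) : ContDiff ℝ ∞ (lft f) := h

lemma Smooth.continuous {f : Dom → ℂ} (h : Smooth f) : Continuous f :=
  continuous_of_lft h.contDiff.continuous

/-- The derivative of `f` in a constant direction, for the group structure of the domain. -/
def dirD (e : ℝ × ℝ × ℝ) (f : Dom → ℂ) (p : Dom) : ℂ :=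
  deriv (fun s : ℝ => f (p.1 + ((s * e.1 : ℝ) : Torus), p.2.1 + s * e.2.1,
    p.2.2 + ((s * e.2.2 : ℝ) : Torus))) 0

lemma Smooth.hasDerivAt_lft {f : Dom → ℂ} (h : Smooth f) (e q : ℝ × ℝ × ℝ) (s : ℝ) :
    HasDerivAt (fun s : ℝ => lft f (q + s • e)) (fderiv ℝ (lft f) (q + s • e) e) s := by
  have h1 : HasFDerivAt (lft f) (fderiv ℝ (lft f) (q + s • e)) (q + s • e) :=
    (h.contDiff.differentiable (by norm_num)).differentiableAt.hasFDerivAt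
  have h2 : HasDerivAt (fun s : ℝ => q + s • e) e s := by
    simpa using ((hasDerivAt_id s).smul_const e).const_add q
  exact h1.comp_hasDerivAt s h2

lemma lft_add_smul (f : Dom → ℂ) (e q : ℝ × ℝ × ℝ) (s : ℝ) :
    lft f (q + s • e) = f ((q.1 : Torus) + ((s * e.1 : ℝ) : Torus), q.2.1 + s * e.2.1,
      (q.2.2 : Torus) + ((s * e.2.2 : ℝ) : Torus)) := by
  simp [lft]

lemma Smooth.lft_dirD {f : Dom → ℂ} (h : Smooth f) (e q : ℝ × ℝ × ℝ) :
    lft (dirD e f) q = fderiv ℝ (lft f) q e := by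
  have h1 := (h.hasDerivAt_lft e q 0).deriv
  simp only [lft_add_smul, zero_smul, add_zero] at h1
  exact h1

lemma Smooth.dirD {f : Dom → ℂ} (h : Smooth f) (e : ℝ × ℝ × ℝ) : Smooth (dirD e f) := by
  have h1 : lft (Couette.dirD e f) = fun q => fderiv ℝ (lft f) q e := funext (h.lft_dirD e)
  change ContDiff ℝ ∞ (lft (Couette.dirD e f))
  rw [h1]
  exact (h.contDiff.fderiv_right (m := ∞) (by norm_num)).clm_apply contDiff_const

lemma Smooth.hasDerivAt {f : Dom → ℂ} (h : Smooth f) (e : ℝ × ℝ × ℝ) (p : Dom) (s : ℝ) :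
    HasDerivAt (fun s : ℝ => f (p.1 + ((s * e.1 : ℝ) : Torus), p.2.1 + s * e.2.1,
      p.2.2 + ((s * e.2.2 : ℝ) : Torus))) (Couette.dirD e f (p.1 + ((s * e.1 : ℝ) : Torus),
        p.2.1 + s * e.2.1, p.2.2 + ((s * e.2.2 : ℝ) : Torus))) s := by
  obtain ⟨q, rfl⟩ := exists_coe_eq p
  have h1 := h.hasDerivAt_lft e q s
  rw [← h.lft_dirD] at h1
  simpa only [lft_add_smul] using h1

lemma dx_eq_dirD (f : Dom → ℂ) : dx f = dirD (1, 0, 0) f := by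
  ext p; simp [dx, dirD]

lemma dy_eq_dirD (f : Dom → ℂ) : dy f = dirD (0, 1, 0) f := by
  ext p; simp [dy, dirD]

lemma dz_eq_dirD (f : Dom → ℂ) : dz f = dirD (0, 0, 1) f := by
  ext p; simp [dz, dirD]

lemma Smooth.dx {f : Dom → ℂ} (h : Smooth f) : Smooth (dx f) := by
  rw [dx_eq_dirD]; exact h.dirD _

lemma Smooth.dy {f : Dom → ℂ} (h : Smooth f) : Smooth (dy f) := by
  rw [dy_eq_dirD]; exact h.dirD _

lemma Smooth.dz {f : Dom → ℂ} (h : Smooth f) : Smooth (dz f) := by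
  rw [dz_eq_dirD]; exact h.dirD _

lemma hasDerivAt_integral_of_compact {X : Type*} [TopologicalSpace X] [CompactSpace X]
    [MeasurableSpace X] [BorelSpace X] [SecondCountableTopology X] {μ : Measure X}
    [IsFiniteMeasure μ]
    {G G' : ℝ → X → ℂ} (hG : ∀ s, Continuous (G s)) (hG' : Continuous (Function.uncurry G'))
    (hd : ∀ s x, HasDerivAt (fun s => G s x) (G' s x) s) (s : ℝ) :
    HasDerivAt (fun s => ∫ x, G s x ∂μ) (∫ x, G' s x ∂μ) s := by
  obtain ⟨C, hC⟩ := ((isCompact_closedBall s 1).prod (isCompact_univ (X := X))).exists_bound_of_continuousOn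
    hG'.continuousOn
  have hG1 : ∀ s, Continuous (G' s) := fun s => hG'.comp (by fun_prop : Continuous fun x => (s, x))
  refine (hasDerivAt_integral_of_dominated_loc_of_deriv_le (F := G) (F' := G') (bound := fun _ => C)
    (Metric.ball_mem_nhds s one_pos) ?_ ?_ ?_ ?_ ?_ ?_).2
  · exact Eventually.of_forall fun r => (hG r).aestronglyMeasurable
  · exact (hG s).integrable_of_hasCompactSupport (HasCompactSupport.of_compactSpace _)
  · exact (hG1 s).aestronglyMeasurable
  · exact Eventually.of_forall fun x r hr => hC (r, x) ⟨Metric.ball_subset_closedBall hr, mem_univ _⟩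
  · exact integrable_const C
  · exact Eventually.of_forall fun x r _ => hd r x

lemma integrable_slice {f : Dom → ℂ} (h : Continuous f) (y : ℝ) :
    Integrable (fun q : Torus × Torus => f (q.1, y, q.2)) volume :=
  Continuous.integrable_of_hasCompactSupport (by fun_prop) (HasCompactSupport.of_compactSpace _)

lemma mode_eq_of_continuous {f : Dom → ℂ} (h : Continuous f) (k l : ℤ) (y : ℝ) :
    mode f k l y = ∫ q : Torus × Torus, fourier (-k) q.1 * fourier (-l) q.2 * f (q.1, y, q.2) :=
  mode_eq_integral_of_integrable (integrable_slice h y) k l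

lemma mode_add_of_continuous {f g : Dom → ℂ} (hf : Continuous f) (hg : Continuous g) (k l : ℤ)
    (y : ℝ) : mode (fun p => f p + g p) k l y = mode f k l y + mode g k l y := by
  rw [mode_eq_of_continuous hf, mode_eq_of_continuous hg, mode_eq_of_continuous (by fun_prop),
    ← integral_add]
  · simp only [mul_add]
  · exact Continuous.integrable_of_hasCompactSupport (by fun_prop)
      (HasCompactSupport.of_compactSpace _)
  · exact Continuous.integrable_of_hasCompactSupport (by fun_prop)
      (HasCompactSupport.of_compactSpace _)

lemma Smooth.hasDerivAt_integral {f : Dom → ℂ} (h : Smooth f) (e : ℝ × ℝ × ℝ) (k l : ℤ) (y s : ℝ) :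
    HasDerivAt (fun s : ℝ => ∫ q : Torus × Torus, fourier (-k) q.1 * fourier (-l) q.2 *
      f (q.1 + ((s * e.1 : ℝ) : Torus), y + s * e.2.1, q.2 + ((s * e.2.2 : ℝ) : Torus)))
      (∫ q : Torus × Torus, fourier (-k) q.1 * fourier (-l) q.2 *
      Couette.dirD e f (q.1 + ((s * e.1 : ℝ) : Torus), y + s * e.2.1,
        q.2 + ((s * e.2.2 : ℝ) : Torus))) s := by
  have hc := h.continuous
  have hc' := (h.dirD e).continuous
  have hm : Continuous (fun a : ℝ => (a : Torus)) := AddCircle.continuous_mk' 1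
  refine hasDerivAt_integral_of_compact (G := fun s (q : Torus × Torus) =>
      fourier (-k) q.1 * fourier (-l) q.2 *
      f (q.1 + ((s * e.1 : ℝ) : Torus), y + s * e.2.1, q.2 + ((s * e.2.2 : ℝ) : Torus)))
    (G' := fun s (q : Torus × Torus) => fourier (-k) q.1 * fourier (-l) q.2 *
      Couette.dirD e f (q.1 + ((s * e.1 : ℝ) : Torus), y + s * e.2.1,
        q.2 + ((s * e.2.2 : ℝ) : Torus))) ?_ ?_ ?_ s
  · intro s; fun_prop
  · simp only [Function.uncurry_def]; fun_prop
  · intro s q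
    exact (h.hasDerivAt e (q.1, y, q.2) s).const_mul _

lemma Smooth.hasDerivAt_mode {f : Dom → ℂ} (h : Smooth f) (k l : ℤ) (y : ℝ) :
    HasDerivAt (mode f k l) (mode (Couette.dy f) k l y) y := by
  have h1 := h.hasDerivAt_integral (0, 1, 0) k l 0 y
  simp only [mul_zero, mul_one, zero_add, AddCircle.coe_zero, add_zero] at h1
  rw [mode_eq_of_continuous h.dy.continuous, dy_eq_dirD]
  refine h1.congr_of_eventuallyEq (Eventually.of_forall fun y => ?_)
  exact mode_eq_of_continuous h.continuous k l y

lemma mode_translate_z (f : Dom → ℂ) (k l : ℤ) (y s : ℝ) :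
    mode (fun p => f (p.1, p.2.1, p.2.2 + (s : Torus))) k l y =
      Complex.exp (2 * Real.pi * Complex.I * (l * s)) * mode f k l y := by
  rw [mode, mode, ← integral_const_mul]
  congr 1; ext x
  rw [← integral_sub_right_eq_self (μ := (volume : Measure Torus)) _ (s : Torus),
    ← integral_const_mul]
  congr 1; ext z
  simp only [sub_add_cancel]
  rw [sub_eq_add_neg, fourier_add_torus, ← AddCircle.coe_neg, fourier_coe_torus]
  have : (2 * Real.pi * Complex.I * (((-l : ℤ) : ℂ) * ((-s : ℝ) : ℂ)) : ℂ) =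
      2 * Real.pi * Complex.I * (l * s) := by push_cast; ring
  rw [this]; ring

lemma mode_translate_x (f : Dom → ℂ) (k l : ℤ) (y s : ℝ) :
    mode (fun p => f (p.1 + (s : Torus), p.2.1, p.2.2)) k l y =
      Complex.exp (2 * Real.pi * Complex.I * (k * s)) * mode f k l y := by
  rw [mode, mode, ← integral_const_mul]
  rw [← integral_sub_right_eq_self (μ := (volume : Measure Torus)) _ (s : Torus)]
  congr 1; ext x
  rw [← integral_const_mul]
  congr 1; ext z
  simp only [sub_add_cancel]
  rw [sub_eq_add_neg, fourier_add_torus, ← AddCircle.coe_neg, fourier_coe_torus]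
  have : (2 * Real.pi * Complex.I * (((-k : ℤ) : ℂ) * ((-s : ℝ) : ℂ)) : ℂ) =
      2 * Real.pi * Complex.I * (k * s) := by push_cast; ring
  rw [this]; ring

lemma hasDerivAt_exp_mul (c m : ℂ) :
    HasDerivAt (fun s : ℝ => Complex.exp (2 * Real.pi * Complex.I * (c * s)) * m)
      (2 * Real.pi * Complex.I * c * m) 0 := by
  have h1 : HasDerivAt (fun s : ℝ => (2 * Real.pi * Complex.I * (c * s) : ℂ))
      (2 * Real.pi * Complex.I * c) 0 := by
    have := ((Complex.ofRealCLM.hasDerivAt (x := (0 : ℝ))).const_mul c).const_mul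
      (2 * Real.pi * Complex.I : ℂ)
    simpa using this
  have h2 := h1.cexp.mul_const m
  simpa using h2

/-- The mode of the translate in `z` by `s` is differentiated at `s = 0` in two ways: under the
integral sign and through the phase of `mode_translate_z`. -/
lemma Smooth.mode_dz {f : Dom → ℂ} (h : Smooth f) (k l : ℤ) (y : ℝ) :
    mode (Couette.dz f) k l y = 2 * Real.pi * Complex.I * l * mode f k l y := by
  have h1 := h.hasDerivAt_integral (0, 0, 1) k l y 0
  simp only [mul_zero, mul_one, AddCircle.coe_zero, add_zero] at h1
  rw [← dz_eq_dirD, ← mode_eq_of_continuous h.dz.continuous] at h1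
  have hm : Continuous (fun a : ℝ => (a : Torus)) := AddCircle.continuous_mk' 1
  have hc := h.continuous
  refine h1.unique ((hasDerivAt_exp_mul l (mode f k l y)).congr_of_eventuallyEq
    (Eventually.of_forall fun s => ?_))
  simp only [← mode_translate_z]
  rw [mode_eq_of_continuous (by fun_prop)]

lemma Smooth.mode_dx {f : Dom → ℂ} (h : Smooth f) (k l : ℤ) (y : ℝ) :
    mode (Couette.dx f) k l y = 2 * Real.pi * Complex.I * k * mode f k l y := by
  have h1 := h.hasDerivAt_integral (1, 0, 0) k l y 0
  simp only [mul_zero, mul_one, AddCircle.coe_zero, add_zero] at h1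
  rw [← dx_eq_dirD, ← mode_eq_of_continuous h.dx.continuous] at h1
  have hm : Continuous (fun a : ℝ => (a : Torus)) := AddCircle.continuous_mk' 1
  have hc := h.continuous
  refine h1.unique ((hasDerivAt_exp_mul k (mode f k l y)).congr_of_eventuallyEq
    (Eventually.of_forall fun s => ?_))
  simp only [← mode_translate_x]
  rw [mode_eq_of_continuous (by fun_prop)]

/-! ### Derivatives of the projections -/

lemma Smooth.hasDerivAt_zeroX_y {f : Dom → ℂ} (h : Smooth f) (p : Dom) :
    HasDerivAt (fun s : ℝ => zeroX f (p.1, p.2.1 + s, p.2.2)) (zeroX (Couette.dy f) p) 0 := by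
  have hc := h.continuous
  have hc' := h.dy.continuous
  have h1 := hasDerivAt_integral_of_compact (μ := (volume : Measure Torus))
    (G := fun s (x : Torus) => f (x, p.2.1 + s, p.2.2))
    (G' := fun s (x : Torus) => Couette.dy f (x, p.2.1 + s, p.2.2))
    (fun s => by fun_prop) (by simp only [Function.uncurry_def]; fun_prop)
    (fun s x => by
      have := h.hasDerivAt (0, 1, 0) (x, p.2.1, p.2.2) s
      simpa [dy_eq_dirD] using this) 0
  simpa [zeroX] using h1

lemma Smooth.hasDerivAt_zeroX_z {f : Dom → ℂ} (h : Smooth f) (p : Dom) :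
    HasDerivAt (fun s : ℝ => zeroX f (p.1, p.2.1, p.2.2 + (s : Torus))) (zeroX (Couette.dz f) p)
      0 := by
  have hm : Continuous (fun a : ℝ => (a : Torus)) := AddCircle.continuous_mk' 1
  have hc := h.continuous
  have hc' := h.dz.continuous
  have h1 := hasDerivAt_integral_of_compact (μ := (volume : Measure Torus))
    (G := fun s (x : Torus) => f (x, p.2.1, p.2.2 + (s : Torus)))
    (G' := fun s (x : Torus) => Couette.dz f (x, p.2.1, p.2.2 + (s : Torus)))
    (fun s => by fun_prop) (by simp only [Function.uncurry_def]; fun_prop)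
    (fun s x => by
      have := h.hasDerivAt (0, 0, 1) (x, p.2.1, p.2.2) s
      simpa [dz_eq_dirD] using this) 0
  simpa [zeroX] using h1

lemma Smooth.dy_simpleZero {f : Dom → ℂ} (h : Smooth f) :
    Couette.dy (simpleZero f) = simpleZero (Couette.dy f) := by
  ext p
  have h1 := h.hasDerivAt_zeroX_y p
  have h2 : HasDerivAt (fun s : ℝ => mode f 0 0 (p.2.1 + s)) (mode (Couette.dy f) 0 0 p.2.1) 0 := by
    have := (h.hasDerivAt_mode 0 0 (p.2.1 + 0)).comp_const_add p.2.1 0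
    simpa using this
  have h3 := (h1.sub h2).deriv
  rw [Couette.dy, simpleZero, doubleZero_eq, ← h3]
  congr 1
  ext s
  simp [simpleZero, doubleZero_eq]

lemma Smooth.dz_simpleZero {f : Dom → ℂ} (h : Smooth f) :
    Couette.dz (simpleZero f) = simpleZero (Couette.dz f) := by
  ext p
  have h1 := h.hasDerivAt_zeroX_z p
  have h3 := (h1.sub_const (mode f 0 0 p.2.1)).deriv
  rw [Couette.dz, simpleZero, doubleZero_eq, h.mode_dz]
  simp only [Int.cast_zero, mul_zero, zero_mul, sub_zero]
  rw [← h3]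
  congr 1
  ext s
  simp [simpleZero, doubleZero_eq]

lemma Smooth.iterate_dz {f : Dom → ℂ} (h : Smooth f) (b : ℕ) : Smooth (Couette.dz^[b] f) := by
  induction b with
  | zero => exact h
  | succ n ih => rw [Function.iterate_succ_apply']; exact ih.dz

lemma Smooth.iterate_dy {f : Dom → ℂ} (h : Smooth f) (b : ℕ) : Smooth (Couette.dy^[b] f) := by
  induction b with
  | zero => exact h
  | succ n ih => rw [Function.iterate_succ_apply']; exact ih.dy

/-- Lets the `W^{m,1}` norm of `f̃₀` control the modes of derivatives of `f` itself. -/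
lemma Smooth.iterate_simpleZero {f : Dom → ℂ} (h : Smooth f) (a b : ℕ) :
    Couette.dy^[a] (Couette.dz^[b] (simpleZero f)) =
      simpleZero (Couette.dy^[a] (Couette.dz^[b] f)) := by
  have h1 : Couette.dz^[b] (simpleZero f) = simpleZero (Couette.dz^[b] f) := by
    induction b with
    | zero => rfl
    | succ n ih =>
      rw [Function.iterate_succ_apply', Function.iterate_succ_apply', ih,
        (h.iterate_dz n).dz_simpleZero]
  rw [h1]
  induction a with
  | zero => rfl
  | succ n ih =>
    rw [Function.iterate_succ_apply', Function.iterate_succ_apply', ih,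
      ((h.iterate_dz b).iterate_dy n).dy_simpleZero]

/-! ### Divergence free fields and vorticity -/

lemma fhat_divFree {v : Fin 3 → Dom → ℂ} (hs : ∀ j, Smooth (v j))
    (hm : ∀ j, MemLp (v j) 2 (volume : Measure Dom)) (hd : DivFree v) (k l : ℤ) :
    ∀ᵐ η : ℝ, k * fhat (v 0) k η l + η * fhat (v 1) k η l + l * fhat (v 2) k η l = 0 := by
  have h0 : ∀ y, mode (dy (v 1)) k l y = (-(2 * Real.pi * Complex.I * k)) * mode (v 0) k l y
      + (-(2 * Real.pi * Complex.I * l)) * mode (v 2) k l y := by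
    intro y
    have h1 : mode (fun p => (dx (v 0) p + dy (v 1) p) + dz (v 2) p) k l y = 0 := by
      have : (fun p => (dx (v 0) p + dy (v 1) p) + dz (v 2) p) = fun _ => 0 := funext hd
      rw [this]; simp [mode]
    rw [mode_add_of_continuous (f := fun p => dx (v 0) p + dy (v 1) p)
      ((hs 0).dx.continuous.add (hs 1).dy.continuous)
      (hs 2).dz.continuous, mode_add_of_continuous (hs 0).dx.continuous (hs 1).dy.continuous,
      (hs 0).mode_dx, (hs 2).mode_dz] at h1
    linear_combination h1
  have m0 := (memLp_mode (hm 0) k l).const_mul (-(2 * Real.pi * Complex.I * k))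
  have m2 := (memLp_mode (hm 2) k l).const_mul (-(2 * Real.pi * Complex.I * l))
  -- Square integrability of `∂_y v²` is not assumed; the divergence condition supplies it for each
  -- mode.
  have hm' : MemLp (mode (dy (v 1)) k l) 2 volume := by
    rw [show mode (dy (v 1)) k l = _ from funext h0]
    exact m0.add m2
  have h2 := ftL_deriv (memLp_mode (hm 1) k l) ((hs 1).hasDerivAt_mode k l) hm'
  rw [show mode (dy (v 1)) k l = _ from funext h0] at h2
  filter_upwards [h2, ftL_add m0 m2, ftL_const_mul (memLp_mode (hm 0) k l)
    (-(2 * Real.pi * Complex.I * k)), ftL_const_mul (memLp_mode (hm 2) k l)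
    (-(2 * Real.pi * Complex.I * l))] with η e1 e2 e3 e4
  rw [e2, e3, e4] at e1
  simp only [fhat_eq_ftL]
  have hpi : (2 * Real.pi * Complex.I : ℂ) ≠ 0 := Complex.two_pi_I_ne_zero
  refine mul_left_cancel₀ hpi ?_
  linear_combination -e1

/-- `vort v` need not be square integrable, but each of its modes is, being a combination of modes
of `v`. This suffices for `fhat`. -/
lemma fhat_vort {v : Fin 3 → Dom → ℂ} (hs : ∀ j, Smooth (v j))
    (hm : ∀ j, MemLp (v j) 2 (volume : Measure Dom)) (k l : ℤ) :
    ∀ᵐ η : ℝ, fhat (vort v) k η l =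
      2 * Real.pi * Complex.I * (l * fhat (v 0) k η l - k * fhat (v 2) k η l) := by
  have h0 : ∀ y, mode (vort v) k l y = (2 * Real.pi * Complex.I * l) * mode (v 0) k l y
      + (-(2 * Real.pi * Complex.I * k)) * mode (v 2) k l y := by
    intro y
    have e : vort v = fun p => dz (v 0) p + (-1) * dx (v 2) p := by
      ext p; simp [vort]; ring
    rw [e, mode_add_of_continuous (g := fun p => (-1) * dx (v 2) p) (hs 0).dz.continuous
      (continuous_const.mul (hs 2).dx.continuous),
      mode_const_mul, (hs 0).mode_dz, (hs 2).mode_dx]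
    ring
  have m0 := (memLp_mode (hm 0) k l).const_mul (2 * Real.pi * Complex.I * l)
  have m2 := (memLp_mode (hm 2) k l).const_mul (-(2 * Real.pi * Complex.I * k))
  filter_upwards [ftL_add m0 m2, ftL_const_mul (memLp_mode (hm 0) k l)
    (2 * Real.pi * Complex.I * l), ftL_const_mul (memLp_mode (hm 2) k l)
    (-(2 * Real.pi * Complex.I * k))] with η e2 e3 e4
  simp only [fhat_eq_ftL]
  rw [show mode (vort v) k l = _ from funext h0, e2, e3, e4]
  ring

/-! ### Continuous curves in `L²` of the line -/

/-- `f` is a continuous curve `[0, ∞) → L²(ℝ)`. -/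
structure CurveL2 (f : ℝ → ℝ → ℂ) : Prop where
  memLp : ∀ t, 0 ≤ t → MemLp (f t) 2 (volume : Measure ℝ)
  continuous : ∀ t, 0 ≤ t →
    Tendsto (fun s => eLpNorm (fun y => f s y - f t y) 2 (volume : Measure ℝ)) (𝓝[Ici 0] t) (𝓝 0)

lemma tendsto_zero_of_le_nhdsWithin {f g : ℝ → ℝ≥0∞} {t : ℝ}
    (hg : Tendsto g (𝓝[Ici 0] t) (𝓝 0)) (h : ∀ s, 0 ≤ s → f s ≤ g s) :
    Tendsto f (𝓝[Ici 0] t) (𝓝 0) :=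
  tendsto_of_tendsto_of_tendsto_of_le_of_le' tendsto_const_nhds hg
    (Eventually.of_forall fun _ => zero_le)
    (by filter_upwards [self_mem_nhdsWithin] with s hs using h s hs)

lemma CurveL2.add {f g : ℝ → ℝ → ℂ} (hf : CurveL2 f) (hg : CurveL2 g) :
    CurveL2 (fun t y => f t y + g t y) where
  memLp t ht := (hf.memLp t ht).add (hg.memLp t ht)
  continuous t ht := by
    have h := (hf.continuous t ht).add (hg.continuous t ht)
    rw [add_zero] at h
    refine tendsto_zero_of_le_nhdsWithin h fun s hs => ?_
    have e : (fun y => f s y + g s y - (f t y + g t y)) =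
        (fun y => f s y - f t y) + fun y => g s y - g t y := by
      ext y; simp; ring
    rw [e]
    exact eLpNorm_add_le ((hf.memLp s hs).sub (hf.memLp t ht)).1
      ((hg.memLp s hs).sub (hg.memLp t ht)).1 (by norm_num)

/-- Multiplication by a continuous, locally bounded, time dependent function. -/
lemma CurveL2.mul {f : ℝ → ℝ → ℂ} (hf : CurveL2 f) {a : ℝ → ℝ → ℂ}
    (ha : Continuous (Function.uncurry a)) (hb : ∀ T, ∃ C, ∀ t, 0 ≤ t → t ≤ T → ∀ y, ‖a t y‖ ≤ C) :
    CurveL2 (fun t y => a t y * f t y) := by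
  have hat : ∀ t, Continuous (a t) := fun t => ha.comp (by fun_prop : Continuous fun y => (t, y))
  have hmem : ∀ t, 0 ≤ t → ∀ r, 0 ≤ r →
      MemLp (fun y => a t y * f r y) 2 (volume : Measure ℝ) := by
    intro t ht r hr
    obtain ⟨C, hC⟩ := hb t
    refine (hf.memLp r hr).of_le_mul (c := C)
      ((hat t).aestronglyMeasurable.mul (hf.memLp r hr).1) (Eventually.of_forall fun y => ?_)
    rw [norm_mul]
    gcongr
    exact hC t ht le_rfl y
  refine ⟨fun t ht => hmem t ht t ht, fun t ht => ?_⟩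
  obtain ⟨C, hC⟩ := hb (t + 1)
  have hC0 : 0 ≤ C := (norm_nonneg _).trans (hC t ht (by linarith) 0)
  -- Continuity of `a` in `t` is not uniform in `y`, so this half of the difference needs dominated
  -- convergence; the half with `f s - f t` uses only the bound on `a`.
  have h1 : Tendsto (fun s => eLpNorm (fun y => (a s y - a t y) * f t y) 2 volume)
      (𝓝[Ici 0] t) (𝓝 0) := by
    have h2 : Tendsto (fun s => ∫⁻ y, ‖(a s y - a t y) * f t y‖ₑ ^ 2) (𝓝[Ici 0] t)
        (𝓝 (∫⁻ _ : ℝ, 0)) := by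
      refine tendsto_lintegral_filter_of_dominated_convergence'
        (fun y => (ENNReal.ofReal (2 * C) * ‖f t y‖ₑ) ^ 2) ?_ ?_ ?_ ?_
      · filter_upwards with s
        have h3 : AEStronglyMeasurable (fun y => (a s y - a t y) * f t y) volume :=
          ((hat s).sub (hat t)).aestronglyMeasurable.mul (hf.memLp t ht).1
        exact h3.enorm.pow_const 2
      · have h4 : ∀ᶠ s in 𝓝[Ici 0] t, s ≤ t + 1 :=
          nhdsWithin_le_nhds (Iic_mem_nhds (by linarith))
        filter_upwards [self_mem_nhdsWithin, h4] with s hs hs1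
        refine Eventually.of_forall fun y => ?_
        rw [enorm_mul]
        gcongr
        rw [← ofReal_norm]
        refine ENNReal.ofReal_le_ofReal ((norm_sub_le _ _).trans ?_)
        have := hC s hs hs1 y
        have := hC t ht (by linarith) y
        linarith
      · have := (memLp_two_iff.1 (hf.memLp t ht)).2
        simp only [mul_pow]
        rw [lintegral_const_mul'' _ ((hf.memLp t ht).1.enorm.pow_const 2)]
        exact ENNReal.mul_ne_top (by finiteness) this.ne
      · refine Eventually.of_forall fun y => ?_
        have h5 : Continuous fun s => ‖(a s y - a t y) * f t y‖ₑ ^ 2 := by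
          have : Continuous fun s => a s y := ha.comp (by fun_prop : Continuous fun s => (s, y))
          fun_prop
        have h6 := h5.tendsto t
        simp only [sub_self, zero_mul, enorm_zero] at h6
        have h7 : (0 : ℝ≥0∞) ^ 2 = 0 := by norm_num
        rw [h7] at h6
        exact h6.mono_left nhdsWithin_le_nhds
    simp only [lintegral_zero, ← eLpNorm_two_sq] at h2
    have h3 := h2.ennrpow_const (1 / 2 : ℝ)
    have e : ∀ x : ℝ≥0∞, (x ^ 2) ^ (1 / 2 : ℝ) = x := by
      intro x
      rw [← ENNReal.rpow_natCast, ← ENNReal.rpow_mul]; norm_num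
    simp only [e] at h3
    simpa using h3
  have h2 : Tendsto (fun s => ENNReal.ofReal C * eLpNorm (fun y => f s y - f t y) 2 volume)
      (𝓝[Ici 0] t) (𝓝 0) := by
    have := ENNReal.Tendsto.const_mul (hf.continuous t ht) (a := ENNReal.ofReal C)
      (Or.inr ENNReal.ofReal_ne_top)
    simpa using this
  have h3 := h2.add h1
  rw [add_zero] at h3
  refine tendsto_of_tendsto_of_tendsto_of_le_of_le' tendsto_const_nhds h3
    (Eventually.of_forall fun _ => zero_le) ?_
  have h4 : ∀ᶠ s in 𝓝[Ici 0] t, s ≤ t + 1 :=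
    nhdsWithin_le_nhds (Iic_mem_nhds (by linarith))
  filter_upwards [self_mem_nhdsWithin, h4] with s hs hs1
  have e : (fun y => a s y * f s y - a t y * f t y) =
      (fun y => a s y * (f s y - f t y)) + fun y => (a s y - a t y) * f t y := by
    ext y; simp; ring
  rw [e]
  refine (eLpNorm_add_le ((hat s).aestronglyMeasurable.mul
    ((hf.memLp s hs).sub (hf.memLp t ht)).1)
    (((hat s).sub (hat t)).aestronglyMeasurable.mul (hf.memLp t ht).1) (by norm_num)).trans ?_
  refine add_le_add ?_ le_rfl
  refine eLpNorm_le_mul_eLpNorm_of_ae_le_mul (Eventually.of_forall fun y => ?_) 2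
  change ‖a s y * (f s y - f t y)‖ ≤ _
  rw [norm_mul]
  gcongr
  exact hC s hs hs1 y

lemma ftL_sub {φ ψ : ℝ → ℂ} (hφ : MemLp φ 2 (volume : Measure ℝ))
    (hψ : MemLp ψ 2 (volume : Measure ℝ)) :
    ∀ᵐ η, ftL (fun y => φ y - ψ y) η = ftL φ η - ftL ψ η := by
  filter_upwards [ftL_add hφ (hψ.const_mul (-1)), ftL_const_mul hψ (-1)] with η h1 h2
  rw [h2] at h1
  have : (fun y => φ y - ψ y) = fun y => φ y + -1 * ψ y := by ext; ring
  rw [this, h1]; ring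

lemma CurveL2.ftL {f : ℝ → ℝ → ℂ} (hf : CurveL2 f) : CurveL2 (fun t => ftL (f t)) where
  memLp t _ := memLp_ftL _
  continuous t ht := by
    refine tendsto_zero_of_le_nhdsWithin (hf.continuous t ht) fun s hs => le_of_eq ?_
    rw [← eLpNorm_ftL (φ := fun y => f s y - f t y) ((hf.memLp s hs).sub (hf.memLp t ht))]
    refine eLpNorm_congr_ae ?_
    filter_upwards [ftL_sub (hf.memLp s hs) (hf.memLp t ht)] with y hy
    exact hy.symm

open Classical in
/-- The class of a square integrable function, zero otherwise. -/
def toL2 (f : ℝ → ℂ) : LineL2 := if h : MemLp f 2 (volume : Measure ℝ) then h.toLp f else 0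

lemma coeFn_toL2 {f : ℝ → ℂ} (h : MemLp f 2 (volume : Measure ℝ)) : toL2 f =ᵐ[volume] f := by
  rw [toL2, dif_pos h]; exact h.coeFn_toLp

lemma CurveL2.continuousOn {f : ℝ → ℝ → ℂ} (hf : CurveL2 f) :
    ContinuousOn (fun t => toL2 (f t)) (Ici 0) := by
  intro t ht
  rw [ContinuousWithinAt, tendsto_iff_edist_tendsto_0]
  refine tendsto_zero_of_le_nhdsWithin (hf.continuous t ht) fun s hs => le_of_eq ?_
  simp only [toL2, dif_pos (hf.memLp s hs), dif_pos (hf.memLp t ht)]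
  rw [Lp.edist_toLp_toLp]
  rfl

/-- Bilinear pairing with a fixed square integrable function. -/
lemma exists_pairing {X : ℝ → ℂ} (hX : MemLp X 2 (volume : Measure ℝ)) :
    ∃ Λ : LineL2 →L[ℂ] ℂ, ∀ F : LineL2, Λ F = ∫ η, F η * X η := by
  have hs : MemLp (fun y => (starRingEnd ℂ) (X y)) 2 volume := hX.star
  refine ⟨innerSL ℂ (hs.toLp _), fun F => ?_⟩
  rw [innerSL_apply_apply, L2.inner_def]
  refine integral_congr_ae ?_
  filter_upwards [hs.coeFn_toLp] with y hy
  rw [hy, RCLike.inner_apply]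
  simp

lemma CurveL2.continuousOn_pairing {f : ℝ → ℝ → ℂ} (hf : CurveL2 f) {X : ℝ → ℂ}
    (hX : MemLp X 2 (volume : Measure ℝ)) :
    ContinuousOn (fun t => ∫ η, f t η * X η) (Ici 0) := by
  obtain ⟨Λ, hΛ⟩ := exists_pairing hX
  refine (Λ.continuous.comp_continuousOn hf.continuousOn).congr fun t ht => ?_
  simp only [Function.comp_apply, hΛ]
  refine integral_congr_ae ?_
  filter_upwards [coeFn_toL2 (hf.memLp t ht)] with y hy
  rw [hy]

/-! ### The lemma of du Bois-Reymond -/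

/-- The primitive that starts at the left end of the support also vanishes to the right of it,
because the total integral is zero. -/
lemma exists_antiderivative {g : ℝ → ℝ} (hg : ContDiff ℝ ∞ g) (hc : HasCompactSupport g)
    (hs : tsupport g ⊆ Ioi 0) (h0 : ∫ x, g x = 0) :
    ∃ θ : ℝ → ℝ, ContDiff ℝ ∞ θ ∧ HasCompactSupport θ ∧ tsupport θ ⊆ Ioi 0 ∧
      ∀ x, HasDerivAt θ (g x) x := by
  obtain ⟨a, b, ha, hab⟩ : ∃ a b : ℝ, 0 < a ∧ tsupport g ⊆ Icc a b := by
    rcases (tsupport g).eq_empty_or_nonempty with h | h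
    · exact ⟨1, 1, one_pos, by simp [h]⟩
    · obtain ⟨a, ha, ha'⟩ := hc.isCompact.exists_isLeast h
      obtain ⟨b, hb, hb'⟩ := hc.isCompact.exists_isGreatest h
      exact ⟨a, b, hs ha, fun x hx => ⟨ha' hx, hb' hx⟩⟩
  have hout : ∀ x, x ∉ Icc a b → g x = 0 := fun x hx =>
    image_eq_zero_of_notMem_tsupport fun h => hx (hab h)
  let θ : ℝ → ℝ := fun x => ∫ y in a..x, g y
  have hd : ∀ x, HasDerivAt θ (g x) x := fun x =>
    intervalIntegral.integral_hasDerivAt_right (hg.continuous.intervalIntegrable _ _)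
      (hg.continuous.stronglyMeasurableAtFilter _ _) hg.continuous.continuousAt
  have hz : ∀ x, x ∉ Icc a b → θ x = 0 := by
    intro x hx
    rcases lt_or_ge x a with h | h
    · simp only [θ]
      refine intervalIntegral.integral_zero_ae ?_
      refine (Measure.ae_ne volume a).mono fun y hya hy => hout y fun hy' => ?_
      rw [uIoc_of_ge h.le] at hy
      exact hya (le_antisymm hy.2 hy'.1)
    · have hb : b < x := by
        by_contra hb
        exact hx ⟨h, not_lt.1 hb⟩
      simp only [θ]
      rw [intervalIntegral.integral_of_le h, ← integral_Icc_eq_integral_Ioc,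
        setIntegral_eq_integral_of_forall_compl_eq_zero, h0]
      intro y hy
      exact hout y fun hy' => hy ⟨hy'.1, hy'.2.trans hb.le⟩
  have hts : tsupport θ ⊆ Icc a b := by
    refine closure_minimal (fun x hx => ?_) isClosed_Icc
    by_contra h
    exact hx (hz x h)
  refine ⟨θ, ?_, HasCompactSupport.of_support_subset_isCompact isCompact_Icc
    ((subset_tsupport θ).trans hts), hts.trans fun x hx => ha.trans_le hx.1, hd⟩
  rw [contDiff_infty_iff_deriv]
  exact ⟨fun x => (hd x).differentiableAt, by rwa [show deriv θ = g from funext fun x => (hd x).deriv]⟩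

/-- A continuous function on `[0, ∞)` with a continuous weak derivative is its primitive. -/
lemma sub_eq_integral_of_weak {A B : ℝ → ℂ} (hA : ContinuousOn A (Ici 0))
    (hB : ContinuousOn B (Ici 0))
    (h : ∀ θ : ℝ → ℝ, ContDiff ℝ ∞ θ → HasCompactSupport θ → tsupport θ ⊆ Ioi 0 →
      ∫ t in Ioi (0 : ℝ), (((deriv θ t : ℝ) : ℂ) * A t + (θ t : ℂ) * B t) = 0) {t : ℝ} (ht : 0 ≤ t) :
    A t - A 0 = ∫ r in (0 : ℝ)..t, B r := by
  -- Freezing the value at `0` extends the curves continuously to the whole line; test functions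
  -- supported in `(0, ∞)` do not see the extension.
  let A' : ℝ → ℂ := fun t => A (max t 0)
  let B' : ℝ → ℂ := fun t => B (max t 0)
  have hm : ∀ t : ℝ, max t 0 ∈ Ici (0 : ℝ) := fun t => le_max_right t 0
  have hA' : Continuous A' := hA.comp_continuous (by fun_prop) hm
  have hB' : Continuous B' := hB.comp_continuous (by fun_prop) hm
  let P : ℝ → ℂ := fun t => ∫ r in (0 : ℝ)..t, B' r
  have hP : ∀ t, HasDerivAt P (B' t) t := fun t =>
    intervalIntegral.integral_hasDerivAt_right (hB'.intervalIntegrable _ _)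
      (hB'.stronglyMeasurableAtFilter _ _) hB'.continuousAt
  have hPc : Continuous P := continuous_iff_continuousAt.2 fun t => (hP t).continuousAt
  let c : ℝ → ℂ := fun t => A' t - P t
  have hc : Continuous c := hA'.sub hPc
  have key : ∀ θ : ℝ → ℝ, ContDiff ℝ ∞ θ → HasCompactSupport θ → tsupport θ ⊆ Ioi 0 →
      ∫ t, ((deriv θ t : ℝ) : ℂ) * c t = 0 := by
    intro θ h1 h2 h3
    have hdc : Continuous (deriv θ) := h1.continuous_deriv (by norm_num)
    have e1 : ∫ t in Ioi (0 : ℝ), (((deriv θ t : ℝ) : ℂ) * A t + (θ t : ℂ) * B t) =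
        ∫ t, (((deriv θ t : ℝ) : ℂ) * A' t + (θ t : ℂ) * B' t) := by
      refine Eq.trans ?_ (setIntegral_eq_integral_of_forall_compl_eq_zero (s := Ioi (0 : ℝ)) ?_)
      · refine setIntegral_congr_fun measurableSet_Ioi fun t ht => ?_
        simp only [A', B', max_eq_left (le_of_lt (mem_Ioi.1 ht))]
      · intro t ht
        have h4 : t ∉ tsupport θ := fun h => ht (h3 h)
        have h5 : θ t = 0 := image_eq_zero_of_notMem_tsupport h4
        have h6 : deriv θ t = 0 :=
          image_eq_zero_of_notMem_tsupport fun h => h4 (tsupport_deriv_subset h)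
        simp [h5, h6]
    have i1 : Integrable fun t => ((deriv θ t : ℝ) : ℂ) * A' t :=
      Continuous.integrable_of_hasCompactSupport (by fun_prop)
        ((h2.deriv.comp_left (g := fun x : ℝ => (x : ℂ)) (by simp)).mul_right)
    have i2 : Integrable fun t => (θ t : ℂ) * B' t :=
      Continuous.integrable_of_hasCompactSupport (by have := h1.continuous; fun_prop)
        ((h2.comp_left (g := fun x : ℝ => (x : ℂ)) (by simp)).mul_right)
    have i3 : Integrable fun t => ((deriv θ t : ℝ) : ℂ) * P t :=
      Continuous.integrable_of_hasCompactSupport (by fun_prop)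
        ((h2.deriv.comp_left (g := fun x : ℝ => (x : ℂ)) (by simp)).mul_right)
    have i4 : Integrable fun t => (θ t : ℂ) * P t :=
      Continuous.integrable_of_hasCompactSupport (by have := h1.continuous; fun_prop)
        ((h2.comp_left (g := fun x : ℝ => (x : ℂ)) (by simp)).mul_right)
    have e2 : ∫ t, (θ t : ℂ) * B' t = -∫ t, ((deriv θ t : ℝ) : ℂ) * P t :=
      integral_mul_deriv_eq_deriv_mul_of_integrable (u := fun t => (θ t : ℂ)) (v := P)
        (fun t _ => ((h1.differentiable (by norm_num)) t).hasDerivAt.ofReal_comp)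
        (fun t _ => hP t) i2 i3 i4
    have e3 := h θ h1 h2 h3
    rw [e1, integral_add i1 i2, e2, ← sub_eq_add_neg, ← integral_sub i1 i3] at e3
    rw [← e3]
    congr 1; ext t; simp only [c]; ring
  let b : ContDiffBump (1 : ℝ) := ⟨1 / 4, 1 / 2, by norm_num, by norm_num⟩
  let θ₀ : ℝ → ℝ := b.normed volume
  have hθ₀ : ContDiff ℝ ∞ θ₀ := b.contDiff_normed
  have hθ₀c : HasCompactSupport θ₀ := b.hasCompactSupport_normed
  have hθ₀s : tsupport θ₀ ⊆ Ioi 0 := by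
    rw [b.tsupport_normed_eq]
    intro x hx
    have := hx
    simp only [Metric.mem_closedBall, Real.dist_eq, b, abs_le] at this
    simp only [mem_Ioi]; linarith [this.1]
  have hθ₀i : ∫ x, θ₀ x = 1 := b.integral_normed
  let c₀ : ℂ := ∫ x, (θ₀ x : ℂ) * c x
  have hae : ∀ᵐ x : ℝ, x ∈ Ioi (0 : ℝ) → c x - c₀ = 0 := by
    refine isOpen_Ioi.ae_eq_zero_of_integral_contDiff_smul_eq_zero
      (by have : Continuous fun x => c x - c₀ := by fun_prop
          exact this.locallyIntegrable.locallyIntegrableOn _) fun g hg hgc hgs => ?_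
    let m : ℝ := ∫ x, g x
    -- Subtracting the right multiple of a fixed bump makes any test function the derivative of an
    -- admissible one. Hence `c`, which annihilates such derivatives, is the constant `c₀`.
    obtain ⟨θ, h1, h2, h3, h4⟩ := exists_antiderivative (g := fun x => g x - m * θ₀ x)
      (hg.sub (contDiff_const.mul hθ₀)) (hgc.sub (hθ₀c.mul_left)) (by
        refine (tsupport_sub _ _).trans (union_subset hgs ?_)
        exact (tsupport_mul_subset_right).trans hθ₀s) (by
        rw [integral_sub (hg.continuous.integrable_of_hasCompactSupport hgc)
          ((hθ₀.continuous.integrable_of_hasCompactSupport hθ₀c).const_mul m),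
          integral_const_mul, hθ₀i, mul_one, sub_self])
    have e := key θ h1 h2 h3
    have hgi : Integrable fun x => (g x : ℂ) * c x :=
      Continuous.integrable_of_hasCompactSupport (by have := hg.continuous; fun_prop)
        ((hgc.comp_left (g := fun x : ℝ => (x : ℂ)) (by simp)).mul_right)
    have hti : Integrable fun x => (θ₀ x : ℂ) * c x :=
      Continuous.integrable_of_hasCompactSupport (by have := hθ₀.continuous; fun_prop)
        ((hθ₀c.comp_left (g := fun x : ℝ => (x : ℂ)) (by simp)).mul_right)
    have hgi' : Integrable fun x => (g x : ℂ) * c₀ :=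
      Continuous.integrable_of_hasCompactSupport (by have := hg.continuous; fun_prop)
        ((hgc.comp_left (g := fun x : ℝ => (x : ℂ)) (by simp)).mul_right)
    have e2 : ∫ x, ((deriv θ x : ℝ) : ℂ) * c x = (∫ x, (g x : ℂ) * c x) - m * c₀ := by
      simp only [c₀]
      rw [← integral_const_mul, ← integral_sub hgi (hti.const_mul _)]
      congr 1; ext x; rw [(h4 x).deriv]; push_cast; ring
    have e3 : ∫ x, (g x : ℂ) * c₀ = m * c₀ := by
      rw [integral_mul_const, integral_complex_ofReal]
    simp only [Complex.real_smul, mul_sub]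
    rw [integral_sub hgi hgi', e3, ← e2, e]
  have hall : ∀ x ∈ Ioi (0 : ℝ), c x = c₀ := by
    have h1 : c =ᵐ[volume.restrict (Ioi (0 : ℝ))] fun _ => c₀ := by
      rw [EventuallyEq, ae_restrict_iff' measurableSet_Ioi]
      filter_upwards [hae] with x hx hx'
      exact sub_eq_zero.1 (hx hx')
    exact Measure.eqOn_open_of_ae_eq h1 isOpen_Ioi hc.continuousOn continuousOn_const
  have hall' : ∀ x ∈ Ici (0 : ℝ), c x = c₀ := by
    have : Ici (0 : ℝ) = closure (Ioi 0) := (closure_Ioi _).symm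
    rw [this]
    exact EqOn.closure (fun x hx => hall x hx) hc continuous_const
  have h1 : c t = c 0 := by rw [hall' t ht, hall' 0 (mem_Ici.2 le_rfl)]
  have h2 : P t = ∫ r in (0 : ℝ)..t, B r := by
    refine intervalIntegral.integral_congr fun r hr => ?_
    rw [uIcc_of_le ht] at hr
    simp only [B', max_eq_left hr.1]
  have h3 : P 0 = 0 := intervalIntegral.integral_same
  simp only [c, A', max_eq_left ht, max_self, h3, h2] at h1
  linear_combination h1

/-! ### Schwartz functions: multiplication by the variable and cut-offs -/

/-- Multiplication of a Schwartz function by the variable. -/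
def mulX (G : SchwartzMap ℝ ℂ) : SchwartzMap ℝ ℂ :=
  SchwartzMap.smulLeftCLM ℂ (fun η : ℝ => (η : ℂ)) G

lemma mulX_apply (G : SchwartzMap ℝ ℂ) (η : ℝ) : mulX G η = η * G η := by
  rw [mulX, SchwartzMap.smulLeftCLM_apply_apply (by fun_prop)]; simp

lemma hasDerivAt_fourier_schwartz (G : SchwartzMap ℝ ℂ) (y : ℝ) :
    HasDerivAt (𝓕 (G : ℝ → ℂ)) (-(2 * Real.pi * Complex.I) * 𝓕 (mulX G : ℝ → ℂ) y) y := by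
  have hi : Integrable (fun x : ℝ => x • G x) := by
    refine (mulX G).integrable.congr (Eventually.of_forall fun x => ?_)
    simp [mulX_apply]
  have := Real.hasDerivAt_fourier G.integrable hi y
  have e : -(2 * Real.pi * Complex.I) * 𝓕 (mulX G : ℝ → ℂ) y
      = 𝓕 (fun x : ℝ => (-2 * Real.pi * Complex.I * x) • G x) y := ?_
  · rw [e]; exact this
  rw [fourier_integral, fourier_integral, ← integral_const_mul]
  congr 1; ext η; rw [mulX_apply]; simp; ring

lemma fourier_lin_comb (a b c : ℂ) (G G' G'' : SchwartzMap ℝ ℂ) (y : ℝ) :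
    𝓕 ((a • G + b • G' + c • G'' : SchwartzMap ℝ ℂ) : ℝ → ℂ) y =
      a * 𝓕 (G : ℝ → ℂ) y + b * 𝓕 (G' : ℝ → ℂ) y + c * 𝓕 (G'' : ℝ → ℂ) y := by
  rw [← SchwartzMap.fourier_coe, FourierTransform.fourier_add, FourierTransform.fourier_add,
    FourierTransform.fourier_smul, FourierTransform.fourier_smul, FourierTransform.fourier_smul]
  simp [SchwartzMap.fourier_coe]

/-- The weight `1 + 4π²η²`. -/
def wt (η : ℝ) : ℝ := 1 + 4 * Real.pi ^ 2 * η ^ 2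

lemma wt_pos (η : ℝ) : 0 < wt η := by unfold wt; positivity

lemma one_le_wt (η : ℝ) : 1 ≤ wt η := by
  unfold wt; have : 0 ≤ 4 * Real.pi ^ 2 * η ^ 2 := by positivity
  linarith

lemma exists_cutoff : ∃ χ χ' χ'' : ℝ → ℝ, ContDiff ℝ ∞ χ ∧ HasCompactSupport χ ∧
    (∀ y, HasDerivAt χ (χ' y) y) ∧ (∀ y, HasDerivAt χ' (χ'' y) y) ∧ χ 0 = 1 ∧
    Continuous χ ∧ Continuous χ' ∧ Continuous χ'' ∧
    ∃ C, ∀ y, |χ y| ≤ C ∧ |χ' y| ≤ C ∧ |χ'' y| ≤ C := by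
  let b : ContDiffBump (0 : ℝ) := ⟨1, 2, by norm_num, by norm_num⟩
  have h1 : ContDiff ℝ ∞ (b : ℝ → ℝ) := b.contDiff
  have h2 : ContDiff ℝ ∞ (deriv (b : ℝ → ℝ)) := (contDiff_infty_iff_deriv.1 h1).2
  have h3 : ContDiff ℝ ∞ (deriv (deriv (b : ℝ → ℝ))) := (contDiff_infty_iff_deriv.1 h2).2
  have hc : HasCompactSupport (b : ℝ → ℝ) := b.hasCompactSupport
  obtain ⟨C1, hC1⟩ := hc.exists_bound_of_continuous h1.continuous
  obtain ⟨C2, hC2⟩ := hc.deriv.exists_bound_of_continuous h2.continuous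
  obtain ⟨C3, hC3⟩ := hc.deriv.deriv.exists_bound_of_continuous h3.continuous
  refine ⟨b, deriv b, deriv (deriv b), h1, hc,
    fun y => ((contDiff_infty_iff_deriv.1 h1).1 y).hasDerivAt,
    fun y => ((contDiff_infty_iff_deriv.1 h2).1 y).hasDerivAt,
    b.one_of_mem_closedBall (by simp [b]), h1.continuous, h2.continuous, h3.continuous,
    max C1 (max C2 C3), fun y => ⟨?_, ?_, ?_⟩⟩
  · exact (hC1 y).trans (le_max_left _ _)
  · exact (hC2 y).trans ((le_max_left _ _).trans (le_max_right _ _))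
  · exact (hC3 y).trans ((le_max_right _ _).trans (le_max_right _ _))

/-- If `W ∈ L²` is annihilated by all `ψ - ψ''` with `ψ` a test function, it is annihilated by all
`ψ - ψ''` with `ψ` a Schwartz function. -/
lemma integral_mul_sub_deriv2_eq_zero {W : ℝ → ℂ} (hW : MemLp W 2 (volume : Measure ℝ))
    (h : ∀ ψ ψ' ψ'' : ℝ → ℂ, ContDiff ℝ ∞ ψ → HasCompactSupport ψ →
      (∀ y, HasDerivAt ψ (ψ' y) y) → (∀ y, HasDerivAt ψ' (ψ'' y) y) →
      ∫ y, W y * (ψ y - ψ'' y) = 0)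
    {ψ ψ' ψ'' : ℝ → ℂ} (hs : ContDiff ℝ ∞ ψ) (h1 : ∀ y, HasDerivAt ψ (ψ' y) y)
    (h2 : ∀ y, HasDerivAt ψ' (ψ'' y) y) (m0 : MemLp ψ 2 (volume : Measure ℝ))
    (m1 : MemLp ψ' 2 (volume : Measure ℝ)) (m2 : MemLp ψ'' 2 (volume : Measure ℝ)) :
    ∫ y, W y * (ψ y - ψ'' y) = 0 := by
  obtain ⟨χ, χ', χ'', hχ, hχc, d1, d2, hχ0, c0, c1, c2, C, hC⟩ := exists_cutoff
  let r : ℕ → ℝ := fun n => 1 / ((n : ℝ) + 1)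
  have hr : ∀ n, 0 < r n := fun n => by positivity
  have hr1 : ∀ n, r n ≤ 1 := fun n => by
    simp only [r]; rw [div_le_one (by positivity)]; linarith [(Nat.cast_nonneg n : (0 : ℝ) ≤ n)]
  have hr0 : Tendsto r atTop (𝓝 0) := tendsto_one_div_add_atTop_nhds_zero_nat
  let Φ : ℕ → ℝ → ℂ := fun n y => (χ (r n * y) : ℂ) * ψ y
  let Φ' : ℕ → ℝ → ℂ := fun n y => ((r n * χ' (r n * y) : ℝ) : ℂ) * ψ y + (χ (r n * y) : ℂ) * ψ' y
  let Φ'' : ℕ → ℝ → ℂ := fun n y => ((r n ^ 2 * χ'' (r n * y) : ℝ) : ℂ) * ψ y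
    + 2 * ((r n * χ' (r n * y) : ℝ) : ℂ) * ψ' y + (χ (r n * y) : ℂ) * ψ'' y
  have e0 : ∀ n y, HasDerivAt (fun y => (χ (r n * y) : ℂ)) ((r n * χ' (r n * y) : ℝ) : ℂ) y := by
    intro n y
    have := ((d1 (r n * y)).comp y ((hasDerivAt_id y).const_mul (r n))).ofReal_comp
    refine this.congr_deriv ?_
    push_cast; ring
  have e1 : ∀ n y, HasDerivAt (fun y => ((r n * χ' (r n * y) : ℝ) : ℂ))
      ((r n ^ 2 * χ'' (r n * y) : ℝ) : ℂ) y := by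
    intro n y
    have := (((d2 (r n * y)).comp y ((hasDerivAt_id y).const_mul (r n))).const_mul
      (r n)).ofReal_comp
    refine this.congr_deriv ?_
    push_cast; ring
  have hzero : ∀ n, ∫ y, W y * (Φ n y - Φ'' n y) = 0 := by
    intro n
    refine h (Φ n) (Φ' n) (Φ'' n) ?_ ?_ ?_ ?_
    · have : ContDiff ℝ ∞ fun y => (χ (r n * y) : ℂ) :=
        Complex.ofRealCLM.contDiff.comp (hχ.comp (contDiff_const.mul contDiff_id))
      exact this.mul hs
    · have h3 : HasCompactSupport fun y => χ (r n * y) :=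
        hχc.comp_homeomorph (Homeomorph.mulLeft₀ (r n) (hr n).ne')
      exact (h3.comp_left (g := fun x : ℝ => (x : ℂ)) (by simp)).mul_right
    · intro y
      exact (e0 n y).mul (h1 y)
    · intro y
      have := ((e1 n y).mul (h1 y)).add ((e0 n y).mul (h2 y))
      refine this.congr_deriv ?_
      simp only [Φ'']; ring
  have hlim : Tendsto (fun n => ∫ y, W y * (Φ n y - Φ'' n y)) atTop
      (𝓝 (∫ y, W y * (ψ y - ψ'' y))) := by
    have hi : Integrable (fun y => ‖W y‖ * (4 * C * (‖ψ y‖ + ‖ψ' y‖ + ‖ψ'' y‖))) :=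
      hW.norm.integrable_mul (((m0.norm.add m1.norm).add m2.norm).const_mul (4 * C))
    have hcψ : Continuous ψ := hs.continuous
    have hcψ' : Continuous ψ' := continuous_iff_continuousAt.2 fun y => (h2 y).continuousAt
    refine tendsto_integral_of_dominated_convergence _ (fun n => ?_) hi (fun n => ?_) ?_
    · refine hW.1.mul (AEStronglyMeasurable.sub ?_ ?_)
      · exact Continuous.aestronglyMeasurable (by fun_prop)
      · refine AEStronglyMeasurable.add ?_ ?_
        · exact Continuous.aestronglyMeasurable (by fun_prop)
        · exact (Continuous.aestronglyMeasurable (by fun_prop)).mul m2.1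
    · refine Eventually.of_forall fun y => ?_
      rw [norm_mul]
      gcongr
      obtain ⟨b0, b1, b2⟩ := hC (r n * y)
      have hC0 : 0 ≤ C := (abs_nonneg _).trans b0
      have r0 := (hr n).le
      have r1 := hr1 n
      have n1 : ‖(χ (r n * y) : ℂ)‖ ≤ C := by simpa using b0
      have n2 : ‖((r n * χ' (r n * y) : ℝ) : ℂ)‖ ≤ C := by
        rw [Complex.norm_real, Real.norm_eq_abs, abs_mul, abs_of_nonneg r0]
        nlinarith [abs_nonneg (χ' (r n * y))]
      have n3 : ‖((r n ^ 2 * χ'' (r n * y) : ℝ) : ℂ)‖ ≤ C := by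
        rw [Complex.norm_real, Real.norm_eq_abs, abs_mul, abs_of_nonneg (by positivity)]
        have : r n ^ 2 ≤ 1 := pow_le_one₀ r0 r1
        nlinarith [abs_nonneg (χ'' (r n * y))]
      calc ‖Φ n y - Φ'' n y‖ ≤ ‖Φ n y‖ + ‖Φ'' n y‖ := norm_sub_le _ _
        _ ≤ C * ‖ψ y‖ + (C * ‖ψ y‖ + 2 * C * ‖ψ' y‖ + C * ‖ψ'' y‖) := by
            gcongr
            · rw [norm_mul]; gcongr
            · refine (norm_add₃_le).trans ?_
              rw [norm_mul, norm_mul, norm_mul, norm_mul]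
              gcongr
              simp
        _ ≤ _ := by nlinarith [norm_nonneg (ψ y), norm_nonneg (ψ' y), norm_nonneg (ψ'' y),
            mul_nonneg hC0 (norm_nonneg (ψ y)), mul_nonneg hC0 (norm_nonneg (ψ' y)),
            mul_nonneg hC0 (norm_nonneg (ψ'' y))]
    · refine Eventually.of_forall fun y => ?_
      have hcont : Continuous fun s : ℝ => W y * ((χ (s * y) : ℂ) * ψ y -
          (((s ^ 2 * χ'' (s * y) : ℝ) : ℂ) * ψ y
            + 2 * ((s * χ' (s * y) : ℝ) : ℂ) * ψ' y + (χ (s * y) : ℂ) * ψ'' y)) := by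
        fun_prop
      have := (hcont.tendsto 0).comp hr0
      have e : W y * ((χ (0 * y) : ℂ) * ψ y - (((0 ^ 2 * χ'' (0 * y) : ℝ) : ℂ) * ψ y
            + 2 * ((0 * χ' (0 * y) : ℝ) : ℂ) * ψ' y + (χ (0 * y) : ℂ) * ψ'' y)) =
          W y * (ψ y - ψ'' y) := by simp [hχ0]
      rw [e] at this
      exact this
  simp only [hzero] at hlim
  exact tendsto_nhds_unique hlim tendsto_const_nhds

/-- Test functions whose Fourier transform is compactly supported separate points. -/
lemma ae_eq_zero_of_fourier_test {r : ℝ → ℂ} (hr : MemLp r 2 (volume : Measure ℝ))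
    (h : ∀ G : SchwartzMap ℝ ℂ, HasCompactSupport (𝓕 (G : ℝ → ℂ)) →
      ∫ η, r η * (wt η * G η) = 0) : ∀ᵐ η, r η = 0 := by
  obtain ⟨W, hW, hWr⟩ := exists_ftL_eq hr
  -- Multiplication by `wt` corresponds to `1 - ∂²`: with `r = ftL W`, the pairing of `r` with `wt
  -- G` is that of `W` with `ψ - ψ''` for `ψ = 𝓕 G`.
  let X : SchwartzMap ℝ ℂ → SchwartzMap ℝ ℂ := fun G =>
    (1 : ℂ) • G + (0 : ℂ) • G + (4 * Real.pi ^ 2 : ℂ) • mulX (mulX G)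
  have hX : ∀ G η, X G η = wt η * G η := by
    intro G η
    simp [X, mulX_apply, wt]; ring
  have hpair : ∀ G : SchwartzMap ℝ ℂ, ∫ η, r η * (wt η * G η) = ∫ y, W y * (𝓕 (G : ℝ → ℂ) y -
      (-(2 * Real.pi * Complex.I) * (-(2 * Real.pi * Complex.I) *
        𝓕 (mulX (mulX G) : ℝ → ℂ) y))) := by
    intro G
    have h1 := integral_ftL_mul hW (X G)
    calc _ = ∫ η, ftL W η * X G η := by
          refine integral_congr_ae ?_
          filter_upwards [hWr] with η hη
          rw [hη, hX]
      _ = _ := h1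
      _ = _ := by
          congr 1; ext y
          rw [fourier_lin_comb]
          have : Complex.I ^ 2 = -1 := Complex.I_sq
          linear_combination (4 * Real.pi ^ 2 * W y * 𝓕 (mulX (mulX G) : ℝ → ℂ) y) * this
  have hd2 : ∀ (G : SchwartzMap ℝ ℂ) (y : ℝ), HasDerivAt
      (fun y => -(2 * Real.pi * Complex.I) * 𝓕 (mulX G : ℝ → ℂ) y)
      (-(2 * Real.pi * Complex.I) * (-(2 * Real.pi * Complex.I) *
        𝓕 (mulX (mulX G) : ℝ → ℂ) y)) y := fun G y =>
    (hasDerivAt_fourier_schwartz (mulX G) y).const_mul _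
  have hall : ∀ G : SchwartzMap ℝ ℂ, ∫ η, r η * (wt η * G η) = 0 := by
    intro G
    rw [hpair]
    have hmem : ∀ G : SchwartzMap ℝ ℂ, MemLp (𝓕 (G : ℝ → ℂ)) 2 volume := fun G => by
      rw [← SchwartzMap.fourier_coe]; exact SchwartzMap.memLp _ 2 volume
    refine integral_mul_sub_deriv2_eq_zero hW ?_ ?_ (hasDerivAt_fourier_schwartz G) (hd2 G)
      (hmem G) ((hmem _).const_mul _) (((hmem _).const_mul _).const_mul _)
    · intro ψ ψ' ψ'' hs hc h1 h2
      let S : SchwartzMap ℝ ℂ := hc.toSchwartzMap hs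
      have hS : 𝓕 ((𝓕⁻ S : SchwartzMap ℝ ℂ) : ℝ → ℂ) = ψ := by
        rw [← SchwartzMap.fourier_coe, FourierTransform.fourier_fourierInv_eq]; rfl
      have h3 := h (𝓕⁻ S) (by rw [hS]; exact hc)
      rw [hpair] at h3
      rw [← h3]
      congr 1; ext y
      have a1 : ∀ y, ψ' y = -(2 * Real.pi * Complex.I) *
          𝓕 (mulX (𝓕⁻ S) : ℝ → ℂ) y := fun y => by
        refine (h1 y).unique ?_
        have := hasDerivAt_fourier_schwartz (𝓕⁻ S) y
        rwa [hS] at this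
      have a2 : ψ'' y = -(2 * Real.pi * Complex.I) * (-(2 * Real.pi * Complex.I) *
          𝓕 (mulX (mulX (𝓕⁻ S)) : ℝ → ℂ) y) := by
        refine (h2 y).unique ?_
        rw [show ψ' = _ from funext a1]
        exact hd2 _ y
      rw [hS, a2]
    · rw [← SchwartzMap.fourier_coe]; exact SchwartzMap.smooth' _
  -- Once all Schwartz functions are allowed, `G = g / wt` removes the weight.
  refine ae_eq_zero_of_integral_contDiff_smul_eq_zero (hr.locallyIntegrable (by norm_num)) ?_
  intro g hg hgc
  have h1 : ContDiff ℝ ∞ fun η => ((g η / wt η : ℝ) : ℂ) := by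
    refine Complex.ofRealCLM.contDiff.comp (hg.div ?_ fun η => (wt_pos η).ne')
    unfold wt; fun_prop
  have h2 : HasCompactSupport fun η => ((g η / wt η : ℝ) : ℂ) := by
    have h3 : HasCompactSupport fun η => g η / wt η := by
      simp only [div_eq_mul_inv]; exact hgc.mul_right
    exact h3.comp_left (g := fun x : ℝ => (x : ℂ)) (by simp)
  have h3 := hall (h2.toSchwartzMap h1)
  rw [← h3]
  congr 1; ext η
  have : (wt η : ℂ) ≠ 0 := by exact_mod_cast (wt_pos η).ne'
  change _ = r η * ((wt η : ℂ) * ((g η / wt η : ℝ) : ℂ))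
  rw [Complex.real_smul]; push_cast
  field_simp

/-! ### Moving plane waves as test functions -/

/-- `e^{2πi k t y}`. -/
def tw (k : ℤ) (t y : ℝ) : ℂ := Complex.exp (2 * Real.pi * Complex.I * ((k * t : ℝ) * y))

/-- `e^{-2πi(k(x - ty) + lz)} a(y)`. -/
def wave (k l : ℤ) (t : ℝ) (a : ℝ → ℂ) (p : Dom) : ℂ :=
  fourier (-k) p.1 * fourier (-l) p.2.2 * (tw k t p.2.1 * a p.2.1)

lemma norm_tw (k : ℤ) (t y : ℝ) : ‖tw k t y‖ = 1 := by
  rw [tw, show (2 * Real.pi * Complex.I * ((k * t : ℝ) * y) : ℂ)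
      = ((2 * Real.pi * ((k * t) * y) : ℝ) : ℂ) * Complex.I by push_cast; ring,
      Complex.norm_exp_ofReal_mul_I]

lemma continuous_tw (k : ℤ) : Continuous (Function.uncurry (tw k)) := by
  unfold Function.uncurry tw; fun_prop

lemma hasDerivAt_tw_y (k : ℤ) (t y : ℝ) :
    HasDerivAt (tw k t) (2 * Real.pi * Complex.I * k * t * tw k t y) y := by
  have h1 : HasDerivAt (fun y : ℝ => (2 * Real.pi * Complex.I * ((k * t : ℝ) * y) : ℂ))
      (2 * Real.pi * Complex.I * k * t) y := by
    refine (((Complex.ofRealCLM.hasDerivAt (x := y)).const_mul ((k * t : ℝ) : ℂ)).const_mul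
      (2 * Real.pi * Complex.I : ℂ)).congr_deriv ?_
    simp; ring
  refine h1.cexp.congr_deriv ?_
  rw [tw]; ring

lemma hasDerivAt_tw_t (k : ℤ) (t y : ℝ) :
    HasDerivAt (fun t => tw k t y) (2 * Real.pi * Complex.I * k * y * tw k t y) t := by
  have h1 : HasDerivAt (fun t : ℝ => (2 * Real.pi * Complex.I * ((k * t : ℝ) * y) : ℂ))
      (2 * Real.pi * Complex.I * k * y) t := by
    have e : (fun t : ℝ => (2 * Real.pi * Complex.I * ((k * t : ℝ) * y) : ℂ)) =
        fun t : ℝ => (2 * Real.pi * Complex.I * k * y : ℂ) * t := by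
      ext t; push_cast; ring
    rw [e]
    refine ((Complex.ofRealCLM.hasDerivAt (x := t)).const_mul
      (2 * Real.pi * Complex.I * k * y : ℂ)).congr_deriv ?_
    simp
  refine h1.cexp.congr_deriv ?_
  rw [tw]; ring

lemma hasDerivAt_fourier_torus (k : ℤ) (x : Torus) :
    HasDerivAt (fun s : ℝ => (fourier (-k) (x + (s : Torus)) : ℂ))
      (-(2 * Real.pi * Complex.I * k) * fourier (-k) x) 0 := by
  have h := hasDerivAt_exp_mul (((-k : ℤ) : ℂ)) (fourier (-k) x)
  refine (h.congr_deriv ?_).congr_of_eventuallyEq (Eventually.of_forall fun s => ?_)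
  · push_cast; ring
  · simp only [fourier_add_torus, fourier_coe_torus]; ring

lemma dx_wave (k l : ℤ) (t : ℝ) (a : ℝ → ℂ) (p : Dom) :
    dx (wave k l t a) p = -(2 * Real.pi * Complex.I * k) * wave k l t a p := by
  have h := ((hasDerivAt_fourier_torus k p.1).mul_const (fourier (-l) p.2.2)).mul_const
    (tw k t p.2.1 * a p.2.1)
  rw [dx, wave]
  refine Eq.trans h.deriv ?_
  ring

lemma dz_wave (k l : ℤ) (t : ℝ) (a : ℝ → ℂ) (p : Dom) :
    dz (wave k l t a) p = -(2 * Real.pi * Complex.I * l) * wave k l t a p := by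
  have h := ((hasDerivAt_fourier_torus l p.2.2).const_mul (fourier (-k) p.1)).mul_const
    (tw k t p.2.1 * a p.2.1)
  rw [dz, wave]
  refine Eq.trans h.deriv ?_
  ring

lemma dy_wave (k l : ℤ) (t : ℝ) {a a' : ℝ → ℂ} (ha : ∀ y, HasDerivAt a (a' y) y) :
    dy (wave k l t a) = wave k l t (fun y => a' y + 2 * Real.pi * Complex.I * k * t * a y) := by
  ext p
  have h1 : HasDerivAt (fun s : ℝ => tw k t (p.2.1 + s) * a (p.2.1 + s))
      (2 * Real.pi * Complex.I * k * t * tw k t p.2.1 * a p.2.1 + tw k t p.2.1 * a' p.2.1) 0 := by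
    have := ((hasDerivAt_tw_y k t (p.2.1 + 0)).mul (ha (p.2.1 + 0))).comp_const_add p.2.1 0
    simpa using this
  have h := h1.const_mul (fourier (-k) p.1 * fourier (-l) p.2.2 : ℂ)
  rw [dy, wave]
  refine Eq.trans h.deriv ?_
  ring

/-- The profile of the Laplacian of a moving plane wave. -/
def lapProf (k l : ℤ) (t : ℝ) (a a' a'' : ℝ → ℂ) (y : ℝ) : ℂ :=
  a'' y + 4 * Real.pi * Complex.I * k * t * a' y
    - 4 * Real.pi ^ 2 * (k ^ 2 * t ^ 2 + k ^ 2 + l ^ 2) * a y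

lemma wave_mul (k l : ℤ) (t : ℝ) (c : ℂ) (a : ℝ → ℂ) :
    (fun p => c * wave k l t a p) = wave k l t (fun y => c * a y) := by
  ext p; simp only [wave]; ring

lemma lap_wave (k l : ℤ) (t : ℝ) {a a' a'' : ℝ → ℂ} (ha : ∀ y, HasDerivAt a (a' y) y)
    (ha' : ∀ y, HasDerivAt a' (a'' y) y) (p : Dom) :
    lap (wave k l t a) p = wave k l t (lapProf k l t a a' a'') p := by
  have e1 : dx (wave k l t a) = wave k l t (fun y => -(2 * Real.pi * Complex.I * k) * a y) := by
    rw [← wave_mul]; exact funext fun p => dx_wave k l t a p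
  have e2 : dz (wave k l t a) = wave k l t (fun y => -(2 * Real.pi * Complex.I * l) * a y) := by
    rw [← wave_mul]; exact funext fun p => dz_wave k l t a p
  rw [lap, e1, e2, dx_wave, dz_wave, dy_wave k l t ha,
    dy_wave k l t (a := fun y => a' y + 2 * Real.pi * Complex.I * k * t * a y)
      (a' := fun y => a'' y + 2 * Real.pi * Complex.I * k * t * a' y)
      (fun y => (ha' y).add ((ha y).const_mul _))]
  simp only [wave, lapProf]
  have : Complex.I ^ 2 = -1 := Complex.I_sq
  linear_combination (fourier (-k) p.1 * fourier (-l) p.2.2 * tw k t p.2.1 * a p.2.1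
    * 4 * Real.pi ^ 2 * (k ^ 2 * t ^ 2 + k ^ 2 + l ^ 2)) * this

/-- A plane wave does not decay, so compactness in `y` must come from the profile `a`. This is why
the Schwartz functions used later have compactly supported transforms. -/
lemma isTest_wave (k l : ℤ) {θ : ℝ → ℝ} (hθ : ContDiff ℝ ∞ θ) (hθc : HasCompactSupport θ)
    (hθs : tsupport θ ⊆ Ioi 0) {a : ℝ → ℂ} (ha : ContDiff ℝ ∞ a) (hac : HasCompactSupport a) :
    IsTest (fun q : ℝ × Dom => (θ q.1 : ℂ) * wave k l q.1 a q.2) := by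
  have hsupp : Function.support (fun q : ℝ × Dom => (θ q.1 : ℂ) * wave k l q.1 a q.2) ⊆
      tsupport θ ×ˢ (univ ×ˢ (tsupport a ×ˢ univ)) := by
    intro q hq
    have h1 : θ q.1 ≠ 0 := fun h => hq (by simp [h])
    have h2 : a q.2.2.1 ≠ 0 := fun h => hq (by simp [wave, h])
    exact ⟨subset_tsupport _ h1, mem_univ _, subset_tsupport _ h2, mem_univ _⟩
  have hcpt : IsCompact (tsupport θ ×ˢ ((univ : Set Torus) ×ˢ (tsupport a ×ˢ (univ : Set Torus)))) :=
    hθc.isCompact.prod (isCompact_univ.prod (hac.isCompact.prod isCompact_univ))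
  refine ⟨?_, HasCompactSupport.of_support_subset_isCompact hcpt hsupp, ?_⟩
  · have e : (fun q : ℝ × ℝ × ℝ × ℝ => (fun q : ℝ × Dom => (θ q.1 : ℂ) * wave k l q.1 a q.2)
        (q.1, (q.2.1 : Torus), q.2.2.1, (q.2.2.2 : Torus))) = fun q : ℝ × ℝ × ℝ × ℝ =>
        (θ q.1 : ℂ) * (Complex.exp (2 * Real.pi * Complex.I * (((-k : ℤ) : ℂ) * q.2.1))
          * Complex.exp (2 * Real.pi * Complex.I * (((-l : ℤ) : ℂ) * q.2.2.2))
          * (Complex.exp (2 * Real.pi * Complex.I * (k * q.1 * q.2.2.1)) * a q.2.2.1)) := by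
      ext q
      simp only [wave, fourier_coe_torus, tw]
      push_cast; rfl
    rw [e]
    have hc : ContDiff ℝ ∞ (fun x : ℝ => (x : ℂ)) := Complex.ofRealCLM.contDiff
    have g1 : ContDiff ℝ ∞ fun q : ℝ × ℝ × ℝ × ℝ => (θ q.1 : ℂ) :=
      hc.comp (hθ.comp contDiff_fst)
    have g2 : ContDiff ℝ ∞ fun q : ℝ × ℝ × ℝ × ℝ => (q.1 : ℂ) := hc.comp contDiff_fst
    have g3 : ContDiff ℝ ∞ fun q : ℝ × ℝ × ℝ × ℝ => (q.2.1 : ℂ) := hc.comp (by fun_prop)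
    have g4 : ContDiff ℝ ∞ fun q : ℝ × ℝ × ℝ × ℝ => (q.2.2.1 : ℂ) := hc.comp (by fun_prop)
    have g5 : ContDiff ℝ ∞ fun q : ℝ × ℝ × ℝ × ℝ => (q.2.2.2 : ℂ) := hc.comp (by fun_prop)
    have g6 : ContDiff ℝ ∞ fun q : ℝ × ℝ × ℝ × ℝ => a q.2.2.1 := ha.comp (by fun_prop)
    exact g1.mul (((contDiff_const.mul (contDiff_const.mul g3)).cexp.mul
      (contDiff_const.mul (contDiff_const.mul g5)).cexp).mul
      ((contDiff_const.mul ((contDiff_const.mul g2).mul g4)).cexp.mul g6))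
  · refine (closure_minimal hsupp hcpt.isClosed).trans ?_
    exact prod_mono hθs (subset_univ _)

lemma memLp_tw_mul {a : ℝ → ℂ} (ha : MemLp a 2 (volume : Measure ℝ)) (k : ℤ) (t : ℝ) :
    MemLp (fun y => tw k t y * a y) 2 volume := by
  refine ha.of_le (g := a) ?_ (Eventually.of_forall fun y => ?_)
  · have : Continuous (tw k t) := (continuous_tw k).comp (by fun_prop : Continuous fun y => (t, y))
    exact this.aestronglyMeasurable.mul ha.1
  · rw [norm_mul, norm_tw, one_mul]

/-- The mode in the moving frame. -/
def mmode (f : Dom → ℂ) (k l : ℤ) (t y : ℝ) : ℂ := tw k t y * mode f k l y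

lemma memLp_mmode {f : Dom → ℂ} (hf : MemLp f 2 (volume : Measure Dom)) (k l : ℤ) (t : ℝ) :
    MemLp (mmode f k l t) 2 volume := memLp_tw_mul (memLp_mode hf k l) k t

lemma integral_wave {f : Dom → ℂ} (hf : MemLp f 2 (volume : Measure Dom)) {a : ℝ → ℂ}
    (ha : MemLp a 2 (volume : Measure ℝ)) (k l : ℤ) (t : ℝ) :
    ∫ p : Dom, f p * wave k l t a p = ∫ y, mmode f k l t y * a y := by
  have := integral_char_mul hf (memLp_tw_mul ha k t) k l
  simp only [wave]
  rw [this]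
  congr 1; ext y; simp only [mmode]; ring

lemma integrable_wave {f : Dom → ℂ} (hf : MemLp f 2 (volume : Measure Dom)) {a : ℝ → ℂ}
    (ha : MemLp a 2 (volume : Measure ℝ)) (k l : ℤ) (t : ℝ) :
    Integrable fun p : Dom => f p * wave k l t a p :=
  integrable_char_mul hf (memLp_tw_mul ha k t) k l

/-- The spatial integral in the weak formulation, for a moving plane wave. -/
lemma integral_weak_wave {U c g : Dom → ℂ} (hU : MemLp U 2 (volume : Measure Dom))
    (hc : MemLp c 2 (volume : Measure Dom)) (hg : MemLp g 2 (volume : Measure Dom)) (ν : ℝ)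
    (k l : ℤ) {θ : ℝ → ℝ} (hθ : ContDiff ℝ ∞ θ) {a a' a'' : ℝ → ℂ}
    (ha : ∀ y, HasDerivAt a (a' y) y) (ha' : ∀ y, HasDerivAt a' (a'' y) y)
    (m0 : MemLp a 2 (volume : Measure ℝ)) (m1 : MemLp a' 2 (volume : Measure ℝ))
    (m2 : MemLp a'' 2 (volume : Measure ℝ)) (t : ℝ) :
    ∫ p : Dom, (U p * (deriv (fun s => (θ s : ℂ) * wave k l s a p) t
        + (p.2.1 : ℂ) * dx (fun q => (θ t : ℂ) * wave k l t a q) p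
        + (ν : ℂ) * lap (fun q => (θ t : ℂ) * wave k l t a q) p)
        - (c p + g p) * ((θ t : ℂ) * wave k l t a p)) =
      ((deriv θ t : ℝ) : ℂ) * (∫ y, mmode U k l t y * a y) + (θ t : ℂ) *
        (ν * (∫ y, mmode U k l t y * lapProf k l t a a' a'' y)
          - (∫ y, mmode c k l t y * a y) - ∫ y, mmode g k l t y * a y) := by
  have hlap : MemLp (lapProf k l t a a' a'') 2 volume :=
    (m2.add (m1.const_mul _)).sub (m0.const_mul _)
  rw [← integral_wave hU m0, ← integral_wave hU hlap, ← integral_wave hc m0, ← integral_wave hg m0]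
  have i1 := integrable_wave hU m0 k l t
  have i2 := integrable_wave hU hlap k l t
  have i3 := integrable_wave hc m0 k l t
  have i4 := integrable_wave hg m0 k l t
  have i5 : Integrable fun p : Dom => (ν : ℂ) * (U p * wave k l t (lapProf k l t a a' a'') p)
      - c p * wave k l t a p := (i2.const_mul _).sub i3
  have i6 : Integrable fun p : Dom => (ν : ℂ) * (U p * wave k l t (lapProf k l t a a' a'') p)
      - c p * wave k l t a p - g p * wave k l t a p := i5.sub i4
  rw [← integral_const_mul, ← integral_const_mul, ← integral_sub (i2.const_mul _) i3,
    ← integral_sub i5 i4, ← integral_const_mul, ← integral_add (i1.const_mul _) (i6.const_mul _)]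
  congr 1; ext p
  have e1 : deriv (fun s => (θ s : ℂ) * wave k l s a p) t =
      ((deriv θ t : ℝ) : ℂ) * wave k l t a p
        + (θ t : ℂ) * (2 * Real.pi * Complex.I * k * p.2.1 * wave k l t a p) := by
    have h1 : HasDerivAt (fun s => (θ s : ℂ)) ((deriv θ t : ℝ) : ℂ) t :=
      ((hθ.differentiable (by norm_num)) t).hasDerivAt.ofReal_comp
    have h2 : HasDerivAt (fun s => wave k l s a p)
        (2 * Real.pi * Complex.I * k * p.2.1 * wave k l t a p) t := by
      refine (((hasDerivAt_tw_t k t p.2.1).mul_const (a p.2.1)).const_mul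
        (fourier (-k) p.1 * fourier (-l) p.2.2 : ℂ)).congr_deriv ?_
      simp only [wave]; ring
    exact (h1.mul h2).deriv
  have hca : ∀ y, HasDerivAt (fun y => (θ t : ℂ) * a y) ((θ t : ℂ) * a' y) y :=
    fun y => (ha y).const_mul _
  have hca' : ∀ y, HasDerivAt (fun y => (θ t : ℂ) * a' y) ((θ t : ℂ) * a'' y) y :=
    fun y => (ha' y).const_mul _
  -- The time derivative of the wave contributes `2πi k y` and the transport term `-2πi k y`; these
  -- unbounded terms cancel.
  rw [e1, wave_mul, dx_wave, lap_wave k l t hca hca']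
  simp only [wave, lapProf]
  ring

/-! ### From curves in `L²` to pointwise differential equations -/

/-- The sum of the squared errors has a finite integral, so it is finite almost everywhere, and its
terms tend to zero there. -/
lemma ae_tendsto_of_tsum_lt_top {f : ℕ → ℝ → ℂ} {g : ℝ → ℂ}
    (hf : ∀ n, AEStronglyMeasurable (fun y => f n y - g y) (volume : Measure ℝ))
    (h : ∑' n, ∫⁻ y, ‖f n y - g y‖ₑ ^ 2 ≠ ⊤) :
    ∀ᵐ y, Tendsto (fun n => f n y) atTop (𝓝 (g y)) := by
  rw [← lintegral_tsum fun n => (hf n).enorm.pow_const 2] at h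
  have h1 := ae_lt_top' (AEMeasurable.tsum fun n => (hf n).enorm.pow_const 2) h
  filter_upwards [h1] with y hy
  have h2 := ENNReal.tendsto_atTop_zero_of_tsum_ne_top hy.ne
  rw [tendsto_iff_edist_tendsto_0]
  have h3 := (ENNReal.continuous_rpow_const (y := (1 / 2 : ℝ))).tendsto 0 |>.comp h2
  simp only [ENNReal.zero_rpow_of_pos (by norm_num : (0 : ℝ) < 1 / 2)] at h3
  refine h3.congr fun n => ?_
  rw [Function.comp_apply, ← ENNReal.rpow_natCast, ← ENNReal.rpow_mul, edist_eq_enorm_sub]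
  norm_num

/-- A continuous curve in `L²` has a jointly measurable version. -/
lemma CurveL2.exists_version {f : ℝ → ℝ → ℂ} (hf : CurveL2 f) :
    ∃ F : ℝ → ℝ → ℂ, StronglyMeasurable (Function.uncurry F) ∧
      ∀ t, 0 ≤ t → F t =ᵐ[volume] f t := by
  have hu : ∀ n : ℕ, ∃ δ > 0, ∀ s ∈ Icc (0 : ℝ) n, ∀ t ∈ Icc (0 : ℝ) n, dist s t < δ →
      edist (toL2 (f s)) (toL2 (f t)) < (2⁻¹ : ℝ≥0∞) ^ n := by
    intro n
    have h := isCompact_Icc.uniformContinuousOn_of_continuous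
      (hf.continuousOn.mono (fun x hx => hx.1 : Icc (0 : ℝ) n ⊆ Ici 0))
    rw [EMetric.uniformContinuousOn_iff] at h
    obtain ⟨δ, hδ, H⟩ := h ((2⁻¹ : ℝ≥0∞) ^ n) (ENNReal.pow_pos (by norm_num) n)
    obtain ⟨δ', h0, h1⟩ := ENNReal.lt_iff_exists_nnreal_btwn.1 hδ
    refine ⟨δ', by exact_mod_cast h0, fun s hs t ht hst => H hs ht (lt_trans ?_ h1)⟩
    rw [edist_dist, ENNReal.ofReal_lt_iff_lt_toReal dist_nonneg (by simp)]
    simpa using hst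
  choose δ hδ hδ' using hu
  -- `t` is rounded down to a mesh finer than the modulus of uniform continuity on `[0, n]`. The
  -- step curves are jointly measurable, and their squared `L²` errors are summable once `n ≥ t`, so
  -- they converge almost everywhere.
  let st : ℕ → ℝ → ℝ := fun n t => δ n / 2 * ⌊t / (δ n / 2)⌋
  let F : ℕ → ℝ → ℝ → ℂ := fun n t η => toL2 (f (st n t)) η
  have hFm : ∀ n, StronglyMeasurable (Function.uncurry (F n)) := by
    intro n
    have h1 : Measurable (fun q : ℤ × ℝ => toL2 (f (δ n / 2 * q.1)) q.2) :=
      measurable_from_prod_countable_right fun m =>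
        (Lp.stronglyMeasurable (toL2 (f (δ n / 2 * m)))).measurable
    have h2 : Measurable fun q : ℝ × ℝ => ((⌊q.1 / (δ n / 2)⌋ : ℤ), q.2) := by fun_prop
    exact (h1.comp h2).stronglyMeasurable
  refine ⟨fun t η => limUnder atTop fun n => F n t η, ?_, fun t ht => ?_⟩
  · exact StronglyMeasurable.limUnder hFm
  have hst0 : ∀ n, 0 ≤ st n t := fun n => by
    have := hδ n
    have h2 : (0 : ℝ) ≤ ⌊t / (δ n / 2)⌋ := by
      exact_mod_cast Int.floor_nonneg.2 (by positivity)
    positivity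
  have hst1 : ∀ n, st n t ≤ t := fun n => by
    have := hδ n
    have h2 := Int.floor_le (t / (δ n / 2))
    rw [le_div_iff₀ (by positivity)] at h2
    simp only [st]; linarith
  have hst2 : ∀ n, t - st n t < δ n := fun n => by
    have := hδ n
    have h2 := Int.lt_floor_add_one (t / (δ n / 2))
    rw [div_lt_iff₀ (by positivity)] at h2
    simp only [st]; linarith
  have hb : ∀ n : ℕ, t ≤ n → ∫⁻ y, ‖F n t y - f t y‖ₑ ^ 2 ≤ (2⁻¹ : ℝ≥0∞) ^ n := by
    intro n hn
    have h1 := hδ' n (st n t) ⟨hst0 n, (hst1 n).trans hn⟩ t ⟨ht, hn⟩ (by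
      rw [dist_comm, Real.dist_eq, abs_of_nonneg (by linarith [hst1 n])]; exact hst2 n)
    have e : ∫⁻ y, ‖F n t y - f t y‖ₑ ^ 2 = edist (toL2 (f (st n t))) (toL2 (f t)) ^ 2 := by
      rw [Lp.edist_def, eLpNorm_two_sq]
      refine lintegral_congr_ae ?_
      filter_upwards [coeFn_toL2 (hf.memLp t ht)] with y h1
      simp [F, h1]
    rw [e]
    have h2 : edist (toL2 (f (st n t))) (toL2 (f t)) ^ 2 ≤ ((2⁻¹ : ℝ≥0∞) ^ n) ^ 2 := by gcongr
    refine h2.trans ?_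
    rw [← pow_mul]
    exact pow_le_pow_right_of_le_one' (by norm_num) (by omega)
  obtain ⟨N, hN⟩ := exists_nat_ge t
  have hconv : ∀ᵐ y, Tendsto (fun n => F (n + N) t y) atTop (𝓝 (f t y)) := by
    refine ae_tendsto_of_tsum_lt_top (fun n => ?_) (ne_of_lt ?_)
    · exact (Lp.aestronglyMeasurable _).sub (hf.memLp t ht).1
    · refine lt_of_le_of_lt (ENNReal.tsum_le_tsum fun n => (hb (n + N) (hN.trans (by simp))).trans
        (pow_le_pow_right_of_le_one' (by norm_num) (by omega : n ≤ n + N))) ?_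
      rw [ENNReal.tsum_geometric]
      norm_num
  filter_upwards [hconv] with y hy
  exact ((tendsto_add_atTop_iff_nat N).1 hy).limUnder_eq

lemma enorm_integral_sq_le_of_finite {β : Type*} [MeasurableSpace β] {ν : Measure β}
    {f : β → ℂ} (hf : AEStronglyMeasurable f ν) :
    ‖∫ y, f y ∂ν‖ₑ ^ 2 ≤ ν univ * ∫⁻ y, ‖f y‖ₑ ^ 2 ∂ν := by
  calc ‖∫ y, f y ∂ν‖ₑ ^ 2 ≤ (∫⁻ y, ‖f y‖ₑ ∂ν) ^ 2 := by
        gcongr; exact enorm_integral_le_lintegral_enorm f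
    _ = eLpNorm f 1 ν ^ 2 := by rw [eLpNorm_one_eq_lintegral_enorm]
    _ ≤ (eLpNorm f 2 ν * ν univ ^ (1 / 2 : ℝ)) ^ 2 := by
        gcongr
        have := eLpNorm_le_eLpNorm_mul_rpow_measure_univ (p := 1) (q := 2) (by norm_num) hf
        refine this.trans (le_of_eq ?_)
        norm_num
    _ = ν univ * ∫⁻ y, ‖f y‖ₑ ^ 2 ∂ν := by
        rw [mul_pow, eLpNorm_two_sq, ← ENNReal.rpow_natCast (ν univ ^ _), ← ENNReal.rpow_mul,
          mul_comm]
        norm_num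

lemma memLp_integral_slice_of_finite {α β : Type*} [MeasurableSpace α] [MeasurableSpace β]
    {μ : Measure α} {ν : Measure β} [SFinite μ] [IsFiniteMeasure ν] {f : α × β → ℂ}
    (hf : MemLp f 2 (μ.prod ν)) : MemLp (fun x => ∫ y, f (x, y) ∂ν) 2 μ := by
  refine memLp_two_iff.2 ⟨hf.1.integral_prod_right', ?_⟩
  have h1 : ∫⁻ x, ‖∫ y, f (x, y) ∂ν‖ₑ ^ 2 ∂μ ≤
      ν univ * ∫⁻ q, ‖f q‖ₑ ^ 2 ∂(μ.prod ν) := by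
    rw [lintegral_prod _ (by have := hf.1.enorm; fun_prop),
      ← lintegral_const_mul' _ _ (measure_ne_top ν univ)]
    refine lintegral_mono_ae ?_
    filter_upwards [hf.1.prodMk_left] with x h1
    exact enorm_integral_sq_le_of_finite h1
  exact h1.trans_lt (ENNReal.mul_lt_top (measure_lt_top _ _) (memLp_two_iff.1 hf).2)

lemma CurveL2.exists_bound {f : ℝ → ℝ → ℂ} (hf : CurveL2 f) (T : ℝ) :
    ∃ C : ℝ≥0∞, C ≠ ⊤ ∧ ∀ t, 0 ≤ t → t ≤ T → ∫⁻ y, ‖f t y‖ₑ ^ 2 ≤ C := by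
  obtain ⟨C, hC⟩ := isCompact_Icc.exists_bound_of_continuousOn
    (hf.continuousOn.mono (fun x hx => hx.1 : Icc (0 : ℝ) T ⊆ Ici 0))
  refine ⟨ENNReal.ofReal C ^ 2, by simp, fun t h0 h1 => ?_⟩
  have h2 := hC t ⟨h0, h1⟩
  have h3 : ‖toL2 (f t)‖ₑ ≤ ENNReal.ofReal C := by
    rw [← ofReal_norm]; exact ENNReal.ofReal_le_ofReal h2
  rw [Lp.enorm_def, eLpNorm_congr_ae (coeFn_toL2 (hf.memLp t h0))] at h3
  rw [← eLpNorm_two_sq]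
  gcongr

/-- A weakly differentiable system of continuous curves in `L²` has a version that satisfies the
differential equation at almost every point. -/
theorem exists_pointwise_ode {f : Fin 3 → ℝ → ℝ → ℂ} (hf : ∀ j, CurveL2 (f j))
    {b : Fin 3 → Fin 3 → ℝ → ℝ → ℂ} (hb : ∀ j i, Continuous (Function.uncurry (b j i)))
    (hbb : ∀ j i T, ∃ C, ∀ t, 0 ≤ t → t ≤ T → ∀ η, ‖b j i t η‖ ≤ C * wt η)
    (hw : ∀ (j : Fin 3) (G : SchwartzMap ℝ ℂ), HasCompactSupport (𝓕 (G : ℝ → ℂ)) → ∀ t, 0 ≤ t →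
      (∫ η, f j t η * G η) - ∫ η, f j 0 η * G η =
        ∫ r in (0 : ℝ)..t, ∫ η, (∑ i, b j i r η * f i r η) * G η) :
    ∃ F : Fin 3 → ℝ → ℝ → ℂ, (∀ j t, 0 ≤ t → F j t =ᵐ[volume] f j t) ∧
      ∀ᵐ η, ∀ j t, 0 ≤ t →
        HasDerivWithinAt (fun t => F j t η) (∑ i, b j i t η * F i t η) (Ici 0) t := by
  choose V hVm hV using fun j => (hf j).exists_version
  let R : Fin 3 → ℝ → ℝ → ℂ := fun j r η => ∑ i, b j i r η * V i r η
  have hRm : ∀ j, StronglyMeasurable (Function.uncurry (R j)) := fun j => by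
    have : Function.uncurry (R j) = fun q : ℝ × ℝ =>
        ∑ i, Function.uncurry (b j i) q * Function.uncurry (V i) q := rfl
    rw [this]
    exact Finset.stronglyMeasurable_fun_sum _ fun i _ => (hb j i).stronglyMeasurable.mul (hVm i)
  let μ : ℝ → Measure ℝ := fun T => volume.restrict (Ioc 0 T)
  have hVL : ∀ j T, MemLp (fun q : ℝ × ℝ => V j q.2 q.1) 2 ((volume : Measure ℝ).prod (μ T)) := by
    intro j T
    have hsw : StronglyMeasurable fun q : ℝ × ℝ => V j q.2 q.1 :=
      (hVm j).comp_measurable measurable_swap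
    refine memLp_two_iff.2 ⟨hsw.aestronglyMeasurable, ?_⟩
    obtain ⟨C, hC, hC'⟩ := (hf j).exists_bound T
    rw [lintegral_prod_symm' _ (hsw.enorm.pow_const 2)]
    refine lt_of_le_of_lt (setLIntegral_mono' measurableSet_Ioc (g := fun _ => C)
      fun r hr => ?_) ?_
    · refine le_trans (le_of_eq ?_) (hC' r hr.1.le hr.2)
      refine lintegral_congr_ae ?_
      filter_upwards [hV j r hr.1.le] with y hy
      rw [hy]
    · rw [setLIntegral_const]
      exact ENNReal.mul_lt_top hC.lt_top (by simp)
  -- The coefficients grow like `wt η`, so only `R / wt` is known to be square integrable over `ℝ ×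
  -- (0, T]`.
  have hSL : ∀ j T, MemLp (fun q : ℝ × ℝ => ((wt q.1 : ℝ) : ℂ)⁻¹ * R j q.2 q.1) 2
      ((volume : Measure ℝ).prod (μ T)) := by
    intro j T
    have hwc : Continuous wt := by unfold wt; fun_prop
    have e : (fun q : ℝ × ℝ => ((wt q.1 : ℝ) : ℂ)⁻¹ * R j q.2 q.1) = fun q : ℝ × ℝ =>
        ∑ i, (((wt q.1 : ℝ) : ℂ)⁻¹ * b j i q.2 q.1) * V i q.2 q.1 := by
      ext q; simp only [R, Finset.mul_sum, mul_assoc]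
    rw [e]
    refine memLp_finsetSum _ fun i _ => ?_
    obtain ⟨C, hC⟩ := hbb j i T
    refine (hVL i T).of_le_mul (c := C) ?_ ?_
    · refine AEStronglyMeasurable.mul (Continuous.aestronglyMeasurable ?_) (hVL i T).1
      refine Continuous.mul (Continuous.inv₀ (by fun_prop) fun q => ?_)
        ((hb j i).comp continuous_swap)
      exact_mod_cast (wt_pos q.1).ne'
    · have h1 : ∀ᵐ q ∂((volume : Measure ℝ).prod (μ T)), q.2 ∈ Ioc (0 : ℝ) T :=
        Measure.quasiMeasurePreserving_snd.ae (ae_restrict_mem measurableSet_Ioc)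
      filter_upwards [h1] with q hq
      rw [norm_mul, norm_mul, norm_inv, Complex.norm_real, Real.norm_of_nonneg (wt_pos _).le]
      gcongr
      rw [inv_mul_le_iff₀ (wt_pos _), mul_comm]
      exact hC q.2 hq.1.le hq.2 q.1
  have hRint : ∀ᵐ η, ∀ j, ∀ n : ℕ, IntegrableOn (fun r => R j r η) (Ioc 0 (n : ℝ)) := by
    refine ae_all_iff.2 fun j => ae_all_iff.2 fun n => ?_
    have h : ∀ᵐ η, MemLp (fun r => ((wt η : ℝ) : ℂ)⁻¹ * R j r η) 2 (μ n) := by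
      have h1 := (hSL j n).1.prodMk_left
      have h2 := (memLp_two_iff.1 (hSL j n)).2
      rw [lintegral_prod _ ((hSL j n).1.enorm.pow_const 2)] at h2
      have h3 := ae_lt_top' ((hSL j n).1.enorm.pow_const 2).lintegral_prod_right' h2.ne
      filter_upwards [h1, h3] with η h4 h5
      exact memLp_two_iff.2 ⟨h4, h5⟩
    filter_upwards [h] with η hη
    have h2 := (hη.integrable (by norm_num)).const_mul ((wt η : ℝ) : ℂ)
    refine h2.congr (Eventually.of_forall fun r => ?_)
    have : ((wt η : ℝ) : ℂ) ≠ 0 := by exact_mod_cast (wt_pos η).ne'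
    simp only; field_simp
  have hstep : ∀ j T, 0 ≤ T → ∀ᵐ η, V j T η = V j 0 η + ∫ r in (0 : ℝ)..T, R j r η := by
    intro j T hT
    have hI := memLp_integral_slice_of_finite (hSL j T)
    have hwi : MemLp (fun η => ((wt η : ℝ) : ℂ)⁻¹ * (V j T η - V j 0 η)) 2 volume := by
      have hd : MemLp (fun η => V j T η - V j 0 η) 2 volume :=
        ((memLp_congr_ae (hV j T hT)).2 ((hf j).memLp T hT)).sub
          ((memLp_congr_ae (hV j 0 le_rfl)).2 ((hf j).memLp 0 le_rfl))
      refine hd.of_le (AEStronglyMeasurable.mul (Continuous.aestronglyMeasurable ?_) hd.1)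
        (Eventually.of_forall fun η => ?_)
      · have hwc : Continuous wt := by unfold wt; fun_prop
        exact Continuous.inv₀ (by fun_prop) fun q => by exact_mod_cast (wt_pos q).ne'
      · rw [norm_mul, norm_inv, Complex.norm_real, Real.norm_of_nonneg (wt_pos _).le]
        exact mul_le_of_le_one_left (norm_nonneg _) (inv_le_one_of_one_le₀ (one_le_wt η))
    -- After division by the weight the identity compares functions in `L²`; the weight carried by
    -- the test functions restores the pairings of `hw`.
    have hz := ae_eq_zero_of_fourier_test (hwi.sub hI) fun G hG => ?_
    · filter_upwards [hz] with η hη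
      have hne : ((wt η : ℝ) : ℂ) ≠ 0 := by exact_mod_cast (wt_pos η).ne'
      simp only [Pi.sub_apply, integral_const_mul, ← mul_sub] at hη
      rw [intervalIntegral.integral_of_le hT]
      rcases mul_eq_zero.1 hη with h | h
      · exact absurd h (inv_ne_zero hne)
      · linear_combination h
    · have hwG : MemLp (fun η => (wt η : ℂ) * G η) 2 volume := by
        have e : (fun η => (wt η : ℂ) * G η) = (((1 : ℂ) • G + (0 : ℂ) • G
            + (4 * Real.pi ^ 2 : ℂ) • mulX (mulX G) : SchwartzMap ℝ ℂ) : ℝ → ℂ) := by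
          ext η; simp [mulX_apply, wt]; ring
        rw [e]; exact SchwartzMap.memLp _ _ _
      have hne : ∀ η, ((wt η : ℝ) : ℂ) ≠ 0 := fun η => by exact_mod_cast (wt_pos η).ne'
      have i1 := hwi.integrable_mul hwG
      have i2 := hI.integrable_mul hwG
      have e1 : ∫ η, ((fun η => ((wt η : ℝ) : ℂ)⁻¹ * (V j T η - V j 0 η)) - fun x =>
          ∫ y, ((wt x : ℝ) : ℂ)⁻¹ * R j y x ∂(μ T)) η * (wt η * G η) =
          (∫ η, (((wt η : ℝ) : ℂ)⁻¹ * (V j T η - V j 0 η)) * (wt η * G η)) -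
          ∫ x, (∫ y, ((wt x : ℝ) : ℂ)⁻¹ * R j y x ∂(μ T)) * (wt x * G x) := by
        refine Eq.trans ?_ (integral_sub i1 i2)
        congr 1; ext η; simp only [Pi.sub_apply]; ring
      refine e1.trans ?_
      have e2 : ∫ η, (((wt η : ℝ) : ℂ)⁻¹ * (V j T η - V j 0 η)) * (wt η * G η) =
          (∫ η, f j T η * G η) - ∫ η, f j 0 η * G η := by
        refine Eq.trans (integral_congr_ae ?_)
          (integral_sub (((hf j).memLp T hT).integrable_mul (G.memLp 2 volume))
            (((hf j).memLp 0 le_rfl).integrable_mul (G.memLp 2 volume)))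
        filter_upwards [hV j T hT, hV j 0 le_rfl] with η h1 h2
        have := hne η
        rw [h1, h2]; field_simp
      have i3 : Integrable (fun q : ℝ × ℝ => (((wt q.1 : ℝ) : ℂ)⁻¹ * R j q.2 q.1)
          * (wt q.1 * G q.1)) ((volume : Measure ℝ).prod (μ T)) :=
        (hSL j T).integrable_mul (hwG.comp_fst (μ T))
      have e3 : ∫ x, (∫ y, ((wt x : ℝ) : ℂ)⁻¹ * R j y x ∂(μ T)) * (wt x * G x) =
          ∫ r in (0 : ℝ)..T, ∫ η, (∑ i, b j i r η * f i r η) * G η := by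
        have e4 : ∫ x, (∫ y, ((wt x : ℝ) : ℂ)⁻¹ * R j y x ∂(μ T)) * (wt x * G x) =
            ∫ x, ∫ y, (((wt x : ℝ) : ℂ)⁻¹ * R j y x) * (wt x * G x) ∂(μ T) := by
          congr 1; ext x; rw [integral_mul_const]
        rw [e4, integral_integral_swap i3, intervalIntegral.integral_of_le hT]
        refine setIntegral_congr_fun measurableSet_Ioc fun r hr => ?_
        refine integral_congr_ae ?_
        filter_upwards [ae_all_iff.2 fun i => hV i r hr.1.le] with η h1
        have := hne η
        simp only [R, h1]; field_simp
      rw [e2, e3, hw j G hG T hT, sub_self]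
  -- The null set in `hstep` depends on `T`. The integral defines a version for all times at once,
  -- which agrees with `V j t` almost everywhere for each `t`.
  let F : Fin 3 → ℝ → ℝ → ℂ := fun j t η => V j 0 η + ∫ r in Ioc (0 : ℝ) t, R j r η
  have hFV : ∀ j t, 0 ≤ t → F j t =ᵐ[volume] V j t := fun j t ht => by
    filter_upwards [hstep j t ht] with η h
    rw [h, intervalIntegral.integral_of_le ht]
  refine ⟨F, fun j t ht => (hFV j t ht).trans (hV j t ht), ?_⟩
  have hFm : ∀ j, StronglyMeasurable (Function.uncurry (F j)) := fun j => by
    have h1 : StronglyMeasurable fun q : (ℝ × ℝ) × ℝ =>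
        {q : (ℝ × ℝ) × ℝ | 0 < q.2 ∧ q.2 ≤ q.1.1}.indicator (fun q => R j q.2 q.1.2) q := by
      refine StronglyMeasurable.indicator ((hRm j).comp_measurable (g := fun q : (ℝ × ℝ) × ℝ =>
        (q.2, q.1.2)) (by fun_prop)) ?_
      exact (measurableSet_lt measurable_const measurable_snd).inter
        (measurableSet_le measurable_snd (by fun_prop))
    have h2 := h1.integral_prod_right' (ν := (volume : Measure ℝ))
    have h3 : StronglyMeasurable fun q : ℝ × ℝ => V j 0 q.2 :=
      (hVm j).comp_measurable (g := fun q : ℝ × ℝ => ((0 : ℝ), q.2)) (by fun_prop)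
    have e : Function.uncurry (F j) = (fun q : ℝ × ℝ => V j 0 q.2) + fun x => ∫ y : ℝ,
        {q : (ℝ × ℝ) × ℝ | 0 < q.2 ∧ q.2 ≤ q.1.1}.indicator (fun q => R j q.2 q.1.2) (x, y) := by
      ext q
      simp only [Function.uncurry, F, Pi.add_apply]
      rw [← integral_indicator measurableSet_Ioc]
      rfl
    rw [e]; exact h3.add h2
  -- Fubini exchanges the quantifiers: for almost every `η` the two versions agree for almost every
  -- `t`, which suffices to put `F` in place of `V` under the integral.
  have hae : ∀ᵐ η, ∀ᵐ t ∂(volume.restrict (Ioi (0 : ℝ))), ∀ j, F j t η = V j t η := by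
    have h1 : ∀ᵐ q ∂((volume : Measure ℝ).prod (volume.restrict (Ioi (0 : ℝ)))),
        ∀ j, F j q.2 q.1 = V j q.2 q.1 := by
      refine ae_all_iff.2 fun j => ?_
      have hms : MeasurableSet {q : ℝ × ℝ | F j q.1 q.2 = V j q.1 q.2} :=
        StronglyMeasurable.measurableSet_eq_fun (hFm j) (hVm j)
      have h2 : ∀ᵐ q ∂((volume.restrict (Ioi (0 : ℝ))).prod (volume : Measure ℝ)),
          F j q.1 q.2 = V j q.1 q.2 := by
        rw [Measure.ae_prod_iff_ae_ae hms]
        filter_upwards [ae_restrict_mem measurableSet_Ioi] with t ht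
        exact hFV j t (le_of_lt ht)
      exact (Measure.measurePreserving_swap (μ := (volume : Measure ℝ))
        (ν := volume.restrict (Ioi (0 : ℝ)))).quasiMeasurePreserving.ae h2
    exact Measure.ae_ae_of_ae_prod h1
  filter_upwards [hae, hRint] with η h1 h2 j t ht
  have hloc : ∀ j a c, IntervalIntegrable ((Ioi (0 : ℝ)).indicator fun r => R j r η) volume a c := by
    intro j a c
    obtain ⟨n, hn⟩ := exists_nat_ge (max |a| |c|)
    rw [intervalIntegrable_iff, IntegrableOn, integrable_indicator_iff measurableSet_Ioi,
      IntegrableOn, Measure.restrict_restrict measurableSet_Ioi]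
    refine (h2 j n).mono_set fun r hr => ⟨hr.1, ?_⟩
    refine le_trans hr.2.2 (le_trans ?_ hn)
    exact max_le_max (le_abs_self _) (le_abs_self _)
  have hFe : ∀ j t, 0 ≤ t → F j t η =
      V j 0 η + ∫ r in (0 : ℝ)..t, (Ioi (0 : ℝ)).indicator (fun r => R j r η) r := by
    intro j t ht
    rw [intervalIntegral.integral_of_le ht]
    simp only [F]
    congr 1
    refine setIntegral_congr_fun measurableSet_Ioc fun r hr => ?_
    rw [indicator_of_mem (by exact hr.1)]
  have hFc : ∀ j, Continuous fun t => V j 0 η +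
      ∫ r in (0 : ℝ)..t, (Ioi (0 : ℝ)).indicator (fun r => R j r η) r := fun j =>
    continuous_const.add (intervalIntegral.continuous_primitive (hloc j) 0)
  -- `Φ` is continuous on the whole line, so the integrand expressed through it is continuous and
  -- the fundamental theorem of calculus applies at every `t ≥ 0`.
  let Φ : Fin 3 → ℝ → ℂ := fun j t => V j 0 η +
      ∫ r in (0 : ℝ)..t, (Ioi (0 : ℝ)).indicator (fun r => R j r η) r
  have hgc : Continuous fun r => ∑ i, b j i r η * Φ i r :=
    continuous_finsetSum _ fun i _ =>
      ((hb j i).comp (by fun_prop : Continuous fun r : ℝ => (r, η))).mul (hFc i)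
  have hder : HasDerivAt (fun t => V j 0 η + ∫ r in (0 : ℝ)..t, ∑ i, b j i r η * Φ i r)
      (∑ i, b j i t η * Φ i t) t :=
    (intervalIntegral.integral_hasDerivAt_right (hgc.intervalIntegrable _ _)
      hgc.stronglyMeasurable.stronglyMeasurableAtFilter hgc.continuousAt).const_add _
  have hΦF : ∀ i t, 0 ≤ t → F i t η = Φ i t := hFe
  have heq : ∀ s, 0 ≤ s → F j s η = V j 0 η + ∫ r in (0 : ℝ)..s, ∑ i, b j i r η * Φ i r := by
    intro s hs
    rw [hFe j s hs, intervalIntegral.integral_of_le hs, intervalIntegral.integral_of_le hs]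
    congr 1
    refine setIntegral_congr_ae measurableSet_Ioc ?_
    have h3 := (ae_restrict_iff' measurableSet_Ioi).1 h1
    filter_upwards [h3] with r hr hr'
    rw [indicator_of_mem (by exact hr'.1)]
    refine Finset.sum_congr rfl fun i _ => ?_
    rw [← hr hr'.1 i, hΦF i r hr'.1.le]
  simp only [hΦF _ t ht]
  exact (hder.hasDerivWithinAt (s := Ici 0)).congr (fun s hs => heq s hs) (heq t ht)

/-! ### The equation for a single Fourier mode in the moving frame -/

/-- `k² + (η - kt)² + l²`. -/
def qq (k l : ℤ) (t η : ℝ) : ℝ := (k : ℝ) ^ 2 + (η - k * t) ^ 2 + (l : ℝ) ^ 2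

lemma qq_pos {k l : ℤ} (h : ¬ (k = 0 ∧ l = 0)) (t η : ℝ) : 0 < qq k l t η := by
  unfold qq
  rcases not_and_or.1 h with h | h
  · have : (0 : ℝ) < (k : ℝ) ^ 2 := by positivity
    positivity
  · have : (0 : ℝ) < (l : ℝ) ^ 2 := by positivity
    positivity

/-- The symbol of `∂ᵢ Δ⁻¹ ∂ⱼ` in the moving frame, made continuous. -/
def rz (k l : ℤ) (i j : Fin 3) (t η : ℝ) : ℝ :=
  if k = 0 ∧ l = 0 then (if i = 1 ∧ j = 1 then 1 else 0)
  else freq k (η - k * t) l i * freq k (η - k * t) l j / qq k l t η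

/-- For `k = l = 0` the symbol `η² / η²` equals `1` except at `η = 0`, where division by zero gives
`0`; `rz` is `1` there too. -/
lemma rz_ae_eq (k l : ℤ) (i j : Fin 3) (t : ℝ) :
    ∀ᵐ η, riesz i j k (η - k * t) l = (rz k l i j t η : ℂ) := by
  by_cases h : k = 0 ∧ l = 0
  · obtain ⟨rfl, rfl⟩ := h
    have h0 : ∀ᵐ η : ℝ, η ≠ 0 := by simp [ae_iff]
    filter_upwards [h0] with η hη
    fin_cases i <;> fin_cases j <;> simp [riesz, rz, freq]
    rw [← pow_two, div_self (by exact_mod_cast pow_ne_zero 2 hη)]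
  · refine Eventually.of_forall fun η => ?_
    rw [rz, if_neg h, riesz, qq]

lemma continuous_rz (k l : ℤ) (i j : Fin 3) : Continuous (Function.uncurry (rz k l i j)) := by
  by_cases h : k = 0 ∧ l = 0
  · have : Function.uncurry (rz k l i j) = fun _ => if i = 1 ∧ j = 1 then 1 else 0 := by
      ext q; simp [Function.uncurry, rz, h]
    rw [this]; exact continuous_const
  · have : Function.uncurry (rz k l i j) = fun q => freq k (q.2 - k * q.1) l i
        * freq k (q.2 - k * q.1) l j / qq k l q.1 q.2 := by
      ext q; simp [Function.uncurry, rz, h]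
    rw [this]
    have hf : ∀ i, Continuous fun q : ℝ × ℝ => freq k (q.2 - k * q.1) l i := by
      intro i; fin_cases i <;> simp [freq] <;> fun_prop
    refine Continuous.div ((hf i).mul (hf j)) (by unfold qq; fun_prop) fun q => (qq_pos h _ _).ne'

lemma abs_rz_le (k l : ℤ) (i j : Fin 3) (t η : ℝ) : |rz k l i j t η| ≤ 1 := by
  rw [rz]
  split_ifs with h h1
  · simp
  · simp
  · have hq := qq_pos h t η
    rw [abs_div, abs_of_pos hq, div_le_one hq, abs_mul]
    have hf : ∀ i, |freq k (η - k * t) l i| ^ 2 ≤ qq k l t η := by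
      intro i; rw [sq_abs]
      fin_cases i <;> simp [freq, qq] <;> nlinarith [sq_nonneg (k : ℝ), sq_nonneg (η - k * t),
        sq_nonneg (l : ℝ)]
    nlinarith [hf i, hf j, sq_nonneg (|freq k (η - k * t) l i| - |freq k (η - k * t) l j|)]

/-- The matrix of the linear system for the Fourier modes. -/
def bmat (ν β : ℝ) (k l : ℤ) (j i : Fin 3) (t η : ℝ) : ℂ :=
  ((![![-(4 * Real.pi ^ 2 * ν * qq k l t η) + β * rz k l 0 1 t η,
        -(1 - β) - (β - 2) * rz k l 0 0 t η, 0],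
      ![-β + β * rz k l 1 1 t η,
        -(4 * Real.pi ^ 2 * ν * qq k l t η) - (β - 2) * rz k l 1 0 t η, 0],
      ![β * rz k l 2 1 t η, -(β - 2) * rz k l 2 0 t η, -(4 * Real.pi ^ 2 * ν * qq k l t η)]] j i
        : ℝ) : ℂ)

lemma continuous_bmat (ν β : ℝ) (k l : ℤ) (j i : Fin 3) :
    Continuous (Function.uncurry (bmat ν β k l j i)) := by
  have h : ∀ i j, Continuous fun q : ℝ × ℝ => rz k l i j q.1 q.2 := continuous_rz k l
  have hq : Continuous fun q : ℝ × ℝ => qq k l q.1 q.2 := by unfold qq; fun_prop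
  unfold Function.uncurry bmat
  refine Complex.continuous_ofReal.comp ?_
  have h1 := h 0 0; have h2 := h 0 1; have h3 := h 1 0; have h4 := h 1 1
  have h5 := h 2 0; have h6 := h 2 1
  fin_cases j <;> fin_cases i
  all_goals
    simp only [Fin.zero_eta, Fin.mk_one, Fin.reduceFinMk, Fin.isValue, Matrix.cons_val]
    fun_prop

/-- The Riesz symbols are bounded by one, and `qq` is quadratic in `η`, uniformly for `0 ≤ t ≤ T`.
-/
lemma norm_bmat_le (ν β : ℝ) (k l : ℤ) (j i : Fin 3) (T : ℝ) :
    ∃ C, ∀ t, 0 ≤ t → t ≤ T → ∀ η, ‖bmat ν β k l j i t η‖ ≤ C * wt η := by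
  refine ⟨4 * Real.pi ^ 2 * |ν| * ((k : ℝ) ^ 2 + 2 + 2 * (k : ℝ) ^ 2 * T ^ 2 + (l : ℝ) ^ 2)
    + (3 + 3 * |β|), fun t h0 h1 η => ?_⟩
  have hr := fun i j => abs_le.1 (abs_rz_le k l i j t η)
  have hw := one_le_wt η
  have hqw : qq k l t η ≤ ((k : ℝ) ^ 2 + 2 + 2 * (k : ℝ) ^ 2 * T ^ 2 + (l : ℝ) ^ 2) * wt η := by
    have e1 : (η - k * t) ^ 2 ≤ 2 * η ^ 2 + 2 * (k : ℝ) ^ 2 * T ^ 2 := by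
      have : (k : ℝ) ^ 2 * t ^ 2 ≤ (k : ℝ) ^ 2 * T ^ 2 := by gcongr
      nlinarith [sq_nonneg (η + k * t)]
    have e2 : η ^ 2 ≤ wt η := by
      unfold wt; nlinarith [Real.pi_gt_three, sq_nonneg η, mul_nonneg (sq_nonneg η) (by nlinarith [Real.pi_gt_three] : 0 ≤ 4 * Real.pi ^ 2 - 1)]
    unfold qq
    nlinarith [mul_nonneg (by positivity : 0 ≤ (k : ℝ) ^ 2 + 2 * (k : ℝ) ^ 2 * T ^ 2 + (l : ℝ) ^ 2)
      (sub_nonneg.2 hw)]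
  have hq0 : 0 ≤ qq k l t η := by unfold qq; positivity
  have hN : |4 * Real.pi ^ 2 * ν * qq k l t η| ≤ 4 * Real.pi ^ 2 * |ν|
      * ((k : ℝ) ^ 2 + 2 + 2 * (k : ℝ) ^ 2 * T ^ 2 + (l : ℝ) ^ 2) * wt η := by
    rw [abs_mul, abs_mul, abs_of_nonneg (by positivity : 0 ≤ 4 * Real.pi ^ 2), abs_of_nonneg hq0]
    calc _ ≤ 4 * Real.pi ^ 2 * |ν| * (((k : ℝ) ^ 2 + 2 + 2 * (k : ℝ) ^ 2 * T ^ 2 + (l : ℝ) ^ 2)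
        * wt η) := by gcongr
      _ = _ := by ring
  have hB : ∀ i j, |β * rz k l i j t η| ≤ |β| := fun i j => by
    rw [abs_mul]; exact mul_le_of_le_one_right (abs_nonneg _) (abs_rz_le k l i j t η)
  have hB2 : ∀ i j, |rz k l i j t η| ≤ 1 := fun i j => abs_rz_le k l i j t η
  have hNn : 0 ≤ 4 * Real.pi ^ 2 * |ν|
      * ((k : ℝ) ^ 2 + 2 + 2 * (k : ℝ) ^ 2 * T ^ 2 + (l : ℝ) ^ 2) * wt η := (abs_nonneg _).trans hN
  have hβw : |β| ≤ |β| * wt η := le_mul_of_one_le_right (abs_nonneg _) hw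
  have hb0 := abs_nonneg β
  rw [bmat, Complex.norm_real, Real.norm_eq_abs, add_mul]
  have hb1 := neg_abs_le β
  have hb2 := le_abs_self β
  generalize hX : 4 * Real.pi ^ 2 * |ν|
      * ((k : ℝ) ^ 2 + 2 + 2 * (k : ℝ) ^ 2 * T ^ 2 + (l : ℝ) ^ 2) * wt η = X at *
  have hB' := fun i j => abs_le.1 (hB i j)
  have hB2' := fun i j => abs_le.1 (hB2 i j)
  have hN' := abs_le.1 hN
  rw [abs_le]
  fin_cases j <;> fin_cases i <;> simp <;> constructor
  all_goals
    have a1 := hB' 0 0; have a2 := hB' 0 1; have a3 := hB' 1 0; have a4 := hB' 1 1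
    have a5 := hB' 2 0; have a6 := hB' 2 1
    have c1 := hB2' 0 0; have c3 := hB2' 1 0
    have c5 := hB2' 2 0
    linarith [a1.1, a1.2, a2.1, a2.2, a3.1, a3.2, a4.1, a4.2, a5.1, a5.2, a6.1, a6.2, c1.1, c1.2,
      c3.1, c3.2, c5.1, c5.2, hN'.1, hN'.2]

lemma ftL_mmode {f : Dom → ℂ} (hf : MemLp f 2 (volume : Measure Dom)) (k l : ℤ) (t : ℝ) :
    ∀ᵐ η, ftL (mmode f k l t) η = fhat f k (η - k * t) l :=
  ftL_modulate (memLp_mode hf k l) (k * t)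

lemma ae_shift {P : ℝ → Prop} (h : ∀ᵐ η, P η) (s : ℝ) : ∀ᵐ η, P (η - s) :=
  (measurePreserving_sub_right (volume : Measure ℝ) s).quasiMeasurePreserving.ae h

variable {ν β : ℝ} {uin : Fin 3 → Dom → ℂ} {u : ℝ → Fin 3 → Dom → ℂ}

/-- Taking a mode is a contraction of `L²`, and the twist `tw` is continuous of modulus one. -/
lemma IsSolution.curveL2_mmode (S : IsSolution ν β uin u) (k l : ℤ) (j : Fin 3) :
    CurveL2 fun t => mmode (u t j) k l t := by
  have h1 : CurveL2 fun t => mode (u t j) k l := by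
    refine ⟨fun t ht => memLp_mode (S.memLp t ht j) k l, fun t ht => ?_⟩
    refine tendsto_zero_of_le_nhdsWithin (S.continuous t ht j) fun s hs => ?_
    have hm := lintegral_mode_le ((S.memLp s hs j).sub (S.memLp t ht j)) k l
    rw [← eLpNorm_two_sq, ← eLpNorm_two_sq] at hm
    have h2 := (ENNReal.pow_le_pow_left_iff (by norm_num)).1 hm
    refine le_trans (le_of_eq (eLpNorm_congr_ae ?_)) h2
    filter_upwards [mode_sub (S.memLp s hs j) (S.memLp t ht j) k l] with y hy
    rw [hy]
  exact h1.mul (continuous_tw k) fun T => ⟨1, fun t _ _ y => (norm_tw k t y).le⟩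

/-- The Laplacian on the Fourier side, for the Fourier transform of a Schwartz function. -/
lemma lapProf_fourier (k l : ℤ) (t : ℝ) (G : SchwartzMap ℝ ℂ) :
    ∃ H : SchwartzMap ℝ ℂ, (∀ η, H η = -(4 * Real.pi ^ 2 * qq k l t η : ℝ) * G η) ∧
      lapProf k l t (𝓕 (G : ℝ → ℂ)) (fun y => -(2 * Real.pi * Complex.I) * 𝓕 (mulX G : ℝ → ℂ) y)
        (fun y => -(2 * Real.pi * Complex.I) * (-(2 * Real.pi * Complex.I)
          * 𝓕 (mulX (mulX G) : ℝ → ℂ) y)) = 𝓕 (H : ℝ → ℂ) := by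
  refine ⟨(-(4 * Real.pi ^ 2 * (k ^ 2 * t ^ 2 + k ^ 2 + l ^ 2)) : ℂ) • G
    + (8 * Real.pi ^ 2 * k * t : ℂ) • mulX G + (-(4 * Real.pi ^ 2) : ℂ) • mulX (mulX G),
    fun η => ?_, ?_⟩
  · simp [mulX_apply, qq]; ring
  · ext y
    rw [fourier_lin_comb, lapProf]
    linear_combination (4 * Real.pi ^ 2 * 𝓕 (mulX (mulX G) : ℝ → ℂ) y
      - 8 * Real.pi ^ 2 * k * t * 𝓕 (mulX G : ℝ → ℂ) y) * Complex.I_sq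

lemma memLp_coriolis {v : Fin 3 → Dom → ℂ} (hv : ∀ j, MemLp (v j) 2 (volume : Measure Dom))
    (j : Fin 3) : MemLp (coriolis β v j) 2 (volume : Measure Dom) := by
  have e : ∀ j, coriolis β v j = fun p =>
      (![(1 - (β : ℂ)) * v 1 p, (β : ℂ) * v 0 p, 0] : Fin 3 → ℂ) j := fun _ => rfl
  rw [e]
  fin_cases j
  · exact (hv 1).const_mul _
  · exact (hv 0).const_mul _
  · exact MemLp.zero

lemma ftL_mmode_coriolis {v : Fin 3 → Dom → ℂ} (hv : ∀ j, MemLp (v j) 2 (volume : Measure Dom))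
    (j : Fin 3) (k l : ℤ) (t : ℝ) : ∀ᵐ η, ftL (mmode (coriolis β v j) k l t) η =
      (![(1 - (β : ℂ)) * ftL (mmode (v 1) k l t) η, (β : ℂ) * ftL (mmode (v 0) k l t) η, 0]
        : Fin 3 → ℂ) j := by
  have e : ∀ j, coriolis β v j = fun p =>
      (![(1 - (β : ℂ)) * v 1 p, (β : ℂ) * v 0 p, 0] : Fin 3 → ℂ) j := fun _ => rfl
  have hc : ∀ (c : ℂ) (i : Fin 3), ∀ᵐ η, ftL (mmode (fun p => c * v i p) k l t) η =
      c * ftL (mmode (v i) k l t) η := by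
    intro c i
    have e1 : mmode (fun p => c * v i p) k l t = fun y => c * mmode (v i) k l t y := by
      ext y; simp only [mmode]; rw [mode_const_mul]; ring
    rw [e1]
    exact ftL_const_mul (memLp_mmode (hv i) k l t) c
  rw [e]
  fin_cases j
  · exact hc _ 1
  · exact hc _ 0
  · have := hc 0 0
    simpa using this

/-- The modes of a solution satisfy the linear system pointwise. -/
theorem Setting.exists_modes (S : Setting ν β uin u) (k l : ℤ) :
    ∃ F : Fin 3 → ℝ → ℝ → ℂ,
      (∀ j t, 0 ≤ t → ∀ᵐ η, F j t η = fhat (u t j) k (η - k * t) l) ∧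
      ∀ᵐ η, ∀ j t, 0 ≤ t →
        HasDerivWithinAt (fun t => F j t η) (∑ i, bmat ν β k l j i t η * F i t η) (Ici 0) t := by
  have hsol := S.solution
  obtain ⟨g, hg, hweak⟩ := hsol.equation
  let fm : Fin 3 → ℝ → ℝ → ℂ := fun j t => ftL (mmode (u t j) k l t)
  have hfm : ∀ j, CurveL2 (fm j) := fun j => (hsol.curveL2_mmode k l j).ftL
  have hgm : ∀ j t, 0 ≤ t → ∀ᵐ η, ftL (mmode (g t j) k l t) η =
      ((β : ℂ) - 2) * (rz k l j 0 t η * fm 1 t η) - (β : ℂ) * (rz k l j 1 t η * fm 0 t η) := by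
    intro j t ht
    filter_upwards [ftL_mmode (hg t ht j).1 k l t, ae_shift ((hg t ht j).2 k l) (k * t),
      ftL_mmode (hsol.memLp t ht 0) k l t, ftL_mmode (hsol.memLp t ht 1) k l t,
      rz_ae_eq k l j 0 t, rz_ae_eq k l j 1 t] with η h1 h2 h3 h4 h5 h6
    rw [h1, h2, h5, h6]; simp only [fm]; rw [h3, h4]
  -- On the frequency side viscosity, the zeroth order term and the pressure gradient combine into
  -- the rows of `bmat`.
  have hB : ∀ (j : Fin 3) (G : SchwartzMap ℝ ℂ) t, 0 ≤ t →
      ν * (∫ y, mmode (u t j) k l t y * lapProf k l t (𝓕 (G : ℝ → ℂ))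
          (fun y => -(2 * Real.pi * Complex.I) * 𝓕 (mulX G : ℝ → ℂ) y)
          (fun y => -(2 * Real.pi * Complex.I) * (-(2 * Real.pi * Complex.I)
          * 𝓕 (mulX (mulX G) : ℝ → ℂ) y)) y)
          - (∫ y, mmode (coriolis β (u t) j) k l t y * 𝓕 (G : ℝ → ℂ) y)
          - ∫ y, mmode (g t j) k l t y * 𝓕 (G : ℝ → ℂ) y =
        ∫ η, (∑ i, bmat ν β k l j i t η * fm i t η) * G η := by
    intro j G t ht
    obtain ⟨H, hH, hH'⟩ := lapProf_fourier k l t G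
    have hm := fun j => memLp_mmode (hsol.memLp t ht j) k l t
    have hmc := memLp_mmode (memLp_coriolis (β := β) (hsol.memLp t ht) j) k l t
    have hmg := memLp_mmode (hg t ht j).1 k l t
    rw [hH', ← integral_ftL_mul (hm j), ← integral_ftL_mul hmc, ← integral_ftL_mul hmg,
      ← integral_const_mul]
    have i1 := ((memLp_ftL (mmode (u t j) k l t)).integrable_mul (H.memLp 2 volume)).const_mul (ν : ℂ)
    have i2 := (memLp_ftL (mmode (coriolis β (u t) j) k l t)).integrable_mul (G.memLp 2 volume)
    have i3 := (memLp_ftL (mmode (g t j) k l t)).integrable_mul (G.memLp 2 volume)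
    refine Eq.trans ?_ (integral_congr_ae (f := fun η => (ν : ℂ) * (ftL (mmode (u t j) k l t) η * H η)
      - ftL (mmode (coriolis β (u t) j) k l t) η * G η - ftL (mmode (g t j) k l t) η * G η) ?_)
    · refine Eq.trans ?_ (integral_sub (i1.sub i2) i3).symm
      congr 1
      exact (integral_sub i1 i2).symm
    filter_upwards [ftL_mmode_coriolis (β := β) (hsol.memLp t ht) j k l t, hgm j t ht] with η h1 h2
    simp only [h1, h2, hH, Fin.sum_univ_three, fm]
    fin_cases j <;> simp [bmat] <;> ring
  refine (exists_pointwise_ode hfm (continuous_bmat ν β k l) (norm_bmat_le ν β k l) ?_).imp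
    fun F hF => ⟨fun j t ht => ?_, hF.2⟩
  · intro j G hG t ht
    have hGm := G.memLp 2 (volume : Measure ℝ)
    have hwG : MemLp (fun η => (wt η : ℂ) * G η) 2 volume := by
      have e : (fun η => (wt η : ℂ) * G η) = (((1 : ℂ) • G + (0 : ℂ) • G
          + (4 * Real.pi ^ 2 : ℂ) • mulX (mulX G) : SchwartzMap ℝ ℂ) : ℝ → ℂ) := by
        ext η; simp [mulX_apply, wt]; ring
      rw [e]; exact SchwartzMap.memLp _ _ _
    refine sub_eq_integral_of_weak (A := fun t => ∫ η, fm j t η * G η)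
      (B := fun t => ∫ η, (∑ i, bmat ν β k l j i t η * fm i t η) * G η)
      ((hfm j).continuousOn_pairing hGm) ?_ ?_ ht
    · have hc : ∀ i, CurveL2 fun t η => ((wt η : ℂ)⁻¹ * bmat ν β k l j i t η) * fm i t η := by
        intro i
        refine (hfm i).mul (a := fun t η => (wt η : ℂ)⁻¹ * bmat ν β k l j i t η) ?_ fun T => ?_
        · have hwc : Continuous wt := by unfold wt; fun_prop
          have hb := continuous_bmat ν β k l j i
          refine Continuous.mul (Continuous.inv₀ (by fun_prop) fun q => ?_) hb
          exact_mod_cast (wt_pos q.2).ne'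
        · obtain ⟨C, hC⟩ := norm_bmat_le ν β k l j i T
          refine ⟨C, fun t h0 h1 η => ?_⟩
          rw [norm_mul, norm_inv, Complex.norm_real, Real.norm_of_nonneg (wt_pos _).le,
            inv_mul_le_iff₀ (wt_pos _), mul_comm]
          exact hC t h0 h1 η
      refine ((((hc 0).add (hc 1)).add (hc 2)).continuousOn_pairing hwG).congr fun t _ => ?_
      refine integral_congr_ae (Eventually.of_forall fun η => ?_)
      have : ((wt η : ℝ) : ℂ) ≠ 0 := by exact_mod_cast (wt_pos η).ne'
      simp only [Fin.sum_univ_three]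
      field_simp
    · intro θ hθ hθc hθs
      have hFs : ContDiff ℝ ∞ (𝓕 (G : ℝ → ℂ)) := by
        rw [← SchwartzMap.fourier_coe]; exact SchwartzMap.smooth _ _
      -- The spatial profile is `𝓕 G`, admissible because its support is compact by `hG`.
      have h := hweak j _ (isTest_wave k l hθ hθc hθs hFs hG)
      rw [← h]
      refine setIntegral_congr_fun measurableSet_Ioi fun t ht => ?_
      have ht' : (0 : ℝ) ≤ t := le_of_lt ht
      have hFm : ∀ G : SchwartzMap ℝ ℂ, MemLp (𝓕 (G : ℝ → ℂ)) 2 volume := fun G => by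
        rw [← SchwartzMap.fourier_coe]; exact SchwartzMap.memLp _ _ _
      have hw := integral_weak_wave (hsol.memLp t ht' j) (memLp_coriolis (β := β)
        (hsol.memLp t ht') j) (hg t ht' j).1 ν k l hθ (hasDerivAt_fourier_schwartz G)
        (fun y => (hasDerivAt_fourier_schwartz (mulX G) y).const_mul _) (hFm G)
        ((hFm _).const_mul _) (((hFm _).const_mul _).const_mul _) t
      refine Eq.trans ?_ hw.symm
      rw [hB j G t ht', integral_ftL_mul (memLp_mmode (hsol.memLp t ht' j) k l t)]
  · filter_upwards [hF.1 j t ht, ftL_mmode (hsol.memLp t ht j) k l t] with η h1 h2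
    rw [h1]; exact h2

/-! ### Analysis of the linear system at a fixed frequency -/

lemma eq_of_hasDerivWithinAt_zero {g : ℝ → ℂ} (h : ∀ t, 0 ≤ t → HasDerivWithinAt g 0 (Ici 0) t)
    {t : ℝ} (ht : 0 ≤ t) : g t = g 0 := by
  refine constant_of_has_deriv_right_zero (a := 0) (b := t) (f := g)
    (fun s hs => ((h s hs.1).continuousWithinAt).mono fun x hx => hx.1)
    (fun s hs => (h s hs.1).mono (Ici_subset_Ici.2 hs.1)) t ⟨ht, le_rfl⟩

/-- A scalar linear equation `g' = Λ' g`. -/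
lemma eq_exp_mul_of_hasDerivWithinAt {g Λ Λ' : ℝ → ℂ}
    (hg : ∀ t, 0 ≤ t → HasDerivWithinAt g (Λ' t * g t) (Ici 0) t)
    (hΛ : ∀ t, 0 ≤ t → HasDerivWithinAt Λ (Λ' t) (Ici 0) t) (h0 : Λ 0 = 0) {t : ℝ} (ht : 0 ≤ t) :
    g t = Complex.exp (Λ t) * g 0 := by
  have h := eq_of_hasDerivWithinAt_zero (g := fun t => Complex.exp (-Λ t) * g t) (fun t ht => by
    refine ((hΛ t ht).neg.cexp.mul (hg t ht)).congr_deriv ?_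
    ring) ht
  simp only [h0, neg_zero, Complex.exp_zero, one_mul] at h
  rw [← h, ← mul_assoc, ← Complex.exp_add]; simp

/-- Contracting `ξⱼξᵢ / |ξ|²` with `ξ` gives `ξᵢ`. This is how the pressure cancels the divergence
produced by the other terms in `dvg_eq`. -/
lemma sum_freq_mul_rz (k l : ℤ) (t η : ℝ) (i : Fin 3) :
    k * rz k l 0 i t η + (η - k * t) * rz k l 1 i t η + l * rz k l 2 i t η
      = freq k (η - k * t) l i := by
  by_cases h : k = 0 ∧ l = 0
  · obtain ⟨rfl, rfl⟩ := h
    fin_cases i <;> simp [rz, freq]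
  · have hq := (qq_pos h t η).ne'
    simp only [rz, if_neg h]
    field_simp
    have e : qq k l t η = k * freq k (η - k * t) l 0 + (η - k * t) * freq k (η - k * t) l 1
        + l * freq k (η - k * t) l 2 := by simp [qq, freq]; ring
    rw [e]

/-- A primitive in time of `k² + (η - kt)² + l²`. -/
def qprim (k l : ℤ) (t η : ℝ) : ℝ :=
  ((k : ℝ) ^ 2 + (l : ℝ) ^ 2 + η ^ 2) * t - k * η * t ^ 2 + (k : ℝ) ^ 2 * t ^ 3 / 3

lemma hasDerivAt_qprim (k l : ℤ) (t η : ℝ) :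
    HasDerivAt (fun t => qprim k l t η) (qq k l t η) t := by
  have h1 := (hasDerivAt_id t).const_mul ((k : ℝ) ^ 2 + (l : ℝ) ^ 2 + η ^ 2)
  have h2 := ((hasDerivAt_id t).pow 2).const_mul (k * η : ℝ)
  have h3 := (((hasDerivAt_id t).pow 3).const_mul ((k : ℝ) ^ 2)).div_const 3
  refine ((h1.sub h2).add h3).congr_deriv ?_
  simp [qq]; ring

lemma qprim_zero (k l : ℤ) (η : ℝ) : qprim k l 0 η = 0 := by simp [qprim]

/-- Completing the square, `∫₀ᵗ q = (k² + l²) t + t (η - kt/2)² + k² t³/12`. The last term is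
independent of `η` and is the source of enhanced dissipation. -/
lemma le_qprim {k : ℤ} (hk : k ≠ 0) (l : ℤ) {t : ℝ} (ht : 0 ≤ t) (η : ℝ) :
    t ^ 3 / 12 ≤ qprim k l t η := by
  have hk1 : (1 : ℝ) ≤ (k : ℝ) ^ 2 := by
    have : (1 : ℤ) ≤ k ^ 2 := by have := sq_nonneg k; have : k ^ 2 ≠ 0 := by positivity
                                 omega
    exact_mod_cast this
  have e : qprim k l t η = ((k : ℝ) ^ 2 + (l : ℝ) ^ 2) * t + t * (η - k * t / 2) ^ 2
      + (k : ℝ) ^ 2 * (t ^ 3 / 12) := by unfold qprim; ring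
  have h3 : 0 ≤ t ^ 3 / 12 := by positivity
  have h4 : 0 ≤ ((k : ℝ) ^ 2 + (l : ℝ) ^ 2) * t := by positivity
  have h5 : 0 ≤ t * (η - k * t / 2) ^ 2 := by positivity
  nlinarith

section System

variable {ν β η : ℝ} {k l : ℤ} {f : Fin 3 → ℝ → ℂ}

/-- `f` solves the linear system for the mode `(k, l)` at the frequency `η`. -/
def Solves (ν β : ℝ) (k l : ℤ) (η : ℝ) (f : Fin 3 → ℝ → ℂ) : Prop :=
  ∀ j t, 0 ≤ t → HasDerivWithinAt (f j) (∑ i, bmat ν β k l j i t η * f i t) (Ici 0) t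

/-- The divergence in the moving frame. -/
def dvg (k l : ℤ) (η : ℝ) (f : Fin 3 → ℝ → ℂ) (t : ℝ) : ℂ :=
  k * f 0 t + (η - k * t : ℝ) * f 1 t + l * f 2 t

/-- The vorticity in the moving frame, without the factor `2πi`. -/
def vrt (k l : ℤ) (f : Fin 3 → ℝ → ℂ) (t : ℝ) : ℂ := l * f 0 t - k * f 2 t

/-- The divergence `D` solves the scalar equation `D' = -4π²ν q D`: the moving frame, the zeroth
order terms and the pressure cancel exactly, and only viscosity remains. -/
lemma dvg_eq (hode : Solves ν β k l η f) {t : ℝ} (ht : 0 ≤ t) (h0 : dvg k l η f 0 = 0) : dvg k l η f t = 0 := by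
  have h := eq_exp_mul_of_hasDerivWithinAt (g := dvg k l η f)
    (Λ := fun t => ((-(4 * Real.pi ^ 2 * ν) * qprim k l t η : ℝ) : ℂ))
    (Λ' := fun t => ((-(4 * Real.pi ^ 2 * ν) * qq k l t η : ℝ) : ℂ)) (fun t ht => ?_)
    (fun t ht => ((hasDerivAt_qprim k l t η).const_mul _).ofReal_comp.hasDerivWithinAt)
    (by simp [qprim_zero]) ht
  · rw [h, h0, mul_zero]
  · have hκ : HasDerivWithinAt (fun t : ℝ => ((η - k * t : ℝ) : ℂ)) (-(k : ℂ)) (Ici 0) t := by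
      have := (((hasDerivAt_id t).const_mul (k : ℝ)).const_sub η).ofReal_comp
      refine (this.congr_deriv ?_).hasDerivWithinAt
      simp
    have h1 := (((hode 0 t ht).const_mul (k : ℂ)).add (hκ.mul (hode 1 t ht))).add
      ((hode 2 t ht).const_mul (l : ℂ))
    refine h1.congr_deriv ?_
    have e0 : (k : ℂ) * rz k l 0 0 t η + ((η - k * t : ℝ) : ℂ) * rz k l 1 0 t η
        + l * rz k l 2 0 t η = k := by
      have := sum_freq_mul_rz k l t η 0
      simp only [freq, Matrix.cons_val_zero] at this
      exact_mod_cast congrArg (fun x : ℝ => (x : ℂ)) this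
    have e1 : (k : ℂ) * rz k l 0 1 t η + ((η - k * t : ℝ) : ℂ) * rz k l 1 1 t η
        + l * rz k l 2 1 t η = ((η - k * t : ℝ) : ℂ) := by
      have := sum_freq_mul_rz k l t η 1
      simp only [freq, Matrix.cons_val_one, Matrix.cons_val_zero] at this
      exact_mod_cast congrArg (fun x : ℝ => (x : ℂ)) this
    simp only [Fin.sum_univ_three, bmat, dvg, Matrix.cons_val, Fin.isValue]
    push_cast at e0 e1 ⊢
    linear_combination -(β - 2 : ℂ) * f 1 t * e0 + β * f 0 t * e1

/-- A gradient has no vorticity, so the pressure drops out and the only forcing is the term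
`(1-β)u²` of the first equation. -/
lemma hasDerivWithinAt_vrt (hode : Solves ν β k l η f) (hkl : ¬ (k = 0 ∧ l = 0)) {t : ℝ} (ht : 0 ≤ t) :
    HasDerivWithinAt (vrt k l f) (-((4 * Real.pi ^ 2 * ν * qq k l t η : ℝ) : ℂ) * vrt k l f t
      + (β - 1) * l * f 1 t) (Ici 0) t := by
  have h1 := ((hode 0 t ht).const_mul (l : ℂ)).sub ((hode 2 t ht).const_mul (k : ℂ))
  refine h1.congr_deriv ?_
  simp only [Fin.sum_univ_three, bmat, vrt, Matrix.cons_val, Fin.isValue, rz, if_neg hkl, freq]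
  push_cast
  ring

/-- Incompressibility gives `(k² + l²) f₀ = l ω - k(η - kt) f₁`, which eliminates the first
component in favour of the vorticity `ω`. -/
lemma hasDerivWithinAt_second (hode : Solves ν β k l η f) (hkl : ¬ (k = 0 ∧ l = 0)) {t : ℝ} (ht : 0 ≤ t)
    (hD : dvg k l η f t = 0) :
    HasDerivWithinAt (f 1) (-((4 * Real.pi ^ 2 * ν * qq k l t η : ℝ) : ℂ) * f 1 t
      - (β * l / qq k l t η : ℝ) * vrt k l f t
      + (2 * (k * (η - k * t)) / qq k l t η : ℝ) * f 1 t) (Ici 0) t := by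
  refine (hode 1 t ht).congr_deriv ?_
  have hq : (qq k l t η : ℂ) ≠ 0 := by exact_mod_cast (qq_pos hkl t η).ne'
  simp only [Fin.sum_univ_three, bmat, vrt, Matrix.cons_val, Fin.isValue, rz, if_neg hkl, freq]
  simp only [dvg] at hD
  have e : (qq k l t η : ℂ) = k ^ 2 + ((η : ℂ) - k * t) ^ 2 + l ^ 2 := by simp [qq]
  push_cast at hD ⊢
  field_simp
  rw [e]
  linear_combination -(β * k : ℂ) * hD

/-- Makes the weight in `energy_bound` differentiable at the time when `k(η - kt)` changes sign. -/
lemma hasDerivAt_max_sq (x : ℝ) : HasDerivAt (fun x : ℝ => max 0 x ^ 2) (2 * max 0 x) x := by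
  rcases lt_trichotomy x 0 with h | h | h
  · rw [max_eq_left h.le, mul_zero]
    refine (hasDerivAt_const x (0 : ℝ)).congr_of_eventuallyEq ?_
    filter_upwards [Iio_mem_nhds h] with y hy
    rw [max_eq_left (le_of_lt hy)]; simp
  · subst h
    have h1 : HasDerivWithinAt (fun x : ℝ => max 0 x ^ 2) 0 (Iic 0) 0 :=
      (hasDerivWithinAt_const 0 _ (0 : ℝ)).congr (fun y hy => by rw [max_eq_left hy]; simp)
        (by simp)
    have h2 : HasDerivWithinAt (fun x : ℝ => max 0 x ^ 2) 0 (Ici 0) 0 := by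
      have h3 := ((hasDerivAt_id (0 : ℝ)).pow 2).hasDerivWithinAt (s := Ici 0)
      refine (h3.congr_deriv (by simp)).congr (fun y hy => ?_) (by simp)
      rw [max_eq_right hy]; simp
    have h3 := h1.union h2
    rw [Iic_union_Ici, hasDerivWithinAt_univ] at h3
    simpa using h3
  · rw [max_eq_right h.le]
    have h3 := (hasDerivAt_id x).pow 2
    refine (h3.congr_deriv (by simp)).congr_of_eventuallyEq ?_
    filter_upwards [Ioi_mem_nhds h] with y hy
    rw [max_eq_right (le_of_lt hy)]; simp

/-- Apart from viscosity, the energy changes only through a multiple of `k(η - kt) |f₁|²`, which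
makes it grow exactly while `q` decreases. A weight equal to `q` during that period absorbs the
growth; afterwards the term has the good sign and the weight stays constant. At its smallest the
weight is `k² + l²`, at time zero it is at most `q(0)`. -/
lemma energy_bound (hode : Solves ν β k l η f) (hβ : 2 ≤ |β|) (hk : k ≠ 0)
    (h0 : dvg k l η f 0 = 0) {t : ℝ} (ht : 0 ≤ t) :
    ((k : ℝ) ^ 2 + (l : ℝ) ^ 2) * ((β - 1) / β * qq k l t η * ‖f 1 t‖ ^ 2 + ‖vrt k l f t‖ ^ 2)
        * Real.exp (2 * (4 * Real.pi ^ 2 * ν) * qprim k l t η) ≤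
      qq k l 0 η * ((β - 1) / β * qq k l 0 η * ‖f 1 0‖ ^ 2 + ‖vrt k l f 0‖ ^ 2) := by
  have hkl : ¬ (k = 0 ∧ l = 0) := fun h => hk h.1
  have hk2 : (0 : ℝ) < (k : ℝ) ^ 2 := by positivity
  have hβ0 : β ≠ 0 := by rintro rfl; norm_num at hβ
  have hc : 0 ≤ (β - 1) / β := by
    rcases le_abs.1 hβ with h | h
    · exact div_nonneg (by linarith) (by linarith)
    · exact div_nonneg_of_nonpos (by linarith) (by linarith)
  -- For `k(η - kt) ≥ 0` the last summand is `(η - kt)²` and `w = q`; for the other sign `w = k² +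
  -- l²`.
  let w : ℝ → ℝ := fun t => (k : ℝ) ^ 2 + (l : ℝ) ^ 2 + max 0 (k * (η - k * t)) ^ 2 / (k : ℝ) ^ 2
  let E : ℝ → ℝ := fun t => (β - 1) / β * qq k l t η * ‖f 1 t‖ ^ 2 + ‖vrt k l f t‖ ^ 2
  let X : ℝ → ℝ := fun t => Real.exp (2 * (4 * Real.pi ^ 2 * ν) * qprim k l t η)
  have hw : ∀ t, HasDerivAt w (-(2 * max 0 (k * (η - k * t)))) t := by
    intro t
    have h1 : HasDerivAt (fun t : ℝ => (k : ℝ) * (η - k * t)) (-(k : ℝ) ^ 2) t := by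
      refine ((((hasDerivAt_id t).const_mul (k : ℝ)).const_sub η).const_mul (k : ℝ)).congr_deriv ?_
      simp; ring
    have h2 := (((hasDerivAt_max_sq (k * (η - k * t))).comp t h1).div_const ((k : ℝ) ^ 2)).const_add
      ((k : ℝ) ^ 2 + (l : ℝ) ^ 2)
    refine h2.congr_deriv ?_
    field_simp
  have hX : ∀ t, HasDerivAt X (X t * (2 * (4 * Real.pi ^ 2 * ν) * qq k l t η)) t := fun t =>
    ((hasDerivAt_qprim k l t η).const_mul _).exp
  have hq : ∀ t, HasDerivAt (fun t => qq k l t η) (-2 * (k * (η - k * t))) t := by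
    intro t
    have h1 : HasDerivAt (fun t : ℝ => η - k * t) (-(k : ℝ)) t := by
      refine (((hasDerivAt_id t).const_mul (k : ℝ)).const_sub η).congr_deriv ?_
      simp
    refine (((h1.pow 2).const_add ((k : ℝ) ^ 2)).add_const ((l : ℝ) ^ 2)).congr_deriv ?_
    simp; ring
  -- The factor `(β-1)/β` is chosen so that the coupling terms `∓ 2(β-1) l Re(f₁ ω̄)` cancel. The
  -- derivative of `q` and the term `2k(η-kt)/q` in the equation of `f₁` add up to the remainder.
  have hE : ∀ t, 0 ≤ t → HasDerivWithinAt E (-(2 * (4 * Real.pi ^ 2 * ν) * qq k l t η) * E t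
      + 2 * ((β - 1) / β) * (k * (η - k * t)) * ‖f 1 t‖ ^ 2) (Ici 0) t := by
    intro t ht
    have h1 := (hasDerivWithinAt_second hode hkl ht (dvg_eq hode ht h0)).norm_sq
    have h2 := (hasDerivWithinAt_vrt hode hkl ht).norm_sq
    have h3 := (((hq t).hasDerivWithinAt (s := Ici 0)).const_mul ((β - 1) / β)).mul h1
    refine (h3.add h2).congr_deriv ?_
    have hq0 := (qq_pos hkl t η).ne'
    simp only [E, ← Complex.normSq_eq_norm_sq, Complex.normSq_apply, Complex.inner]
    generalize f 1 t = z
    generalize vrt k l f t = o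
    simp only [Complex.mul_re, Complex.mul_im, Complex.add_re, Complex.add_im, Complex.sub_re,
      Complex.sub_im, Complex.neg_re, Complex.neg_im, Complex.ofReal_re, Complex.ofReal_im,
      Complex.conj_re, Complex.conj_im, Complex.one_re, Complex.one_im, Complex.intCast_re,
      Complex.intCast_im]
    field_simp
    ring
  have hG : ∀ t, 0 ≤ t → HasDerivWithinAt (fun t => w t * E t * X t) (X t *
      (-(2 * max 0 (k * (η - k * t))) * E t
        + 2 * w t * ((β - 1) / β) * (k * (η - k * t)) * ‖f 1 t‖ ^ 2)) (Ici 0) t := by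
    intro t ht
    refine ((((hw t).hasDerivWithinAt).mul (hE t ht)).mul (hX t).hasDerivWithinAt).congr_deriv ?_
    rw [Pi.mul_apply]; ring
  have hneg : ∀ t, 0 ≤ t → X t * (-(2 * max 0 (k * (η - k * t))) * E t
        + 2 * w t * ((β - 1) / β) * (k * (η - k * t)) * ‖f 1 t‖ ^ 2) ≤ 0 := by
    intro t ht
    refine mul_nonpos_of_nonneg_of_nonpos (Real.exp_pos _).le ?_
    rcases le_total 0 (k * (η - k * t)) with h | h
    · have e : w t = qq k l t η := by
        simp only [w, max_eq_right h, qq]; field_simp; ring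
      rw [e, max_eq_right h]
      -- In this period the `f₁` terms cancel, and `-2k(η - kt)|ω|² ≤ 0` is left.
      simp only [E]
      have : 0 ≤ k * (η - k * t) * ‖vrt k l f t‖ ^ 2 := by positivity
      linarith
    · rw [max_eq_left h]
      have h1 : 0 ≤ 2 * w t * ((β - 1) / β) * ‖f 1 t‖ ^ 2 := by
        have : 0 ≤ w t := by simp only [w]; positivity
        positivity
      have := mul_nonpos_of_nonneg_of_nonpos h1 h
      linarith
  have hanti : AntitoneOn (fun t => w t * E t * X t) (Ici 0) := by
    refine antitoneOn_of_deriv_nonpos (convex_Ici 0) (fun t ht => (hG t ht).continuousWithinAt) ?_ ?_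
    · intro t ht
      rw [interior_Ici] at ht
      exact ((hG t (le_of_lt ht)).hasDerivAt (Ici_mem_nhds ht)).differentiableAt.differentiableWithinAt
    · intro t ht
      rw [interior_Ici] at ht
      rw [((hG t (le_of_lt ht)).hasDerivAt (Ici_mem_nhds ht)).deriv]
      exact hneg t (le_of_lt ht)
  have hE0 : ∀ t, 0 ≤ E t := fun t => by
    have := (qq_pos hkl t η).le
    simp only [E]; positivity
  have h1 := hanti (mem_Ici.2 le_rfl) (mem_Ici.2 ht) ht
  have hX0 : X 0 = 1 := by simp [X, qprim_zero]
  simp only [hX0, mul_one] at h1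
  have h2 : (k : ℝ) ^ 2 + (l : ℝ) ^ 2 ≤ w t := by
    simp only [w]; have : 0 ≤ max 0 (k * (η - k * t)) ^ 2 / (k : ℝ) ^ 2 := by positivity
    linarith
  have h3 : w 0 ≤ qq k l 0 η := by
    have h4 : max 0 ((k : ℝ) * (η - k * 0)) ^ 2 / (k : ℝ) ^ 2 ≤ η ^ 2 := by
      rw [div_le_iff₀ hk2]
      rcases le_total 0 ((k : ℝ) * (η - k * 0)) with h | h
      · rw [max_eq_right h]; nlinarith
      · rw [max_eq_left h]; nlinarith [mul_nonneg (sq_nonneg η) hk2.le]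
    simp only [w, qq]
    simp only [mul_zero, sub_zero] at h4 ⊢
    linarith
  calc _ ≤ w t * E t * X t := by
        gcongr
        exact hE0 t
    _ ≤ w 0 * E 0 := h1
    _ ≤ qq k l 0 η * E 0 := by gcongr; exact hE0 0

set_option maxHeartbeats 800000 in
/-- Bounds for the modes with `k ≠ 0`. -/
lemma mode_bounds (hode : Solves ν β k l η f) (hν : 0 < ν) (hβ : 2 ≤ |β|) (hk : k ≠ 0)
    (h0 : dvg k l η f 0 = 0) {t : ℝ} (ht : 0 ≤ t) :
    ‖f 0 t‖ ^ 2 ≤ 6 * Real.exp (-(1 / 12) * ν * t ^ 3) *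
        (qq k l 0 η ^ 2 * ‖f 1 0‖ ^ 2 + qq k l 0 η * ‖vrt k l f 0‖ ^ 2) ∧
      ‖f 2 t‖ ^ 2 ≤ 6 * Real.exp (-(1 / 12) * ν * t ^ 3) *
        (qq k l 0 η ^ 2 * ‖f 1 0‖ ^ 2 + qq k l 0 η * ‖vrt k l f 0‖ ^ 2) ∧
      (1 + t ^ 2) * ‖f 1 t‖ ^ 2 ≤ 6 * Real.exp (-(1 / 12) * ν * t ^ 3) * (1 + η ^ 2) *
        (qq k l 0 η ^ 2 * ‖f 1 0‖ ^ 2 + qq k l 0 η * ‖vrt k l f 0‖ ^ 2) := by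
  have hE := energy_bound hode hβ hk h0 ht
  have hkl : ¬ (k = 0 ∧ l = 0) := fun h => hk h.1
  have hk1 : (1 : ℝ) ≤ (k : ℝ) ^ 2 := by
    have : (1 : ℤ) ≤ k ^ 2 := by have := sq_nonneg k; have : k ^ 2 ≠ 0 := by positivity
                                 omega
    exact_mod_cast this
  -- The condition `|β| ≥ 2` enters here: the energy is comparable to `q|f₁|² + |ω|²` with constants
  -- that do not depend on `β`.
  have hc1 : 1 / 2 ≤ (β - 1) / β ∧ (β - 1) / β ≤ 3 / 2 := by
    rcases le_abs.1 hβ with h | h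
    · constructor
      · rw [le_div_iff₀ (by linarith)]; linarith
      · rw [div_le_iff₀ (by linarith)]; linarith
    · constructor
      · rw [le_div_iff_of_neg (by linarith)]; linarith
      · rw [div_le_iff_of_neg (by linarith)]; linarith
  have hq := qq_pos hkl t η
  have hq0 := qq_pos hkl 0 η
  generalize (β - 1) / β = c at hE hc1
  set q := qq k l t η with hqdef
  set q0 := qq k l 0 η
  set M : ℝ := (k : ℝ) ^ 2 + (l : ℝ) ^ 2 with hM
  have hM1 : 1 ≤ M := by have := sq_nonneg (l : ℝ); linarith
  set R := q0 ^ 2 * ‖f 1 0‖ ^ 2 + q0 * ‖vrt k l f 0‖ ^ 2 with hR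
  set e := Real.exp (-(1 / 12) * ν * t ^ 3) with he
  -- From `8π² ≥ 1` and `∫₀ᵗ q ≥ t³/12`. The rate `1/12` belongs to squares and becomes `1/24` for
  -- the norms.
  have hexp : 1 ≤ e * Real.exp (2 * (4 * Real.pi ^ 2 * ν) * qprim k l t η) := by
    rw [he, ← Real.exp_add, Real.one_le_exp_iff]
    have h1 := le_qprim hk l ht η
    have h2 : 1 ≤ 2 * (4 * Real.pi ^ 2) := by nlinarith [Real.pi_gt_three]
    have h3 : ν * (t ^ 3 / 12) ≤ ν * qprim k l t η := by gcongr
    have h4 : 0 ≤ ν * (t ^ 3 / 12) := by positivity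
    nlinarith
  have hE2 : M * (1 / 2 * q * ‖f 1 t‖ ^ 2 + ‖vrt k l f t‖ ^ 2) ≤ 3 / 2 * e * R := by
    have hs : 0 ≤ M * (c * q * ‖f 1 t‖ ^ 2 + ‖vrt k l f t‖ ^ 2) := by
      have := hc1.1; have : 0 ≤ c := by linarith
      positivity
    have hA : M * (1 / 2 * q * ‖f 1 t‖ ^ 2 + ‖vrt k l f t‖ ^ 2) ≤
        M * (c * q * ‖f 1 t‖ ^ 2 + ‖vrt k l f t‖ ^ 2) := by
      gcongr; exact hc1.1
    have hB : q0 * (c * q0 * ‖f 1 0‖ ^ 2 + ‖vrt k l f 0‖ ^ 2) ≤ 3 / 2 * R := by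
      have h1 : q0 * (c * q0 * ‖f 1 0‖ ^ 2 + ‖vrt k l f 0‖ ^ 2) ≤
          q0 * (3 / 2 * q0 * ‖f 1 0‖ ^ 2 + ‖vrt k l f 0‖ ^ 2) := by gcongr; exact hc1.2
      have h2 : 0 ≤ q0 * ‖vrt k l f 0‖ ^ 2 := by positivity
      rw [hR]; nlinarith
    calc _ ≤ M * (c * q * ‖f 1 t‖ ^ 2 + ‖vrt k l f t‖ ^ 2) := hA
      _ ≤ M * (c * q * ‖f 1 t‖ ^ 2 + ‖vrt k l f t‖ ^ 2)
          * (e * Real.exp (2 * (4 * Real.pi ^ 2 * ν) * qprim k l t η)) :=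
          le_mul_of_one_le_right hs hexp
      _ = e * (M * (c * q * ‖f 1 t‖ ^ 2 + ‖vrt k l f t‖ ^ 2)
          * Real.exp (2 * (4 * Real.pi ^ 2 * ν) * qprim k l t η)) := by ring
      _ ≤ e * (3 / 2 * R) := by
          have : 0 ≤ e := (Real.exp_pos _).le
          exact mul_le_mul_of_nonneg_left (hE.trans hB) this
      _ = _ := by ring
  have hD := dvg_eq hode ht h0
  have hκ : (η - k * t) ^ 2 ≤ q := by
    rw [hqdef, qq]; linarith [sq_nonneg (k : ℝ), sq_nonneg (l : ℝ)]
  -- Zero divergence recovers the other components from `ω` and `f₁`: `(k²+l²) f₀ = lω - k(η-kt)f₁`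
  -- and `(k²+l²) f₂ = -kω - l(η-kt)f₁`. Since `(η-kt)² ≤ q`, the energy controls both right sides
  -- without loss in `t`.
  have hpar : ∀ (a b : ℝ) (z : ℂ), a ^ 2 ≤ M → b ^ 2 ≤ M →
      (M : ℂ) * z = a * vrt k l f t - b * (η - k * t : ℝ) * f 1 t → ‖z‖ ^ 2 ≤ 6 * e * R := by
    intro a b z ha hb hz
    have h1 : M * ‖z‖ ≤ |a| * ‖vrt k l f t‖ + |b| * |η - k * t| * ‖f 1 t‖ := by
      have := congrArg norm hz
      rw [norm_mul, Complex.norm_real, Real.norm_of_nonneg (by linarith)] at this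
      rw [this]
      refine (norm_sub_le _ _).trans ?_
      simp only [norm_mul, Complex.norm_real, Real.norm_eq_abs]
      exact le_rfl
    have h2 : (M * ‖z‖) ^ 2 ≤ 2 * (M * ‖vrt k l f t‖ ^ 2 + M * (q * ‖f 1 t‖ ^ 2)) := by
      calc (M * ‖z‖) ^ 2 ≤ (|a| * ‖vrt k l f t‖ + |b| * |η - k * t| * ‖f 1 t‖) ^ 2 := by gcongr
        _ ≤ 2 * ((|a| * ‖vrt k l f t‖) ^ 2 + (|b| * |η - k * t| * ‖f 1 t‖) ^ 2) := add_sq_le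
        _ = 2 * (a ^ 2 * ‖vrt k l f t‖ ^ 2 + b ^ 2 * ((η - k * t) ^ 2 * ‖f 1 t‖ ^ 2)) := by
            simp only [mul_pow, sq_abs]; ring
        _ ≤ _ := by gcongr
    have h3 : M ^ 2 * ‖z‖ ^ 2 ≤ 6 * e * R := by
      have : 0 ≤ M * ‖vrt k l f t‖ ^ 2 := by positivity
      nlinarith
    refine le_trans ?_ h3
    exact le_mul_of_one_le_left (by positivity) (one_le_pow₀ hM1)
  refine ⟨hpar l k _ ?_ ?_ ?_, hpar (-k) l _ ?_ ?_ ?_, ?_⟩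
  · rw [hM]; linarith [sq_nonneg (k : ℝ)]
  · rw [hM]; linarith [sq_nonneg (l : ℝ)]
  · simp only [vrt, dvg, hM] at hD ⊢; push_cast at hD ⊢
    linear_combination (k : ℂ) * hD
  · rw [hM, neg_sq]; linarith [sq_nonneg (l : ℝ)]
  · rw [hM]; linarith [sq_nonneg (k : ℝ)]
  · simp only [vrt, dvg, hM] at hD ⊢; push_cast at hD ⊢
    linear_combination (l : ℂ) * hD
  · have h1 : 1 / 2 * (q * ‖f 1 t‖ ^ 2) ≤ 3 / 2 * e * R := by
      have h2 : 0 ≤ 1 / 2 * q * ‖f 1 t‖ ^ 2 + ‖vrt k l f t‖ ^ 2 := by positivity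
      have h3 : 0 ≤ ‖vrt k l f t‖ ^ 2 := by positivity
      linarith [le_mul_of_one_le_left h2 hM1]
    -- As `|k| ≥ 1`, a large `t` forces `η` or `η - kt` to be large; the part due to `η` is paid for
    -- by one derivative of the data.
    have h2 : 1 + t ^ 2 ≤ 2 * q * (1 + η ^ 2) := by
      have h3 : t ^ 2 ≤ 2 * (η - k * t) ^ 2 + 2 * η ^ 2 := by
        nlinarith [sq_nonneg (2 * η - k * t), mul_nonneg (sub_nonneg.2 hk1) (sq_nonneg t)]
      have h4 : 1 + (η - k * t) ^ 2 ≤ q := by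
        rw [hqdef, qq]; linarith [sq_nonneg (l : ℝ)]
      linarith [mul_nonneg (sub_nonneg.2 h4) (by positivity : 0 ≤ 1 + η ^ 2),
        mul_nonneg (sq_nonneg (η - k * t)) (sq_nonneg η)]
    calc (1 + t ^ 2) * ‖f 1 t‖ ^ 2 ≤ (2 * q * (1 + η ^ 2)) * ‖f 1 t‖ ^ 2 := by gcongr
      _ = 4 * (1 + η ^ 2) * (1 / 2 * (q * ‖f 1 t‖ ^ 2)) := by ring
      _ ≤ 4 * (1 + η ^ 2) * (3 / 2 * e * R) := by gcongr
      _ = _ := by ring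

end System

/-! ### Decay of the non-zero frequencies -/

lemma pairNorm_le_add (a b : ℝ≥0∞) : pairNorm a b ≤ a + b := by
  have h : a ^ 2 + b ^ 2 ≤ (a + b) ^ 2 := by
    rw [add_sq, add_right_comm]; exact le_self_add
  calc pairNorm a b ≤ ((a + b) ^ 2) ^ (1 / 2 : ℝ) := ENNReal.rpow_le_rpow h (by norm_num)
    _ = a + b := by
      rw [← ENNReal.rpow_natCast, ← ENNReal.rpow_mul]; norm_num

lemma jap_pos (k : ℤ) (η : ℝ) (l : ℤ) : 0 < jap k η l := by unfold jap; positivity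

lemma jap_sq (k : ℤ) (η : ℝ) (l : ℤ) :
    jap k η l ^ 2 = 1 + (k : ℝ) ^ 2 + η ^ 2 + (l : ℝ) ^ 2 := by
  unfold jap; rw [Real.sq_sqrt (by positivity)]

lemma ofReal_mul_enorm_sq {a : ℝ} (ha : 0 ≤ a) (z : ℂ) :
    (ENNReal.ofReal a * ‖z‖ₑ) ^ 2 = ENNReal.ofReal ((a * ‖z‖) ^ 2) := by
  rw [← ofReal_norm, ← ENNReal.ofReal_mul ha, ENNReal.ofReal_pow (by positivity)]

/-- `h` may fail to be square integrable. Its norm is then `⊤`, and `c > 0` makes the right side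
infinite. -/
lemma hsNorm_le_of_modes {s s₁ s₂ c : ℝ} (hc : 0 < c) {f g h : Dom → ℂ}
    (hf : MemLp f 2 (volume : Measure Dom)) (hg : MemLp g 2 (volume : Measure Dom))
    (H : ∀ k l : ℤ, ∀ᵐ η : ℝ, (jap k η l ^ s * ‖fhat f k η l‖) ^ 2 ≤
      c ^ 2 * ((jap k η l ^ s₁ * ‖fhat g k η l‖) ^ 2 + (jap k η l ^ s₂ * ‖fhat h k η l‖) ^ 2)) :
    hsNorm s f ≤ ENNReal.ofReal c * (hsNorm s₁ g + hsNorm s₂ h) := by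
  by_cases hh : MemLp h 2 (volume : Measure Dom)
  swap
  · have : hsNorm s₂ h = ⊤ := by rw [hsNorm, if_neg hh]
    rw [this, add_top, ENNReal.mul_top (by simpa using hc)]
    exact le_top
  rw [hsNorm, if_pos hf, hsNorm, if_pos hg, hsNorm, if_pos hh]
  set A := ∑' k : ℤ, ∑' l : ℤ, ∫⁻ η : ℝ, (ENNReal.ofReal (jap k η l ^ s₁) * ‖fhat g k η l‖ₑ) ^ 2
  set B := ∑' k : ℤ, ∑' l : ℤ, ∫⁻ η : ℝ, (ENNReal.ofReal (jap k η l ^ s₂) * ‖fhat h k η l‖ₑ) ^ 2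
  have hjm : ∀ (k l : ℤ) (s : ℝ), Measurable fun η => ENNReal.ofReal (jap k η l ^ s) := by
    intro k l s; unfold jap; fun_prop
  have key : (∑' k : ℤ, ∑' l : ℤ, ∫⁻ η : ℝ, (ENNReal.ofReal (jap k η l ^ s) * ‖fhat f k η l‖ₑ) ^ 2)
      ≤ ENNReal.ofReal (c ^ 2) * (A + B) := by
    rw [← ENNReal.tsum_add, ← ENNReal.tsum_mul_left]
    refine ENNReal.tsum_le_tsum fun k => ?_
    rw [← ENNReal.tsum_add, ← ENNReal.tsum_mul_left]
    refine ENNReal.tsum_le_tsum fun l => ?_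
    rw [← lintegral_add_left', ← lintegral_const_mul' _ _ ENNReal.ofReal_ne_top]
    · refine lintegral_mono_ae ?_
      filter_upwards [H k l] with η hη
      have hp := fun s => Real.rpow_nonneg (jap_pos k η l).le s
      rw [ofReal_mul_enorm_sq (hp _), ofReal_mul_enorm_sq (hp _), ofReal_mul_enorm_sq (hp _),
        ← ENNReal.ofReal_add (by positivity) (by positivity), ← ENNReal.ofReal_mul (by positivity)]
      exact ENNReal.ofReal_le_ofReal hη
    · have : AEMeasurable (fun η => ‖fhat g k η l‖ₑ) volume := (memLp_ftL (mode g k l)).1.enorm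
      exact ((hjm k l s₁).aemeasurable.mul this).pow_const 2
  calc _ ≤ (ENNReal.ofReal (c ^ 2) * (A + B)) ^ (1 / 2 : ℝ) :=
        ENNReal.rpow_le_rpow key (by norm_num)
    _ = ENNReal.ofReal c * (A + B) ^ (1 / 2 : ℝ) := by
        rw [ENNReal.mul_rpow_of_nonneg _ _ (by norm_num), ENNReal.ofReal_pow hc.le,
          ← ENNReal.rpow_natCast, ← ENNReal.rpow_mul]
        norm_num
    _ ≤ _ := by
        gcongr
        exact ENNReal.rpow_add_le_add_rpow _ _ (by norm_num) (by norm_num)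

variable {ν β : ℝ} {uin : Fin 3 → Dom → ℂ} {u : ℝ → Fin 3 → Dom → ℂ}

/-- The modes of a solution, with their initial values. -/
theorem Setting.ae_exists_solves (S : Setting ν β uin u) (k l : ℤ) {t : ℝ} (ht : 0 ≤ t) :
    ∀ᵐ η, ∃ f : Fin 3 → ℝ → ℂ, Solves ν β k l η f ∧ dvg k l η f 0 = 0 ∧
      (∀ j, f j 0 = fhat (uin j) k η l) ∧ ∀ j, f j t = fhat (u t j) k (η - k * t) l := by
  obtain ⟨F, hF, hode⟩ := S.exists_modes k l
  filter_upwards [hode, ae_all_iff.2 fun j => hF j t ht, ae_all_iff.2 fun j => hF j 0 le_rfl,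
    fhat_divFree S.smooth S.memLp S.divFree k l] with η h1 h2 h3 h4
  have h5 : ∀ j, F j 0 η = fhat (uin j) k η l := fun j => by
    rw [h3 j, fhat_congr_ae (S.solution.initial j)]; simp
  refine ⟨fun j t => F j t η, h1, ?_, h5, h2⟩
  simp only [dvg, h5, mul_zero, sub_zero]
  exact h4

lemma rpow_add_two_sq {a : ℝ} (ha : 0 < a) (s : ℝ) : (a ^ (s + 2)) ^ 2 = (a ^ s) ^ 2 * (a ^ 2) ^ 2 := by
  rw [Real.rpow_add ha]; norm_cast; ring

lemma rpow_add_one_sq {a : ℝ} (ha : 0 < a) (s : ℝ) : (a ^ (s + 1)) ^ 2 = (a ^ s) ^ 2 * a ^ 2 := by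
  rw [Real.rpow_add ha, Real.rpow_one]; ring

/-- At time zero `q ≤ ⟨k,η,l⟩²`, so the energy costs two derivatives of `u²` and one of the
vorticity; the damping factor costs one more through `1 + η² ≤ ⟨k,η,l⟩²`. The constant is `3`
because `6 ≤ 3²`. -/
theorem Setting.hsNorm_nonzero_le (S : Setting ν β uin u) {s : ℝ} {t : ℝ}
    (ht : 0 ≤ t) :
    (∀ j, j ≠ 1 → hsNorm s (nonzeroX (moving t (u t j))) ≤
      ENNReal.ofReal (3 * Real.exp (-(1 / 24) * ν * t ^ 3))
        * (hsNorm (s + 2) (uin 1) + hsNorm (s + 1) (vort uin))) ∧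
    hsNorm s (nonzeroX (moving t (u t 1))) ≤
      ENNReal.ofReal (3 * (√(1 + t ^ 2))⁻¹ * Real.exp (-(1 / 24) * ν * t ^ 3))
        * (hsNorm (s + 3) (uin 1) + hsNorm (s + 2) (vort uin)) := by
  have hm := S.solution.memLp t ht
  have hexp : Real.exp (-(1 / 24) * ν * t ^ 3) ^ 2 = Real.exp (-(1 / 12) * ν * t ^ 3) := by
    rw [← Real.exp_nat_mul]; congr 1; push_cast; ring
  have hmain : ∀ k l : ℤ, k ≠ 0 → ∀ᵐ η : ℝ,
      (∀ j, j ≠ 1 → ‖fhat (nonzeroX (moving t (u t j))) k η l‖ ^ 2 ≤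
        6 * Real.exp (-(1 / 12) * ν * t ^ 3) * ((jap k η l ^ 2) ^ 2 * ‖fhat (uin 1) k η l‖ ^ 2
          + jap k η l ^ 2 * ‖fhat (vort uin) k η l‖ ^ 2)) ∧
      (1 + t ^ 2) * ‖fhat (nonzeroX (moving t (u t 1))) k η l‖ ^ 2 ≤
        6 * Real.exp (-(1 / 12) * ν * t ^ 3) * jap k η l ^ 2 *
          ((jap k η l ^ 2) ^ 2 * ‖fhat (uin 1) k η l‖ ^ 2
          + jap k η l ^ 2 * ‖fhat (vort uin) k η l‖ ^ 2) := by
    intro k l hk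
    filter_upwards [S.ae_exists_solves k l ht, fhat_vort S.smooth S.memLp k l,
      ae_all_iff.2 fun j => fhat_nonzeroX_moving (hm j) t hk l] with η ⟨f, h1, h2, h3, h4⟩ hv h5
    obtain ⟨b0, b2, b1⟩ := mode_bounds h1 S.visc S.rot hk h2 ht
    have hj := jap_sq k η l
    have hq : qq k l 0 η ≤ jap k η l ^ 2 := by rw [hj, qq]; simp
    have hq0 : 0 ≤ qq k l 0 η := by unfold qq; positivity
    have hηj : 1 + η ^ 2 ≤ jap k η l ^ 2 := by
      rw [hj]; linarith [sq_nonneg (k : ℝ), sq_nonneg (l : ℝ)]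
    -- `vrt` omits the factor `2πi` of the vorticity, whose modulus exceeds one.
    have hvn : ‖vrt k l f 0‖ ≤ ‖fhat (vort uin) k η l‖ := by
      rw [hv, vrt, h3, h3, norm_mul]
      refine le_mul_of_one_le_left (norm_nonneg _) ?_
      simp [abs_of_pos Real.pi_pos]
      linarith [Real.pi_gt_three]
    have hR : qq k l 0 η ^ 2 * ‖f 1 0‖ ^ 2 + qq k l 0 η * ‖vrt k l f 0‖ ^ 2 ≤
        (jap k η l ^ 2) ^ 2 * ‖fhat (uin 1) k η l‖ ^ 2
          + jap k η l ^ 2 * ‖fhat (vort uin) k η l‖ ^ 2 := by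
      rw [h3]; gcongr
    refine ⟨fun j hj1 => ?_, ?_⟩
    · rw [h5, ← h4]
      fin_cases j
      · exact b0.trans (by gcongr)
      · exact absurd rfl hj1
      · exact b2.trans (by gcongr)
    · rw [h5, ← h4]
      exact b1.trans (by gcongr)
  refine ⟨fun j hj => ?_, ?_⟩
  · refine hsNorm_le_of_modes (by positivity) (memLp_nonzeroX (memLp_moving (hm j) t)) (S.memLp 1)
      fun k l => ?_
    by_cases hk : k = 0
    · subst hk
      filter_upwards [fhat_nonzeroX_moving_zero (hm j) t l] with η h
      rw [h]; simp; positivity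
    · filter_upwards [hmain k l hk] with η h
      have hp := jap_pos k η l
      simp only [mul_pow, rpow_add_two_sq hp, rpow_add_one_sq hp, hexp]
      calc _ ≤ (jap k η l ^ s) ^ 2 * (6 * Real.exp (-(1 / 12) * ν * t ^ 3) *
            ((jap k η l ^ 2) ^ 2 * ‖fhat (uin 1) k η l‖ ^ 2
            + jap k η l ^ 2 * ‖fhat (vort uin) k η l‖ ^ 2)) := by gcongr; exact h.1 j hj
        _ = 6 * ((jap k η l ^ s) ^ 2 * Real.exp (-(1 / 12) * ν * t ^ 3) *
            ((jap k η l ^ 2) ^ 2 * ‖fhat (uin 1) k η l‖ ^ 2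
            + jap k η l ^ 2 * ‖fhat (vort uin) k η l‖ ^ 2)) := by ring
        _ ≤ 9 * ((jap k η l ^ s) ^ 2 * Real.exp (-(1 / 12) * ν * t ^ 3) *
            ((jap k η l ^ 2) ^ 2 * ‖fhat (uin 1) k η l‖ ^ 2
            + jap k η l ^ 2 * ‖fhat (vort uin) k η l‖ ^ 2)) := by gcongr; norm_num
        _ = _ := by ring
  · refine hsNorm_le_of_modes (by positivity) (memLp_nonzeroX (memLp_moving (hm 1) t)) (S.memLp 1)
      fun k l => ?_
    by_cases hk : k = 0
    · subst hk
      filter_upwards [fhat_nonzeroX_moving_zero (hm 1) t l] with η h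
      rw [h]; simp; positivity
    · filter_upwards [hmain k l hk] with η h
      have hp := jap_pos k η l
      have e3 : s + 3 = (s + 1) + 2 := by ring
      simp only [e3, mul_pow, rpow_add_two_sq hp, rpow_add_one_sq hp, hexp, inv_pow,
        Real.sq_sqrt (by positivity : (0 : ℝ) ≤ 1 + t ^ 2)]
      have ht1 : 0 < 1 + t ^ 2 := by positivity
      have h2 := h.2
      rw [mul_comm (1 + t ^ 2), ← le_div_iff₀ ht1] at h2
      calc _ ≤ (jap k η l ^ s) ^ 2 * (6 * Real.exp (-(1 / 12) * ν * t ^ 3) * jap k η l ^ 2 *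
            ((jap k η l ^ 2) ^ 2 * ‖fhat (uin 1) k η l‖ ^ 2
            + jap k η l ^ 2 * ‖fhat (vort uin) k η l‖ ^ 2) / (1 + t ^ 2)) := by gcongr
        _ = 6 * ((jap k η l ^ s) ^ 2 * jap k η l ^ 2 * Real.exp (-(1 / 12) * ν * t ^ 3) *
            (1 + t ^ 2)⁻¹ * ((jap k η l ^ 2) ^ 2 * ‖fhat (uin 1) k η l‖ ^ 2
            + jap k η l ^ 2 * ‖fhat (vort uin) k η l‖ ^ 2)) := by ring
        _ ≤ 9 * ((jap k η l ^ s) ^ 2 * jap k η l ^ 2 * Real.exp (-(1 / 12) * ν * t ^ 3) *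
            (1 + t ^ 2)⁻¹ * ((jap k η l ^ 2) ^ 2 * ‖fhat (uin 1) k η l‖ ^ 2
            + jap k η l ^ 2 * ‖fhat (vort uin) k η l‖ ^ 2)) := by gcongr; norm_num
        _ = _ := by ring

theorem Setting.nonzero_frequencies (S : Setting ν β uin u) (s : ℝ) {t : ℝ} (ht : 0 ≤ t) :
    pairNorm (hsNorm s (nonzeroX (moving t (u t 0)))) (hsNorm s (nonzeroX (moving t (u t 2))))
      ≤ ENNReal.ofReal (6 * Real.exp (-(1 / 24) * ν * t ^ 3))
        * (hsNorm (s + 2) (uin 1) + hsNorm (s + 1) (vort uin)) ∧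
    hsNorm s (nonzeroX (moving t (u t 1)))
      ≤ ENNReal.ofReal (6 * (√(1 + t ^ 2))⁻¹ * Real.exp (-(1 / 24) * ν * t ^ 3))
        * (hsNorm (s + 3) (uin 1) + hsNorm (s + 2) (vort uin)) := by
  obtain ⟨h1, h2⟩ := S.hsNorm_nonzero_le (s := s) ht
  refine ⟨(pairNorm_le_add _ _).trans ((add_le_add (h1 0 (by decide)) (h1 2 (by decide))).trans
    (le_of_eq ?_)), h2.trans ?_⟩
  · rw [← add_mul, ← ENNReal.ofReal_add (by positivity) (by positivity)]
    congr 2; ring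
  · gcongr; norm_num

/-! ### The zero frequency in `x` -/

lemma beta_mul_pos {β : ℝ} (hβ : 2 ≤ |β|) : 0 < β * (β - 1) := by
  rcases le_abs.1 hβ with h | h <;> nlinarith

lemma beta_sub_one_ne {β : ℝ} (hβ : 2 ≤ |β|) : β - 1 ≠ 0 := fun h => by
  have := beta_mul_pos hβ; rw [h, mul_zero] at this; exact lt_irrefl _ this

/-- The angular frequency `√(β(β-1)) |l| / |(η, l)|`. -/
def angFreq (β η : ℝ) (l : ℤ) : ℝ := √(β * (β - 1)) * (symDz l * (symGrad η l)⁻¹)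

lemma symDz_mul_inv (η : ℝ) (l : ℤ) : symDz l * (symGrad η l)⁻¹ = |(l : ℝ)| / √(η ^ 2 + (l : ℝ) ^ 2) := by
  unfold symDz symGrad
  have := Real.pi_pos
  rw [mul_inv]; field_simp

lemma angFreq_sq {β η : ℝ} {l : ℤ} (hβ : 2 ≤ |β|) :
    angFreq β η l ^ 2 = (β - 1) * (β * (l : ℝ) ^ 2 / (η ^ 2 + (l : ℝ) ^ 2)) := by
  rw [angFreq, symDz_mul_inv, mul_pow, div_pow, Real.sq_sqrt (beta_mul_pos hβ).le,
    Real.sq_sqrt (by positivity), sq_abs]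
  ring

lemma angFreq_pos {β η : ℝ} {l : ℤ} (hβ : 2 ≤ |β|) (hl : l ≠ 0) : 0 < angFreq β η l := by
  have h1 := beta_mul_pos hβ
  have h2 : (0 : ℝ) < (l : ℝ) ^ 2 := by positivity
  rw [angFreq, symDz_mul_inv]
  have : 0 < |(l : ℝ)| := by positivity
  positivity

lemma symLplus_eq (ν β η : ℝ) (l : ℤ) : symLplus ν β η l =
    ((-(4 * Real.pi ^ 2 * ν) * (η ^ 2 + (l : ℝ) ^ 2) : ℝ) : ℂ) + Complex.I * (angFreq β η l : ℂ) := by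
  rw [symLplus, angFreq, symLap]; congr 2; ring

lemma symLminus_eq (ν β η : ℝ) (l : ℤ) : symLminus ν β η l =
    ((-(4 * Real.pi ^ 2 * ν) * (η ^ 2 + (l : ℝ) ^ 2) : ℝ) : ℂ) - Complex.I * (angFreq β η l : ℂ) := by
  rw [symLminus, angFreq, symLap]; congr 2; ring

lemma eq_exp_mul_of_const {g : ℝ → ℂ} {c : ℂ}
    (hg : ∀ t, 0 ≤ t → HasDerivWithinAt g (c * g t) (Ici 0) t) {t : ℝ} (ht : 0 ≤ t) :
    g t = Complex.exp (c * t) * g 0 :=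
  eq_exp_mul_of_hasDerivWithinAt (Λ := fun t => c * (t : ℂ)) (Λ' := fun _ => c) hg
    (fun t _ => by
      have := ((Complex.ofRealCLM.hasDerivAt (x := t)).const_mul c).hasDerivWithinAt (s := Ici 0)
      simpa using this) (by simp) ht

section Explicit

variable {ν β η : ℝ} {l : ℤ} {f : Fin 3 → ℝ → ℂ}

/-- The solution of the system for `k = 0`, `l ≠ 0`. -/
lemma solves_zero (hode : Solves ν β 0 l η f) (hβ : 2 ≤ |β|) (hl : l ≠ 0) {t : ℝ} (ht : 0 ≤ t) :
    f 0 t = (1 / 2) * (expPlus ν β t η l + expMinus ν β t η l) * f 0 0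
      + Complex.I / 2 * (((β - 1) / √(β * (β - 1)) : ℝ) : ℂ)
          * ((symGrad η l * (symDz l)⁻¹ : ℝ) : ℂ) * (expMinus ν β t η l - expPlus ν β t η l) * f 1 0 ∧
    f 1 t = (1 / 2) * (expPlus ν β t η l + expMinus ν β t η l) * f 1 0
      + Complex.I / 2 * ((√(β * (β - 1)) / (β - 1) : ℝ) : ℂ)
          * (((symGrad η l)⁻¹ * symDz l : ℝ) : ℂ) * (expPlus ν β t η l - expMinus ν β t η l)
            * f 0 0 := by
  have hΩ := angFreq_pos (η := η) hβ hl
  have hΩ2 := angFreq_sq (η := η) (l := l) hβ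
  have ha := beta_sub_one_ne hβ
  have hs : 0 < √(β * (β - 1)) := Real.sqrt_pos.2 (beta_mul_pos hβ)
  have hm : 0 < symDz l * (symGrad η l)⁻¹ := by
    have := hΩ; rw [angFreq] at this; exact (pos_iff_pos_of_mul_pos this).1 hs
  have e1 : (β - 1) / √(β * (β - 1)) * (symGrad η l * (symDz l)⁻¹) = (β - 1) / angFreq β η l := by
    rw [angFreq, div_mul_eq_div_div, div_eq_mul_inv _ (symDz l * _), mul_inv, inv_inv]; ring
  have e2 : √(β * (β - 1)) / (β - 1) * ((symGrad η l)⁻¹ * symDz l) = angFreq β η l / (β - 1) := by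
    rw [angFreq]; ring
  generalize hΩg : angFreq β η l = Ω at *
  have hq0 : qq 0 l 0 η ≠ 0 := (qq_pos (fun h => hl h.2) 0 η).ne'
  have hlq : η ^ 2 + (l : ℝ) ^ 2 ≠ 0 := by
    have : (0 : ℝ) < (l : ℝ) ^ 2 := by positivity
    positivity
  have hkl : ¬ ((0 : ℤ) = 0 ∧ l = 0) := fun h => hl h.2
  have hr : ∀ (i j : Fin 3) (t : ℝ), rz 0 l i j t η =
      freq 0 η l i * freq 0 η l j / (η ^ 2 + (l : ℝ) ^ 2) := fun i j t => by
    rw [rz, if_neg hkl]; simp [qq]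
  set N : ℝ := -(4 * Real.pi ^ 2 * ν) * (η ^ 2 + (l : ℝ) ^ 2) with hN
  have d0 : ∀ t, 0 ≤ t → HasDerivWithinAt (f 0) ((N : ℂ) * f 0 t + ((β - 1 : ℝ) : ℂ) * f 1 t)
      (Ici 0) t := fun t ht => by
    refine (hode 0 t ht).congr_deriv ?_
    simp only [Fin.sum_univ_three, bmat, Matrix.cons_val, Fin.isValue, hr, freq, qq, hN]
    push_cast; ring
  have d1 : ∀ t, 0 ≤ t → HasDerivWithinAt (f 1) ((N : ℂ) * f 1 t
      - ((β * (l : ℝ) ^ 2 / (η ^ 2 + (l : ℝ) ^ 2) : ℝ) : ℂ) * f 0 t) (Ici 0) t := fun t ht => by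
    refine (hode 1 t ht).congr_deriv ?_
    have : ((η : ℂ) ^ 2 + (l : ℂ) ^ 2) ≠ 0 := by exact_mod_cast hlq
    simp only [Fin.sum_univ_three, bmat, Matrix.cons_val, Fin.isValue, hr, freq, qq, hN]
    push_cast
    simp only [zero_mul, sub_zero, ne_eq, OfNat.ofNat_ne_zero, not_false_eq_true, zero_pow, zero_add]
    field_simp
    ring
  have hΩc : (Ω : ℂ) ^ 2 = ((β - 1 : ℝ) : ℂ)
      * ((β * (l : ℝ) ^ 2 / (η ^ 2 + (l : ℝ) ^ 2) : ℝ) : ℂ) := by exact_mod_cast hΩ2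
  have hI := Complex.I_sq
  generalize ((β * (l : ℝ) ^ 2 / (η ^ 2 + (l : ℝ) ^ 2) : ℝ) : ℂ) = b at *
  -- Because `Ω² = (β-1) b`, the combinations `Ω f₀ ± i(β-1) f₁` diagonalize the system: the one
  -- with plus sign evolves by `𝓛₋`, the other by `𝓛₊`.
  have p1 := eq_exp_mul_of_const (g := fun t => Ω * f 0 t + Complex.I * ((β - 1 : ℝ) : ℂ) * f 1 t)
    (c := symLminus ν β η l) (fun t ht => by
      refine (((d0 t ht).const_mul (Ω : ℂ)).add
        ((d1 t ht).const_mul (Complex.I * ((β - 1 : ℝ) : ℂ)))).congr_deriv ?_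
      rw [symLminus_eq, hΩg]
      linear_combination (Complex.I * f 0 t) * hΩc + Ω * ((β - 1 : ℝ) : ℂ) * f 1 t * hI) ht
  have p2 := eq_exp_mul_of_const (g := fun t => Ω * f 0 t - Complex.I * ((β - 1 : ℝ) : ℂ) * f 1 t)
    (c := symLplus ν β η l) (fun t ht => by
      refine (((d0 t ht).const_mul (Ω : ℂ)).sub
        ((d1 t ht).const_mul (Complex.I * ((β - 1 : ℝ) : ℂ)))).congr_deriv ?_
      rw [symLplus_eq, hΩg]
      linear_combination (-Complex.I * f 0 t) * hΩc + Ω * ((β - 1 : ℝ) : ℂ) * f 1 t * hI) ht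
  have hΩ0 : (Ω : ℂ) ≠ 0 := by exact_mod_cast hΩ.ne'
  have ha0 : ((β - 1 : ℝ) : ℂ) ≠ 0 := by exact_mod_cast ha
  have e1c : (((β - 1) / √(β * (β - 1)) : ℝ) : ℂ) * ((symGrad η l * (symDz l)⁻¹ : ℝ) : ℂ)
      = ((β - 1 : ℝ) : ℂ) / Ω := by
    rw [← Complex.ofReal_mul, e1, Complex.ofReal_div]
  have e2c : ((√(β * (β - 1)) / (β - 1) : ℝ) : ℂ) * (((symGrad η l)⁻¹ * symDz l : ℝ) : ℂ)
      = Ω / ((β - 1 : ℝ) : ℂ) := by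
    rw [← Complex.ofReal_mul, e2, Complex.ofReal_div]
  rw [mul_assoc (Complex.I / 2) (((β - 1) / √(β * (β - 1)) : ℝ) : ℂ),
    mul_assoc (Complex.I / 2) ((√(β * (β - 1)) / (β - 1) : ℝ) : ℂ), e1c, e2c]
  simp only [expPlus, expMinus]
  generalize ((β - 1 : ℝ) : ℂ) = a at *
  generalize Complex.exp (symLminus ν β η l * t) = X at *
  generalize Complex.exp (symLplus ν β η l * t) = Y at *
  constructor
  · field_simp
    linear_combination p1 + p2
  · field_simp
    linear_combination -Complex.I * p1 + Complex.I * p2 + 2 * a * (f 1 t) * hI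
      - (X + Y) * a * f 1 0 * hI

/-- The solution of the system for `k = l = 0`. -/
lemma solves_zero_zero (hode : Solves ν β 0 0 η f) (hη : η ≠ 0) (h0 : dvg 0 0 η f 0 = 0) {t : ℝ}
    (ht : 0 ≤ t) : f 0 t = expHeat ν t η 0 * f 0 0 ∧ f 1 t = 0 ∧ f 2 t = expHeat ν t η 0 * f 2 0 := by
  -- With `k = l = 0` incompressibility reads `η f₁ = 0`.
  have h1 : ∀ t, 0 ≤ t → f 1 t = 0 := fun t ht => by
    have := dvg_eq hode ht h0
    simpa [dvg, hη] using this
  have he : ∀ t, expHeat ν t η 0 = Complex.exp (((-(4 * Real.pi ^ 2 * ν) * η ^ 2 : ℝ) : ℂ) * t) := by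
    intro t; rw [expHeat]; congr 1; push_cast; ring
  refine ⟨?_, h1 t ht, ?_⟩
  · rw [he]
    refine eq_exp_mul_of_const (fun t ht => (hode 0 t ht).congr_deriv ?_) ht
    simp [Fin.sum_univ_three, bmat, rz, qq, h1 t ht]
  · rw [he]
    refine eq_exp_mul_of_const (fun t ht => (hode 2 t ht).congr_deriv ?_) ht
    simp [Fin.sum_univ_three, bmat, rz, qq, h1 t ht]

end Explicit

variable {ν β : ℝ} {uin : Fin 3 → Dom → ℂ} {u : ℝ → Fin 3 → Dom → ℂ}

/-- Symbol of `(e^{𝓛₊ t} + e^{𝓛₋ t}) / 2`. -/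
def symC (ν β t η : ℝ) (l : ℤ) : ℂ := (1 / 2) * (expPlus ν β t η l + expMinus ν β t η l)

/-- Symbol of the map from `u²_in` to `u¹(t)`. -/
def symA (ν β t η : ℝ) (l : ℤ) : ℂ := Complex.I / 2 * (((β - 1) / √(β * (β - 1)) : ℝ) : ℂ)
  * ((symGrad η l * (symDz l)⁻¹ : ℝ) : ℂ) * (expMinus ν β t η l - expPlus ν β t η l)

/-- Symbol of the map from `u¹_in` to `u²(t)`. -/
def symB (ν β t η : ℝ) (l : ℤ) : ℂ := Complex.I / 2 * ((√(β * (β - 1)) / (β - 1) : ℝ) : ℂ)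
  * (((symGrad η l)⁻¹ * symDz l : ℝ) : ℂ) * (expPlus ν β t η l - expMinus ν β t η l)

lemma Setting.fhat_zero_mode (S : Setting ν β uin u) {l : ℤ} (hl : l ≠ 0) {t : ℝ} (ht : 0 ≤ t) :
    ∀ᵐ η, fhat (u t 0) 0 η l = symC ν β t η l * fhat (uin 0) 0 η l
        + symA ν β t η l * fhat (uin 1) 0 η l ∧
      fhat (u t 1) 0 η l = symC ν β t η l * fhat (uin 1) 0 η l
        + symB ν β t η l * fhat (uin 0) 0 η l ∧
      η * fhat (u t 1) 0 η l + l * fhat (u t 2) 0 η l = 0 := by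
  filter_upwards [S.ae_exists_solves 0 l ht] with η ⟨f, h1, h2, h3, h4⟩
  have h5 : ∀ j, f j t = fhat (u t j) 0 η l := fun j => by rw [h4]; simp
  obtain ⟨e0, e1⟩ := solves_zero h1 S.rot hl ht
  have e2 := dvg_eq h1 ht h2
  simp only [h3, h5] at e0 e1
  refine ⟨e0, e1, ?_⟩
  simpa [dvg, h5] using e2

lemma Setting.fhat_zero_zero_mode (S : Setting ν β uin u) {t : ℝ} (ht : 0 ≤ t) :
    ∀ᵐ η, fhat (u t 0) 0 η 0 = expHeat ν t η 0 * fhat (uin 0) 0 η 0 ∧ fhat (u t 1) 0 η 0 = 0 ∧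
      fhat (u t 2) 0 η 0 = expHeat ν t η 0 * fhat (uin 2) 0 η 0 := by
  have h0 : ∀ᵐ η : ℝ, η ≠ 0 := by simp [ae_iff]
  filter_upwards [S.ae_exists_solves 0 0 ht, h0] with η ⟨f, h1, h2, h3, h4⟩ hη
  have h5 : ∀ j, f j t = fhat (u t j) 0 η 0 := fun j => by rw [h4]; simp
  have := solves_zero_zero h1 hη h2 ht
  simpa only [h3, h5] using this

lemma norm_expPlus (ν β t η : ℝ) (l : ℤ) :
    ‖expPlus ν β t η l‖ = Real.exp (-(4 * Real.pi ^ 2 * ν) * (η ^ 2 + (l : ℝ) ^ 2) * t) := by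
  rw [expPlus, Complex.norm_exp, symLplus_eq]
  generalize -(4 * Real.pi ^ 2 * ν) * (η ^ 2 + (l : ℝ) ^ 2) = r
  simp

lemma norm_expMinus (ν β t η : ℝ) (l : ℤ) :
    ‖expMinus ν β t η l‖ = Real.exp (-(4 * Real.pi ^ 2 * ν) * (η ^ 2 + (l : ℝ) ^ 2) * t) := by
  rw [expMinus, Complex.norm_exp, symLminus_eq]
  generalize -(4 * Real.pi ^ 2 * ν) * (η ^ 2 + (l : ℝ) ^ 2) = r
  simp

lemma exp_decay_le_one {ν t : ℝ} (hν : 0 < ν) (ht : 0 ≤ t) (η : ℝ) (l : ℤ) :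
    Real.exp (-(4 * Real.pi ^ 2 * ν) * (η ^ 2 + (l : ℝ) ^ 2) * t) ≤ 1 := by
  rw [Real.exp_le_one_iff]
  have : 0 ≤ (4 * Real.pi ^ 2 * ν) * (η ^ 2 + (l : ℝ) ^ 2) * t := by positivity
  linarith

lemma norm_symC_le (hν : 0 < ν) {t : ℝ} (ht : 0 ≤ t) (η : ℝ) (l : ℤ) : ‖symC ν β t η l‖ ≤ 1 := by
  have h := norm_add_le (expPlus ν β t η l) (expMinus ν β t η l)
  rw [norm_expPlus, norm_expMinus] at h
  rw [symC, norm_mul]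
  have h2 := exp_decay_le_one hν ht η l
  norm_num
  linarith

/-- The second bound, proportional to the angular frequency, compensates the unbounded factor
`|∇||∂_z|⁻¹` in `symA`. -/
lemma norm_sub_exp_le (hν : 0 < ν) {t : ℝ} (ht : 0 ≤ t) (η : ℝ) (l : ℤ) :
    ‖expMinus ν β t η l - expPlus ν β t η l‖ ≤ 2 ∧
      ‖expMinus ν β t η l - expPlus ν β t η l‖ ≤ 2 * (angFreq β η l * t) := by
  constructor
  · have h := norm_sub_le (expMinus ν β t η l) (expPlus ν β t η l)
    rw [norm_expPlus, norm_expMinus] at h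
    linarith [exp_decay_le_one hν ht η l]
  · have e : expMinus ν β t η l - expPlus ν β t η l = -(expMinus ν β t η l *
        (Complex.exp (Complex.I * ((2 * (angFreq β η l * t) : ℝ) : ℂ)) - 1)) := by
      rw [mul_sub, expMinus, expPlus, ← Complex.exp_add, symLminus_eq, symLplus_eq, mul_one, neg_sub]
      congr 2; push_cast; ring
    rw [e, norm_neg, norm_mul, norm_expMinus]
    have h0 : 0 ≤ angFreq β η l := by
      rw [angFreq, symDz_mul_inv]; positivity
    have h1 := Real.norm_exp_I_mul_ofReal_sub_one_le (x := 2 * (angFreq β η l * t))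
    rw [Real.norm_of_nonneg (by positivity)] at h1
    calc _ ≤ 1 * (2 * (angFreq β η l * t)) := by
          gcongr; exact exp_decay_le_one hν ht η l
      _ = _ := one_mul _

lemma measurable_symbols (ν β t : ℝ) (l : ℤ) : Measurable (fun η => expPlus ν β t η l) ∧
    Measurable (fun η => expMinus ν β t η l) ∧ Measurable fun η => symGrad η l := by
  refine ⟨?_, ?_, ?_⟩
  · unfold expPlus symLplus symLap symGrad; fun_prop
  · unfold expMinus symLminus symLap symGrad; fun_prop
  · unfold symGrad; fun_prop

/-- The explicit form of the zero frequency. -/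
theorem Setting.zero_frequency (S : Setting ν β uin u) {t : ℝ} (ht : 0 ≤ t) :
    (∃ a b : Dom → ℂ, IsMul (symC ν β t) (simpleZero (uin 0)) a ∧
      IsMul (symA ν β t) (simpleZero (uin 1)) b ∧ simpleZero (u t 0) =ᵐ[volume] a + b) ∧
    (∃ a b : Dom → ℂ, IsMul (symC ν β t) (simpleZero (uin 1)) a ∧
      IsMul (symB ν β t) (simpleZero (uin 0)) b ∧ simpleZero (u t 1) =ᵐ[volume] a + b) ∧
    IsMul (fun η l => -symDzInvDy η l) (simpleZero (u t 1)) (simpleZero (u t 2)) ∧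
    IsMul (expHeat ν t) (doubleZero (uin 0)) (doubleZero (u t 0)) ∧
    doubleZero (u t 1) =ᵐ[volume] 0 ∧
    IsMul (expHeat ν t) (doubleZero (uin 2)) (doubleZero (u t 2)) := by
  have hm := S.solution.memLp t ht
  have hmi := S.memLp
  have hsz := fun j => memLp_simpleZero (hm j)
  have hszi := fun j => memLp_simpleZero (hmi j)
  have hmC : ∀ l, Measurable fun η => symC ν β t η l := fun l => by
    obtain ⟨h1, h2, h3⟩ := measurable_symbols ν β t l
    unfold symC; fun_prop
  have hmA : ∀ l, Measurable fun η => symA ν β t η l := fun l => by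
    obtain ⟨h1, h2, h3⟩ := measurable_symbols ν β t l
    unfold symA; fun_prop
  have hmB : ∀ l, Measurable fun η => symB ν β t η l := fun l => by
    obtain ⟨h1, h2, h3⟩ := measurable_symbols ν β t l
    unfold symB; fun_prop
  have hs : 0 < √(β * (β - 1)) := Real.sqrt_pos.2 (beta_mul_pos S.rot)
  have hbA : ∀ η l, ‖symA ν β t η l‖ ≤ |β - 1| * t := by
    intro η l
    have h := (norm_sub_exp_le (β := β) S.visc ht η l).2
    have hg : 0 ≤ symGrad η l := by unfold symGrad; positivity
    have hz : 0 ≤ symDz l := by unfold symDz; positivity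
    rw [symA, norm_mul, norm_mul, norm_mul, Complex.norm_real, Complex.norm_real]
    simp only [norm_div, Complex.norm_I, Real.norm_eq_abs, abs_mul, abs_inv, abs_of_nonneg hg,
      abs_of_nonneg hz, abs_of_pos hs]
    -- Only an inequality, since for `l = 0` the factor `symDz l` and its inverse are both zero.
    have h2 : symGrad η l * (symDz l)⁻¹ * (symDz l * (symGrad η l)⁻¹) ≤ 1 := by
      have e : symGrad η l * (symDz l)⁻¹ * (symDz l * (symGrad η l)⁻¹) =
        ((symDz l)⁻¹ * symDz l) * (symGrad η l * (symGrad η l)⁻¹) := by ring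
      rw [e]
      exact mul_le_one₀ (inv_mul_le_one) (by positivity) (mul_inv_le_one)
    calc _ ≤ 1 / ‖(2 : ℂ)‖ * (|β - 1| / √(β * (β - 1))) * (symGrad η l * (symDz l)⁻¹)
          * (2 * (angFreq β η l * t)) := by gcongr
      _ = |β - 1| * t * (symGrad η l * (symDz l)⁻¹ * (symDz l * (symGrad η l)⁻¹)) := by
          rw [angFreq]; norm_num; field_simp
      _ ≤ |β - 1| * t * 1 := by gcongr
      _ = _ := mul_one _
  have hbB : ∀ η l, ‖symB ν β t η l‖ ≤ |√(β * (β - 1)) / (β - 1)| := by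
    intro η l
    have h := (norm_sub_exp_le (β := β) S.visc ht η l).1
    rw [norm_sub_rev] at h
    have h2 : |(symGrad η l)⁻¹ * symDz l| ≤ 1 := by
      rw [mul_comm, symDz_mul_inv, abs_of_nonneg (by positivity)]
      refine div_le_one_of_le₀ ?_ (by positivity)
      exact Real.abs_le_sqrt (by linarith [sq_nonneg η])
    rw [symB, norm_mul, norm_mul, norm_mul, Complex.norm_real, Complex.norm_real, Real.norm_eq_abs,
      Real.norm_eq_abs, norm_div, Complex.norm_I]
    calc _ ≤ 1 / ‖(2 : ℂ)‖ * |√(β * (β - 1)) / (β - 1)| * 1 * 2 := by gcongr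
      _ = _ := by norm_num; ring
  have hcomb : ∀ (j i : Fin 3) (m : ℝ → ℤ → ℂ) (C : ℝ), (∀ l, Measurable fun η => m η l) →
      (∀ η l, ‖m η l‖ ≤ C) → (∀ l, l ≠ 0 → ∀ᵐ η, fhat (u t j) 0 η l =
        symC ν β t η l * fhat (uin j) 0 η l + m η l * fhat (uin i) 0 η l) →
      ∃ a b : Dom → ℂ, IsMul (symC ν β t) (simpleZero (uin j)) a ∧
        IsMul m (simpleZero (uin i)) b ∧ simpleZero (u t j) =ᵐ[volume] a + b := by
    intro j i m C h1 h2 h3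
    obtain ⟨a, ha⟩ := exists_isMul hmC (norm_symC_le S.visc ht) (hszi j)
    obtain ⟨b, hb⟩ := exists_isMul h1 h2 (hszi i)
    refine ⟨a, b, ha, hb, ae_eq_of_fhat (hsz j) (ha.1.add hb.1) fun k l => ?_⟩
    by_cases hl : k = 0 ∧ l ≠ 0
    · obtain ⟨rfl, hl⟩ := hl
      filter_upwards [h3 l hl, fhat_add ha.1 hb.1 0 l, ha.2 0 l, hb.2 0 l] with η g1 g2 g3 g4
      rw [g2, g3, g4, fhat_simpleZero (hm j) hl, fhat_simpleZero (hmi j) hl,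
        fhat_simpleZero (hmi i) hl, g1]
    · filter_upwards [fhat_add ha.1 hb.1 k l, ha.2 k l, hb.2 k l, fhat_simpleZero_zero (hm j) hl,
        fhat_simpleZero_zero (hmi j) hl, fhat_simpleZero_zero (hmi i) hl] with η g2 g3 g4 g5 g6 g7
      rw [g2, g3, g4, g5, g6, g7]; simp
  have hheat : ∀ j, (∀ᵐ η, fhat (u t j) 0 η 0 = expHeat ν t η 0 * fhat (uin j) 0 η 0) →
      IsMul (expHeat ν t) (doubleZero (uin j)) (doubleZero (u t j)) := by
    intro j h
    refine ⟨memLp_doubleZero (hm j), fun k l => ?_⟩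
    by_cases hl : k = 0 ∧ l = 0
    · obtain ⟨rfl, rfl⟩ := hl
      filter_upwards [h] with η h1
      rw [fhat_doubleZero, fhat_doubleZero, h1]
    · filter_upwards [fhat_doubleZero_zero (u t j) hl, fhat_doubleZero_zero (uin j) hl] with η h1 h2
      rw [h1, h2, mul_zero]
  refine ⟨hcomb 0 1 _ _ hmA hbA fun l hl => (S.fhat_zero_mode hl ht).mono fun _ h => h.1,
    hcomb 1 0 _ _ hmB hbB fun l hl => (S.fhat_zero_mode hl ht).mono fun _ h => h.2.1,
    ⟨hsz 2, fun k l => ?_⟩, hheat 0 ((S.fhat_zero_zero_mode ht).mono fun _ h => h.1), ?_,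
    hheat 2 ((S.fhat_zero_zero_mode ht).mono fun _ h => h.2.2)⟩
  · by_cases hl : k = 0 ∧ l ≠ 0
    · obtain ⟨rfl, hl⟩ := hl
      filter_upwards [S.fhat_zero_mode hl ht] with η h
      rw [fhat_simpleZero (hm 2) hl, fhat_simpleZero (hm 1) hl, symDzInvDy]
      have hl' : (l : ℂ) ≠ 0 := by exact_mod_cast hl
      have hπ : (Real.pi : ℂ) ≠ 0 := by exact_mod_cast Real.pi_ne_zero
      have hI := Complex.I_ne_zero
      field_simp
      linear_combination h.2.2
    · filter_upwards [fhat_simpleZero_zero (hm 2) hl, fhat_simpleZero_zero (hm 1) hl] with η h1 h2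
      rw [h1, h2, mul_zero]
  · refine ae_eq_of_fhat (memLp_doubleZero (hm 1)) MemLp.zero fun k l => ?_
    have hz : ∀ᵐ η : ℝ, fhat (0 : Dom → ℂ) k η l = 0 :=
      fhat_zero_of_mode (Eventually.of_forall fun y => by simp [mode])
    by_cases hl : k = 0 ∧ l = 0
    · obtain ⟨rfl, rfl⟩ := hl
      filter_upwards [hz, S.fhat_zero_zero_mode ht] with η h1 h2
      rw [fhat_doubleZero, h1, h2.2.1]
    · filter_upwards [hz, fhat_doubleZero_zero (u t 1) hl] with η h1 h2
      rw [h1, h2]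

/-! ### Oscillatory integrals -/

/-- `e^{iφ}`. -/
def osc (φ : ℝ → ℝ) (x : ℝ) : ℂ := Complex.exp (Complex.I * (φ x : ℂ))

lemma norm_osc (φ : ℝ → ℝ) (x : ℝ) : ‖osc φ x‖ = 1 := by
  rw [osc, mul_comm, Complex.norm_exp_ofReal_mul_I]

lemma hasDerivAt_osc {φ : ℝ → ℝ} {d x : ℝ} (h : HasDerivAt φ d x) :
    HasDerivAt (osc φ) (Complex.I * d * osc φ x) x := by
  refine ((h.ofReal_comp.const_mul Complex.I).cexp).congr_deriv ?_
  rw [osc]; ring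

lemma norm_integral_osc_le (φ : ℝ → ℝ) {a b : ℝ} (hab : a ≤ b) :
    ‖∫ x in a..b, osc φ x‖ ≤ b - a := by
  have := intervalIntegral.norm_integral_le_of_norm_le_const (a := a) (b := b) (f := osc φ) (C := 1)
    fun x _ => (norm_osc φ x).le
  rwa [one_mul, abs_of_nonneg (by linarith)] at this

lemma norm_integral_osc_neg (φ : ℝ → ℝ) (a b : ℝ) :
    ‖∫ x in a..b, osc (fun x => -φ x) x‖ = ‖∫ x in a..b, osc φ x‖ := by
  have e : ∀ x, osc (fun x => -φ x) x = (starRingEnd ℂ) (osc φ x) := fun x => by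
    rw [osc, osc, ← Complex.exp_conj]; simp
  simp only [e]
  rw [intervalIntegral.intervalIntegral_eq_integral_uIoc,
    intervalIntegral.intervalIntegral_eq_integral_uIoc, integral_conj, norm_smul, norm_smul,
    RCLike.norm_conj]

/-- A twice continuously differentiable phase, with its derivatives. -/
structure Phase (φ φ' φ'' : ℝ → ℝ) : Prop where
  first : ∀ x, HasDerivAt φ (φ' x) x
  second : ∀ x, HasDerivAt φ' (φ'' x) x
  continuous : Continuous φ''

section VanDerCorput

variable {φ φ' φ'' : ℝ → ℝ} {a b : ℝ}

lemma Phase.continuous_osc (h : Phase φ φ' φ'') : Continuous (osc φ) :=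
  continuous_iff_continuousAt.2 fun x => (hasDerivAt_osc (h.first x)).continuousAt

lemma Phase.continuous_first (h : Phase φ φ' φ'') : Continuous φ' :=
  continuous_iff_continuousAt.2 fun x => (h.second x).continuousAt

lemma Phase.neg (h : Phase φ φ' φ'') :
    Phase (fun x => -φ x) (fun x => -φ' x) (fun x => -φ'' x) :=
  ⟨fun x => (h.first x).neg, fun x => (h.second x).neg, h.continuous.neg⟩

lemma Phase.reflect (h : Phase φ φ' φ'') :
    Phase (fun x => φ (-x)) (fun x => -φ' (-x)) (fun x => φ'' (-x)) := by
  refine ⟨fun x => ?_, fun x => ?_, h.continuous.comp continuous_neg⟩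
  · exact ((h.first (-x)).comp x (hasDerivAt_neg x)).congr_deriv (by ring)
  · exact ((h.second (-x)).comp x (hasDerivAt_neg x)).neg.congr_deriv (by ring)

/-- The first derivative test. -/
lemma Phase.norm_integral_le_of_first (h : Phase φ φ' φ'') (hab : a ≤ b) {δ : ℝ} (hδ : 0 < δ)
    (h1 : ∀ x ∈ Icc a b, δ ≤ φ' x) (h2 : ∀ x ∈ Icc a b, 0 ≤ φ'' x) :
    ‖∫ x in a..b, osc φ x‖ ≤ 3 / δ := by
  have hu : uIcc a b = Icc a b := uIcc_of_le hab
  have hpos : ∀ x ∈ Icc a b, 0 < φ' x := fun x hx => hδ.trans_le (h1 x hx)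
  have hne : ∀ x ∈ Icc a b, (φ' x : ℂ) ≠ 0 := fun x hx => by exact_mod_cast (hpos x hx).ne'
  -- `osc φ + r` is the derivative of `-i osc φ / φ'`. Moreover `|r| = φ''/φ'²` is the derivative of
  -- `-1/φ'`, so its integral telescopes; each of the three resulting terms is at most `1/δ`.
  let r : ℝ → ℂ := fun x => osc φ x * (Complex.I * ((φ'' x / φ' x ^ 2 : ℝ) : ℂ))
  have hr : ContinuousOn (fun x => φ'' x / φ' x ^ 2) (Icc a b) :=
    h.continuous.continuousOn.div (h.continuous_first.continuousOn.pow 2)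
      fun x hx => pow_ne_zero 2 (hpos x hx).ne'
  have hrc : ContinuousOn r (Icc a b) := h.continuous_osc.continuousOn.mul
    (continuousOn_const.mul (Complex.continuous_ofReal.comp_continuousOn hr))
  have hder : ∀ x ∈ uIcc a b, HasDerivAt (fun x => -Complex.I * (osc φ x * ((φ' x)⁻¹ : ℝ)))
      (osc φ x + r x) x := by
    intro x hx
    rw [hu] at hx
    have h3 := ((h.second x).fun_inv (hpos x hx).ne').ofReal_comp
    refine (((hasDerivAt_osc (h.first x)).mul h3).const_mul (-Complex.I)).congr_deriv ?_
    have := hne x hx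
    simp only [r]; push_cast
    field_simp
    linear_combination (-(φ' x : ℂ) ^ 2 * osc φ x) * Complex.I_sq
  have hInt := intervalIntegral.integral_eq_sub_of_hasDerivAt hder
    (ContinuousOn.intervalIntegrable (by rw [hu]; exact h.continuous_osc.continuousOn.add hrc))
  rw [intervalIntegral.integral_add (h.continuous_osc.intervalIntegrable _ _)
    (ContinuousOn.intervalIntegrable (by rw [hu]; exact hrc))] at hInt
  have hder2 : ∀ x ∈ uIcc a b, HasDerivAt (fun x => -(φ' x)⁻¹) (φ'' x / φ' x ^ 2) x := by
    intro x hx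
    rw [hu] at hx
    refine ((h.second x).fun_inv (hpos x hx).ne').neg.congr_deriv ?_
    ring
  have hint2 := intervalIntegral.integral_eq_sub_of_hasDerivAt hder2
    (ContinuousOn.intervalIntegrable (by rw [hu]; exact hr))
  have hbr : ‖∫ x in a..b, r x‖ ≤ (φ' a)⁻¹ := by
    have h4 : ‖∫ x in a..b, r x‖ ≤ ∫ x in a..b, φ'' x / φ' x ^ 2 := by
      refine intervalIntegral.norm_integral_le_of_norm_le hab ?_
        (ContinuousOn.intervalIntegrable (by rw [hu]; exact hr))
      refine Eventually.of_forall fun x hx => le_of_eq ?_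
      have hx' : x ∈ Icc a b := Ioc_subset_Icc_self hx
      simp only [r, norm_mul, norm_osc, Complex.norm_I, Complex.norm_real, one_mul]
      rw [Real.norm_of_nonneg (div_nonneg (h2 x hx') (sq_nonneg _))]
    have := inv_pos.2 (hpos b ⟨hab, le_rfl⟩)
    linarith
  have hi : ∀ x ∈ Icc a b, (φ' x)⁻¹ ≤ 1 / δ := fun x hx => by
    rw [one_div]; exact inv_anti₀ hδ (h1 x hx)
  have hg : ∀ x ∈ Icc a b, ‖-Complex.I * (osc φ x * ((φ' x)⁻¹ : ℝ))‖ ≤ 1 / δ := fun x hx => by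
    rw [norm_mul, norm_mul, norm_osc, Complex.norm_real, norm_neg, Complex.norm_I, one_mul, one_mul,
      Real.norm_of_nonneg (inv_pos.2 (hpos x hx)).le]
    exact hi x hx
  have e : ∫ x in a..b, osc φ x = (-Complex.I * (osc φ b * ((φ' b)⁻¹ : ℝ))
      - -Complex.I * (osc φ a * ((φ' a)⁻¹ : ℝ))) - ∫ x in a..b, r x := by
    rw [← hInt]; ring
  rw [e]
  refine (norm_sub_le _ _).trans ((add_le_add (norm_sub_le _ _) hbr).trans ?_)
  have := hg b ⟨hab, le_rfl⟩
  have := hg a ⟨le_rfl, hab⟩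
  have := hi a ⟨le_rfl, hab⟩
  have : 3 / δ = 1 / δ + 1 / δ + 1 / δ := by ring
  linarith

lemma Phase.le_first (h : Phase φ φ' φ'') {ρ : ℝ} (h2 : ∀ x ∈ Icc a b, ρ ≤ φ'' x) {x : ℝ}
    (hx : x ∈ Icc a b) : φ' a + ρ * (x - a) ≤ φ' x := by
  have hm : MonotoneOn (fun x => φ' x - ρ * x) (Icc a b) := by
    have hd : ∀ x, HasDerivAt (fun x => φ' x - ρ * x) (φ'' x - ρ) x := fun x => by
      exact ((h.second x).sub ((hasDerivAt_id x).const_mul ρ)).congr_deriv (by ring)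
    refine monotoneOn_of_deriv_nonneg (convex_Icc a b)
      (fun x _ => (hd x).continuousAt.continuousWithinAt)
      (fun x _ => (hd x).differentiableAt.differentiableWithinAt) fun x hx => ?_
    rw [(hd x).deriv]
    linarith [h2 x (interior_subset hx)]
  have := hm ⟨le_rfl, hx.1.trans hx.2⟩ hx hx.1
  simp only at this
  linarith

/-- The interval `[a, a + ε]` contributes at most `ε`. Beyond it convexity gives `φ' ≥ ε⁻² · ε =
ε⁻¹`, and the first derivative test contributes `3ε`. -/
lemma Phase.norm_integral_le_of_right (h : Phase φ φ' φ'') (hab : a ≤ b) {ε : ℝ} (hε : 0 < ε)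
    (h1 : 0 ≤ φ' a) (h2 : ∀ x ∈ Icc a b, (ε ^ 2)⁻¹ ≤ φ'' x) :
    ‖∫ x in a..b, osc φ x‖ ≤ 4 * ε := by
  rcases le_total b (a + ε) with hb | hb
  · exact (norm_integral_osc_le φ hab).trans (by linarith)
  · rw [← intervalIntegral.integral_add_adjacent_intervals
      (h.continuous_osc.intervalIntegrable a (a + ε)) (h.continuous_osc.intervalIntegrable _ _)]
    have h3 := norm_integral_osc_le φ (by linarith : a ≤ a + ε)
    have h4 := h.norm_integral_le_of_first hb (δ := ε⁻¹) (by positivity) (fun x hx => by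
      have h5 := h.le_first h2 (x := x) ⟨by linarith [hx.1], hx.2⟩
      have h6 : (ε ^ 2)⁻¹ * ε ≤ (ε ^ 2)⁻¹ * (x - a) := by
        gcongr; linarith [hx.1]
      have h7 : (ε ^ 2)⁻¹ * ε = ε⁻¹ := by field_simp
      linarith)
      (fun x hx => le_trans (by positivity) (h2 x ⟨by linarith [hx.1], hx.2⟩))
    refine (norm_add_le _ _).trans ?_
    have : 3 / ε⁻¹ = 3 * ε := by field_simp
    linarith

lemma Phase.norm_integral_le_of_left (h : Phase φ φ' φ'') (hab : a ≤ b) {ε : ℝ} (hε : 0 < ε)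
    (h1 : φ' b ≤ 0) (h2 : ∀ x ∈ Icc a b, (ε ^ 2)⁻¹ ≤ φ'' x) :
    ‖∫ x in a..b, osc φ x‖ ≤ 4 * ε := by
  have h3 := h.reflect.norm_integral_le_of_right (a := -b) (b := -a) (by linarith) hε
    (by simpa using h1) (fun x hx => h2 (-x) ⟨by linarith [hx.2], by linarith [hx.1]⟩)
  have e : ∫ x in (-b)..(-a), osc (fun x => φ (-x)) x = ∫ x in a..b, osc φ x := by
    have := intervalIntegral.integral_comp_neg (a := -b) (b := -a) (osc φ)
    rw [neg_neg, neg_neg] at this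
    exact this
  rwa [e] at h3

/-- The second derivative test. -/
lemma Phase.norm_integral_le_of_second (h : Phase φ φ' φ'') (hab : a ≤ b) {ε : ℝ} (hε : 0 < ε)
    (h2 : ∀ x ∈ Icc a b, (ε ^ 2)⁻¹ ≤ φ'' x) : ‖∫ x in a..b, osc φ x‖ ≤ 8 * ε := by
  rcases le_total 0 (φ' a) with ha | ha
  · exact (h.norm_integral_le_of_right hab hε ha h2).trans (by linarith)
  rcases le_total (φ' b) 0 with hb | hb
  · exact (h.norm_integral_le_of_left hab hε hb h2).trans (by linarith)
  -- The interval is split at the stationary point.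
  obtain ⟨c, hc, hc0⟩ := intermediate_value_Icc hab h.continuous_first.continuousOn ⟨ha, hb⟩
  rw [← intervalIntegral.integral_add_adjacent_intervals
      (h.continuous_osc.intervalIntegrable a c) (h.continuous_osc.intervalIntegrable _ _)]
  have h3 := h.norm_integral_le_of_left hc.1 hε hc0.le fun x hx => h2 x ⟨hx.1, hx.2.trans hc.2⟩
  have h4 := h.norm_integral_le_of_right hc.2 hε hc0.ge fun x hx => h2 x ⟨hc.1.trans hx.1, hx.2⟩
  exact (norm_add_le _ _).trans (by linarith)

lemma Phase.norm_integral_le_of_second_neg (h : Phase φ φ' φ'') (hab : a ≤ b) {ε : ℝ} (hε : 0 < ε)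
    (h2 : ∀ x ∈ Icc a b, φ'' x ≤ -(ε ^ 2)⁻¹) : ‖∫ x in a..b, osc φ x‖ ≤ 8 * ε := by
  rw [← norm_integral_osc_neg]
  exact h.neg.norm_integral_le_of_second hab hε fun x hx => by linarith [h2 x hx]

end VanDerCorput

/-- Insertion of an amplitude into an oscillatory integral. -/
lemma norm_integral_mul_amplitude_le {ψ : ℝ → ℂ} (hψ : Continuous ψ) {B B' : ℝ → ℝ}
    (hB : ∀ x, HasDerivAt B (B' x) x) (hB' : Continuous B') {a b M : ℝ} (hab : a ≤ b)
    (hM : ∀ x ∈ Icc a b, ‖∫ y in a..x, ψ y‖ ≤ M) :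
    ‖∫ x in a..b, ψ x * B x‖ ≤ M * (|B b| + ∫ x in a..b, |B' x|) := by
  have hM0 : 0 ≤ M := (norm_nonneg _).trans (hM a ⟨le_rfl, hab⟩)
  let Ψ : ℝ → ℂ := fun x => ∫ y in a..x, ψ y
  have hΨ : ∀ x, HasDerivAt Ψ (ψ x) x := fun x =>
    intervalIntegral.integral_hasDerivAt_right (hψ.intervalIntegrable _ _)
      hψ.stronglyMeasurable.stronglyMeasurableAtFilter hψ.continuousAt
  have hΨc : Continuous Ψ := continuous_iff_continuousAt.2 fun x => (hΨ x).continuousAt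
  have hBc : ∀ x, HasDerivAt (fun x => (B x : ℂ)) (B' x : ℂ) x := fun x => (hB x).ofReal_comp
  have hB'c : Continuous fun x => (B' x : ℂ) := Complex.continuous_ofReal.comp hB'
  have hBcc : Continuous fun x => (B x : ℂ) :=
    continuous_iff_continuousAt.2 fun x => (hBc x).continuousAt
  have h := intervalIntegral.integral_deriv_mul_eq_sub_of_hasDerivAt (a := a) (b := b) (u := Ψ)
    (v := fun x => (B x : ℂ)) (u' := ψ) (v' := fun x => (B' x : ℂ)) hΨc.continuousOn
    hBcc.continuousOn (fun x _ => hΨ x) (fun x _ => hBc x) (hψ.intervalIntegrable _ _) (hB'c.intervalIntegrable _ _)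
  have i1 : IntervalIntegrable (fun x => ψ x * (B x : ℂ)) volume a b :=
    (hψ.mul hBcc).intervalIntegrable _ _
  have i2 : IntervalIntegrable (fun x => Ψ x * (B' x : ℂ)) volume a b :=
    (hΨc.mul hB'c).intervalIntegrable _ _
  rw [intervalIntegral.integral_add i1 i2] at h
  have e : ∫ x in a..b, ψ x * B x = Ψ b * B b - ∫ x in a..b, Ψ x * B' x := by
    have : Ψ a = 0 := by simp [Ψ]
    rw [this] at h
    linear_combination h
  rw [e]
  have h1 : ‖Ψ b * B b‖ ≤ M * |B b| := by
    rw [norm_mul, Complex.norm_real, Real.norm_eq_abs]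
    gcongr
    exact hM b ⟨hab, le_rfl⟩
  have h2 : ‖∫ x in a..b, Ψ x * B' x‖ ≤ ∫ x in a..b, M * |B' x| := by
    refine intervalIntegral.norm_integral_le_of_norm_le hab
      (Eventually.of_forall fun x hx => ?_) ((continuous_const.mul hB'.abs).intervalIntegrable _ _)
    rw [norm_mul, Complex.norm_real, Real.norm_eq_abs]
    gcongr
    exact hM x (Ioc_subset_Icc_self hx)
  rw [intervalIntegral.integral_const_mul] at h2
  rw [mul_add]
  exact (norm_sub_le _ _).trans (add_le_add h1 h2)

/-- A differentiable monotone amplitude on `[0, ∞)` with values in `[0, 1]`. -/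
structure Amplitude (B B' : ℝ → ℝ) : Prop where
  deriv : ∀ x, HasDerivAt B (B' x) x
  continuous : Continuous B'
  nonneg : ∀ x, 0 ≤ x → 0 ≤ B x
  le_one : ∀ x, 0 ≤ x → B x ≤ 1
  mono : (∀ x, 0 ≤ x → 0 ≤ B' x) ∨ ∀ x, 0 ≤ x → B' x ≤ 0

/-- For a monotone amplitude with values in `[0, 1]`, the end value plus the total variation is at
most `2`. -/
lemma Amplitude.norm_integral_le {B B' : ℝ → ℝ} (hB : Amplitude B B') {ψ : ℝ → ℂ}
    (hψ : Continuous ψ) {a b M : ℝ} (ha : 0 ≤ a) (hab : a ≤ b)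
    (hM : ∀ x ∈ Icc a b, ‖∫ y in a..x, ψ y‖ ≤ M) : ‖∫ x in a..b, ψ x * B x‖ ≤ 2 * M := by
  have hM0 : 0 ≤ M := (norm_nonneg _).trans (hM a ⟨le_rfl, hab⟩)
  refine (norm_integral_mul_amplitude_le hψ hB.deriv hB.continuous hab hM).trans ?_
  rw [mul_comm]
  gcongr
  have hi := intervalIntegral.integral_eq_sub_of_hasDerivAt (a := a) (b := b)
    (fun x _ => hB.deriv x) (hB.continuous.intervalIntegrable _ _)
  rw [abs_of_nonneg (hB.nonneg b (ha.trans hab))]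
  have b1 := hB.nonneg b (ha.trans hab)
  have b2 := hB.le_one b (ha.trans hab)
  have b3 := hB.nonneg a ha
  have b4 := hB.le_one a ha
  rcases hB.mono with h | h
  · have e : ∫ x in a..b, |B' x| = ∫ x in a..b, B' x := by
      refine intervalIntegral.integral_congr fun x hx => ?_
      rw [uIcc_of_le hab] at hx
      exact abs_of_nonneg (h x (ha.trans hx.1))
    rw [e, hi]; linarith
  · have e : ∫ x in a..b, |B' x| = ∫ x in a..b, -B' x := by
      refine intervalIntegral.integral_congr fun x hx => ?_
      rw [uIcc_of_le hab] at hx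
      exact abs_of_nonpos (h x (ha.trans hx.1))
    rw [e, intervalIntegral.integral_neg, hi]; linarith

/-! ### The phase `λx + τ (1 + x²)^{-1/2}` -/

/-- `(1 + x²)^{1/2}`. -/
def br (x : ℝ) : ℝ := √(1 + x ^ 2)

lemma br_sq (x : ℝ) : br x ^ 2 = 1 + x ^ 2 := Real.sq_sqrt (by positivity)

lemma br_pos (x : ℝ) : 0 < br x := Real.sqrt_pos.2 (by positivity)

lemma hasDerivAt_br (x : ℝ) : HasDerivAt br (x / br x) x := by
  have h := (((hasDerivAt_id x).pow 2).const_add 1).sqrt (by simp; positivity)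
  refine h.congr_deriv ?_
  simp [br]; ring

lemma continuous_br : Continuous br := by unfold br; fun_prop

lemma hasDerivAt_inv_br (x : ℝ) : HasDerivAt (fun x => (br x)⁻¹) (-x / br x ^ 3) x := by
  refine ((hasDerivAt_br x).fun_inv (br_pos x).ne').congr_deriv ?_
  have := (br_pos x).ne'
  field_simp

/-- The second derivative changes sign at `±1/√2`; without this degeneracy the rate on bounded sets
would be `τ^{-1/2}`. -/
lemma phase_kernel (lam τ : ℝ) : Phase (fun x => lam * x + τ * (br x)⁻¹)
    (fun x => lam - τ * (x / br x ^ 3)) (fun x => τ * ((2 * x ^ 2 - 1) / br x ^ 5)) := by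
  refine ⟨fun x => ?_, fun x => ?_, ?_⟩
  · refine (((hasDerivAt_id x).const_mul lam).add ((hasDerivAt_inv_br x).const_mul τ)).congr_deriv ?_
    simp; ring
  · have hb := (br_pos x).ne'
    refine ((((hasDerivAt_id x).div ((hasDerivAt_br x).pow 3) (pow_ne_zero 3 hb)).const_mul
      τ).const_sub lam).congr_deriv ?_
    have h2 := br_sq x
    simp only [id, Nat.cast_ofNat, Pi.pow_apply]
    have e : x ^ 2 = br x ^ 2 - 1 := by rw [h2]; ring
    field_simp
    simp only [e]
    ring
  · exact continuous_const.mul (Continuous.div (by fun_prop) (continuous_br.pow 5)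
      fun x => pow_ne_zero 5 (br_pos x).ne')

lemma amplitude_one : Amplitude (fun _ => 1) (fun _ => 0) :=
  ⟨fun x => hasDerivAt_const x 1, continuous_const, fun _ _ => zero_le_one, fun _ _ => le_rfl,
    Or.inl fun _ _ => le_rfl⟩

lemma one_le_br (x : ℝ) : 1 ≤ br x := by
  unfold br; rw [Real.one_le_sqrt]; nlinarith [sq_nonneg x]

lemma amplitude_inv_br : Amplitude (fun x => (br x)⁻¹) (fun x => -x / br x ^ 3) := by
  refine ⟨hasDerivAt_inv_br, ?_, fun x _ => (inv_pos.2 (br_pos x)).le,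
    fun x _ => inv_le_one_of_one_le₀ (one_le_br x), Or.inr fun x hx => ?_⟩
  · exact Continuous.div (by fun_prop) (continuous_br.pow 3) fun x => pow_ne_zero 3 (br_pos x).ne'
  · exact div_nonpos_of_nonpos_of_nonneg (by linarith) (pow_pos (br_pos x) 3).le

lemma amplitude_div_br : Amplitude (fun x => x / br x) (fun x => 1 / br x ^ 3) := by
  refine ⟨fun x => ?_, ?_, fun x hx => div_nonneg hx (br_pos x).le,
    fun x hx => ?_, Or.inl fun x hx => ?_⟩
  · refine ((hasDerivAt_id x).div (hasDerivAt_br x) (br_pos x).ne').congr_deriv ?_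
    have hb := (br_pos x).ne'
    have h2 := br_sq x
    simp only [id]
    have e : x ^ 2 = br x ^ 2 - 1 := by rw [h2]; ring
    field_simp
    rw [e]; ring
  · exact Continuous.div (by fun_prop) (continuous_br.pow 3) fun x => pow_ne_zero 3 (br_pos x).ne'
  · rw [div_le_one (br_pos x), br]; exact Real.le_sqrt_of_sq_le (by linarith)
  · have := br_pos x; positivity

/-- The algebraic factor comes from `Δ⁻²`, the Gaussian from the heat semigroup; both decrease on
the half line. -/
lemma amplitude_decay {q : ℝ} (hq : 0 ≤ q) :
    Amplitude (fun x => ((1 + x ^ 2) ^ 2)⁻¹ * Real.exp (-q * x ^ 2))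
      (fun x => -(4 * x * (1 + x ^ 2)) / ((1 + x ^ 2) ^ 2) ^ 2 * Real.exp (-q * x ^ 2)
        + ((1 + x ^ 2) ^ 2)⁻¹ * (Real.exp (-q * x ^ 2) * (-q * (2 * x)))) := by
  have hp : ∀ x : ℝ, (0 : ℝ) < (1 + x ^ 2) ^ 2 := fun x => by positivity
  refine ⟨fun x => ?_, ?_, fun x _ => by have := hp x; positivity, fun x _ => ?_,
    Or.inr fun x hx => ?_⟩
  · have h1 : HasDerivAt (fun x : ℝ => (1 + x ^ 2) ^ 2) (4 * x * (1 + x ^ 2)) x := by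
      refine ((((hasDerivAt_id x).pow 2).const_add 1).pow 2).congr_deriv ?_
      simp; ring
    have h2 : HasDerivAt (fun x : ℝ => Real.exp (-q * x ^ 2))
        (Real.exp (-q * x ^ 2) * (-q * (2 * x))) x := by
      refine ((((hasDerivAt_id x).pow 2).const_mul (-q)).exp).congr_deriv ?_
      simp
    exact (h1.fun_inv (hp x).ne').mul h2
  · refine Continuous.add (Continuous.mul (Continuous.div (by fun_prop) (by fun_prop)
      fun x => pow_ne_zero 2 (hp x).ne') (by fun_prop)) (Continuous.mul (Continuous.inv₀ (by fun_prop)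
      fun x => (hp x).ne') (by fun_prop))
  · refine mul_le_one₀ (inv_le_one_of_one_le₀ ?_) (Real.exp_pos _).le ?_
    · exact one_le_pow₀ (by nlinarith [sq_nonneg x])
    · rw [Real.exp_le_one_iff]; nlinarith [mul_nonneg hq (sq_nonneg x)]
  · have h1 : 0 ≤ 4 * x * (1 + x ^ 2) / ((1 + x ^ 2) ^ 2) ^ 2 * Real.exp (-q * x ^ 2) := by positivity
    have h2 : 0 ≤ ((1 + x ^ 2) ^ 2)⁻¹ * (Real.exp (-q * x ^ 2) * (q * (2 * x))) := by positivity
    rw [neg_div]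
    linarith

/-! ### Decay of the kernel -/

/-- The amplitude `c(x) (1 + x²)⁻² e^{-qx²}`. -/
def ampl (c : ℝ → ℝ) (q x : ℝ) : ℝ := c x * (((1 + x ^ 2) ^ 2)⁻¹ * Real.exp (-q * x ^ 2))

section Kernel

variable {c c' : ℝ → ℝ}

lemma Amplitude.continuous_self (hc : Amplitude c c') : Continuous c :=
  continuous_iff_continuousAt.2 fun x => (hc.deriv x).continuousAt

lemma Amplitude.continuous_ampl (hc : Amplitude c c') {q : ℝ} (hq : 0 ≤ q) :
    Continuous (ampl c q) :=
  hc.continuous_self.mul (amplitude_decay hq).continuous_self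

lemma Amplitude.abs_ampl_le (hc : Amplitude c c') {q : ℝ} (hq : 0 ≤ q) {x : ℝ} (hx : 0 ≤ x) :
    |ampl c q x| ≤ ((1 + x ^ 2) ^ 2)⁻¹ := by
  have h1 := hc.nonneg x hx
  have h2 := hc.le_one x hx
  have h3 : Real.exp (-q * x ^ 2) ≤ 1 := by
    rw [Real.exp_le_one_iff]; nlinarith [mul_nonneg hq (sq_nonneg x)]
  have h4 : (0 : ℝ) ≤ ((1 + x ^ 2) ^ 2)⁻¹ := by positivity
  rw [ampl, abs_of_nonneg (by positivity)]
  calc c x * (((1 + x ^ 2) ^ 2)⁻¹ * Real.exp (-q * x ^ 2))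
      ≤ 1 * (((1 + x ^ 2) ^ 2)⁻¹ * 1) := by gcongr
    _ = _ := by ring

lemma Amplitude.norm_osc_ampl_le (hc : Amplitude c c') {q : ℝ} (hq : 0 ≤ q) (φ : ℝ → ℝ) {x : ℝ}
    (hx : 0 ≤ x) : ‖osc φ x * (ampl c q x : ℂ)‖ ≤ (1 + x ^ 2)⁻¹ := by
  rw [norm_mul, norm_osc, one_mul, Complex.norm_real]
  refine (hc.abs_ampl_le hq hx).trans (inv_anti₀ (by positivity) ?_)
  nlinarith [sq_nonneg x, sq_nonneg (x ^ 2)]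

lemma Amplitude.integrableOn (hc : Amplitude c c') {q : ℝ} (hq : 0 ≤ q) {φ : ℝ → ℝ}
    (hφ : Continuous (osc φ)) : IntegrableOn (fun x => osc φ x * (ampl c q x : ℂ)) (Ioi 0) := by
  have hcont : Continuous fun x => osc φ x * (ampl c q x : ℂ) :=
    hφ.mul (Complex.continuous_ofReal.comp (hc.continuous_ampl hq))
  refine Integrable.mono' integrable_inv_one_add_sq.integrableOn hcont.aestronglyMeasurable ?_
  filter_upwards [ae_restrict_mem measurableSet_Ioi] with x hx
  exact hc.norm_osc_ampl_le hq φ (le_of_lt hx)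

/-- Two monotone amplitudes are inserted one after the other, each at the price of a factor `2`. -/
lemma Amplitude.norm_integral_piece_le (hc : Amplitude c c') {q : ℝ} (hq : 0 ≤ q) {φ : ℝ → ℝ}
    (hφ : Continuous (osc φ)) {a b M : ℝ} (ha : 0 ≤ a) (hab : a ≤ b)
    (hM : ∀ x ∈ Icc a b, ‖∫ y in a..x, osc φ y‖ ≤ M) :
    ‖∫ x in a..b, osc φ x * (ampl c q x : ℂ)‖ ≤ 4 * M := by
  have h1 : ∀ x ∈ Icc a b, ‖∫ y in a..x, osc φ y * (c y : ℂ)‖ ≤ 2 * M := fun x hx =>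
    hc.norm_integral_le hφ ha hx.1 fun y hy => hM y ⟨hy.1, hy.2.trans hx.2⟩
  have h2 := (amplitude_decay hq).norm_integral_le
    (hφ.mul (Complex.continuous_ofReal.comp hc.continuous_self)) ha hab h1
  refine le_trans (le_of_eq ?_) (h2.trans (by linarith))
  congr 2; ext x
  simp only [ampl, Pi.mul_apply, Function.comp_apply]; push_cast; ring

/-- The numerator is at most `-μ` at distance `μ` from its zero, and the denominator is at most `6`
there. -/
lemma second_deriv_lower_left {μ x : ℝ} (hμ : 0 < μ) (hx0 : 0 ≤ x) (hx : x ≤ √(1 / 2) - μ) :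
    (2 * x ^ 2 - 1) / br x ^ 5 ≤ -(μ / 6) := by
  have hs : √(1 / 2 : ℝ) ^ 2 = 1 / 2 := Real.sq_sqrt (by norm_num)
  have hs7 : (7 / 10 : ℝ) ≤ √(1 / 2) := Real.le_sqrt_of_sq_le (by norm_num)
  set r := √(1 / 2 : ℝ)
  have h1 : 2 * x ^ 2 - 1 ≤ -μ := by nlinarith
  have hb : br x ^ 5 ≤ 6 := by
    have h2 := br_sq x
    have h3 : br x ^ 2 ≤ 3 / 2 := by rw [h2]; nlinarith
    have h4 : br x ≤ 5 / 4 := by nlinarith [br_pos x]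
    calc br x ^ 5 ≤ (5 / 4) ^ 5 := by
          have := (br_pos x).le
          gcongr
      _ ≤ 6 := by norm_num
  have hp : 0 < br x ^ 5 := pow_pos (br_pos x) 5
  rw [div_le_iff₀ hp]
  nlinarith

/-- For `x ≤ 1` distance `X⁻³` from the zero suffices as on the left. For `x ≥ 1` the quotient is at
least `x⁻³/6`, and `x ≤ X`. The excluded distance `X⁻³` is chosen so that both ranges give the same
bound. -/
lemma second_deriv_lower_right {X x : ℝ} (hX : 0 < X) (hx : √(1 / 2) + (X ^ 3)⁻¹ ≤ x) (hx1 : x ≤ X) :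
    (X ^ 3)⁻¹ / 6 ≤ (2 * x ^ 2 - 1) / br x ^ 5 := by
  have hs : √(1 / 2 : ℝ) ^ 2 = 1 / 2 := Real.sq_sqrt (by norm_num)
  have hs7 : (7 / 10 : ℝ) ≤ √(1 / 2) := Real.le_sqrt_of_sq_le (by norm_num)
  set r := √(1 / 2 : ℝ)
  have hμ : 0 < (X ^ 3)⁻¹ := by positivity
  have hp : 0 < br x ^ 5 := pow_pos (br_pos x) 5
  have hb0 := br_pos x
  rw [le_div_iff₀ hp]
  rcases le_total x 1 with h | h
  · have h1 : (X ^ 3)⁻¹ ≤ 2 * x ^ 2 - 1 := by nlinarith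
    have hb : br x ^ 5 ≤ 6 := by
      have h2 := br_sq x
      have h3 : br x ^ 2 ≤ 2 := by rw [h2]; nlinarith
      have h4 : br x ≤ 3 / 2 := by nlinarith
      calc br x ^ 5 = (br x ^ 2) ^ 2 * br x := by ring
        _ ≤ 2 ^ 2 * (3 / 2) := by gcongr
        _ ≤ 6 := by norm_num
    nlinarith
  · have hx0 : 0 < x := by linarith
    have h2 := br_sq x
    have h3 : br x ^ 2 ≤ 2 * x ^ 2 := by rw [h2]; nlinarith
    have h4 : br x ≤ 3 / 2 * x := by nlinarith
    have hb : br x ^ 5 ≤ 6 * x ^ 5 := by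
      calc br x ^ 5 = (br x ^ 2) ^ 2 * br x := by ring
        _ ≤ (2 * x ^ 2) ^ 2 * (3 / 2 * x) := by gcongr
        _ = 6 * x ^ 5 := by ring
    have h5 : (X ^ 3)⁻¹ ≤ (x ^ 3)⁻¹ := by gcongr
    calc (X ^ 3)⁻¹ / 6 * br x ^ 5 ≤ (x ^ 3)⁻¹ / 6 * (6 * x ^ 5) := by gcongr
      _ = x ^ 2 := by field_simp
      _ ≤ 2 * x ^ 2 - 1 := by nlinarith

/-- Here `τ = X⁹` and `μ = X⁻³ = τ^{-1/3}`, which avoids fractional powers. The neighbourhood of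
radius `μ` around the degenerate point contributes at most `2μ`. On the rest of `[0, X]` the second
derivative is at least `τμ/6` in modulus, so that the second derivative test gives a multiple of
`(τμ)^{-1/2} = μ`. Beyond `X` the decay `x⁻⁴` of the amplitude gives at most `μ`. -/
lemma Amplitude.norm_kernel_le_of_pow (hc : Amplitude c c') {q X : ℝ} (hq : 0 ≤ q) (hX : 0 < X)
    (lam : ℝ) :
    ‖∫ x in Ioi (0 : ℝ), osc (fun x => lam * x + X ^ 9 * (br x)⁻¹) x * (ampl c q x : ℂ)‖
      ≤ 200 * (X ^ 3)⁻¹ := by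
  have hph := phase_kernel lam (X ^ 9)
  set φ : ℝ → ℝ := fun x => lam * x + X ^ 9 * (br x)⁻¹
  have hosc := hph.continuous_osc
  have hInt := hc.integrableOn hq hosc
  have hcont : Continuous fun x => osc φ x * (ampl c q x : ℂ) :=
    hosc.mul (Complex.continuous_ofReal.comp (hc.continuous_ampl hq))
  -- For `X³ ≤ 2` the trivial bound `π` suffices; otherwise `μ ≤ 1/2`, and the points `1/√2 ± μ` lie
  -- in `(0, X]`.
  rcases le_total (X ^ 3) 2 with h2 | h2
  · have h3 : ‖∫ x in Ioi (0 : ℝ), osc φ x * (ampl c q x : ℂ)‖ ≤ Real.pi := by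
      rw [← integral_univ_inv_one_add_sq]
      refine (norm_integral_le_integral_norm _).trans ?_
      refine (setIntegral_mono_on hInt.norm integrable_inv_one_add_sq.integrableOn
        measurableSet_Ioi fun x hx => hc.norm_osc_ampl_le hq φ (le_of_lt hx)).trans ?_
      exact setIntegral_le_integral integrable_inv_one_add_sq
        (Eventually.of_forall fun x => by positivity)
    have h4 : (2 : ℝ)⁻¹ ≤ (X ^ 3)⁻¹ := by gcongr
    linarith [Real.pi_lt_four]
  set μ : ℝ := (X ^ 3)⁻¹ with hμdef
  have hμ : 0 < μ := by positivity
  have hμ2 : μ ≤ 1 / 2 := by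
    rw [hμdef, one_div]; gcongr
  have hs7 : (7 / 10 : ℝ) ≤ √(1 / 2) := Real.le_sqrt_of_sq_le (by norm_num)
  have hs8 : √(1 / 2 : ℝ) ≤ 71 / 100 := by
    rw [Real.sqrt_le_left (by norm_num)]; norm_num
  have hX1 : 5 / 4 ≤ X := by
    by_contra h
    push Not at h
    have : X ^ 3 < (5 / 4) ^ 3 := by gcongr
    norm_num at this
    linarith
  set r := √(1 / 2 : ℝ)
  have hε : 0 < 5 / 2 * μ := by positivity
  -- Written in powers of `X`, this is `4/25 ≤ 1/6`.
  have hεμ : ((5 / 2 * μ) ^ 2)⁻¹ ≤ X ^ 9 * (μ / 6) := by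
    have e1 : ((5 / 2 * μ) ^ 2)⁻¹ = 4 / 25 * X ^ 6 := by rw [hμdef]; field_simp; norm_num
    have e2 : X ^ 9 * (μ / 6) = X ^ 6 / 6 := by rw [hμdef]; field_simp
    rw [e1, e2]
    have : 0 < X ^ 6 := by positivity
    linarith
  have hX9 : (0 : ℝ) < X ^ 9 := by positivity
  have hrX : r + μ ≤ X := by linarith
  have p1 : ‖∫ x in (0 : ℝ)..(r - μ), osc φ x * (ampl c q x : ℂ)‖ ≤ 4 * (8 * (5 / 2 * μ)) := by
    refine hc.norm_integral_piece_le hq hosc le_rfl (by linarith) fun x hx =>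
      hph.norm_integral_le_of_second_neg hx.1 hε fun y hy => ?_
    have := mul_le_mul_of_nonneg_left (second_deriv_lower_left hμ hy.1 (hy.2.trans hx.2)) hX9.le
    linarith
  have p2 : ‖∫ x in (r - μ)..(r + μ), osc φ x * (ampl c q x : ℂ)‖ ≤ 2 * μ := by
    have := intervalIntegral.norm_integral_le_of_norm_le_const (a := r - μ) (b := r + μ)
      (f := fun x => osc φ x * (ampl c q x : ℂ)) (C := 1) fun x hx => by
        rw [uIoc_of_le (by linarith)] at hx
        refine (hc.norm_osc_ampl_le hq φ (by linarith [hx.1])).trans (inv_le_one_of_one_le₀ ?_)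
        nlinarith [sq_nonneg x]
    refine this.trans (le_of_eq ?_)
    rw [abs_of_nonneg (by linarith)]; ring
  have p3 : ‖∫ x in (r + μ)..X, osc φ x * (ampl c q x : ℂ)‖ ≤ 4 * (8 * (5 / 2 * μ)) := by
    refine hc.norm_integral_piece_le hq hosc (by linarith) hrX fun x hx =>
      hph.norm_integral_le_of_second hx.1 hε fun y hy => ?_
    have := mul_le_mul_of_nonneg_left
      (second_deriv_lower_right hX hy.1 (hy.2.trans hx.2)) hX9.le
    linarith
  have p4 : ‖∫ x in Ioi X, osc φ x * (ampl c q x : ℂ)‖ ≤ μ := by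
    have hi : IntegrableOn (fun x : ℝ => x ^ (-4 : ℝ)) (Ioi X) :=
      integrableOn_Ioi_rpow_of_lt (by norm_num) hX
    have hv := integral_Ioi_rpow_of_lt (a := -4) (by norm_num) hX
    have hv2 : ∫ x in Ioi X, x ^ (-4 : ℝ) = μ / 3 := by
      rw [hv, hμdef, show (-4 + 1 : ℝ) = -(3 : ℕ) by norm_num, Real.rpow_neg hX.le, Real.rpow_natCast]
      push_cast; ring
    refine (norm_integral_le_integral_norm _).trans ?_
    refine (setIntegral_mono_on (hInt.mono_set (Ioi_subset_Ioi hX.le)).norm hi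
      measurableSet_Ioi fun x hx => ?_).trans (by rw [hv2]; linarith)
    have hx0 : 0 < x := hX.trans hx
    rw [norm_mul, norm_osc, one_mul, Complex.norm_real]
    refine (hc.abs_ampl_le hq hx0.le).trans ?_
    rw [show (-4 : ℝ) = -((4 : ℕ) : ℝ) by norm_num, Real.rpow_neg hx0.le, Real.rpow_natCast]
    gcongr
    nlinarith [sq_nonneg x, sq_nonneg (x ^ 2)]
  have e : ∫ x in Ioi (0 : ℝ), osc φ x * (ampl c q x : ℂ) =
      (∫ x in (0 : ℝ)..(r - μ), osc φ x * (ampl c q x : ℂ))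
      + (∫ x in (r - μ)..(r + μ), osc φ x * (ampl c q x : ℂ))
      + (∫ x in (r + μ)..X, osc φ x * (ampl c q x : ℂ))
      + ∫ x in Ioi X, osc φ x * (ampl c q x : ℂ) := by
    rw [intervalIntegral.integral_add_adjacent_intervals (hcont.intervalIntegrable _ _)
      (hcont.intervalIntegrable _ _), intervalIntegral.integral_add_adjacent_intervals
      (hcont.intervalIntegrable _ _) (hcont.intervalIntegrable _ _),
      intervalIntegral.integral_of_le hX.le, ← setIntegral_union Ioc_disjoint_Ioi_same
      measurableSet_Ioi (hInt.mono_set Ioc_subset_Ioi_self) (hInt.mono_set (Ioi_subset_Ioi hX.le)),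
      Ioc_union_Ioi_eq_Ioi hX.le]
  rw [e]
  refine (norm_add_le _ _).trans ((add_le_add ((norm_add_le _ _).trans (add_le_add
    ((norm_add_le _ _).trans (add_le_add p1 p2)) p3)) p4).trans ?_)
  linarith

lemma Amplitude.norm_kernel_le (hc : Amplitude c c') {q τ : ℝ} (hq : 0 ≤ q) (hτ : 0 < τ)
    (lam : ℝ) :
    ‖∫ x in Ioi (0 : ℝ), osc (fun x => lam * x + τ * (br x)⁻¹) x * (ampl c q x : ℂ)‖
      ≤ 200 * τ ^ (-(1 / 3) : ℝ) := by
  have hX : 0 < τ ^ (1 / 9 : ℝ) := Real.rpow_pos_of_pos hτ _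
  have h := hc.norm_kernel_le_of_pow hq hX lam
  have e1 : (τ ^ (1 / 9 : ℝ)) ^ 9 = τ := by
    rw [← Real.rpow_natCast, ← Real.rpow_mul hτ.le]; norm_num
  have e2 : ((τ ^ (1 / 9 : ℝ)) ^ 3)⁻¹ = τ ^ (-(1 / 3) : ℝ) := by
    rw [← Real.rpow_natCast, ← Real.rpow_mul hτ.le, ← Real.rpow_neg hτ.le]; norm_num
  rwa [e1, e2] at h

/-- The kernel on the whole line, for an even or odd amplitude and either sign of the phase. -/
lemma Amplitude.norm_kernel_line_le (hc : Amplitude c c') {q τ σ p : ℝ} (hq : 0 ≤ q) (hτ : 0 < τ)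
    (hσ : σ = 1 ∨ σ = -1) (hp : ∀ x, c (-x) = p * c x) (hp1 : |p| = 1) (lam : ℝ) :
    Integrable (fun x => osc (fun x => lam * x + σ * (τ * (br x)⁻¹)) x * (ampl c q x : ℂ)) ∧
    ‖∫ x, osc (fun x => lam * x + σ * (τ * (br x)⁻¹)) x * (ampl c q x : ℂ)‖
      ≤ 400 * τ ^ (-(1 / 3) : ℝ) := by
  have hsgn : ∀ lam, ‖∫ x in Ioi (0 : ℝ), osc (fun x => lam * x + σ * (τ * (br x)⁻¹)) x
      * (ampl c q x : ℂ)‖ ≤ 200 * τ ^ (-(1 / 3) : ℝ) := by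
    intro lam
    rcases hσ with rfl | rfl
    · simpa using hc.norm_kernel_le hq hτ lam
    · have h := hc.norm_kernel_le hq hτ (-lam)
      rw [← RCLike.norm_conj, ← integral_conj] at h
      refine le_trans (le_of_eq ?_) h
      congr 2; ext x
      rw [map_mul, Complex.conj_ofReal, osc, osc, ← Complex.exp_conj]
      congr 2
      simp
      ring
  have hcont : ∀ lam, Continuous (osc (fun x => lam * x + σ * (τ * (br x)⁻¹))) := fun lam => by
    have := (phase_kernel lam (σ * τ)).continuous_osc
    simpa only [mul_assoc] using this
  have hrefl : ∀ x, osc (fun x => lam * x + σ * (τ * (br x)⁻¹)) (-x) * (ampl c q (-x) : ℂ) =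
      (p : ℂ) * (osc (fun x => -lam * x + σ * (τ * (br x)⁻¹)) x * (ampl c q x : ℂ)) := by
    intro x
    have e1 : br (-x) = br x := by simp [br]
    have e2 : ampl c q (-x) = p * ampl c q x := by simp only [ampl, hp, neg_sq]; ring
    simp only [osc, e1, e2]
    push_cast
    rw [show (lam : ℂ) * -x = -lam * x by ring]
    ring
  have i1 := hc.integrableOn hq (hcont lam)
  have i2 := hc.integrableOn hq (hcont (-lam))
  have i3 : IntegrableOn (fun x => osc (fun x => lam * x + σ * (τ * (br x)⁻¹)) x
      * (ampl c q x : ℂ)) (Iic 0) := by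
    rw [← integrableOn_Ici_iff_integrableOn_Ioi] at i2
    have := i2.const_mul (p : ℂ)
    rw [← (Measure.measurePreserving_neg (volume : Measure ℝ)).integrableOn_comp_preimage
      (Homeomorph.neg ℝ).measurableEmbedding]
    have hpre : (Neg.neg : ℝ → ℝ) ⁻¹' Iic 0 = Ici 0 := by ext x; simp
    rw [hpre]
    refine this.congr (Eventually.of_forall fun x => ?_)
    exact (hrefl x).symm
  refine ⟨integrableOn_univ.1 (by rw [← Iic_union_Ioi]; exact i3.union i1), ?_⟩
  rw [← setIntegral_univ, ← Iic_union_Ioi (a := (0 : ℝ)),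
    setIntegral_union (Iic_disjoint_Ioi le_rfl) measurableSet_Ioi i3 i1]
  have e : ∫ x in Iic (0 : ℝ), osc (fun x => lam * x + σ * (τ * (br x)⁻¹)) x * (ampl c q x : ℂ) =
      p * ∫ x in Ioi (0 : ℝ), osc (fun x => -lam * x + σ * (τ * (br x)⁻¹)) x * (ampl c q x : ℂ) := by
    rw [← integral_const_mul, ← neg_zero, ← integral_comp_neg_Ioi]
    simp only [hrefl, neg_zero]
  rw [e]
  refine (norm_add_le _ _).trans ?_
  rw [norm_mul, Complex.norm_real, Real.norm_eq_abs, hp1, one_mul]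
  linarith [hsgn lam, hsgn (-lam)]

end Kernel

/-! ### Multipliers with a dispersive kernel -/

/-- The symbol of `Δ_{y,z}⁻²` at the frequency `l` in `z`. -/
def symLapInvSq (l : ℤ) (η : ℝ) : ℝ := ((4 * Real.pi ^ 2 * (η ^ 2 + (l : ℝ) ^ 2)) ^ 2)⁻¹

/-- The kernel in `y` of the multiplier `m(η) Δ_{y,z}⁻²` at the frequency `l` is bounded by `R`. -/
def KernelBound (l : ℤ) (R : ℝ) (m : ℝ → ℂ) : Prop :=
  Integrable (fun η => m η * (symLapInvSq l η : ℂ)) ∧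
    ∀ y : ℝ, ‖∫ η : ℝ, Complex.exp (2 * Real.pi * Complex.I * (η * y))
      * (m η * (symLapInvSq l η : ℂ))‖ ≤ R

lemma norm_exp_two_pi_I (η y : ℝ) : ‖Complex.exp (2 * Real.pi * Complex.I * (η * y))‖ = 1 := by
  rw [show (2 * Real.pi * Complex.I * (η * y) : ℂ) = ((2 * Real.pi * (η * y) : ℝ) : ℂ) * Complex.I by
    push_cast; ring, Complex.norm_exp_ofReal_mul_I]

lemma integrable_exp_mul {g : ℝ → ℂ} (hg : Integrable g) (y : ℝ) :
    Integrable fun η : ℝ => Complex.exp (2 * Real.pi * Complex.I * (η * y)) * g η :=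
  hg.bdd_mul (c := 1) (by fun_prop) (Eventually.of_forall fun η => (norm_exp_two_pi_I η y).le)

lemma KernelBound.const_mul {l : ℤ} {R : ℝ} {m : ℝ → ℂ} (h : KernelBound l R m) (a : ℂ) :
    KernelBound l (‖a‖ * R) (fun η => a * m η) := by
  refine ⟨(h.1.const_mul a).congr (Eventually.of_forall fun η => (mul_assoc _ _ _).symm), fun y => ?_⟩
  have e : (∫ η : ℝ, Complex.exp (2 * Real.pi * Complex.I * (η * y))
      * (a * m η * (symLapInvSq l η : ℂ))) = a * ∫ η : ℝ,
      Complex.exp (2 * Real.pi * Complex.I * (η * y)) * (m η * (symLapInvSq l η : ℂ)) := by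
    rw [← integral_const_mul]; congr 1; ext η; ring
  rw [e, norm_mul]
  exact mul_le_mul_of_nonneg_left (h.2 y) (norm_nonneg a)

lemma KernelBound.add {l : ℤ} {R R' : ℝ} {m m' : ℝ → ℂ} (h : KernelBound l R m)
    (h' : KernelBound l R' m') : KernelBound l (R + R') (fun η => m η + m' η) := by
  refine ⟨(h.1.add h'.1).congr (Eventually.of_forall fun η => (add_mul _ _ _).symm), fun y => ?_⟩
  have e : (∫ η : ℝ, Complex.exp (2 * Real.pi * Complex.I * (η * y))
      * ((m η + m' η) * (symLapInvSq l η : ℂ))) = (∫ η : ℝ,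
      Complex.exp (2 * Real.pi * Complex.I * (η * y)) * (m η * (symLapInvSq l η : ℂ))) + ∫ η : ℝ,
      Complex.exp (2 * Real.pi * Complex.I * (η * y)) * (m' η * (symLapInvSq l η : ℂ)) := by
    rw [← integral_add (integrable_exp_mul h.1 y) (integrable_exp_mul h'.1 y)]
    congr 1; ext η; ring
  rw [e]
  exact (norm_add_le _ _).trans (add_le_add (h.2 y) (h'.2 y))

lemma KernelBound.mono {l : ℤ} {R R' : ℝ} {m : ℝ → ℂ} (h : KernelBound l R m) (hR : R ≤ R') :
    KernelBound l R' m := ⟨h.1, fun y => (h.2 y).trans hR⟩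

/-- The symbol `c(η/|l|) e^{νΔt ± i √(β(β-1)) |l| |(η,l)|⁻¹ t}`, the sign being `σ`. -/
def dispSym (ν β t σ : ℝ) (l : ℤ) (c : ℝ → ℝ) (η : ℝ) : ℂ :=
  (c (η / |(l : ℝ)|) : ℂ) * Complex.exp ((((-(4 * Real.pi ^ 2 * ν) * (η ^ 2 + (l : ℝ) ^ 2) : ℝ) : ℂ)
    + Complex.I * ((σ * angFreq β η l : ℝ) : ℂ)) * t)

lemma one_le_abs_int {l : ℤ} (hl : l ≠ 0) : (1 : ℝ) ≤ |(l : ℝ)| := by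
  exact_mod_cast Int.one_le_abs hl

lemma sqrt_eq_mul_br {l : ℤ} (hl : l ≠ 0) (η : ℝ) :
    √(η ^ 2 + (l : ℝ) ^ 2) = |(l : ℝ)| * br (η / |(l : ℝ)|) := by
  have h1 := one_le_abs_int hl
  rw [br, ← Real.sqrt_sq (abs_nonneg (l : ℝ)), ← Real.sqrt_mul (sq_nonneg _), Real.sqrt_sq (abs_nonneg _)]
  congr 1
  rw [← sq_abs (l : ℝ)]
  field_simp
  ring

/-- The scaling `η = |l| x` gives `|l|` from the measure and `|l|⁻⁴` from `Δ⁻²`, together `|l|⁻³`.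
The phase becomes `τ (1+x²)^{-1/2}` with `τ` independent of `l`. The heat factor splits into `e^{-q}
≤ e^{-νt}` and the Gaussian `e^{-qx²}`, which joins the amplitude. -/
lemma Amplitude.kernelBound_dispSym {c c' : ℝ → ℝ} (hc : Amplitude c c') {ν β t σ p : ℝ} {l : ℤ}
    (hν : 0 < ν) (hβ : 2 ≤ |β|) (ht : 0 < t) (hσ : σ = 1 ∨ σ = -1) (hp : ∀ x, c (-x) = p * c x)
    (hp1 : |p| = 1) (hl : l ≠ 0) :
    KernelBound l (400 * (|(l : ℝ)| ^ 3)⁻¹ * dispRate ν β t) (dispSym ν β t σ l c) := by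
  have h1 := one_le_abs_int hl
  set L : ℝ := |(l : ℝ)| with hL
  have hL0 : 0 < L := by linarith
  have hl2 : (l : ℝ) ^ 2 = L ^ 2 := (sq_abs _).symm
  have hπ := Real.pi_gt_three
  have hs : 0 < √(β * (β - 1)) := Real.sqrt_pos.2 (beta_mul_pos hβ)
  set τ := √(β * (β - 1)) * t with hτd
  have hτ : 0 < τ := by positivity
  set q := 4 * Real.pi ^ 2 * ν * L ^ 2 * t with hqd
  have hq : 0 ≤ q := by positivity
  set K : ℝ := Real.exp (-q) * ((4 * Real.pi ^ 2 * L ^ 2) ^ 2)⁻¹ with hK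
  have key : ∀ y η : ℝ, Complex.exp (2 * Real.pi * Complex.I * (η * y))
      * (dispSym ν β t σ l c η * (symLapInvSq l η : ℂ)) = (K : ℂ) *
      (osc (fun x => 2 * Real.pi * L * y * x + σ * (τ * (br x)⁻¹)) (η / L)
        * (ampl c q (η / L) : ℂ)) := by
    intro y η
    have hb := (br_pos (η / L)).ne'
    have hx : η = L * (η / L) := by field_simp
    have ha : angFreq β η l = √(β * (β - 1)) * (br (η / L))⁻¹ := by
      rw [angFreq, symDz_mul_inv, sqrt_eq_mul_br hl]; congr 1; rw [← hL]; field_simp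
    rw [dispSym, ha, symLapInvSq, ampl, osc, ← hL, hl2]
    generalize hxx : η / L = x at *
    subst hx
    have e1 : ((4 * Real.pi ^ 2 * ((L * x) ^ 2 + L ^ 2)) ^ 2)⁻¹
        = ((4 * Real.pi ^ 2 * L ^ 2) ^ 2)⁻¹ * ((1 + x ^ 2) ^ 2)⁻¹ := by
      rw [← mul_inv, ← mul_pow]; congr 2; ring
    rw [e1, hK]
    push_cast
    have e2 : Complex.exp (2 * Real.pi * Complex.I * (L * x * y)) * Complex.exp
        ((-(4 * Real.pi ^ 2 * ν) * ((L * x) ^ 2 + L ^ 2) + Complex.I *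
          (σ * (√(β * (β - 1)) * (br x : ℂ)⁻¹))) * t)
        = Complex.exp (-q) * Complex.exp (Complex.I * (2 * Real.pi * L * y * x + σ * (τ * (br x : ℂ)⁻¹)))
          * Complex.exp (-q * x ^ 2) := by
      rw [← Complex.exp_add, ← Complex.exp_add, ← Complex.exp_add, hqd, hτd]
      congr 1; push_cast; ring
    linear_combination (c x : ℂ) * (((4 * Real.pi ^ 2 * L ^ 2) ^ 2)⁻¹ * ((1 + x ^ 2) ^ 2)⁻¹) * e2
  have hker := fun y => hc.norm_kernel_line_le (τ := τ) hq hτ hσ hp hp1 (2 * Real.pi * L * y)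
  refine ⟨?_, fun y => ?_⟩
  · have h := ((hker 0).1.comp_div hL0.ne').const_mul (K : ℂ)
    refine h.congr (Eventually.of_forall fun η => ?_)
    have := key 0 η
    simp only [Complex.ofReal_zero, mul_zero, Complex.exp_zero, one_mul] at this
    simp only [this, mul_zero]
  · rw [integral_congr_ae (Eventually.of_forall (key y)), integral_const_mul,
      Measure.integral_comp_div (fun x => osc (fun x => 2 * Real.pi * L * y * x
        + σ * (τ * (br x)⁻¹)) x * (ampl c q x : ℂ)) L, norm_mul, norm_smul, Complex.norm_real,
      Real.norm_of_nonneg (by positivity : 0 ≤ K), abs_of_pos hL0, Real.norm_of_nonneg hL0.le]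
    have hKL : K * L ≤ Real.exp (-ν * t) * (L ^ 3)⁻¹ := by
      have e1 : K * L = Real.exp (-q) * ((L ^ 3)⁻¹ * ((4 * Real.pi ^ 2) ^ 2)⁻¹) := by
        rw [hK]; field_simp
      have hπ2 : 1 ≤ 4 * Real.pi ^ 2 := by nlinarith
      have e2 : ((4 * Real.pi ^ 2) ^ 2)⁻¹ ≤ 1 := inv_le_one_of_one_le₀ (one_le_pow₀ hπ2)
      have e3 : Real.exp (-q) ≤ Real.exp (-ν * t) := by
        rw [Real.exp_le_exp, hqd]
        have : 1 ≤ 4 * Real.pi ^ 2 * L ^ 2 :=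
          one_le_mul_of_one_le_of_one_le hπ2 (one_le_pow₀ h1)
        nlinarith [mul_pos hν ht]
      rw [e1]
      calc _ ≤ Real.exp (-ν * t) * ((L ^ 3)⁻¹ * 1) := by gcongr
        _ = _ := by rw [mul_one]
    calc _ ≤ K * (L * (400 * τ ^ (-(1 / 3) : ℝ))) := by
          gcongr
          exact (hker y).2
      _ = (K * L) * (400 * τ ^ (-(1 / 3) : ℝ)) := by ring
      _ ≤ (Real.exp (-ν * t) * (L ^ 3)⁻¹) * (400 * τ ^ (-(1 / 3) : ℝ)) := by gcongr
      _ = _ := by rw [dispRate]; ring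

section Symbols

variable {ν β t : ℝ} {l : ℤ}

lemma expPlus_mul_eq_dispSym (c : ℝ → ℝ) (η : ℝ) :
    (c (η / |(l : ℝ)|) : ℂ) * expPlus ν β t η l = dispSym ν β t 1 l c η := by
  rw [dispSym, expPlus, symLplus_eq, one_mul]

lemma expMinus_mul_eq_dispSym (c : ℝ → ℝ) (η : ℝ) :
    (c (η / |(l : ℝ)|) : ℂ) * expMinus ν β t η l = dispSym ν β t (-1) l c η := by
  rw [dispSym, expMinus, symLminus_eq]; congr 3; push_cast; ring

lemma dispRate_nonneg (ν β : ℝ) (ht : 0 ≤ t) : 0 ≤ dispRate ν β t := by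
  unfold dispRate; positivity

lemma kernelBound_symC (hν : 0 < ν) (hβ : 2 ≤ |β|) (ht : 0 < t) (hl : l ≠ 0) :
    KernelBound l (400 * (|(l : ℝ)| ^ 3)⁻¹ * dispRate ν β t) (fun η => symC ν β t η l) := by
  have h := fun σ hσ => amplitude_one.kernelBound_dispSym (σ := σ) (p := 1) hν hβ ht hσ
    (fun x => by simp) (by simp) hl
  have h2 := ((h 1 (Or.inl rfl)).add (h (-1) (Or.inr rfl))).const_mul (1 / 2)
  convert h2 using 1
  · norm_num; ring
  · ext η; rw [symC, ← expPlus_mul_eq_dispSym, ← expMinus_mul_eq_dispSym]; push_cast; ring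

lemma Amplitude.kernelBound_sub_dispSym {c c' : ℝ → ℝ} (hc : Amplitude c c') {p a : ℝ}
    (hν : 0 < ν) (hβ : 2 ≤ |β|) (ht : 0 < t) (hp : ∀ x, c (-x) = p * c x)
    (hp1 : |p| = 1) (hl : l ≠ 0) (ha : |a| ≤ 2) :
    KernelBound l (2 * (400 * (|(l : ℝ)| ^ 3)⁻¹ * dispRate ν β t)) (fun η => Complex.I / 2 * (a : ℂ)
      * (c (η / |(l : ℝ)|) : ℂ) * (expPlus ν β t η l - expMinus ν β t η l)) := by
  have h := fun σ hσ => hc.kernelBound_dispSym (σ := σ) hν hβ ht hσ hp hp1 hl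
  have h2 := ((h 1 (Or.inl rfl)).add ((h (-1) (Or.inr rfl)).const_mul (-1))).const_mul
    (Complex.I / 2 * (a : ℂ))
  have hD := dispRate_nonneg ν β ht.le
  refine KernelBound.mono (R := ‖Complex.I / 2 * (a : ℂ)‖ * (400 * (|(l : ℝ)| ^ 3)⁻¹ * dispRate ν β t
    + ‖(-1 : ℂ)‖ * (400 * (|(l : ℝ)| ^ 3)⁻¹ * dispRate ν β t))) ?_ ?_
  · convert h2 using 2 with η
    rw [← expPlus_mul_eq_dispSym, ← expMinus_mul_eq_dispSym]; ring
  · have hR : 0 ≤ 400 * (|(l : ℝ)| ^ 3)⁻¹ * dispRate ν β t := by positivity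
    rw [norm_mul, norm_div, Complex.norm_I, Complex.norm_real, Real.norm_eq_abs, norm_neg, norm_one]
    norm_num
    nlinarith

/-- The square is `β/(β-1)`, which stays bounded for `|β| ≥ 2`; so the constants do not depend on
`β`. -/
lemma abs_sqrt_div_le (hβ : 2 ≤ |β|) : |√(β * (β - 1)) / (β - 1)| ≤ 2 := by
  have h := beta_mul_pos hβ
  refine abs_le_of_sq_le_sq ?_ (by norm_num)
  have h1 := beta_sub_one_ne hβ
  rw [div_pow, Real.sq_sqrt h.le, div_le_iff₀ (by positivity)]
  rcases le_abs.1 hβ with h | h <;> nlinarith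

lemma abs_div_sqrt_le (hβ : 2 ≤ |β|) : |(β - 1) / √(β * (β - 1))| ≤ 2 := by
  have h := beta_mul_pos hβ
  refine abs_le_of_sq_le_sq ?_ (by norm_num)
  rw [div_pow, Real.sq_sqrt h.le, div_le_iff₀ h]
  rcases le_abs.1 hβ with h | h <;> nlinarith

lemma kernelBound_symB (hν : 0 < ν) (hβ : 2 ≤ |β|) (ht : 0 < t) (hl : l ≠ 0) :
    KernelBound l (2 * (400 * (|(l : ℝ)| ^ 3)⁻¹ * dispRate ν β t)) (fun η => symB ν β t η l) := by
  have h := amplitude_inv_br.kernelBound_sub_dispSym (p := 1) hν hβ ht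
    (fun x => by simp [br]) (by simp) hl (abs_sqrt_div_le hβ)
  have hL := one_le_abs_int hl
  convert h using 2 with η
  rw [symB, mul_comm (symGrad η l)⁻¹, symDz_mul_inv, sqrt_eq_mul_br hl]
  congr 4
  field_simp

/-- The part of `symA` that is estimated without a further derivative. -/
def symALow (ν β t : ℝ) (l : ℤ) (η : ℝ) : ℂ := Complex.I / 2 * ((-((β - 1) / √(β * (β - 1))) : ℝ) : ℂ)
  * (((br (η / |(l : ℝ)|))⁻¹ : ℝ) : ℂ) * (expPlus ν β t η l - expMinus ν β t η l)

/-- The factor of `η / |l|` in the remaining part of `symA`. -/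
def symAHigh (ν β t : ℝ) (l : ℤ) (η : ℝ) : ℂ := Complex.I / 2 * ((-((β - 1) / √(β * (β - 1))) : ℝ) : ℂ)
  * (((η / |(l : ℝ)|) / br (η / |(l : ℝ)|) : ℝ) : ℂ) * (expPlus ν β t η l - expMinus ν β t η l)

/-- With `x = η/|l|` the unbounded factor is split as `√(1+x²) = 1/√(1+x²) + (x/√(1+x²)) · x`. Both
quotients are bounded monotone amplitudes of definite parity, and the remaining `x` is paid for by a
derivative in `y` of the data. Hence `u²_in` enters with five derivatives. -/
lemma symA_eq (hl : l ≠ 0) (η : ℝ) : symA ν β t η l =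
    symALow ν β t l η + symAHigh ν β t l η * ((η / |(l : ℝ)| : ℝ) : ℂ) := by
  have hL := one_le_abs_int hl
  have hπ := Real.pi_pos
  have e : symGrad η l * (symDz l)⁻¹ = br (η / |(l : ℝ)|) := by
    rw [symGrad, symDz, sqrt_eq_mul_br hl]; field_simp
  have hb : br (η / |(l : ℝ)|) = (br (η / |(l : ℝ)|))⁻¹
      + (η / |(l : ℝ)|) / br (η / |(l : ℝ)|) * (η / |(l : ℝ)|) := by
    have := br_sq (η / |(l : ℝ)|)
    have := br_pos (η / |(l : ℝ)|)
    generalize η / |(l : ℝ)| = x at *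
    field_simp
    linarith
  have hbc := congrArg (fun r : ℝ => (r : ℂ)) hb
  simp only [Complex.ofReal_add, Complex.ofReal_mul] at hbc
  rw [symA, e, symALow, symAHigh, Complex.ofReal_neg]
  linear_combination Complex.I / 2 * (((β - 1) / √(β * (β - 1)) : ℝ) : ℂ)
    * (expMinus ν β t η l - expPlus ν β t η l) * hbc

lemma kernelBound_symALow (hν : 0 < ν) (hβ : 2 ≤ |β|) (ht : 0 < t) (hl : l ≠ 0) :
    KernelBound l (2 * (400 * (|(l : ℝ)| ^ 3)⁻¹ * dispRate ν β t)) (symALow ν β t l) :=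
  amplitude_inv_br.kernelBound_sub_dispSym (p := 1) hν hβ ht
    (fun x => by simp [br]) (by simp) hl ((abs_neg _).trans_le (abs_div_sqrt_le hβ))

lemma kernelBound_symAHigh (hν : 0 < ν) (hβ : 2 ≤ |β|) (ht : 0 < t) (hl : l ≠ 0) :
    KernelBound l (2 * (400 * (|(l : ℝ)| ^ 3)⁻¹ * dispRate ν β t)) (symAHigh ν β t l) :=
  amplitude_div_br.kernelBound_sub_dispSym (p := -1) hν hβ ht
    (fun x => by simp [br, neg_div]) (by simp) hl ((abs_neg _).trans_le (abs_div_sqrt_le hβ))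

end Symbols

/-! ### Applying a multiplier to an integrable function -/

/-- `ψ` is integrable, and its inverse Fourier transform is bounded by `R`. -/
def InvBound (ψ : ℝ → ℂ) (R : ℝ) : Prop := Integrable ψ ∧ ∀ y, ‖𝓕⁻ ψ y‖ ≤ R

lemma InvBound.add {ψ ψ' : ℝ → ℂ} {R R' : ℝ} (h : InvBound ψ R) (h' : InvBound ψ' R') :
    InvBound (fun η => ψ η + ψ' η) (R + R') := by
  refine ⟨h.1.add h'.1, fun y => ?_⟩
  have e : 𝓕⁻ (fun η => ψ η + ψ' η) y = 𝓕⁻ ψ y + 𝓕⁻ ψ' y := by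
    rw [fourierInv_integral, fourierInv_integral, fourierInv_integral,
      ← integral_add (integrable_exp_mul h.1 y) (integrable_exp_mul h'.1 y)]
    congr 1; ext η; ring
  rw [e]
  exact (norm_add_le _ _).trans (add_le_add (h.2 y) (h'.2 y))

lemma InvBound.const_mul {ψ : ℝ → ℂ} {R : ℝ} (h : InvBound ψ R) (a : ℂ) :
    InvBound (fun η => a * ψ η) (‖a‖ * R) := by
  refine ⟨h.1.const_mul a, fun y => ?_⟩
  have e : 𝓕⁻ (fun η => a * ψ η) y = a * 𝓕⁻ ψ y := by
    rw [fourierInv_integral, fourierInv_integral, ← integral_const_mul]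
    congr 1; ext η; ring
  rw [e, norm_mul]
  exact mul_le_mul_of_nonneg_left (h.2 y) (norm_nonneg a)

lemma InvBound.congr {ψ ψ' : ℝ → ℂ} {R : ℝ} (h : InvBound ψ R) (h' : ∀ᵐ η, ψ η = ψ' η) :
    InvBound ψ' R := by
  refine ⟨h.1.congr h', fun y => ?_⟩
  have e : 𝓕⁻ ψ' y = 𝓕⁻ ψ y := by
    rw [fourierInv_integral, fourierInv_integral]
    exact integral_congr_ae (h'.mono fun η hη => by simp only [hη])
  rw [e]
  exact h.2 y

/-- By Fubini the inverse transform is the convolution of `h` with a kernel bounded by `R`. -/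
lemma KernelBound.invBound {l : ℤ} {R : ℝ} {m h : ℝ → ℂ} (hm : KernelBound l R m)
    (hh : Integrable h) :
    InvBound (fun η => m η * (symLapInvSq l η : ℂ) * 𝓕 h η) (R * ∫ s, ‖h s‖) := by
  have hcont : Continuous (𝓕 h) := by
    refine VectorFourier.fourierIntegral_continuous Real.continuous_fourierChar ?_ hh
    exact continuous_inner
  have hbd : ∀ η, ‖𝓕 h η‖ ≤ ∫ s, ‖h s‖ := fun η => by
    rw [fourier_integral]
    refine (norm_integral_le_integral_norm _).trans (le_of_eq ?_)
    congr 1; ext s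
    rw [norm_mul, show (-(2 * Real.pi * Complex.I * (s * η)) : ℂ)
      = 2 * Real.pi * Complex.I * ((s : ℝ) * ((-η : ℝ) : ℂ)) by push_cast; ring,
      norm_exp_two_pi_I, one_mul]
  refine ⟨hm.1.mul_bdd (c := ∫ s, ‖h s‖) hcont.aestronglyMeasurable
    (Eventually.of_forall hbd), fun y => ?_⟩
  have hprod : Integrable (Function.uncurry fun η s : ℝ =>
      Complex.exp (2 * Real.pi * Complex.I * (η * ((y - s : ℝ) : ℂ)))
        * (m η * (symLapInvSq l η : ℂ)) * h s) (volume.prod volume) := by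
    have h1 := hm.1.mul_prod hh
    refine (h1.bdd_mul (c := 1) (f := fun q : ℝ × ℝ => Complex.exp (2 * Real.pi * Complex.I *
      (q.1 * ((y - q.2 : ℝ) : ℂ)))) (by fun_prop)
      (Eventually.of_forall fun q => (norm_exp_two_pi_I q.1 (y - q.2)).le)).congr
      (Eventually.of_forall fun q => ?_)
    simp only [Function.uncurry]; ring
  have e : 𝓕⁻ (fun η => m η * (symLapInvSq l η : ℂ) * 𝓕 h η) y =
      ∫ s, (∫ η : ℝ, Complex.exp (2 * Real.pi * Complex.I * (η * ((y - s : ℝ) : ℂ)))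
        * (m η * (symLapInvSq l η : ℂ))) * h s := by
    rw [fourierInv_integral]
    calc _ = ∫ η : ℝ, ∫ s : ℝ, Complex.exp (2 * Real.pi * Complex.I * (η * ((y - s : ℝ) : ℂ)))
          * (m η * (symLapInvSq l η : ℂ)) * h s := by
          congr 1; ext η
          rw [fourier_integral, ← integral_const_mul, ← integral_const_mul]
          congr 1; ext s
          have : Complex.exp (2 * Real.pi * Complex.I * (η * ((y - s : ℝ) : ℂ)))
              = Complex.exp (2 * Real.pi * Complex.I * (η * y))
                * Complex.exp (-(2 * Real.pi * Complex.I * (s * η))) := by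
            rw [← Complex.exp_add]; congr 1; push_cast; ring
          rw [this]; ring
      _ = _ := by
          rw [integral_integral_swap hprod]
          congr 1; ext s
          rw [integral_mul_const]
  rw [e]
  refine (norm_integral_le_integral_norm _).trans ?_
  rw [← integral_const_mul]
  refine integral_mono_of_nonneg (Eventually.of_forall fun _ => norm_nonneg _)
    (hh.norm.const_mul R) (Eventually.of_forall fun s => ?_)
  simp only [norm_mul]
  exact mul_le_mul_of_nonneg_right (hm.2 (y - s)) (norm_nonneg _)

lemma InvBound.ae_norm_le {V ψ : ℝ → ℂ} {R : ℝ} (h : InvBound ψ R) (hV : MemLp V 2)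
    (he : ∀ᵐ η, ftL V η = ψ η) : ∀ᵐ y, ‖V y‖ ≤ R := by
  filter_upwards [ae_eq_fourierInv hV h.1 he] with y hy
  rw [hy]; exact h.2 y

/-! ### Integrability of the modes of the data -/

lemma lintegral_enorm_mode_le {f : Dom → ℂ} (hf : Continuous f) (k l : ℤ) :
    ∫⁻ y, ‖mode f k l y‖ₑ ≤ eLpNorm f 1 (volume : Measure Dom) := by
  rw [eLpNorm_one_eq_lintegral_enorm, ← lintegral_pull]
  calc ∫⁻ y, ‖mode f k l y‖ₑ ≤ ∫⁻ y, ∫⁻ q : Torus × Torus, ‖f (q.1, y, q.2)‖ₑ := by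
        refine lintegral_mono fun y => ?_
        rw [mode_eq_of_continuous hf]
        refine (enorm_integral_le_lintegral_enorm _).trans (le_of_eq ?_)
        congr 1; ext q
        rw [enorm_mul, enorm_mul, enorm_fourier_apply, enorm_fourier_apply, one_mul, one_mul]
    _ = _ := by
        refine (lintegral_prod (μ := (volume : Measure ℝ)) (ν := (volume : Measure (Torus × Torus)))
          (fun q : ℝ × (Torus × Torus) => ‖f (q.2.1, q.1, q.2.2)‖ₑ) ?_).symm
        have h2 : Continuous fun q : ℝ × (Torus × Torus) => ‖f (q.2.1, q.1, q.2.2)‖ₑ := by fun_prop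
        exact h2.aemeasurable

lemma Smooth.continuous_zeroX {f : Dom → ℂ} (h : Smooth f) : Continuous (zeroX f) := by
  have hc := h.continuous
  have h1 : Continuous (Function.uncurry fun (p : Dom) (x : Torus) => f (x, p.2.1, p.2.2)) := by
    simp only [Function.uncurry_def]; fun_prop
  have h2 := continuous_parametric_integral_of_continuous (μ := (volume : Measure Torus)) h1
    isCompact_univ
  simp only [setIntegral_univ] at h2
  exact h2

lemma Smooth.continuous_mode {f : Dom → ℂ} (h : Smooth f) (k l : ℤ) : Continuous (mode f k l) :=
  continuous_iff_continuousAt.2 fun y => (h.hasDerivAt_mode k l y).continuousAt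

lemma Smooth.continuous_doubleZero {f : Dom → ℂ} (h : Smooth f) : Continuous (doubleZero f) := by
  rw [show doubleZero f = fun p => mode f 0 0 p.2.1 from funext (doubleZero_eq f)]
  exact (h.continuous_mode 0 0).comp (by fun_prop)

lemma Smooth.mode_simpleZero {f : Dom → ℂ} (h : Smooth f) {l : ℤ} (hl : l ≠ 0) (y : ℝ) :
    mode (simpleZero f) 0 l y = mode f 0 l y := by
  have hd := h.continuous_doubleZero
  have e : simpleZero f = fun p => zeroX f p + (-1) * doubleZero f p := by
    ext p; simp only [simpleZero]; ring
  rw [e, mode_add_of_continuous (g := fun p => (-1) * doubleZero f p) h.continuous_zeroX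
    (by fun_prop), mode_const_mul, mode_doubleZero, mode_zeroX_of_integrable
    (integrable_slice h.continuous y)]
  simp [hl]

lemma Smooth.lintegral_enorm_mode_le_simpleZero {f : Dom → ℂ} (h : Smooth f) {l : ℤ} (hl : l ≠ 0) :
    ∫⁻ y, ‖mode f 0 l y‖ₑ ≤ eLpNorm (simpleZero f) 1 (volume : Measure Dom) := by
  simp only [← h.mode_simpleZero hl]
  exact lintegral_enorm_mode_le (h.continuous_zeroX.sub h.continuous_doubleZero) 0 l

lemma Smooth.mode_iterate_dy {f : Dom → ℂ} (h : Smooth f) (k l : ℤ) (a : ℕ) :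
    mode (Couette.dy^[a] f) k l = iteratedDeriv a (mode f k l) := by
  induction a with
  | zero => simp
  | succ n ih =>
    rw [iteratedDeriv_succ, ← ih, Function.iterate_succ_apply']
    exact funext fun y => (((h.iterate_dy n).hasDerivAt_mode k l y).deriv).symm

lemma Smooth.mode_iterate_dz {f : Dom → ℂ} (h : Smooth f) (k l : ℤ) (b : ℕ) (y : ℝ) :
    mode (Couette.dz^[b] f) k l y = (2 * Real.pi * Complex.I * l) ^ b * mode f k l y := by
  induction b with
  | zero => simp
  | succ n ih => rw [Function.iterate_succ_apply', (h.iterate_dz n).mode_dz, ih]; ring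

lemma Smooth.mode_iterate {f : Dom → ℂ} (h : Smooth f) (k l : ℤ) (a b : ℕ) (y : ℝ) :
    mode (Couette.dy^[a] (Couette.dz^[b] f)) k l y =
      (2 * Real.pi * Complex.I * l) ^ b * iteratedDeriv a (mode f k l) y := by
  rw [(h.iterate_dz b).mode_iterate_dy, funext (h.mode_iterate_dz k l b),
    iteratedDeriv_const_mul_field]

lemma Smooth.contDiff_mode {f : Dom → ℂ} (h : Smooth f) (k l : ℤ) (N : ℕ∞) :
    ContDiff ℝ N (mode f k l) :=
  contDiff_of_differentiable_iteratedDeriv fun m _ => by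
    rw [← h.mode_iterate_dy]
    exact fun y => ((h.iterate_dy m).hasDerivAt_mode k l y).differentiableAt

lemma eLpNorm_le_wm1Norm {m a b : ℕ} (hab : a + b ≤ m) (f : Dom → ℂ) :
    eLpNorm (Couette.dy^[a] (Couette.dz^[b] f)) 1 (volume : Measure Dom) ≤ wm1Norm m f :=
  Finset.single_le_sum (f := fun ab : ℕ × ℕ => eLpNorm (Couette.dy^[ab.1] (Couette.dz^[ab.2] f)) 1
    (volume : Measure Dom)) (fun _ _ => zero_le) (a := (a, b)) (by
      simp only [Finset.mem_filter, Finset.mem_product, Finset.mem_range]; omega)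

lemma wm1Norm_mono {m n : ℕ} (hmn : m ≤ n) (f : Dom → ℂ) : wm1Norm m f ≤ wm1Norm n f := by
  refine Finset.sum_le_sum_of_subset fun ab h => ?_
  simp only [Finset.mem_filter, Finset.mem_product, Finset.mem_range] at h ⊢
  omega

/-- These are the derivatives that occur in `∂_y^a Δ² = ∂_y^a (∂_y⁴ + 2∂_y²∂_z² + ∂_z⁴)`. Their
multi-indices are distinct, so one copy of the norm bounds the sum. -/
lemma eLpNorm_add_le_wm1Norm (a : ℕ) (f : Dom → ℂ) :
    eLpNorm (Couette.dy^[a + 4] (Couette.dz^[0] f)) 1 (volume : Measure Dom)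
      + (eLpNorm (Couette.dy^[a + 2] (Couette.dz^[2] f)) 1 (volume : Measure Dom)
      + eLpNorm (Couette.dy^[a] (Couette.dz^[4] f)) 1 (volume : Measure Dom)) ≤ wm1Norm (a + 4) f := by
  have h : ∑ ab ∈ ({(a + 4, 0), (a + 2, 2), (a, 4)} : Finset (ℕ × ℕ)),
      eLpNorm (Couette.dy^[ab.1] (Couette.dz^[ab.2] f)) 1 (volume : Measure Dom) ≤ wm1Norm (a + 4) f := by
    refine Finset.sum_le_sum_of_subset fun ab h => ?_
    simp only [Finset.mem_insert, Finset.mem_singleton] at h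
    simp only [Finset.mem_filter, Finset.mem_product, Finset.mem_range]
    rcases h with rfl | rfl | rfl <;> simp
  rwa [Finset.sum_insert (by simp), Finset.sum_insert (by simp), Finset.sum_singleton] at h

lemma fourier_add_const_mul {f g h : ℝ → ℂ} (hf : Integrable f) (hg : Integrable g)
    (hh : Integrable h) (c d : ℂ) (η : ℝ) :
    𝓕 (fun y : ℝ => (f y + (c * g y + d * h y) : ℂ)) η = 𝓕 f η + (c * 𝓕 g η + d * 𝓕 h η) := by
  have hexp : ∀ s : ℝ, (-(2 * Real.pi * Complex.I * (s * η)) : ℂ)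
      = 2 * Real.pi * Complex.I * (s * ((-η : ℝ) : ℂ)) := fun s => by push_cast; ring
  have f1 := integrable_exp_mul hf (-η)
  have f2 := (integrable_exp_mul hg (-η)).const_mul c
  have f3 := (integrable_exp_mul hh (-η)).const_mul d
  simp only [fourier_integral, hexp]
  rw [← integral_const_mul, ← integral_const_mul, ← integral_add f2 f3, ← integral_add f1]
  · refine integral_congr_ae (Eventually.of_forall fun s => ?_)
    ring
  · exact f2.add f3

/-- If `f̃₀` is in `W^{a+4,1}`, then `∂_y^a Δ_{y,z}² f` has an integrable mode of frequency `(0, l)`. -/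
lemma Smooth.exists_laplacian_sq {f : Dom → ℂ} (h : Smooth f) (hf : MemLp f 2 (volume : Measure Dom))
    {l : ℤ} (hl : l ≠ 0) (a : ℕ) (hW : wm1Norm (a + 4) (simpleZero f) ≠ ⊤) :
    ∃ g : ℝ → ℂ, Integrable g ∧ ∫ s, ‖g s‖ ≤ 2 * (wm1Norm (a + 4) (simpleZero f)).toReal ∧
      ∀ᵐ η : ℝ, 𝓕 g η = (2 * Real.pi * Complex.I * η) ^ a
        * ((((4 * Real.pi ^ 2 * (η ^ 2 + (l : ℝ) ^ 2)) ^ 2 : ℝ) : ℂ) * fhat f 0 η l) := by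
  set D : ℕ → ℕ → Dom → ℂ := fun i j => Couette.dy^[i] (Couette.dz^[j] f) with hD
  have hDs : ∀ i j, Smooth (D i j) := fun i j => (h.iterate_dz j).iterate_dy i
  have hle : ∀ i j, ∫⁻ y, ‖mode (D i j) 0 l y‖ₑ ≤
      eLpNorm (Couette.dy^[i] (Couette.dz^[j] (simpleZero f))) 1 (volume : Measure Dom) := fun i j => by
    rw [h.iterate_simpleZero]; exact (hDs i j).lintegral_enorm_mode_le_simpleZero hl
  have hfin : ∀ i j, i + j ≤ a + 4 → ∫⁻ y, ‖mode (D i j) 0 l y‖ₑ ≠ ⊤ := fun i j hij =>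
    ne_top_of_le_ne_top hW ((hle i j).trans (eLpNorm_le_wm1Norm hij _))
  have hInt : ∀ i j, i + j ≤ a + 4 → Integrable (mode (D i j) 0 l) := fun i j hij =>
    ⟨((hDs i j).continuous_mode 0 l).aestronglyMeasurable, (hfin i j hij).lt_top⟩
  have hit : ∀ n : ℕ, (n : ℕ∞) ≤ ((a + 4 : ℕ) : ℕ∞) → Integrable (iteratedDeriv n (mode f 0 l)) := by
    intro n hn
    have := hInt n 0 (by rw [add_zero]; exact_mod_cast hn)
    rwa [hD, show mode (Couette.dy^[n] (Couette.dz^[0] f)) 0 l = iteratedDeriv n (mode f 0 l) from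
      h.mode_iterate_dy 0 l n] at this
  have hF : ∀ n : ℕ, n ≤ a + 4 → ∀ η : ℝ, 𝓕 (iteratedDeriv n (mode f 0 l)) η =
      (2 * Real.pi * Complex.I * η) ^ n * 𝓕 (mode f 0 l) η := fun n hn η =>
    congrFun (Real.fourier_iteratedDeriv (h.contDiff_mode 0 l _) hit (by exact_mod_cast hn)) η
  have i1 := hInt (a + 4) 0 (by omega)
  have i2 := hInt (a + 2) 2 (by omega)
  have i3 := hInt a 4 (by omega)
  -- The mode of `∂_y^a Δ_{y,z}² f`; the coefficient of the mixed derivative is responsible for the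
  -- constant `2`.
  refine ⟨fun y => mode (D (a + 4) 0) 0 l y + (2 * mode (D (a + 2) 2) 0 l y + mode (D a 4) 0 l y),
    i1.add ((i2.const_mul 2).add i3), ?_, ?_⟩
  · have hn : ∀ i j, i + j ≤ a + 4 → ∫ y, ‖mode (D i j) 0 l y‖ ≤
        (eLpNorm (Couette.dy^[i] (Couette.dz^[j] (simpleZero f))) 1 (volume : Measure Dom)).toReal := fun i j hij => by
      rw [integral_norm_eq_lintegral_enorm (hInt i j hij).1]
      exact ENNReal.toReal_mono (ne_top_of_le_ne_top hW (eLpNorm_le_wm1Norm hij _)) (hle i j)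
    have hne : ∀ i j, i + j ≤ a + 4 →
        eLpNorm (Couette.dy^[i] (Couette.dz^[j] (simpleZero f))) 1 (volume : Measure Dom) ≠ ⊤ := fun i j hij =>
      ne_top_of_le_ne_top hW (eLpNorm_le_wm1Norm hij _)
    have hsum := ENNReal.toReal_mono hW (eLpNorm_add_le_wm1Norm a (simpleZero f))
    rw [ENNReal.toReal_add (hne _ _ (by omega)) (ENNReal.add_ne_top.2 ⟨hne _ _ (by omega),
      hne _ _ (by omega)⟩), ENNReal.toReal_add (hne _ _ (by omega)) (hne _ _ (by omega))] at hsum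
    have n1 := hn (a + 4) 0 (by omega)
    have n2 := hn (a + 2) 2 (by omega)
    have n3 := hn a 4 (by omega)
    have p1 : 0 ≤ ∫ y, ‖mode (D (a + 4) 0) 0 l y‖ := integral_nonneg fun _ => norm_nonneg _
    have p3 : 0 ≤ ∫ y, ‖mode (D a 4) 0 l y‖ := integral_nonneg fun _ => norm_nonneg _
    have i23 : Integrable fun y => 2 * ‖mode (D (a + 2) 2) 0 l y‖ + ‖mode (D a 4) 0 l y‖ :=
      (i2.norm.const_mul 2).add i3.norm
    calc _ ≤ ∫ y, (‖mode (D (a + 4) 0) 0 l y‖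
          + (2 * ‖mode (D (a + 2) 2) 0 l y‖ + ‖mode (D a 4) 0 l y‖)) := by
          refine integral_mono (i1.add ((i2.const_mul 2).add i3)).norm (i1.norm.add i23) fun y => ?_
          refine (norm_add_le _ _).trans (add_le_add le_rfl ((norm_add_le _ _).trans ?_))
          rw [norm_mul]; norm_num
      _ = (∫ y, ‖mode (D (a + 4) 0) 0 l y‖) + (2 * (∫ y, ‖mode (D (a + 2) 2) 0 l y‖)
          + ∫ y, ‖mode (D a 4) 0 l y‖) := by
          rw [integral_add i1.norm i23, integral_add (i2.norm.const_mul 2) i3.norm,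
            integral_const_mul]
      _ ≤ _ := by linarith
  · filter_upwards [ftL_eq_fourier (memLp_mode hf 0 l) (hit 0 (by simp))] with η hη
    rw [fhat_eq_ftL, hη]
    have e : (fun y => mode (D (a + 4) 0) 0 l y + (2 * mode (D (a + 2) 2) 0 l y + mode (D a 4) 0 l y))
        = fun y : ℝ => iteratedDeriv (a + 4) (mode f 0 l) y +
          (2 * (2 * Real.pi * Complex.I * l) ^ 2 * iteratedDeriv (a + 2) (mode f 0 l) y
          + (2 * Real.pi * Complex.I * l) ^ 4 * iteratedDeriv a (mode f 0 l) y) := by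
      ext y; simp only [hD, h.mode_iterate]; ring
    rw [e, fourier_add_const_mul (hit (a + 4) le_rfl)
      (hit (a + 2) (by exact_mod_cast (by omega : a + 2 ≤ a + 4)))
      (hit a (by exact_mod_cast (by omega : a ≤ a + 4))), hF _ le_rfl, hF _ (by omega), hF _ (by omega)]
    push_cast
    have hI : Complex.I ^ 2 = -1 := Complex.I_sq
    have hI4 : Complex.I ^ 4 = 1 := Complex.I_pow_four
    simp only [pow_add, mul_pow, hI, hI4]
    ring

lemma symLapInvSq_mul {l : ℤ} (hl : l ≠ 0) (η : ℝ) :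
    (symLapInvSq l η : ℂ) * (((4 * Real.pi ^ 2 * (η ^ 2 + (l : ℝ) ^ 2)) ^ 2 : ℝ) : ℂ) = 1 := by
  have hπ := Real.pi_pos
  have hl2 : (0 : ℝ) < (l : ℝ) ^ 2 := by positivity
  have : (4 * Real.pi ^ 2 * (η ^ 2 + (l : ℝ) ^ 2)) ^ 2 ≠ 0 := by positivity
  rw [symLapInvSq, ← Complex.ofReal_mul, inv_mul_cancel₀ this, Complex.ofReal_one]

/-- Inserting `Δ⁻²Δ²` spends four derivatives of `f` on the decay of the kernel. -/
lemma KernelBound.invBound_fhat {l : ℤ} {R : ℝ} {m : ℝ → ℂ} (hm : KernelBound l R m) (hR : 0 ≤ R)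
    (hl : l ≠ 0) {f : Dom → ℂ} (h : Smooth f) (hf : MemLp f 2 (volume : Measure Dom))
    (hW : wm1Norm 4 (simpleZero f) ≠ ⊤) : InvBound (fun η => m η * fhat f 0 η l)
      (2 * R * (wm1Norm 4 (simpleZero f)).toReal) := by
  obtain ⟨g, hg, hn, he⟩ := h.exists_laplacian_sq hf hl 0 hW
  have h1 := hm.invBound hg
  refine InvBound.congr (ψ := fun η => m η * (symLapInvSq l η : ℂ) * 𝓕 g η)
    ⟨h1.1, fun y => (h1.2 y).trans ?_⟩ ?_
  · calc _ ≤ R * (2 * (wm1Norm 4 (simpleZero f)).toReal) := by gcongr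
      _ = _ := by ring
  · filter_upwards [he] with η hη
    rw [hη]
    linear_combination m η * fhat f 0 η l * symLapInvSq_mul hl η

/-- The additional factor `η` is a fifth derivative of `f`; dividing by `2π|l| ≥ 1` costs nothing.
-/
lemma KernelBound.invBound_mul_fhat {l : ℤ} {R : ℝ} {m : ℝ → ℂ} (hm : KernelBound l R m)
    (hR : 0 ≤ R) (hl : l ≠ 0) {f : Dom → ℂ} (h : Smooth f) (hf : MemLp f 2 (volume : Measure Dom))
    (hW : wm1Norm 5 (simpleZero f) ≠ ⊤) :
    InvBound (fun η => m η * (((η / |(l : ℝ)| : ℝ) : ℂ) * fhat f 0 η l))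
      (2 * R * (wm1Norm 5 (simpleZero f)).toReal) := by
  obtain ⟨g, hg, hn, he⟩ := h.exists_laplacian_sq hf hl 1 hW
  have hL := one_le_abs_int hl
  have hπ := Real.pi_gt_three
  have h1 := (hm.invBound hg).const_mul (2 * Real.pi * Complex.I * ((|(l : ℝ)| : ℝ) : ℂ))⁻¹
  refine InvBound.congr (ψ := fun η => (2 * Real.pi * Complex.I * ((|(l : ℝ)| : ℝ) : ℂ))⁻¹ *
    (m η * (symLapInvSq l η : ℂ) * 𝓕 g η)) ⟨h1.1, fun y => (h1.2 y).trans ?_⟩ ?_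
  · have hc : ‖(2 * Real.pi * Complex.I * ((|(l : ℝ)| : ℝ) : ℂ))⁻¹‖ ≤ 1 := by
      rw [norm_inv]
      refine inv_le_one_of_one_le₀ ?_
      simp only [norm_mul, Complex.norm_I, Complex.norm_real, Real.norm_eq_abs, abs_abs]
      rw [abs_of_pos Real.pi_pos]
      norm_num
      nlinarith
    have h0 : 0 ≤ R * ∫ s, ‖g s‖ := mul_nonneg hR (integral_nonneg fun _ => norm_nonneg _)
    calc _ ≤ 1 * (R * ∫ s, ‖g s‖) := by gcongr
      _ ≤ 1 * (R * (2 * (wm1Norm 5 (simpleZero f)).toReal)) := by gcongr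
      _ = _ := by ring
  · filter_upwards [he] with η hη
    have hL0 : ((|(l : ℝ)| : ℝ) : ℂ) ≠ 0 := by
      rw [Complex.ofReal_ne_zero]; positivity
    have hπ0 : (Real.pi : ℂ) ≠ 0 := by exact_mod_cast Real.pi_ne_zero
    rw [hη, Complex.ofReal_div]
    have e : (2 * Real.pi * Complex.I * ((|(l : ℝ)| : ℝ) : ℂ))⁻¹ * (2 * Real.pi * Complex.I * η) ^ 1
        = (η : ℂ) / ((|(l : ℝ)| : ℝ) : ℂ) := by
      field_simp
    linear_combination m η * (symLapInvSq l η : ℂ) *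
      ((((4 * Real.pi ^ 2 * (η ^ 2 + (l : ℝ) ^ 2)) ^ 2 : ℝ) : ℂ) * fhat f 0 η l) * e
      + m η * ((η : ℂ) / ((|(l : ℝ)| : ℝ) : ℂ)) * fhat f 0 η l * symLapInvSq_mul hl η

/-! ### Sup bound from bounds of the modes -/

/-- `∑ |l|⁻³` over the non-zero integers. -/
def cubeSum : ℝ := ∑' l : ℤ, (|(l : ℝ)| ^ 3)⁻¹

lemma summable_inv_cube : Summable fun l : ℤ => (|(l : ℝ)| ^ 3)⁻¹ := by
  refine (Real.summable_abs_int_rpow (b := 3) (by norm_num)).congr fun l => ?_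
  rw [Real.rpow_neg (abs_nonneg _)]; norm_cast

lemma cubeSum_nonneg : 0 ≤ cubeSum := tsum_nonneg fun _ => by positivity

lemma integral_fourier_mul_fourier (k l j : ℤ) :
    ∫ q : Torus × Torus, (fourier (-k) q.1 * fourier (-l) q.2 * fourier j q.2 : ℂ)
      = if k = 0 ∧ l = j then 1 else 0 := by
  have e : ∀ q : Torus × Torus, (fourier (-k) q.1 * fourier (-l) q.2 * fourier j q.2 : ℂ)
      = fourier (-k) q.1 * fourier (-l + j) q.2 := fun q => by rw [fourier_add, mul_assoc]
  simp only [e]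
  refine (integral_prod_mul (μ := (volume : Measure Torus)) (ν := (volume : Measure Torus))
    (fun x => (fourier (-k) x : ℂ)) (fun z => (fourier (-l + j) z : ℂ))).trans ?_
  rw [integral_fourier_torus, integral_fourier_torus]
  by_cases hk : k = 0 <;> by_cases hl : l = j <;>
    simp [hk, hl, neg_add_eq_zero]

/-- A square integrable function of `(x, z)` with absolutely summable Fourier coefficients, supported
on `k = 0`, is bounded by the sum of their absolute values. -/
lemma ae_norm_le_of_fourier {V : Torus × Torus → ℂ} (hV : MemLp V 2 volume) {a : ℤ → ℂ} {b : ℤ → ℝ}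
    (hb : Summable b) (hab : ∀ l, ‖a l‖ ≤ b l)
    (h : ∀ k l : ℤ, ∫ q, fourier (-k) q.1 * fourier (-l) q.2 * V q = if k = 0 then a l else 0) :
    ∀ᵐ q, ‖V q‖ ≤ ∑' l, b l := by
  have hbound : ∀ (l : ℤ) (q : Torus × Torus), ‖a l * fourier l q.2‖ ≤ b l := fun l q => by
    rw [norm_mul, norm_fourier_apply, mul_one]; exact hab l
  set G : Torus × Torus → ℂ := fun q => ∑' l, a l * fourier l q.2 with hG
  have hGc : Continuous G := continuous_tsum (fun l => by fun_prop) hb hbound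
  have hGm : MemLp G 2 volume := by
    refine MemLp.of_bound hGc.aestronglyMeasurable (∑' l, b l) (Eventually.of_forall fun q => ?_)
    exact tsum_of_norm_bounded hb.hasSum (hbound · q)
  have hGi : ∀ k l : ℤ, ∫ q, fourier (-k) q.1 * fourier (-l) q.2 * G q = if k = 0 then a l else 0 := by
    intro k l
    have hcont : ∀ j : ℤ, Continuous fun q : Torus × Torus =>
        (fourier (-k) q.1 * fourier (-l) q.2 * (a j * fourier j q.2) : ℂ) := fun j => by fun_prop
    have hnorm : ∀ (j : ℤ) (q : Torus × Torus),
        ‖(fourier (-k) q.1 * fourier (-l) q.2 * (a j * fourier j q.2) : ℂ)‖ ≤ b j := fun j q => by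
      rw [norm_mul, norm_mul, norm_fourier_apply, norm_fourier_apply, one_mul, one_mul]
      exact hbound j q
    have hs := hasSum_integral_of_dominated_convergence (μ := (volume : Measure (Torus × Torus)))
      (F := fun (j : ℤ) (q : Torus × Torus) =>
        (fourier (-k) q.1 * fourier (-l) q.2 * (a j * fourier j q.2) : ℂ))
      (f := fun q => fourier (-k) q.1 * fourier (-l) q.2 * G q) (fun j _ => b j)
      (fun j => (hcont j).aestronglyMeasurable)
      (fun j => Eventually.of_forall (hnorm j)) (Eventually.of_forall fun _ => hb)
      (integrable_const _) (Eventually.of_forall fun q =>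
        ((Summable.of_norm_bounded hb (hbound · q)).hasSum).mul_left _)
    have e : ∀ j : ℤ, ∫ q : Torus × Torus,
        (fourier (-k) q.1 * fourier (-l) q.2 * (a j * fourier j q.2) : ℂ)
          = if j = l then (if k = 0 then a l else 0) else 0 := fun j => by
      have e1 : ∀ q : Torus × Torus, (fourier (-k) q.1 * fourier (-l) q.2 * (a j * fourier j q.2) : ℂ)
          = a j * (fourier (-k) q.1 * fourier (-l) q.2 * fourier j q.2) := fun q => by ring
      simp only [e1]
      rw [integral_const_mul, integral_fourier_mul_fourier]
      by_cases hk : k = 0 <;> by_cases hj : j = l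
      · simp [hk, hj]
      · simp [hj, Ne.symm hj]
      · simp [hk]
      · simp [hk]
    simp only [e] at hs
    exact hs.unique (hasSum_ite_eq l _)
  have hz := ae_eq_zero_of_fourier_prod (hV.sub hGm) fun k l => by
    have i1 : Integrable fun q : Torus × Torus => (fourier (-k) q.1 * fourier (-l) q.2 * V q : ℂ) :=
      (memLp_fourier_mul (-k) (-l) hV).integrable (by norm_num)
    have i2 : Integrable fun q : Torus × Torus => (fourier (-k) q.1 * fourier (-l) q.2 * G q : ℂ) :=
      (memLp_fourier_mul (-k) (-l) hGm).integrable (by norm_num)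
    simp only [Pi.sub_apply, mul_sub]
    rw [integral_sub i1 i2, h, hGi, sub_self]
  filter_upwards [hz] with q hq
  rw [sub_eq_zero.1 hq]
  exact tsum_of_norm_bounded hb.hasSum (hbound · q)

lemma supNorm_simpleZero_le {f : Dom → ℂ} (hf : MemLp f 2 (volume : Measure Dom)) {B : ℝ}
    (h : ∀ l : ℤ, l ≠ 0 → ∀ᵐ y, ‖mode f 0 l y‖ ≤ (|(l : ℝ)| ^ 3)⁻¹ * B) :
    supNorm (simpleZero f) ≤ ENNReal.ofReal (cubeSum * B) := by
  have hV := memLp_simpleZero hf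
  have hall : ∀ᵐ p, simpleZero f p ∈ Metric.closedBall (0 : ℂ) (cubeSum * B) := by
    refine ae_of_ae_slice hV.1 Metric.isClosed_closedBall.measurableSet ?_
    filter_upwards [ae_memLp_slice_y hV, ae_all_iff.2 fun k => ae_all_iff.2 fun l => ae_mode_eq hV k l,
      ae_all_iff.2 fun k => ae_all_iff.2 fun l => ae_mode_simpleZero hf k l,
      ae_all_iff.2 fun l => ae_all_iff.2 (h l)] with y h1 h2 h3 h4
    have hs := summable_inv_cube.mul_right B
    have := ae_norm_le_of_fourier h1 (a := fun l => if l = 0 then 0 else mode f 0 l y) hs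
      (fun l => by
        -- The coefficient at `l = 0` is zero, and so is its bound, because the inverse of zero is
        -- zero.
        by_cases hl : l = 0
        · simp [hl]
        · simpa only [hl, if_false] using h4 l hl)
      (fun k l => by
        rw [← h2, h3]
        by_cases hk : k = 0 <;> by_cases hl : l = 0 <;> simp [hk, hl])
    filter_upwards [this] with q hq
    rw [mem_closedBall_zero_iff, cubeSum, ← tsum_mul_right]
    exact hq
  rw [supNorm, eLpNorm_exponent_top]
  refine eLpNormEssSup_le_of_ae_bound (C := cubeSum * B) ?_
  filter_upwards [hall] with p hp
  exact mem_closedBall_zero_iff.1 hp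

lemma dispRate_pos {ν β t : ℝ} (hβ : 2 ≤ |β|) (ht : 0 < t) : 0 < dispRate ν β t := by
  have := Real.sqrt_pos.2 (beta_mul_pos hβ)
  unfold dispRate; positivity

/-- Adding `1` to `cubeSum` makes the constant visibly positive, so that an infinite norm of the
data gives a trivial bound. -/
lemma supNorm_simpleZero_le_mul {f : Dom → ℂ} (hf : MemLp f 2 (volume : Measure Dom)) {D : ℝ}
    (hD : 0 < D) {W : ℝ≥0∞} (h : W ≠ ⊤ → ∀ l : ℤ, l ≠ 0 → ∀ᵐ y, ‖mode f 0 l y‖ ≤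
      8 * (400 * (|(l : ℝ)| ^ 3)⁻¹ * D) * W.toReal) :
    supNorm (simpleZero f) ≤ ENNReal.ofReal (3200 * (cubeSum + 1) * D) * W := by
  have hS := cubeSum_nonneg
  by_cases hW : W = ⊤
  · rw [hW, ENNReal.mul_top]
    · exact le_top
    · rw [Ne, ENNReal.ofReal_eq_zero, not_le]; positivity
  · have h1 := supNorm_simpleZero_le hf (B := 3200 * D * W.toReal) fun l hl => by
      filter_upwards [h hW l hl] with y hy
      exact hy.trans (le_of_eq (by ring))
    refine h1.trans ?_
    rw [← ENNReal.ofReal_toReal hW, ← ENNReal.ofReal_mul (by positivity),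
      ENNReal.toReal_ofReal ENNReal.toReal_nonneg]
    refine ENNReal.ofReal_le_ofReal ?_
    have : 0 ≤ D * W.toReal := by positivity
    nlinarith

lemma add_le_two_mul_pairNorm (a b : ℝ≥0∞) : a + b ≤ 2 * pairNorm a b := by
  have h : ∀ c d : ℝ≥0∞, c ≤ (c ^ 2 + d ^ 2) ^ (1 / 2 : ℝ) := fun c d => by
    have e : c = (c ^ 2) ^ (1 / 2 : ℝ) := by
      rw [← ENNReal.rpow_natCast, ← ENNReal.rpow_mul]; norm_num
    nth_rewrite 1 [e]
    exact ENNReal.rpow_le_rpow le_self_add (by norm_num)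
  rw [two_mul]
  refine add_le_add (h a b) ?_
  rw [pairNorm, add_comm]
  exact h b a

/-! ### Dispersive decay -/

section

variable {ν β t : ℝ} {uin : Fin 3 → Dom → ℂ} {u : ℝ → Fin 3 → Dom → ℂ}

/-- With `R = 400 |l|⁻³` times the rate, the three multipliers contribute `2R`, `4R` and `4R`; the
last two both act on `u²_in`, which gives the factor `8`. -/
lemma Setting.supNorm_first_le (S : Setting ν β uin u) (ht : 0 < t) :
    supNorm (simpleZero (u t 0)) ≤ ENNReal.ofReal (3200 * (cubeSum + 1) * dispRate ν β t)
      * (wm1Norm 4 (simpleZero (uin 0)) + wm1Norm 5 (simpleZero (uin 1))) := by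
  have hm := S.solution.memLp t ht.le 0
  have hD := dispRate_pos (ν := ν) S.rot ht
  refine supNorm_simpleZero_le_mul hm hD fun hW l hl => ?_
  obtain ⟨w0, w1⟩ := ENNReal.add_ne_top.1 hW
  have w41 := ne_top_of_le_ne_top w1 (wm1Norm_mono (by norm_num : 4 ≤ 5) _)
  have hR : 0 ≤ 400 * (|(l : ℝ)| ^ 3)⁻¹ * dispRate ν β t := by positivity
  have i1 := (kernelBound_symC S.visc S.rot ht hl).invBound_fhat hR hl (S.smooth 0) (S.memLp 0) w0
  have i2 := (kernelBound_symALow S.visc S.rot ht hl).invBound_fhat (by positivity) hl (S.smooth 1)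
    (S.memLp 1) w41
  have i3 := (kernelBound_symAHigh S.visc S.rot ht hl).invBound_mul_fhat (by positivity) hl
    (S.smooth 1) (S.memLp 1) w1
  filter_upwards [(i1.add (i2.add i3)).ae_norm_le (memLp_mode hm 0 l) (by
    filter_upwards [S.fhat_zero_mode hl ht.le] with η hη
    rw [← fhat_eq_ftL, hη.1, symA_eq hl]; ring)] with y hy
  refine hy.trans ?_
  rw [ENNReal.toReal_add w0 w1]
  have hmono := ENNReal.toReal_mono w1 (wm1Norm_mono (by norm_num : 4 ≤ 5) (simpleZero (uin 1)))
  have p0 : 0 ≤ (wm1Norm 4 (simpleZero (uin 0))).toReal := ENNReal.toReal_nonneg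
  have hm1 := mul_le_mul_of_nonneg_left hmono hR
  have hm2 := mul_nonneg hR p0
  linarith

lemma Setting.supNorm_second_le (S : Setting ν β uin u) (ht : 0 < t) :
    supNorm (simpleZero (u t 1)) ≤ ENNReal.ofReal (3200 * (cubeSum + 1) * dispRate ν β t)
      * (wm1Norm 4 (simpleZero (uin 0)) + wm1Norm 4 (simpleZero (uin 1))) := by
  have hm := S.solution.memLp t ht.le 1
  have hD := dispRate_pos (ν := ν) S.rot ht
  refine supNorm_simpleZero_le_mul hm hD fun hW l hl => ?_
  obtain ⟨w0, w1⟩ := ENNReal.add_ne_top.1 hW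
  have hR : 0 ≤ 400 * (|(l : ℝ)| ^ 3)⁻¹ * dispRate ν β t := by positivity
  have i1 := (kernelBound_symC S.visc S.rot ht hl).invBound_fhat hR hl (S.smooth 1) (S.memLp 1) w1
  have i2 := (kernelBound_symB S.visc S.rot ht hl).invBound_fhat (by positivity) hl (S.smooth 0)
    (S.memLp 0) w0
  filter_upwards [(i1.add i2).ae_norm_le (memLp_mode hm 0 l) (by
    filter_upwards [S.fhat_zero_mode hl ht.le] with η hη
    rw [← fhat_eq_ftL, hη.2.1])] with y hy
  refine hy.trans ?_
  rw [ENNReal.toReal_add w0 w1]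
  have p0 := mul_nonneg hR (ENNReal.toReal_nonneg (a := wm1Norm 4 (simpleZero (uin 0))))
  have p1 := mul_nonneg hR (ENNReal.toReal_nonneg (a := wm1Norm 4 (simpleZero (uin 1))))
  linarith

/-- Incompressibility gives `û³ = -(|l|/l) (η/|l|) û²`: a constant of modulus one and one more
derivative in the formula of the second component. -/
lemma Setting.supNorm_third_le (S : Setting ν β uin u) (ht : 0 < t) :
    supNorm (simpleZero (u t 2)) ≤ ENNReal.ofReal (3200 * (cubeSum + 1) * dispRate ν β t)
      * (wm1Norm 5 (simpleZero (uin 0)) + wm1Norm 5 (simpleZero (uin 1))) := by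
  have hm := S.solution.memLp t ht.le 2
  have hD := dispRate_pos (ν := ν) S.rot ht
  refine supNorm_simpleZero_le_mul hm hD fun hW l hl => ?_
  obtain ⟨w0, w1⟩ := ENNReal.add_ne_top.1 hW
  have hR : 0 ≤ 400 * (|(l : ℝ)| ^ 3)⁻¹ * dispRate ν β t := by positivity
  have hL := one_le_abs_int hl
  have hl0 : (l : ℂ) ≠ 0 := by exact_mod_cast hl
  have i1 := (kernelBound_symC S.visc S.rot ht hl).invBound_mul_fhat hR hl (S.smooth 1) (S.memLp 1) w1
  have i2 := (kernelBound_symB S.visc S.rot ht hl).invBound_mul_fhat (by positivity) hl (S.smooth 0)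
    (S.memLp 0) w0
  filter_upwards [((i1.add i2).const_mul (-(((|(l : ℝ)| : ℝ) : ℂ) / l))).ae_norm_le
    (memLp_mode hm 0 l) (by
    filter_upwards [S.fhat_zero_mode hl ht.le] with η hη
    have hL0 : ((|(l : ℝ)| : ℝ) : ℂ) ≠ 0 := by
      rw [Complex.ofReal_ne_zero]; positivity
    rw [← fhat_eq_ftL]
    have h3 := hη.2.2
    rw [hη.2.1] at h3
    push_cast
    refine mul_left_cancel₀ hl0 ?_
    field_simp
    linear_combination h3)] with y hy
  refine hy.trans ?_
  have hc : ‖-(((|(l : ℝ)| : ℝ) : ℂ) / l)‖ = 1 := by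
    rw [norm_neg, norm_div, Complex.norm_real, Complex.norm_intCast, Real.norm_eq_abs, abs_abs,
      div_self (by positivity)]
  rw [hc, ENNReal.toReal_add w0 w1]
  have p0 := mul_nonneg hR (ENNReal.toReal_nonneg (a := wm1Norm 5 (simpleZero (uin 0))))
  have p1 := mul_nonneg hR (ENNReal.toReal_nonneg (a := wm1Norm 5 (simpleZero (uin 1))))
  linarith

/-- Passing from the sum of the norms to their quadratic mean doubles the constant. -/
lemma ofReal_mul_add_le_pairNorm {D : ℝ} (hD : 0 ≤ D) (a b : ℝ≥0∞) :
    ENNReal.ofReal (3200 * (cubeSum + 1) * D) * (a + b)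
      ≤ ENNReal.ofReal (6400 * (cubeSum + 1) * D) * pairNorm a b := by
  have hS := cubeSum_nonneg
  calc _ ≤ ENNReal.ofReal (3200 * (cubeSum + 1) * D) * (2 * pairNorm a b) := by
        gcongr; exact add_le_two_mul_pairNorm a b
    _ = _ := by
        rw [← mul_assoc, show (2 : ℝ≥0∞) = ENNReal.ofReal 2 by norm_num,
          ← ENNReal.ofReal_mul (by positivity)]
        congr 2; ring

lemma Setting.dispersive_decay (S : Setting ν β uin u) (ht : 0 < t) :
    supNorm (simpleZero (u t 0)) ≤ ENNReal.ofReal (6400 * (cubeSum + 1) * dispRate ν β t)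
        * (wm1Norm 4 (simpleZero (uin 0)) + wm1Norm 5 (simpleZero (uin 1))) ∧
      supNorm (simpleZero (u t 1)) ≤ ENNReal.ofReal (6400 * (cubeSum + 1) * dispRate ν β t)
        * pairNorm (wm1Norm 4 (simpleZero (uin 0))) (wm1Norm 4 (simpleZero (uin 1))) ∧
      supNorm (simpleZero (u t 2)) ≤ ENNReal.ofReal (6400 * (cubeSum + 1) * dispRate ν β t)
        * pairNorm (wm1Norm 5 (simpleZero (uin 0))) (wm1Norm 5 (simpleZero (uin 1))) := by
  have hD := dispRate_nonneg ν β ht.le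
  have hS := cubeSum_nonneg
  refine ⟨(S.supNorm_first_le ht).trans ?_,
    (S.supNorm_second_le ht).trans (ofReal_mul_add_le_pairNorm hD _ _),
    (S.supNorm_third_le ht).trans (ofReal_mul_add_le_pairNorm hD _ _)⟩
  gcongr
  norm_num

end

end

end Couette

/-! ### Assembly of the three statements -/

theorem theorem1p1 :
    -- (1) enhanced dissipation and inviscid damping of the non-zero frequencies
    (∀ s : ℝ, 0 ≤ s → ∃ C : ℝ, 0 < C ∧
      ∀ (ν β : ℝ) (uin : Fin 3 → Dom → ℂ) (u : ℝ → Fin 3 → Dom → ℂ), Setting ν β uin u →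
        ∀ t : ℝ, 0 ≤ t →
          pairNorm (hsNorm s (nonzeroX (moving t (u t 0)))) (hsNorm s (nonzeroX (moving t (u t 2))))
            ≤ ENNReal.ofReal (C * Real.exp (-(1 / 24) * ν * t ^ 3))
              * (hsNorm (s + 2) (uin 1) + hsNorm (s + 1) (vort uin)) ∧
          hsNorm s (nonzeroX (moving t (u t 1)))
            ≤ ENNReal.ofReal (C * (√(1 + t ^ 2))⁻¹ * Real.exp (-(1 / 24) * ν * t ^ 3))
              * (hsNorm (s + 3) (uin 1) + hsNorm (s + 2) (vort uin))) ∧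
    -- (2) explicit form of the zero frequency
    (∀ (ν β : ℝ) (uin : Fin 3 → Dom → ℂ) (u : ℝ → Fin 3 → Dom → ℂ), Setting ν β uin u →
      ∀ t : ℝ, 0 ≤ t →
        (∃ a b : Dom → ℂ,
          IsMul (fun η l => (1 / 2) * (expPlus ν β t η l + expMinus ν β t η l))
            (simpleZero (uin 0)) a ∧
          IsMul (fun η l => Complex.I / 2 * (((β - 1) / √(β * (β - 1)) : ℝ) : ℂ)
              * ((symGrad η l * (symDz l)⁻¹ : ℝ) : ℂ) * (expMinus ν β t η l - expPlus ν β t η l))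
            (simpleZero (uin 1)) b ∧
          simpleZero (u t 0) =ᵐ[volume] a + b) ∧
        (∃ a b : Dom → ℂ,
          IsMul (fun η l => (1 / 2) * (expPlus ν β t η l + expMinus ν β t η l))
            (simpleZero (uin 1)) a ∧
          IsMul (fun η l => Complex.I / 2 * ((√(β * (β - 1)) / (β - 1) : ℝ) : ℂ)
              * (((symGrad η l)⁻¹ * symDz l : ℝ) : ℂ) * (expPlus ν β t η l - expMinus ν β t η l))
            (simpleZero (uin 0)) b ∧
          simpleZero (u t 1) =ᵐ[volume] a + b) ∧
        IsMul (fun η l => -symDzInvDy η l) (simpleZero (u t 1)) (simpleZero (u t 2)) ∧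
        IsMul (expHeat ν t) (doubleZero (uin 0)) (doubleZero (u t 0)) ∧
        doubleZero (u t 1) =ᵐ[volume] 0 ∧
        IsMul (expHeat ν t) (doubleZero (uin 2)) (doubleZero (u t 2))) ∧
    -- (3) dispersive decay of the simple zero frequency
    (∃ C : ℝ, 0 < C ∧
      ∀ (ν β : ℝ) (uin : Fin 3 → Dom → ℂ) (u : ℝ → Fin 3 → Dom → ℂ), Setting ν β uin u →
        ∀ t : ℝ, 0 < t →
          supNorm (simpleZero (u t 0)) ≤ ENNReal.ofReal (C * dispRate ν β t)
            * (wm1Norm 4 (simpleZero (uin 0)) + wm1Norm 5 (simpleZero (uin 1))) ∧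
          supNorm (simpleZero (u t 1)) ≤ ENNReal.ofReal (C * dispRate ν β t)
            * pairNorm (wm1Norm 4 (simpleZero (uin 0))) (wm1Norm 4 (simpleZero (uin 1))) ∧
          supNorm (simpleZero (u t 2)) ≤ ENNReal.ofReal (C * dispRate ν β t)
            * pairNorm (wm1Norm 5 (simpleZero (uin 0))) (wm1Norm 5 (simpleZero (uin 1)))) := by
  refine ⟨fun s _ => ⟨6, by norm_num, fun ν β uin u S t ht => S.nonzero_frequencies s ht⟩,
    fun ν β uin u S t ht => S.zero_frequency ht,
    6400 * (cubeSum + 1), mul_pos (by norm_num) (by linarith [cubeSum_nonneg]),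
    fun ν β uin u S t ht => S.dispersive_decay ht⟩
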